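/- **Polarized quivers.** A *skewed-gentle polarized quiver* $\underline Q$ consists of a finite set of vertices $Q_0$, a set of arrows $Q_1=Q_1^{sp}\sqcup Q_1^{ord}$ (special and ordinary arrows) and injective maps $\underline s=(s,s_1),\ \underline t=(t,t_1)\colon Q_1\to Q_0\times\{\pm1\}$, such that each special arrow $\varepsilon$ is a loop with $\underline s(\varepsilon)=\underline t(\varepsilon)=(i,-1)$ for some $i$ (we write $\varepsilon=\varepsilon_i$), and such that there are only finitely many sequences $\alpha_1\cdots\alpha_l$ of arrows with $\underline s(\alpha_j)=-\underline t(\alpha_{j+1})$ for all $j$, where $-(i,\rho):=(i,-\rho)$. Let $\widehat{Q}$ be the same quiver with all arrows considered as ordinary. For a field $k$ let $k\underline Q$ be the path algebra of $(Q_0,Q_1,s,t)$ modulo the relations $\alpha\beta=0$ for ordinary arrows with $\underline s(\alpha)=\underline t(\beta)$, and $\varepsilon_i^2=e_i$ for the special loops; it is finite-dimensional. **Words.** Letters for $\underline Q$ are: $\alpha$ and $\alpha^{-1}$ for $\alpha\in Q_1^{ord}$, with $\underline s(\alpha^{-1})=\underline t(\alpha)$ and $\underline t(\alpha^{-1})=\underline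 s(\alpha)$; $\varepsilon^*=(\varepsilon^*)^{-1}$ for $\varepsilon\in Q_1^{sp}$, with the $\underline s,\underline t$ of $\varepsilon$; and, for $(i,\rho)$ which is not of the form $\underline s(\varepsilon)$ with $\varepsilon$ special, $\mathbb 1_{i,\rho}$ with $\underline t=(i,\rho)$ and $\underline s$ undefined, and its inverse $\mathbb 1_{i,\rho}^{-1}$ with $\underline s=(i,\rho)$ and $\underline t$ undefined. A word is a sequence of letters $w_1\cdots w_m$ with $\underline s(w_j)=-\underline t(w_{j+1})$, and $(w_1\cdots w_m)^{-1}=w_m^{-1}\cdots w_1^{-1}$. Letters with the same $\underline t=(i,\rho)$ are ordered by $\alpha<\mathbb 1_{i,\rho}<\beta^{-1}$, and words lexicographically: $v<w$ iff $v=u\,a\,v'$, $w=u\,b\,w'$ with $a<b$. A *string* is a word whose first letter is some $\mathbb 1_{i,\rho}^{-1}$ and whose last letter is some $\mathbb 1_{j,\sigma}$. A *band* is a non-empty word $w$ such that $ww$ is a word; it is primitive if it is not $v^n$ with $n\ge2$, and symmetric if $w^{-1}$ is a rotation of $w$. A primitive band is *standard* if it is asymmetric, or of the form $\varepsilon^*v\zeta^*v^{-1}$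 with $\varepsilon,\zeta$ special. **Admissible words.** Let $F$ be the map from letters for $\widehat Q$ to letters for $\underline Q$ which sends $\varepsilon_i^{\pm1}$ and the *punctured* letters $\mathbb 1_{i,-1}^{\pm1}$ ($i$ carrying a special loop) to $\varepsilon_i^*$, and is the identity on other letters. A string for $\widehat Q$ has type $(a,b)\in\{u,p\}^2$, with $a=p$ (resp. $b=p$) iff its first (resp. last) letter is punctured; bands have type $(b)$. A string $x$ for $\widehat Q$ is *admissible* if for each factorization $x=u\,\varepsilon^{\pm1}v$ with $\varepsilon$ special we have $u^{-1}\neq v$ and the exponent is $+1$ iff $v<u^{-1}$, and moreover, if $x=x_0\cdots x_n$ is of type $(p,p)$, $F(x)F(x_{n-1}^{-1}\cdots x_1^{-1})$ is a primitive band for $\underline Q$. A band $x$ for $\widehat Q$ is admissible if for each factorization $x=u\,\varepsilon^{\pm1}v$ with $\varepsilon$ special we have $(vu)^{-1}\ne vu$ and the exponent is $+1$ iff $vu<(vu)^{-1}$, and moreover $F(x)$ is a primitive asymmetric band. Here the order is that of $\widehat Q$. For a string or standard primitive band $w$ for $\underline Q$ define $A(w)$ as follows. Replace each special letter of a string $w=u\,\varepsilon^*v$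 by $\varepsilon$ if $v<u^{-1}$ and by $\varepsilon^{-1}$ if $v>u^{-1}$, and each special letter of a band $w=u\,\varepsilon^*v$ by $\varepsilon$ if $vu<(vu)^{-1}$ and by $\varepsilon^{-1}$ if $vu>(vu)^{-1}$. If $w=v\,\varepsilon_b^*v^{-1}$ is a symmetric string, keep only the part coming from $v$ and add $\mathbb 1_{b,-1}$ on the right; if $w=\varepsilon_a^*v\,\varepsilon_b^*v^{-1}$ is a symmetric band, keep only the part coming from $v$, and add $\mathbb 1_{a,-1}^{-1}$ on the left and $\mathbb 1_{b,-1}$ on the right. **The operator $\tau_{\underline Q}$.** The strings for $\underline Q$ with a given first letter are linearly ordered; $w[1]$ is the successor of $w$ in this order, if $w$ is not maximal, and $[1]w=(w^{-1}[1])^{-1}$. Let $\mathbb 1_{i,\rho}^{-1}w^{\max}_{i,\rho}$ be the maximal string with first letter $\mathbb 1_{i,\rho}^{-1}$. The *projective strings* are $(w^{\max}_{i,-\rho})^{-1}w^{\max}_{i,\rho}$ for vertices $i$ without special loop and $\rho=\pm1$, and $w'^{-1}\varepsilon_i^*w'$ for vertices $i$ with special loop, where $w_{i,1}^{\max}=\varepsilon_i^*w'$.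 For a non-projective string $w$ put $\tau_{\underline Q}(w)=[1](w[1])$ if $w$ is not maximal and $\tau_{\underline Q}(w)=([1]w)[1]$ if $w$ is maximal; for bands put $\tau_{\underline Q}(w)=w$. An admissible word $x$ is *projective* if $x$ or $x^{-1}$ is $A(p)$ for a projective string $p$. For a non-projective admissible word put $\tau_{\underline Q}(x)=A(\tau_{\underline Q}(w))$ if $x=A(w)$, and $\tau_{\underline Q}(x)=A(\tau_{\underline Q}(w))^{-1}$ if $x=A(w)^{-1}$ for a string $w$. **Modules.** The algebra $A_x$ is $k$, $k[T]/(T^2-1)$, $k[T]/(T^2-1)$, $k\langle S,T\rangle/(S^2-1,T^2-1)$, $k[T,T^{-1}]$ for $x$ of type $(u,u),(u,p),(p,u),(p,p),(b)$, respectively. Its automorphism $\chi$ changes the signs of $S$ and $T$ for types $(u,p),(p,u),(p,p)$, and is the identity for types $(u,u),(b)$. $X^\chi$ is $X$ twisted by $\chi$. For an admissible $x=x_0\cdots x_n$ and an $A_x$-module $X$, the $k\underline Q$-module $M^\circ_x(X)$ has one copy $X_j$ of $X$ for each $j=1,\dots,n$ (string), resp. $j\in\mathbb Z/(n+1)$ (band),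 placed at the vertex $t(x_j)$. If $x_j=\alpha$ is a direct letter ($1\le j<n$ for strings), $\alpha$ maps $X_{j+1}$ identically to $X_j$; if $x_j=\alpha^{-1}$, $\alpha$ maps $X_j$ identically to $X_{j+1}$; if $x_j=\varepsilon^{\pm1}$ with $\varepsilon$ special, $\varepsilon$ exchanges $X_j$ and $X_{j+1}$ in this way. The only non-identical components are the following: for a band, the maps given by $x_0$ are $T\colon X_1\to X_0$ resp. $T^{-1}\colon X_0\to X_1$ instead of the identity; for a string with $x_n=\mathbb 1_{b,-1}$ punctured, $\varepsilon_b$ acts on $X_n$ by $T$; for a string with $x_0=\mathbb 1_{a,-1}^{-1}$ punctured, $\varepsilon_a$ acts on $X_1$ by $T$ for type $(p,u)$ and by $S$ for type $(p,p)$. All other components of the actions of the arrows are zero. **Corollary.** Let $\underline Q$ be a skewed-gentle polarized quiver and $k$ a field with $\operatorname{char}(k)\neq2$. Let $x$ be an admissible word which is not projective, and let $X$ be an indecomposable finite-dimensional $A_x$-module. Then $\tau_{\underline Q}(x)$ is again an admissible word, of the same type as $x$ (so that $A_{\tau_{\underline Q}(x)}=A_x$), and $$\tau_{k\underline Q}\,M^\circ_x(X)\;\cong\;M^\circ_{\tau_{\underline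 Q}(x)}(X^\chi),$$ where $\tau_{k\underline Q}=D\operatorname{Tr}$ is the Auslander–Reiten translate of finite-dimensional $k\underline Q$-modules. -/

import Mathlib

/-!  Skewed-gentle polarized quivers, strings, bands and admissible words, the modules attached
to admissible words, and the Auslander-Reiten translate of a module over a finite-dimensional
algebra. -/

namespace SkewedGentle

universe uV uE uk uX

/-! ## Polarized quivers -/

/-- The involution `(i, ρ) ↦ (i, -ρ)` on `Q₀ × {-1, 1}`. -/
def flip {V : Type uV} (p : V × ℤˣ) : V × ℤˣ := (p.1, -p.2)

/-- A polarized quiver with set of vertices `V` and set of arrows `E`. -/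
structure PolarizedQuiver (V : Type uV) (E : Type uE) where
  /-- the special arrows; all other arrows are ordinary -/
  special : Set E
  source : E → V × ℤˣ
  target : E → V × ℤˣ
  source_injective : Function.Injective source
  target_injective : Function.Injective target
  special_dual : ∀ e ∈ special, ∃! e', e' ∈ special ∧ source e' = target e ∧ target e' = source e
  special_polarity : ∀ e ∈ special, (source e).2 = -1 ∧ (target e).2 = -1

/-- A sequence of arrows `α₁ α₂ ⋯ α_l` with `s(α_i) = - t(α_{i+1})`. -/
def PolarizedQuiver.IsAdmissiblePath {V : Type uV} {E : Type uE} (Q : PolarizedQuiver V E)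
    (l : List E) : Prop :=
  l ≠ [] ∧ l.IsChain (fun a b => Q.source a = flip (Q.target b))

/-- A skewed-gentle polarized quiver: there are only finitely many admissible paths, and every
special arrow is a loop. -/
structure SkewedGentleQuiver (V : Type uV) (E : Type uE) extends PolarizedQuiver V E where
  finite_paths : {l : List E | toPolarizedQuiver.IsAdmissiblePath l}.Finite
  special_loop : ∀ e ∈ special, (source e).1 = (target e).1

section Words

variable {V : Type uV} {E : Type uE}

/-- The associated gentle polarized quiver: all arrows are now considered as ordinary. -/
def SkewedGentleQuiver.hat (Q : SkewedGentleQuiver V E) : SkewedGentleQuiver V E where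
  special := ∅
  source := Q.source
  target := Q.target
  source_injective := Q.source_injective
  target_injective := Q.target_injective
  special_dual := by simp
  special_polarity := by simp
  finite_paths := Q.finite_paths
  special_loop := by simp

/-! ## Letters and words -/

/-- Symbols for letters: `α`, `α⁻¹`, `ε*`, `𝟙_{i,ρ}` and `𝟙_{i,ρ}⁻¹`. -/
inductive Letter (V : Type uV) (E : Type uE) where
  | dir (a : E)
  | inv (a : E)
  | special (e : E)
  | triv (p : V × ℤˣ)
  | trivInv (p : V × ℤˣ)

/-- The symbols which are letters for `Q`. -/
def Letter.IsValid (Q : SkewedGentleQuiver V E) : Letter V E → Prop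
  | .dir a => a ∉ Q.special
  | .inv a => a ∉ Q.special
  | .special e => e ∈ Q.special
  | .triv p => ∀ e ∈ Q.special, Q.source e ≠ p
  | .trivInv p => ∀ e ∈ Q.special, Q.source e ≠ p

/-- `s` of a letter (`none` stands for the undefined value `*`). -/
def Letter.src (Q : SkewedGentleQuiver V E) : Letter V E → Option (V × ℤˣ)
  | .dir a => some (Q.source a)
  | .inv a => some (Q.target a)
  | .special e => some (Q.source e)
  | .triv _ => none
  | .trivInv p => some p

/-- `t` of a letter (`none` stands for the undefined value `*`). -/
def Letter.tgt (Q : SkewedGentleQuiver V E) : Letter V E → Option (V × ℤˣ)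
  | .dir a => some (Q.target a)
  | .inv a => some (Q.source a)
  | .special e => some (Q.target e)
  | .triv p => some p
  | .trivInv _ => none

/-- The inverse letter. As special arrows are loops, they are their own duals, so that
`(ε*)⁻¹ = ε*`. -/
def Letter.symm : Letter V E → Letter V E
  | .dir a => .inv a
  | .inv a => .dir a
  | .special e => .special e
  | .triv p => .trivInv p
  | .trivInv p => .triv p

/-- The order on the letters with a given target `(i, ρ)`: `α < 𝟙_{i,ρ} < β⁻¹`. -/
def Letter.Lt (Q : SkewedGentleQuiver V E) (x y : Letter V E) : Prop :=
  x.tgt Q = y.tgt Q ∧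
    match x, y with
    | .dir _, .triv _ => True
    | .dir _, .inv _ => True
    | .triv _, .inv _ => True
    | _, _ => False

/-- The condition `s(x) = - t(y)` for `y` to follow `x` in a word. -/
def Letter.Compat (Q : SkewedGentleQuiver V E) (x y : Letter V E) : Prop :=
  ∃ p, x.src Q = some p ∧ y.tgt Q = some (flip p)

/-- `w` is a word for `Q`. -/
def IsWord (Q : SkewedGentleQuiver V E) (w : List (Letter V E)) : Prop :=
  (∀ x ∈ w, x.IsValid Q) ∧ w.IsChain (Letter.Compat Q)

/-- The inverse word. -/
def winv (w : List (Letter V E)) : List (Letter V E) := (w.map Letter.symm).reverse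

/-- The lexicographic order on words. -/
def WordLt (Q : SkewedGentleQuiver V E) (v w : List (Letter V E)) : Prop :=
  ∃ u x y v' w', v = u ++ x :: v' ∧ w = u ++ y :: w' ∧ Letter.Lt Q x y

/-! ## Strings and bands -/

/-- Strings: words which are left and right inextensible. -/
def IsString (Q : SkewedGentleQuiver V E) (w : List (Letter V E)) : Prop :=
  IsWord Q w ∧ (∃ p, w.head? = some (.trivInv p)) ∧ ∃ p, w.getLast? = some (.triv p)

/-- Bands: (non-empty) words `w` such that `w w` is a word. -/
def IsBand (Q : SkewedGentleQuiver V E) (w : List (Letter V E)) : Prop :=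
  w ≠ [] ∧ IsWord Q (w ++ w)

/-- Primitive bands: bands which are not of the form `v ^ n` with `n ≥ 2`. -/
def IsPrimitiveBand (Q : SkewedGentleQuiver V E) (w : List (Letter V E)) : Prop :=
  IsBand Q w ∧ ¬ ∃ (v : List (Letter V E)) (n : ℕ), 2 ≤ n ∧ w = (List.replicate n v).flatten

/-- A band is symmetric if its inverse is one of its rotations. -/
def IsSymmetricBand (w : List (Letter V E)) : Prop := w.IsRotated (winv w)

/-- Primitive bands in standard form: the asymmetric ones, and the symmetric ones of the form
`ε* v ζ* v⁻¹`. -/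
def IsStandardBand (Q : SkewedGentleQuiver V E) (w : List (Letter V E)) : Prop :=
  IsPrimitiveBand Q w ∧
    (¬ IsSymmetricBand w ∨ ∃ e f v, w = .special e :: (v ++ .special f :: winv v))

/-! ## Successors, projective strings and the operator `τ_Q` on strings and bands -/

/-- `w` is the maximal element of the set of all strings with the same first letter. -/
def IsMaxString (Q : SkewedGentleQuiver V E) (w : List (Letter V E)) : Prop :=
  IsString Q w ∧ ∀ z, IsString Q z → ¬ WordLt Q w z

/-- The string `u` is the successor of the string `w` (comparable strings have the same first
letter). -/
def IsSucc (Q : SkewedGentleQuiver V E) (w u : List (Letter V E)) : Prop :=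
  IsString Q w ∧ IsString Q u ∧ WordLt Q w u ∧
    ∀ z, IsString Q z → ¬ (WordLt Q w z ∧ WordLt Q z u)

open Classical in
/-- `w[1]`, the successor of a string `w` which is not maximal (and `w` itself as an unused value
if `w` has no successor). -/
noncomputable def next (Q : SkewedGentleQuiver V E) (w : List (Letter V E)) :
    List (Letter V E) :=
  if h : ∃ u, IsSucc Q w u then Classical.choose h else w

/-- `[1]w = (w⁻¹[1])⁻¹`. -/
noncomputable def lnext (Q : SkewedGentleQuiver V E) (w : List (Letter V E)) :
    List (Letter V E) :=
  winv (next Q (winv w))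

/-- Projective strings: the strings `(w^max_{i,-ρ})⁻¹ w^max_{i,ρ}` for an ordinary vertex `i`,
where `𝟙_{i,ρ}⁻¹ w^max_{i,ρ}` is the maximal string with first letter `𝟙_{i,ρ}⁻¹`, and the strings
`w'⁻¹ ε_i* w'` for a vertex `i` with a special loop `ε_i`, where `w^max_{i,1} = ε_i* w'`. -/
def IsProjectiveString (Q : SkewedGentleQuiver V E) (w : List (Letter V E)) : Prop :=
  (∃ (i : V) (ρ : ℤˣ) (u v : List (Letter V E)), (∀ e ∈ Q.special, (Q.source e).1 ≠ i) ∧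
      IsMaxString Q (.trivInv (i, -ρ) :: u) ∧ IsMaxString Q (.trivInv (i, ρ) :: v) ∧
      w = winv u ++ v) ∨
  ∃ e ∈ Q.special, ∃ u : List (Letter V E),
      IsMaxString Q (.trivInv ((Q.source e).1, 1) :: .special e :: u) ∧
      w = winv u ++ .special e :: u

/-- Whether a word starts with a trivial inverse letter. This distinguishes strings from bands. -/
def startsTrivial : List (Letter V E) → Bool
  | .trivInv _ :: _ => true
  | _ => false

open Classical in
/-- The operator `τ_Q` on the non-projective strings, and on bands, for `Q`. -/
noncomputable def tau (Q : SkewedGentleQuiver V E) (w : List (Letter V E)) :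
    List (Letter V E) :=
  if startsTrivial w then
    if IsMaxString Q w then next Q (lnext Q w) else lnext Q (next Q w)
  else w

/-! ## Admissible words -/

open Classical in
/-- The map `F` from the letters for the associated gentle quiver to the letters for `Q`. -/
noncomputable def Letter.F (Q : SkewedGentleQuiver V E) : Letter V E → Letter V E
  | .dir a => if a ∈ Q.special then .special a else .dir a
  | .inv a => if a ∈ Q.special then .special a else .inv a
  | .special e => .special e
  | .triv p => if h : ∃ e ∈ Q.special, Q.source e = p then .special (Classical.choose h) else .triv p
  | .trivInv p =>
      if h : ∃ e ∈ Q.special, Q.source e = p then .special (Classical.choose h) else .trivInv p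

/-- Punctured letters: the trivial letters `𝟙_{i,-1}^{±1}` where `i` carries a special loop. -/
def Letter.IsPunctured (Q : SkewedGentleQuiver V E) : Letter V E → Prop
  | .triv p => ∃ e ∈ Q.special, Q.source e = p
  | .trivInv p => ∃ e ∈ Q.special, Q.source e = p
  | _ => False

/-- The possible types of strings, `(u,u), (u,p), (p,u), (p,p)`, and the type `(b)` of bands. -/
inductive WordType where
  | uu | up | pu | pp | b

open Classical in
/-- The type of a string or band for the associated gentle quiver. -/
noncomputable def wordType (Q : SkewedGentleQuiver V E) (x : List (Letter V E)) : WordType :=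
  if startsTrivial x then
    if ∃ l, x.head? = some l ∧ l.IsPunctured Q then
      if ∃ l, x.getLast? = some l ∧ l.IsPunctured Q then .pp else .pu
    else
      if ∃ l, x.getLast? = some l ∧ l.IsPunctured Q then .up else .uu
  else .b

/-- Admissible strings. For `x = x₀ ⋯ x_n` of type `(p,p)` the completion is
`F(x) F(x_{n-1}⁻¹ ⋯ x₁⁻¹)`. -/
def IsAdmissibleString (Q : SkewedGentleQuiver V E) (x : List (Letter V E)) : Prop :=
  IsString Q.hat x ∧
  (∀ e ∈ Q.special, ∀ u v,
    (x = u ++ .dir e :: v → winv u ≠ v ∧ WordLt Q.hat v (winv u)) ∧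
    (x = u ++ .inv e :: v → winv u ≠ v ∧ ¬ WordLt Q.hat v (winv u))) ∧
  (wordType Q x = .pp →
    IsPrimitiveBand Q (x.map (Letter.F Q) ++ (winv x.tail.dropLast).map (Letter.F Q)))

/-- Admissible bands. -/
def IsAdmissibleBand (Q : SkewedGentleQuiver V E) (x : List (Letter V E)) : Prop :=
  IsBand Q.hat x ∧
  (∀ e ∈ Q.special, ∀ u v,
    (x = u ++ .dir e :: v → winv (v ++ u) ≠ v ++ u ∧ WordLt Q.hat (v ++ u) (winv (v ++ u))) ∧
    (x = u ++ .inv e :: v → winv (v ++ u) ≠ v ++ u ∧ ¬ WordLt Q.hat (v ++ u) (winv (v ++ u)))) ∧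
  IsPrimitiveBand Q (x.map (Letter.F Q)) ∧ ¬ IsSymmetricBand (x.map (Letter.F Q))

/-- Admissible words. -/
def IsAdmissibleWord (Q : SkewedGentleQuiver V E) (x : List (Letter V E)) : Prop :=
  IsAdmissibleString Q x ∨ IsAdmissibleBand Q x

/-! ## The construction `A(w)` -/

open Classical in
/-- The special letter `w_i = ε*` of the string `w` is replaced by `ε` if
`(w₀ ⋯ w_{i-1})⁻¹ > w_{i+1} ⋯ w_n`, and by `ε⁻¹` otherwise. -/
noncomputable def orientString (Q : SkewedGentleQuiver V E) (w : List (Letter V E)) :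
    List (Letter V E) :=
  w.mapIdx fun i x => match x with
    | .special e => if WordLt Q (w.drop (i + 1)) (winv (w.take i)) then .dir e else .inv e
    | x => x

open Classical in
/-- The special letter `w_i = ε*` of the band `w` is replaced by `ε` if
`(w_{i+1} ⋯ w_n w₀ ⋯ w_{i-1})⁻¹ > w_{i+1} ⋯ w_n w₀ ⋯ w_{i-1}`, and by `ε⁻¹` otherwise. -/
noncomputable def orientBand (Q : SkewedGentleQuiver V E) (w : List (Letter V E)) :
    List (Letter V E) :=
  w.mapIdx fun i x => match x with
    | .special e =>
        if WordLt Q (w.drop (i + 1) ++ w.take i) (winv (w.drop (i + 1) ++ w.take i))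
        then .dir e else .inv e
    | x => x

/-- The puncture which corresponds to the special letter at the given position of `w`. -/
def punctureAt (Q : SkewedGentleQuiver V E) (w : List (Letter V E)) (i : ℕ) :
    List (Letter V E) :=
  match w[i]? with
  | some (.special e) => [.triv (Q.source e)]
  | _ => []

open Classical in
/-- The word `A(w)` for the associated gentle quiver, for `w` a string or a standard band for `Q`.
A symmetric string is cut at its middle letter `w_m = ε_b*`, which becomes `𝟙_{b,-1}`. From a
symmetric band `ε_a* v ε_b* v⁻¹` in standard form one keeps `v`, put between `𝟙_{a,-1}⁻¹` and
`𝟙_{b,-1}`. -/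
noncomputable def A (Q : SkewedGentleQuiver V E) (w : List (Letter V E)) : List (Letter V E) :=
  if startsTrivial w then
    if winv w = w then
      (orientString Q w).take (w.length / 2) ++ punctureAt Q w (w.length / 2)
    else orientString Q w
  else
    if IsSymmetricBand w then
      winv (punctureAt Q w 0) ++ ((orientBand Q w).take (w.length / 2)).tail ++
        punctureAt Q w (w.length / 2)
    else orientBand Q w

/-- The word `x` is projective: `x^{±1} = A(p)` for a projective string `p`. -/
def IsProjectiveWord (Q : SkewedGentleQuiver V E) (x : List (Letter V E)) : Prop :=
  ∃ p, IsProjectiveString Q p ∧ (x = A Q p ∨ winv x = A Q p)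

open Classical in
/-- The operator `τ_Q` on admissible words (with `x` itself as an unused value if `x` is neither
`A(w)` nor `A(w)⁻¹`). -/
noncomputable def tauWord (Q : SkewedGentleQuiver V E) (x : List (Letter V E)) :
    List (Letter V E) :=
  if h : ∃ w, (IsString Q w ∨ IsStandardBand Q w) ∧ x = A Q w then
    A Q (tau Q (Classical.choose h))
  else if h : ∃ w, IsString Q w ∧ x = winv (A Q w) then
    winv (A Q (tau Q (Classical.choose h)))
  else x

end Words

/-! ## The algebras `A_x` -/

/-- Generators of the algebra `A_x` for a word `x` of the given type: none for type `(u,u)`, `T` for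
the types `(u,p)` and `(p,u)`, `S` and `T` for type `(p,p)`, `T` and `T⁻¹` for type `(b)`. -/
inductive WordType.Gen : WordType → Type
  | upT : WordType.Gen .up
  | puT : WordType.Gen .pu
  | ppS : WordType.Gen .pp
  | ppT : WordType.Gen .pp
  | bT : WordType.Gen .b
  | bTinv : WordType.Gen .b

/-- Relations of `A_x`. -/
inductive WordType.Rel (k : Type uk) [Field k] :
    ∀ σ : WordType, FreeAlgebra k σ.Gen → FreeAlgebra k σ.Gen → Prop
  | up : Rel k .up (FreeAlgebra.ι k .upT * FreeAlgebra.ι k .upT) 1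
  | pu : Rel k .pu (FreeAlgebra.ι k .puT * FreeAlgebra.ι k .puT) 1
  | ppS : Rel k .pp (FreeAlgebra.ι k .ppS * FreeAlgebra.ι k .ppS) 1
  | ppT : Rel k .pp (FreeAlgebra.ι k .ppT * FreeAlgebra.ι k .ppT) 1
  | bRight : Rel k .b (FreeAlgebra.ι k .bT * FreeAlgebra.ι k .bTinv) 1
  | bLeft : Rel k .b (FreeAlgebra.ι k .bTinv * FreeAlgebra.ι k .bT) 1

/-- The algebra `A_x` for a word `x` of type `σ`: it is `k`, `k[T]/(T² - 1)`, `k[T]/(T² - 1)`,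
`k⟨S, T⟩/(S² - 1, T² - 1)` and `k[T, T⁻¹]`, respectively. -/
abbrev WordAlg (k : Type uk) [Field k] (σ : WordType) : Type uk := RingQuot (WordType.Rel k σ)

section WordAlg

variable (k : Type uk) [Field k]

/-- A generator as an element of `A_x`. -/
def WordAlg.gen {σ : WordType} (g : σ.Gen) : WordAlg k σ :=
  RingQuot.mkAlgHom k (WordType.Rel k σ) (FreeAlgebra.ι k g)

/-- `U_x(η₀)` (and `1` if there is no loop `η₀`). -/
def WordAlg.etaZero : ∀ σ : WordType, WordAlg k σ
  | .pu => WordAlg.gen k .puT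
  | .pp => WordAlg.gen k .ppS
  | .uu => 1
  | .up => 1
  | .b => 1

/-- `U_x(η₁)` (and `1` if there is no loop `η₁`). -/
def WordAlg.etaOne : ∀ σ : WordType, WordAlg k σ
  | .up => WordAlg.gen k .upT
  | .pp => WordAlg.gen k .ppT
  | .uu => 1
  | .pu => 1
  | .b => 1

/-- For type `(b)`: `T` for `true`, and `T⁻¹` for `false`. -/
def WordAlg.bandUnit : Bool → ∀ σ : WordType, WordAlg k σ
  | true, .b => WordAlg.gen k .bT
  | false, .b => WordAlg.gen k .bTinv
  | _, .uu => 1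
  | _, .up => 1
  | _, .pu => 1
  | _, .pp => 1

theorem WordAlg.gen_mul {σ : WordType} (g h : σ.Gen)
    (r : WordType.Rel k σ (FreeAlgebra.ι k g * FreeAlgebra.ι k h) 1) :
    WordAlg.gen k g * WordAlg.gen k h = 1 := by
  have h := RingQuot.mkAlgHom_rel k r
  rwa [map_mul, map_one] at h

theorem WordAlg.etaZero_mul_self (σ : WordType) :
    WordAlg.etaZero k σ * WordAlg.etaZero k σ = 1 := by
  cases σ
  case pu => exact WordAlg.gen_mul k _ _ .pu
  case pp => exact WordAlg.gen_mul k _ _ .ppS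
  all_goals exact one_mul 1

theorem WordAlg.etaOne_mul_self (σ : WordType) :
    WordAlg.etaOne k σ * WordAlg.etaOne k σ = 1 := by
  cases σ
  case up => exact WordAlg.gen_mul k _ _ .up
  case pp => exact WordAlg.gen_mul k _ _ .ppT
  all_goals exact one_mul 1

theorem WordAlg.bandUnit_mul (c : Bool) (σ : WordType) :
    WordAlg.bandUnit k c σ * WordAlg.bandUnit k (!c) σ = 1 := by
  cases σ <;> cases c
  case b.true => exact WordAlg.gen_mul k _ _ .bRight
  case b.false => exact WordAlg.gen_mul k _ _ .bLeft
  all_goals exact one_mul 1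

/-- Values of `χ` on the generators: `χ(S) = -S` and `χ(T) = -T`, but `χ = id` for bands. -/
def WordAlg.chiGen : ∀ σ : WordType, σ.Gen → WordAlg k σ
  | _, .upT => - WordAlg.gen k .upT
  | _, .puT => - WordAlg.gen k .puT
  | _, .ppS => - WordAlg.gen k .ppS
  | _, .ppT => - WordAlg.gen k .ppT
  | _, .bT => WordAlg.gen k .bT
  | _, .bTinv => WordAlg.gen k .bTinv

theorem WordAlg.chi_rel (σ : WordType) (x y : FreeAlgebra k σ.Gen) (r : WordType.Rel k σ x y) :
    FreeAlgebra.lift k (WordAlg.chiGen k σ) x = FreeAlgebra.lift k (WordAlg.chiGen k σ) y := by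
  cases r <;> simp only [map_mul, map_one, FreeAlgebra.lift_ι_apply, WordAlg.chiGen]
  · exact (neg_mul_neg _ _).trans (WordAlg.gen_mul k _ _ .up)
  · exact (neg_mul_neg _ _).trans (WordAlg.gen_mul k _ _ .pu)
  · exact (neg_mul_neg _ _).trans (WordAlg.gen_mul k _ _ .ppS)
  · exact (neg_mul_neg _ _).trans (WordAlg.gen_mul k _ _ .ppT)
  · exact WordAlg.gen_mul k _ _ .bRight
  · exact WordAlg.gen_mul k _ _ .bLeft

/-- The automorphism `χ` of `A_x`. -/
def WordAlg.chi (σ : WordType) : WordAlg k σ →ₐ[k] WordAlg k σ :=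
  RingQuot.liftAlgHom k ⟨FreeAlgebra.lift k (WordAlg.chiGen k σ), fun {x y} h =>
    WordAlg.chi_rel k σ x y h⟩

/-- The twist `X^χ` of an `A_x`-module `X`: the same vector space, where `a` acts as `χ(a)`. -/
def ChiTwist (_k : Type uk) (_σ : WordType) (X : Type uX) : Type uX := X

instance (σ : WordType) (X : Type uX) [AddCommGroup X] : AddCommGroup (ChiTwist k σ X) :=
  inferInstanceAs (AddCommGroup X)

instance (σ : WordType) (X : Type uX) [AddCommGroup X] [Module k X] : Module k (ChiTwist k σ X) :=
  inferInstanceAs (Module k X)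

instance (σ : WordType) (X : Type uX) [AddCommGroup X] [Module (WordAlg k σ) X] :
    Module (WordAlg k σ) (ChiTwist k σ X) :=
  Module.compHom X (WordAlg.chi k σ).toRingHom

theorem ChiTwist.smul_def (σ : WordType) (X : Type uX) [AddCommGroup X] [Module (WordAlg k σ) X]
    (a : WordAlg k σ) (x : ChiTwist k σ X) :
    a • x = (show ChiTwist k σ X from (WordAlg.chi k σ a • (show X from x) : X)) := rfl

instance (σ : WordType) (X : Type uX) [AddCommGroup X] [Module k X] [Module (WordAlg k σ) X]
    [IsScalarTower k (WordAlg k σ) X] : IsScalarTower k (WordAlg k σ) (ChiTwist k σ X) where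
  smul_assoc c a x := by
    rw [ChiTwist.smul_def, ChiTwist.smul_def, map_smul]
    exact smul_assoc c (WordAlg.chi k σ a) (show X from x)

end WordAlg

/-! ## The skewed-gentle algebra `kQ` -/

section PathAlgebra

variable (k : Type uk) [Field k] {V : Type uV} {E : Type uE} [Fintype V]

/-- Relations between the trivial paths `e_i` and the arrows in `kQ`. A product `αβ` of arrows is
the path `β` followed by `α`. The first five relations define the path algebra. -/
inductive PathRel (Q : SkewedGentleQuiver V E) :
    FreeAlgebra k (V ⊕ E) → FreeAlgebra k (V ⊕ E) → Prop
  | idem (i : V) :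
      PathRel Q (FreeAlgebra.ι k (.inl i) * FreeAlgebra.ι k (.inl i)) (FreeAlgebra.ι k (.inl i))
  | orth (i j : V) (h : i ≠ j) :
      PathRel Q (FreeAlgebra.ι k (.inl i) * FreeAlgebra.ι k (.inl j)) 0
  | one : PathRel Q (∑ i : V, FreeAlgebra.ι k (.inl i)) 1
  | target (a : E) :
      PathRel Q (FreeAlgebra.ι k (.inl (Q.target a).1) * FreeAlgebra.ι k (.inr a))
        (FreeAlgebra.ι k (.inr a))
  | source (a : E) :
      PathRel Q (FreeAlgebra.ι k (.inr a) * FreeAlgebra.ι k (.inl (Q.source a).1))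
        (FreeAlgebra.ι k (.inr a))
  | ordinary (a b : E) (ha : a ∉ Q.special) (hb : b ∉ Q.special) (h : Q.source a = Q.target b) :
      PathRel Q (FreeAlgebra.ι k (.inr a) * FreeAlgebra.ι k (.inr b)) 0
  | special (e : E) (he : e ∈ Q.special) :
      PathRel Q (FreeAlgebra.ι k (.inr e) * FreeAlgebra.ι k (.inr e))
        (FreeAlgebra.ι k (.inl (Q.source e).1))

/-- The algebra `kQ`: the path algebra of the underlying quiver modulo the relations `αβ = 0` for
ordinary arrows with `s(α) = t(β)` (including polarizations) and `ε² = e_i` for special loops. -/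
abbrev PathAlg (Q : SkewedGentleQuiver V E) : Type (max uk uV uE) := RingQuot (PathRel k Q)

end PathAlgebra

/-! ## The quiver `H°(x)` of an admissible word -/

section HQuiver

variable {V : Type uV} {E : Type uE}

/-- The number of vertices of `H°(x)`: for a string `x₀ x₁ ⋯ x_n` these are `1, …, n` (numbered
`0, …, n - 1` here), for a band `x₀ x₁ ⋯ x_n` these are `0, …, n`. -/
def numVertices (x : List (Letter V E)) : ℕ :=
  if startsTrivial x then x.length - 1 else x.length

/-- The left end of the edge given by the letter `x_i`: the vertex `i` in the numbering of the
words. For `x₀` in a string, which has no left end, it is by definition the right end. -/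
def leftEnd (x : List (Letter V E)) (i : ℕ) : ℕ :=
  if startsTrivial x then i - 1 else i

/-- The right end of the edge given by the letter `x_i`: the vertex `i + 1` in the numbering of
the words. For the last letter of a string, which has no right end, it is by definition the left
end. -/
def rightEnd (x : List (Letter V E)) (i : ℕ) : ℕ :=
  if startsTrivial x then min i (x.length - 2) else (i + 1) % x.length

/-- Position of the letter on the right of the vertex `j`. -/
def rightLetter (x : List (Letter V E)) (j : ℕ) : ℕ := if startsTrivial x then j + 1 else j

/-- Position of the letter on the left of the vertex `j`. -/
def leftLetter (x : List (Letter V E)) (j : ℕ) : ℕ :=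
  if startsTrivial x then j else (j + x.length - 1) % x.length

/-- `ℓ.IsArrow Q d a`: the edge of `H°(x)` given by the letter `ℓ` of `x` carries an arrow which is
mapped to the arrow `a` of `Q`, and which is directed to the left if `d = true`, and to the right
if `d = false`. A direct letter gives an arrow to the left, an inverse letter gives an arrow to the
right, and arrows which are mapped to special loops are there in both directions. The punctured
letters at the ends of a string give loops. -/
def Letter.IsArrow (Q : SkewedGentleQuiver V E) : Letter V E → Bool → E → Prop
  | .dir b, d, a => a = b ∧ (d = true ∨ a ∈ Q.special)
  | .inv b, d, a => a = b ∧ (d = false ∨ a ∈ Q.special)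
  | .special _, _, _ => False
  | .triv p, d, a => d = true ∧ a ∈ Q.special ∧ Q.source a = p
  | .trivInv p, d, a => d = false ∧ a ∈ Q.special ∧ Q.source a = p

/-- The vertex of the target of a letter. -/
def Letter.tgtVertex (Q : SkewedGentleQuiver V E) : Letter V E → V
  | .dir a => (Q.target a).1
  | .inv a => (Q.source a).1
  | .special e => (Q.target e).1
  | .triv p => p.1
  | .trivInv p => p.1

/-- Strings and bands for the associated gentle quiver. -/
def IsHatWord (Q : SkewedGentleQuiver V E) (x : List (Letter V E)) : Prop :=
  IsString Q.hat x ∨ IsBand Q.hat x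

theorem IsAdmissibleWord.isHatWord {Q : SkewedGentleQuiver V E} {x : List (Letter V E)}
    (h : IsAdmissibleWord Q x) : IsHatWord Q x :=
  h.imp (fun h => h.1) (fun h => h.1)

theorem flip_ne (p : V × ℤˣ) : flip p ≠ p := by
  intro h
  have h2 : -p.2 = p.2 := congrArg Prod.snd h
  rcases Int.units_eq_one_or p.2 with h3 | h3 <;> rw [h3] at h2 <;> exact absurd h2 (by decide)

theorem flip_flip (p : V × ℤˣ) : flip (flip p) = p := by simp [flip]

theorem special_source_eq_target (Q : SkewedGentleQuiver V E) {e : E} (he : e ∈ Q.special) :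
    Q.source e = Q.target e :=
  Prod.ext (Q.special_loop e he)
    ((Q.special_polarity e he).1.trans (Q.special_polarity e he).2.symm)

variable {Q : SkewedGentleQuiver V E} {x : List (Letter V E)}

theorem isHatWord_cases (hx : IsHatWord Q x) :
    (startsTrivial x = true ∧ 2 ≤ x.length ∧ IsString Q.hat x) ∨
    (startsTrivial x = false ∧ 1 ≤ x.length ∧ IsBand Q.hat x) := by
  rcases hx with hx | hx
  · left
    obtain ⟨-, ⟨p, hp⟩, ⟨q, hq⟩⟩ := id hx
    match x, hp, hq with
    | [], hp, _ => simp at hp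
    | [a], hp, hq => simp_all
    | a :: b :: l, hp, hq =>
      simp only [List.head?_cons, Option.some.injEq] at hp
      subst hp
      exact ⟨rfl, by simp, hx⟩
  · right
    refine ⟨?_, List.length_pos_iff.2 hx.1, hx⟩
    match x, hx with
    | [], hx => exact absurd rfl hx.1
    | .dir a :: l, _ => rfl
    | .inv a :: l, _ => rfl
    | .special a :: l, _ => rfl
    | .triv a :: l, _ => rfl
    | .trivInv a :: l, hx =>
      exfalso
      have h := List.isChain_append.1 hx.2.2
      obtain ⟨p, -, h3⟩ := h.2.2 _ (List.getLast?_eq_getLast_of_ne_nil (by simp)) (.trivInv a)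
        (by simp)
      simp [Letter.tgt] at h3

/-- The letters on the left and on the right of a vertex fit together. -/
theorem compat_at (hx : IsHatWord Q x) {j : ℕ} (hj : j < numVertices x) :
    ∃ (h1 : leftLetter x j < x.length) (h2 : rightLetter x j < x.length),
      Letter.Compat Q.hat x[leftLetter x j] x[rightLetter x j] := by
  rcases isHatWord_cases hx with ⟨hs, hl, h⟩ | ⟨hs, hl, h⟩
  · simp only [numVertices, leftLetter, rightLetter, hs, if_true] at hj ⊢
    exact ⟨by omega, by omega, List.isChain_iff_getElem.1 h.1.2 j (by omega)⟩
  · simp only [numVertices, leftLetter, rightLetter, hs, Bool.false_eq_true, if_false] at hj ⊢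
    have hc := List.isChain_iff_getElem.1 h.2.2
    refine ⟨Nat.mod_lt _ (by omega), hj, ?_⟩
    rcases Nat.eq_zero_or_pos j with rfl | h0
    · have h3 := hc (x.length - 1) (by simp; omega)
      have e1 : (0 + x.length - 1) % x.length = x.length - 1 := by
        rw [Nat.zero_add]; exact Nat.mod_eq_of_lt (by omega)
      have e2 : x.length - 1 + 1 = x.length := by omega
      simp only [e1]
      simp only [e2] at h3
      rw [List.getElem_append_left (by omega), List.getElem_append_right (by omega)] at h3
      simpa using h3
    · have h3 := hc (j - 1) (by simp; omega)
      have e1 : (j + x.length - 1) % x.length = j - 1 := by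
        have : j + x.length - 1 = (j - 1) + x.length := by omega
        rw [this, Nat.add_mod_right]; exact Nat.mod_eq_of_lt (by omega)
      have e2 : j - 1 + 1 = j := by omega
      simp only [e1]
      simp only [e2] at h3
      rw [List.getElem_append_left (by omega), List.getElem_append_left (by omega)] at h3
      exact h3

theorem leftEnd_lt (hx : IsHatWord Q x) {i : ℕ} (hi : i < x.length) :
    leftEnd x i < numVertices x := by
  rcases isHatWord_cases hx with ⟨hs, hl, h⟩ | ⟨hs, hl, h⟩ <;>
    simp only [numVertices, leftEnd, hs, if_true, Bool.false_eq_true, if_false] <;> omega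

theorem rightEnd_lt (hx : IsHatWord Q x) {i : ℕ} (hi : i < x.length) :
    rightEnd x i < numVertices x := by
  rcases isHatWord_cases hx with ⟨hs, hl, h⟩ | ⟨hs, hl, h⟩
  · simp only [numVertices, rightEnd, hs, if_true]; omega
  · simp only [numVertices, rightEnd, hs, Bool.false_eq_true, if_false]
    exact Nat.mod_lt _ (by omega)

theorem leftEnd_rightLetter (j : ℕ) : leftEnd x (rightLetter x j) = j := by
  cases hs : startsTrivial x <;> simp [leftEnd, rightLetter, hs]

theorem rightEnd_leftLetter {j : ℕ} (hj : j < numVertices x) :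
    rightEnd x (leftLetter x j) = j := by
  cases hs : startsTrivial x
  · simp only [numVertices, rightEnd, leftLetter, hs, Bool.false_eq_true, if_false] at hj ⊢
    rw [Nat.mod_add_mod]
    have : j + x.length - 1 + 1 = j + x.length := by omega
    rw [this, Nat.add_mod_right]
    exact Nat.mod_eq_of_lt hj
  · simp only [numVertices, rightEnd, leftLetter, hs, if_true] at hj ⊢
    omega

theorem rightLetter_leftEnd (hx : IsHatWord Q x) {i : ℕ} (hi : i < x.length)
    (h : ∀ p, x[i] ≠ .trivInv p) : rightLetter x (leftEnd x i) = i := by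
  rcases isHatWord_cases hx with ⟨hs, hl, hst⟩ | ⟨hs, hl, h⟩
  · simp only [rightLetter, leftEnd, hs, if_true]
    rcases Nat.eq_zero_or_pos i with rfl | h0
    · obtain ⟨p, hp⟩ := hst.2.1
      rw [List.head?_eq_getElem?, List.getElem?_eq_getElem hi] at hp
      exact absurd (Option.some.inj hp) (h p)
    · omega
  · simp [rightLetter, leftEnd, hs]

theorem leftLetter_rightEnd (hx : IsHatWord Q x) {i : ℕ} (hi : i < x.length)
    (h : ∀ p, x[i] ≠ .triv p) : leftLetter x (rightEnd x i) = i := by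
  rcases isHatWord_cases hx with ⟨hs, hl, hst⟩ | ⟨hs, hl, hst⟩
  · simp only [leftLetter, rightEnd, hs, if_true]
    by_cases h0 : i = x.length - 1
    · obtain ⟨p, hp⟩ := hst.2.2
      subst h0
      rw [List.getLast?_eq_getElem?, List.getElem?_eq_getElem hi] at hp
      exact absurd (Option.some.inj hp) (h p)
    · omega
  · simp only [leftLetter, rightEnd, hs, Bool.false_eq_true, if_false]
    by_cases h0 : i + 1 = x.length
    · rw [h0, Nat.mod_self, Nat.zero_add, Nat.mod_eq_of_lt (by omega)]; omega
    · have e1 : (i + 1) % x.length = i + 1 := Nat.mod_eq_of_lt (by omega)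
      have e2 : i + 1 + x.length - 1 = i + x.length := by omega
      rw [e1, e2, Nat.add_mod_right]
      exact Nat.mod_eq_of_lt hi

theorem ends_eq_of_triv (hx : IsHatWord Q x) {i : ℕ} (hi : i < x.length) {p : V × ℤˣ}
    (h : x[i] = .triv p) : leftEnd x i = rightEnd x i := by
  by_contra hne
  have h1 := leftEnd_lt hx hi
  have h2 := rightEnd_lt hx hi
  rcases isHatWord_cases hx with ⟨hs, hl, hst⟩ | ⟨hs, hl, hst⟩
  · simp only [leftEnd, rightEnd, hs, if_true] at hne
    have h3 := List.isChain_iff_getElem.1 hst.1.2 i (by omega)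
    obtain ⟨q, h4, -⟩ := h3
    rw [h] at h4
    simp [Letter.src] at h4
  · obtain ⟨g1, g2, q, h4, -⟩ := compat_at hx h2
    have e : leftLetter x (rightEnd x i) = i := by
      simp only [leftLetter, rightEnd, hs, Bool.false_eq_true, if_false]
      by_cases h0 : i + 1 = x.length
      · rw [h0, Nat.mod_self, Nat.zero_add, Nat.mod_eq_of_lt (by omega)]; omega
      · have e1 : (i + 1) % x.length = i + 1 := Nat.mod_eq_of_lt (by omega)
        have e2 : i + 1 + x.length - 1 = i + x.length := by omega
        rw [e1, e2, Nat.add_mod_right]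
        exact Nat.mod_eq_of_lt hi
    simp only [e, h] at h4
    simp [Letter.src] at h4

theorem ends_eq_of_trivInv (hx : IsHatWord Q x) {i : ℕ} (hi : i < x.length) {p : V × ℤˣ}
    (h : x[i] = .trivInv p) : leftEnd x i = rightEnd x i := by
  by_contra hne
  have h1 := leftEnd_lt hx hi
  rcases isHatWord_cases hx with ⟨hs, hl, hst⟩ | ⟨hs, hl, hst⟩
  · simp only [leftEnd, rightEnd, hs, if_true] at hne
    have h3 := List.isChain_iff_getElem.1 hst.1.2 (i - 1) (by omega)
    obtain ⟨q, -, h4⟩ := h3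
    have e : i - 1 + 1 = i := by omega
    simp only [e, h] at h4
    simp [Letter.tgt] at h4
  · obtain ⟨g1, g2, q, -, h4⟩ := compat_at hx h1
    have e : rightLetter x (leftEnd x i) = i := by simp [rightLetter, leftEnd, hs]
    simp only [e, h] at h4
    simp [Letter.tgt] at h4

/-- The target of the arrow (given by the letter `x_i`) which is directed to the left if
`d = true`, and to the right if `d = false`. -/
def hTarget (hx : IsHatWord Q x) (i : Fin x.length) (d : Bool) : Fin (numVertices x) :=
  if d then ⟨leftEnd x i, leftEnd_lt hx i.2⟩ else ⟨rightEnd x i, rightEnd_lt hx i.2⟩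

/-- The source of the arrow (given by the letter `x_i`) which is directed to the left if
`d = true`, and to the right if `d = false`. -/
def hSource (hx : IsHatWord Q x) (i : Fin x.length) (d : Bool) : Fin (numVertices x) :=
  hTarget hx i (!d)

/-- The map from the vertices of `H°(x)` to the vertices of `Q`. -/
def hVertex (hx : IsHatWord Q x) (j : Fin (numVertices x)) : V :=
  (x[rightLetter x j]'((compat_at hx j.2).2.1)).tgtVertex Q

/-- An arrow of `H°(x)` over the arrow `a` of `Q`. -/
def IsHArrow (Q : SkewedGentleQuiver V E) (x : List (Letter V E)) (a : E)
    (p : Fin x.length × Bool) : Prop :=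
  (x[p.1]).IsArrow Q p.2 a

theorem hat_src (l : Letter V E) : l.src Q.hat = l.src Q := by cases l <;> rfl

theorem hat_tgt (l : Letter V E) : l.tgt Q.hat = l.tgt Q := by cases l <;> rfl

theorem tgtVertex_of_tgt {l : Letter V E} {p : V × ℤˣ} (h : l.tgt Q = some p) :
    l.tgtVertex Q = p.1 := by
  cases l <;> simp_all [Letter.tgt, Letter.tgtVertex]

/-- The polarized vertex of `Q` at which the letter on the right of `j` ends. -/
theorem exists_pol (hx : IsHatWord Q x) (j : Fin (numVertices x)) :
    ∃ P : V × ℤˣ, hVertex hx j = P.1 ∧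
      (∀ (i : Fin x.length), (i : ℕ) = rightLetter x j → (x[i]).tgt Q = some P) ∧
      (∀ (i : Fin x.length), (i : ℕ) = leftLetter x j → (x[i]).src Q = some (flip P)) := by
  obtain ⟨h1, h2, p, h3, h4⟩ := compat_at hx j.2
  rw [hat_src] at h3
  rw [hat_tgt] at h4
  refine ⟨flip p, tgtVertex_of_tgt h4, ?_, ?_⟩
  · rintro ⟨i, hi⟩ rfl
    exact h4
  · rintro ⟨i, hi⟩ rfl
    rw [flip_flip]
    exact h3

theorem arrow_in (hx : IsHatWord Q x) {a : E} {p : Fin x.length × Bool} (hp : IsHArrow Q x a p)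
    {j : Fin (numVertices x)} (hj : hTarget hx p.1 p.2 = j) {P : V × ℤˣ}
    (hr : ∀ (i : Fin x.length), (i : ℕ) = rightLetter x j → (x[i]).tgt Q = some P)
    (hl : ∀ (i : Fin x.length), (i : ℕ) = leftLetter x j → (x[i]).src Q = some (flip P)) :
    (p.2 = true ∧ (p.1 : ℕ) = rightLetter x j ∧ P = Q.target a) ∨
    (p.2 = false ∧ (p.1 : ℕ) = leftLetter x j ∧ flip P = Q.target a) := by
  obtain ⟨i, d⟩ := p
  subst hj
  have hp : (x[i]).IsArrow Q d a := hp
  cases d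
  · right
    have h1 : (i : ℕ) = leftLetter x (hTarget hx i false) := by
      refine (leftLetter_rightEnd hx i.2 ?_).symm
      intro q hq
      have hq : x[i] = .triv q := hq
      rw [hq] at hp
      simp [Letter.IsArrow] at hp
    refine ⟨rfl, h1, ?_⟩
    have h2 := hl i h1
    generalize x[i] = l at hp h2
    cases l <;> simp only [Letter.IsArrow, Letter.src, Option.some.injEq, reduceCtorEq,
      false_and] at hp h2
    · obtain ⟨rfl, h3⟩ := hp
      rw [← h2, special_source_eq_target Q (by simpa using h3)]
    · rw [← h2, hp.1]
    · rw [← h2, ← special_source_eq_target Q hp.2.1, hp.2.2]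
  · left
    have h1 : (i : ℕ) = rightLetter x (hTarget hx i true) := by
      refine (rightLetter_leftEnd hx i.2 ?_).symm
      intro q hq
      have hq : x[i] = .trivInv q := hq
      rw [hq] at hp
      simp [Letter.IsArrow] at hp
    refine ⟨rfl, h1, ?_⟩
    have h2 := hr i h1
    generalize x[i] = l at hp h2
    cases l <;> simp only [Letter.IsArrow, Letter.tgt, Option.some.injEq, reduceCtorEq,
      false_and] at hp h2
    · rw [← h2, hp.1]
    · obtain ⟨rfl, h3⟩ := hp
      rw [← h2, special_source_eq_target Q (by simpa using h3)]
    · rw [← h2, ← special_source_eq_target Q hp.2.1, hp.2.2]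

/-- A special arrow has a reverse arrow over the same loop. -/
theorem exists_reverse (hx : IsHatWord Q x) {e : E} (he : e ∈ Q.special)
    {p : Fin x.length × Bool} (hp : IsHArrow Q x e p) :
    ∃ d, IsHArrow Q x e (p.1, d) ∧ hTarget hx p.1 d = hSource hx p.1 p.2 ∧
      hSource hx p.1 d = hTarget hx p.1 p.2 ∧
      (d = (!p.2) ∨ (d = p.2 ∧ ((∃ q, x[p.1] = .triv q) ∨ ∃ q, x[p.1] = .trivInv q))) := by
  obtain ⟨i, d⟩ := p
  have hp : (x[i]).IsArrow Q d e := hp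
  have key : (∀ q, x[i] ≠ .triv q) → (∀ q, x[i] ≠ .trivInv q) →
      IsHArrow Q x e (i, !d) := by
    intro h1 h2
    change (x[i]).IsArrow Q (!d) e
    generalize x[i] = l at hp h1 h2
    cases l <;> simp_all [Letter.IsArrow]
  by_cases h1 : ∃ q, x[i] = .triv q
  · obtain ⟨q, hq⟩ := h1
    have h3 : hTarget hx i false = hTarget hx i true :=
      Fin.ext (ends_eq_of_triv hx i.2 hq).symm
    refine ⟨d, hp, ?_, ?_, Or.inr ⟨rfl, Or.inl ⟨q, hq⟩⟩⟩ <;> cases d <;> simp [hSource, h3]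
  · by_cases h2 : ∃ q, x[i] = .trivInv q
    · obtain ⟨q, hq⟩ := h2
      have h3 : hTarget hx i false = hTarget hx i true :=
        Fin.ext (ends_eq_of_trivInv hx i.2 hq).symm
      refine ⟨d, hp, ?_, ?_, Or.inr ⟨rfl, Or.inr ⟨q, hq⟩⟩⟩ <;> cases d <;> simp [hSource, h3]
    · exact ⟨!d, key (not_exists.1 h1) (not_exists.1 h2), rfl, by simp [hSource], Or.inl rfl⟩

theorem arrow_out (hx : IsHatWord Q x) {a : E} (ha : a ∉ Q.special) {p : Fin x.length × Bool}
    (hp : IsHArrow Q x a p) {j : Fin (numVertices x)} (hj : hSource hx p.1 p.2 = j) {P : V × ℤˣ}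
    (hr : ∀ (i : Fin x.length), (i : ℕ) = rightLetter x j → (x[i]).tgt Q = some P)
    (hl : ∀ (i : Fin x.length), (i : ℕ) = leftLetter x j → (x[i]).src Q = some (flip P)) :
    (p.2 = true ∧ x[p.1] = .dir a ∧ (p.1 : ℕ) = leftLetter x j ∧ flip P = Q.source a) ∨
    (p.2 = false ∧ x[p.1] = .inv a ∧ (p.1 : ℕ) = rightLetter x j ∧ P = Q.source a) := by
  obtain ⟨i, d⟩ := p
  subst hj
  have hp : (x[i]).IsArrow Q d a := hp
  have hlet : (d = true ∧ x[i] = .dir a) ∨ (d = false ∧ x[i] = .inv a) := by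
    generalize x[i] = l at hp
    cases l <;> simp_all [Letter.IsArrow]
  rcases hlet with ⟨rfl, h⟩ | ⟨rfl, h⟩
  · left
    have h1 : (i : ℕ) = leftLetter x (hSource hx i true) := by
      refine (leftLetter_rightEnd hx i.2 ?_).symm
      intro q hq
      have hq : x[i] = .triv q := hq
      rw [h] at hq
      cases hq
    refine ⟨rfl, h, h1, ?_⟩
    have h2 := hl i h1
    rw [h] at h2
    exact (Option.some.inj h2).symm
  · right
    have h1 : (i : ℕ) = rightLetter x (hSource hx i false) := by
      refine (rightLetter_leftEnd hx i.2 ?_).symm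
      intro q hq
      have hq : x[i] = .trivInv q := hq
      rw [h] at hq
      cases hq
    refine ⟨rfl, h, h1, ?_⟩
    have h2 := hr i h1
    rw [h] at h2
    exact (Option.some.inj h2).symm

theorem hVertex_target (hx : IsHatWord Q x) {a : E} {p : Fin x.length × Bool}
    (hp : IsHArrow Q x a p) : hVertex hx (hTarget hx p.1 p.2) = (Q.target a).1 := by
  obtain ⟨P, h1, h2, h3⟩ := exists_pol hx (hTarget hx p.1 p.2)
  rw [h1]
  rcases arrow_in hx hp rfl h2 h3 with ⟨-, -, h⟩ | ⟨-, -, h⟩ <;> rw [← h]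
  rfl

theorem hVertex_source (hx : IsHatWord Q x) {a : E} {p : Fin x.length × Bool}
    (hp : IsHArrow Q x a p) : hVertex hx (hSource hx p.1 p.2) = (Q.source a).1 := by
  by_cases ha : a ∈ Q.special
  · obtain ⟨d, h1, h2, -⟩ := exists_reverse hx ha hp
    rw [← h2, special_source_eq_target Q ha]
    exact hVertex_target hx h1
  · obtain ⟨P, h1, h2, h3⟩ := exists_pol hx (hSource hx p.1 p.2)
    rw [h1]
    rcases arrow_out hx ha hp rfl h2 h3 with ⟨-, -, -, h⟩ | ⟨-, -, -, h⟩ <;> rw [← h]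
    rfl

theorem arrow_unique (hx : IsHatWord Q x) {a : E} {p q : Fin x.length × Bool}
    (hp : IsHArrow Q x a p) (hq : IsHArrow Q x a q)
    (h : hTarget hx p.1 p.2 = hTarget hx q.1 q.2) : p = q := by
  obtain ⟨P, -, h2, h3⟩ := exists_pol hx (hTarget hx q.1 q.2)
  rcases arrow_in hx hp h h2 h3 with ⟨a1, a2, a3⟩ | ⟨a1, a2, a3⟩ <;>
    rcases arrow_in hx hq rfl h2 h3 with ⟨b1, b2, b3⟩ | ⟨b1, b2, b3⟩
  · exact Prod.ext (Fin.ext (a2.trans b2.symm)) (a1.trans b1.symm)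
  · exact absurd (b3.trans a3.symm) (flip_ne P)
  · exact absurd (a3.trans b3.symm) (flip_ne P)
  · exact Prod.ext (Fin.ext (a2.trans b2.symm)) (a1.trans b1.symm)

theorem isHatWord_valid (hx : IsHatWord Q x) (i : Fin x.length) : (x[i]).IsValid Q.hat := by
  rcases hx with hx | hx
  · exact hx.1.1 _ (List.getElem_mem i.2)
  · exact hx.2.1 _ (List.mem_append_left _ (List.getElem_mem i.2))

theorem exists_arrow (hx : IsHatWord Q x) {e : E} (he : e ∈ Q.special)
    {j : Fin (numVertices x)} (hj : hVertex hx j = (Q.source e).1) :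
    ∃ p, IsHArrow Q x e p ∧ hTarget hx p.1 p.2 = j := by
  obtain ⟨P, h1, h2, h3⟩ := exists_pol hx j
  obtain ⟨g1, g2, -⟩ := compat_at hx j.2
  have hpol := (Q.special_polarity e he).1
  have hst := special_source_eq_target Q he
  rcases Int.units_eq_one_or P.2 with h4 | h4
  · have h5 : flip P = Q.source e := Prod.ext (h1.symm.trans hj) (by
      change -P.2 = _
      rw [h4, hpol])
    refine ⟨(⟨leftLetter x j, g1⟩, false), ?_, Fin.ext (rightEnd_leftLetter j.2)⟩
    have h6 := h3 ⟨leftLetter x j, g1⟩ rfl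
    have h7 := isHatWord_valid hx ⟨leftLetter x j, g1⟩
    change (x[(⟨leftLetter x j, g1⟩ : Fin x.length)]).IsArrow Q false e
    rw [h5] at h6
    generalize x[(⟨leftLetter x j, g1⟩ : Fin x.length)] = l at h6 h7
    cases l <;> simp only [Letter.src, Option.some.injEq, reduceCtorEq] at h6
    · exact ⟨(Q.source_injective h6).symm, Or.inr he⟩
    · exact ⟨(Q.target_injective (h6.trans hst)).symm, Or.inl rfl⟩
    · exact absurd h7 (by simp [Letter.IsValid, SkewedGentleQuiver.hat])
    · exact ⟨rfl, he, h6.symm⟩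
  · have h5 : P = Q.source e := Prod.ext (h1.symm.trans hj) (h4.trans hpol.symm)
    refine ⟨(⟨rightLetter x j, g2⟩, true), ?_, Fin.ext (leftEnd_rightLetter _)⟩
    have h6 := h2 ⟨rightLetter x j, g2⟩ rfl
    have h7 := isHatWord_valid hx ⟨rightLetter x j, g2⟩
    change (x[(⟨rightLetter x j, g2⟩ : Fin x.length)]).IsArrow Q true e
    rw [h5] at h6
    generalize x[(⟨rightLetter x j, g2⟩ : Fin x.length)] = l at h6 h7
    cases l <;> simp only [Letter.tgt, Option.some.injEq, reduceCtorEq] at h6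
    · exact ⟨(Q.target_injective (h6.trans hst)).symm, Or.inl rfl⟩
    · exact ⟨(Q.source_injective h6).symm, Or.inr he⟩
    · exact absurd h7 (by simp [Letter.IsValid, SkewedGentleQuiver.hat])
    · exact ⟨rfl, he, h6.symm⟩

theorem ordinary_comp (hx : IsHatWord Q x) {a b : E} (ha : a ∉ Q.special) (hb : b ∉ Q.special)
    (hab : Q.source a = Q.target b) {p q : Fin x.length × Bool}
    (hp : IsHArrow Q x a p) (hq : IsHArrow Q x b q) :
    hTarget hx q.1 q.2 ≠ hSource hx p.1 p.2 := by
  intro h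
  obtain ⟨P, -, h2, h3⟩ := exists_pol hx (hSource hx p.1 p.2)
  have hq' : (x[q.1]).IsArrow Q q.2 b := hq
  rcases arrow_out hx ha hp rfl h2 h3 with ⟨a1, a2, a3, a4⟩ | ⟨a1, a2, a3, a4⟩ <;>
    rcases arrow_in hx hq h h2 h3 with ⟨b1, b2, b3⟩ | ⟨b1, b2, b3⟩
  · exact flip_ne P ((a4.trans hab).trans b3.symm)
  · have e : q.1 = p.1 := Fin.ext (b2.trans a3.symm)
    have e2 : x[q.1] = x[p.1] := congrArg (fun i : Fin x.length => x[i]) e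
    rw [e2, a2, b1] at hq'
    simp [Letter.IsArrow, hb] at hq'
  · have e : q.1 = p.1 := Fin.ext (b2.trans a3.symm)
    have e2 : x[q.1] = x[p.1] := congrArg (fun i : Fin x.length => x[i]) e
    rw [e2, a2, b1] at hq'
    simp [Letter.IsArrow, hb] at hq'
  · exact flip_ne P (b3.trans (hab.symm.trans a4.symm))

/-- The set of admissible words. -/
abbrev AdmWord (Q : SkewedGentleQuiver V E) : Type (max uV uE) :=
  {x : List (Letter V E) // IsAdmissibleWord Q x}

end HQuiver

/-! ## The modules `M°_x(X)` -/

section Modules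

variable (k : Type uk) [Field k] {V : Type uV} {E : Type uE}

/-- The unit `U_x` of `A_x` attached to an arrow of `H°(x)`. For a band it is `T` resp. `T⁻¹` for
an arrow given by the letter `x₀` which is directed to the left resp. to the right. -/
def arrowUnit (σ : WordType) (x : List (Letter V E)) (p : Fin x.length × Bool) : WordAlg k σ :=
  match x[p.1] with
  | .triv _ => WordAlg.etaOne k σ
  | .trivInv _ => WordAlg.etaZero k σ
  | _ => if startsTrivial x = false ∧ (p.1 : ℕ) = 0 then WordAlg.bandUnit k p.2 σ else 1

theorem arrowUnit_mul_reverse (σ : WordType) (x : List (Letter V E)) (p : Fin x.length × Bool)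
    (d : Bool)
    (h : d = (!p.2) ∨ (d = p.2 ∧ ((∃ q, x[p.1] = .triv q) ∨ ∃ q, x[p.1] = .trivInv q))) :
    arrowUnit k σ x p * arrowUnit k σ x (p.1, d) = 1 := by
  obtain ⟨i, c⟩ := p
  dsimp only at h
  unfold arrowUnit
  dsimp only
  generalize x[i] = l at h
  cases l with
  | triv q => exact WordAlg.etaOne_mul_self k σ
  | trivInv q => exact WordAlg.etaZero_mul_self k σ
  | dir a | inv a | special a =>
    simp only [reduceCtorEq, exists_false, or_self, and_false, or_false] at h
    subst h
    dsimp only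
    split_ifs
    · exact WordAlg.bandUnit_mul k c σ
    · exact one_mul 1

/-- The underlying space of the module `M°_x(X)`: one copy of `X` for each vertex of `H°(x)`. -/
def WordModule (_k : Type uk) (_σ : WordType) {Q : SkewedGentleQuiver V E} (x : AdmWord Q)
    (X : Type uX) : Type uX := Fin (numVertices x.1) → X

variable {Q : SkewedGentleQuiver V E}

instance (σ : WordType) (x : AdmWord Q) (X : Type uX) [AddCommGroup X] :
    AddCommGroup (WordModule k σ x X) :=
  inferInstanceAs (AddCommGroup (Fin (numVertices x.1) → X))

instance (σ : WordType) (x : AdmWord Q) (X : Type uX) [AddCommGroup X] [Module k X] :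
    Module k (WordModule k σ x X) :=
  inferInstanceAs (Module k (Fin (numVertices x.1) → X))

variable (σ : WordType) (x : AdmWord Q) (X : Type uX) [AddCommGroup X] [Module k X]

open Classical in
/-- The action of the trivial path `e_i` on `M°_x(X)`. -/
noncomputable def vertexAct (i : V) : Module.End k (WordModule k σ x X) where
  toFun m := fun j => if hVertex x.2.isHatWord j = i then m j else 0
  map_add' m n := by
    funext j
    change (if _ then m j + n j else 0) = (if _ then m j else 0) + (if _ then n j else 0)
    split_ifs <;> simp
  map_smul' c m := by
    funext j
    change (if _ then c • m j else 0) = c • (if _ then m j else 0)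
    split_ifs <;> simp

variable [Module (WordAlg k σ) X]

open Classical in
/-- The component at the vertex `j` of `a m`, for `m` in `M°_x(X)` and an arrow `a` of `Q`: the sum
of `U_x(ν) m_{s(ν)}` over all the arrows `ν` of `H°(x)` over `a` with `t(ν) = j`. -/
noncomputable def arrowActFun (a : E) (m : Fin (numVertices x.1) → X)
    (j : Fin (numVertices x.1)) : X :=
  ∑ p : Fin x.1.length × Bool,
    if IsHArrow Q x.1 a p ∧ hTarget x.2.isHatWord p.1 p.2 = j then
      arrowUnit k σ x.1 p • m (hSource x.2.isHatWord p.1 p.2) else 0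

theorem arrowActFun_eq (a : E) (m : Fin (numVertices x.1) → X) (p : Fin x.1.length × Bool)
    (hp : IsHArrow Q x.1 a p) :
    arrowActFun k σ x X a m (hTarget x.2.isHatWord p.1 p.2) =
      arrowUnit k σ x.1 p • m (hSource x.2.isHatWord p.1 p.2) := by
  classical
  unfold arrowActFun
  rw [Finset.sum_eq_single p]
  · exact if_pos ⟨hp, rfl⟩
  · intro q _ hq
    exact if_neg fun h => hq (arrow_unique x.2.isHatWord h.1 hp h.2)
  · intro h
    exact absurd (Finset.mem_univ p) h

theorem arrowActFun_eq_zero (a : E) (m : Fin (numVertices x.1) → X) (j : Fin (numVertices x.1))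
    (h : ∀ p, IsHArrow Q x.1 a p → hTarget x.2.isHatWord p.1 p.2 = j →
      m (hSource x.2.isHatWord p.1 p.2) = 0) : arrowActFun k σ x X a m j = 0 := by
  classical
  unfold arrowActFun
  refine Finset.sum_eq_zero fun p _ => ?_
  split_ifs with h1
  · rw [h p h1.1 h1.2, smul_zero]
  · rfl

variable [IsScalarTower k (WordAlg k σ) X]

/-- The action of an arrow `a` of `Q` on `M°_x(X)`. -/
noncomputable def arrowAct (a : E) : Module.End k (WordModule k σ x X) where
  toFun m := arrowActFun k σ x X a m
  map_add' m n := by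
    classical
    funext j
    change arrowActFun k σ x X a _ j = arrowActFun k σ x X a m j + arrowActFun k σ x X a n j
    unfold arrowActFun
    rw [← Finset.sum_add_distrib]
    refine Finset.sum_congr rfl fun p _ => ?_
    split_ifs
    · exact smul_add _ _ _
    · exact (add_zero 0).symm
  map_smul' c m := by
    classical
    funext j
    change arrowActFun k σ x X a _ j = c • arrowActFun k σ x X a m j
    unfold arrowActFun
    rw [Finset.smul_sum]
    refine Finset.sum_congr rfl fun p _ => ?_
    split_ifs
    · have : SMulCommClass k (WordAlg k σ) X := IsScalarTower.to_smulCommClass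
      exact (smul_comm c _ _).symm
    · exact (smul_zero c).symm

variable [Fintype V]

theorem act_rel (u v : FreeAlgebra k (V ⊕ E)) (h : PathRel k Q u v) :
    FreeAlgebra.lift k (Sum.elim (vertexAct k σ x X) (arrowAct k σ x X)) u =
      FreeAlgebra.lift k (Sum.elim (vertexAct k σ x X) (arrowAct k σ x X)) v := by
  classical
  have hx := x.2.isHatWord
  cases h <;> simp only [map_mul, map_zero, map_one, map_sum, FreeAlgebra.lift_ι_apply,
    Sum.elim_inl, Sum.elim_inr] <;> refine LinearMap.ext fun m => funext fun j => ?_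
  case idem i =>
    change (if _ then (if _ then m j else 0) else 0) = if _ then m j else 0
    split_ifs <;> rfl
  case orth i i' h =>
    change (if hVertex hx j = i then (if hVertex hx j = i' then m j else 0) else 0) = 0
    split_ifs with h1 h2
    · exact absurd (h1.symm.trans h2) h
    · rfl
    · rfl
  case one =>
    have : (∑ i : V, vertexAct k σ x X i) m j = ∑ i : V, if hVertex hx j = i then m j else 0 := by
      rw [LinearMap.sum_apply]
      exact Finset.sum_apply j Finset.univ fun i => (vertexAct k σ x X i m : Fin _ → X)
    rw [this]
    simp
  case target a =>
    change (if hVertex hx j = (Q.target a).1 then arrowActFun k σ x X a m j else 0) =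
      arrowActFun k σ x X a m j
    split_ifs with h1
    · rfl
    · refine (arrowActFun_eq_zero k σ x X a m j ?_).symm
      rintro p hp rfl
      exact absurd (hVertex_target hx hp) h1
  case source a =>
    change arrowActFun k σ x X a (vertexAct k σ x X (Q.source a).1 m) j =
      arrowActFun k σ x X a m j
    unfold arrowActFun
    refine Finset.sum_congr rfl fun p _ => ?_
    split_ifs with h1
    · have : vertexAct k σ x X (Q.source a).1 m (hSource hx p.1 p.2) = m (hSource hx p.1 p.2) :=
        if_pos (hVertex_source hx h1.1)
      rw [this]
    · rfl
  case ordinary a b ha hb hab =>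
    change arrowActFun k σ x X a (arrowActFun k σ x X b m) j = 0
    refine arrowActFun_eq_zero k σ x X a _ j fun p hp _ => ?_
    refine arrowActFun_eq_zero k σ x X b m _ fun q hq h => ?_
    exact absurd h (ordinary_comp hx ha hb hab hp hq)
  case special e he =>
    change arrowActFun k σ x X e (arrowActFun k σ x X e m) j =
      if hVertex hx j = (Q.source e).1 then m j else 0
    split_ifs with h1
    · obtain ⟨p, hp, rfl⟩ := exists_arrow hx he h1
      obtain ⟨d, g1, g2, g3, g4⟩ := exists_reverse hx he hp
      have h2 := arrowActFun_eq k σ x X e m (p.1, d) g1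
      dsimp only at h2
      rw [arrowActFun_eq k σ x X e _ p hp, ← g2, h2, g3, ← mul_smul,
        arrowUnit_mul_reverse k σ x.1 p d g4, one_smul]
    · refine arrowActFun_eq_zero k σ x X e _ j ?_
      rintro p hp rfl
      exact absurd ((hVertex_target hx hp).trans
        (congrArg Prod.fst (special_source_eq_target Q he)).symm) h1

/-- The representation of `kQ` on `M°_x(X)`. -/
noncomputable def pathRep : PathAlg k Q →ₐ[k] Module.End k (WordModule k σ x X) :=
  RingQuot.liftAlgHom k
    ⟨FreeAlgebra.lift k (Sum.elim (vertexAct k σ x X) (arrowAct k σ x X)),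
      fun {u v} h => act_rel k σ x X u v h⟩

/-- The `kQ`-module `M°_x(X)`. -/
noncomputable instance : Module (PathAlg k Q) (WordModule k σ x X) :=
  Module.compHom (WordModule k σ x X) (pathRep k σ x X).toRingHom

theorem WordModule.smul_def (u : PathAlg k Q) (m : WordModule k σ x X) :
    u • m = pathRep k σ x X u m := rfl

instance : IsScalarTower k (PathAlg k Q) (WordModule k σ x X) where
  smul_assoc c u m := by
    rw [WordModule.smul_def, WordModule.smul_def, map_smul]
    rfl

end Modules

/-! ## The Auslander-Reiten translate -/

section AuslanderReiten

universe uM uN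

variable (k : Type uk) [Field k] {R : Type uX} [Ring R] [Algebra k R]

/-- `P₁ → P₀ → M → 0` is a minimal projective presentation. -/
structure IsMinimalPresentation {P₁ P₀ : Type uX} {M : Type uM} [AddCommGroup P₁] [Module R P₁]
    [AddCommGroup P₀] [Module R P₀] [AddCommGroup M] [Module R M]
    (f : P₁ →ₗ[R] P₀) (g : P₀ →ₗ[R] M) : Prop where
  finite_one : Module.Finite R P₁
  finite_zero : Module.Finite R P₀
  projective_one : Module.Projective R P₁
  projective_zero : Module.Projective R P₀
  surjective : Function.Surjective g
  exact : LinearMap.range f = LinearMap.ker g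
  minimal_zero : ∀ N : Submodule R P₀, LinearMap.ker g ⊔ N = ⊤ → N = ⊤
  minimal_one : ∀ N : Submodule R P₁, LinearMap.ker f ⊔ N = ⊤ → N = ⊤

/-- The map `Hom_R(f, R) : Hom_R(P₀, R) → Hom_R(P₁, R)`. -/
def homDual {P₁ P₀ : Type uX} [AddCommGroup P₁] [Module R P₁] [AddCommGroup P₀] [Module R P₀]
    (f : P₁ →ₗ[R] P₀) : (P₀ →ₗ[R] R) →ₗ[k] (P₁ →ₗ[R] R) where
  toFun h := h ∘ₗ f
  map_add' _ _ := rfl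
  map_smul' _ _ := rfl

/-- The right action of `R` on `Hom_R(P, R)`: `(h r)(p) = h(p) r`. -/
def rightMul {P : Type uX} [AddCommGroup P] [Module R P] (h : P →ₗ[R] R) (r : R) : P →ₗ[R] R where
  toFun p := h p * r
  map_add' p q := by rw [map_add, add_mul]
  map_smul' a p := by simp [mul_assoc]

/-- `N` is the Auslander-Reiten translate `D Tr M` of the left `R`-module `M`: for a minimal
projective presentation `f : P₁ → P₀` of `M`, with transpose `Tr M = Coker Hom_R(f, R)` (a right
module), `N` is isomorphic to the dual `D Tr M = Hom_k(Tr M, k)`, as left `R`-module. -/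
def IsARTranslate (M : Type uM) (N : Type uN) [AddCommGroup M] [Module R M]
    [AddCommGroup N] [Module k N] [Module R N] : Prop :=
  ∃ (P₁ P₀ : Type uX) (_ : AddCommGroup P₁) (_ : AddCommGroup P₀) (_ : Module R P₁)
    (_ : Module R P₀) (f : P₁ →ₗ[R] P₀) (g : P₀ →ₗ[R] M),
    IsMinimalPresentation f g ∧
    ∃ φ : N ≃ₗ[k] Module.Dual k ((P₁ →ₗ[R] R) ⧸ LinearMap.range (homDual k f)),
      ∀ (r : R) (n : N) (h : P₁ →ₗ[R] R),
        φ (r • n) (Submodule.Quotient.mk h) = φ n (Submodule.Quotient.mk (rightMul h r))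

/-- Indecomposable modules. -/
def IsIndecomposable (R : Type uX) [Ring R] (M : Type uM) [AddCommGroup M] [Module R M] : Prop :=
  Nontrivial M ∧ ∀ p q : Submodule R M, IsCompl p q → p = ⊥ ∨ q = ⊥

end AuslanderReiten

end SkewedGentle

/-!
# The Auslander-Reiten translate of the modules of admissible words

The translate `D Tr M` is computed from a projective presentation `P₁ → P₀ → M → 0`, as the dual of
the cokernel of the transposed map. The presentation need not be minimal: it suffices that no
non-zero direct summand of `P₁` lies in the kernel of `P₁ → P₀`, since by Fitting's argument the
presentation is then the sum of a minimal one and of an isomorphism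
(`isARTranslate_of_presentation`). The algebra `kQ` enters through its basis of admissible paths
(`pathBasis`), which follows from a representation on the span of the paths, and through the
filtration by the number of ordinary arrows.

A module and its translate are read off from one combinatorial object. The positions of a `Diagram`
are joined by arrows as those of a word, and a position belongs to the word `x` (`isM`), to its
translate `y` (`isN`), or to both. There are generators at every position, except at the outer ends
of the tails which belong to `y` only, where they are replaced by zero. The relation of an arrow
`j → j'` says that it maps the generators at `j` to those at `j'`, and at a puncture with loop `ε`
there is a relation with the idempotent `(1 - tε) / 2`, where `t` is the prescribed eigenvalue; this
requires `2 ≠ 0`. These relations present the module of `x`, and the cokernel of the transposed map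
has a dual with coordinates at the positions of `y`. Transposing replaces a relation by the
condition that a function vanishes on it, so that `ε` acts by `-t` on the coordinates at a puncture:
this is the twist by `χ` (`Diagram.Describes`, `Diagram.CoDescribes`, `Diagram.isARTranslate`,
`isARTranslate_of_embedding`).

For words of type `(p,p)` and for bands, the diagram is that of the word itself, all of whose
positions belong to both `x` and `y = x` (`isARTranslate_self`).

For the other types let `x = A(w)`. An end of a string is replaced in its successor by adding a hook
or by deleting a cohook (`Ext.isSucc`), and the words which occur at the ends are the extremal ones
(`ExtTail`). Applying this at both ends shows that a string `Z` contains `w` and its translate as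
two intervals whose ends have the shape which is required of a diagram, unless `w` is projective
(`projective_or_step`, `Step`). The word of the gentle quiver over `Z` therefore has a diagram which
describes `x` and `τ(x)` (`Interval.isARTranslate`).

The orders of `Q` and of the associated gentle quiver differ, since the letters `ε` and `ε⁻¹` become
equal under `F`. They nevertheless define the same orientations of the special letters: if two words
that are compared at a special letter first differ at letters over a common special letter, the
comparison at that letter decides, and induction applies (`oriented_keys_iff`). Therefore `A(w)` is
admissible (`isAdmissibleString_A`), every admissible string without a left puncture arises in this
way (`exists_eq_A`), and the orientations agree with the ones which the diagram requires
(`isOriented_of_order`).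
-/

set_option linter.unusedSectionVars false
namespace SkewedGentle
universe uV uE uk uX uM uN
noncomputable section
variable {k : Type uk} [Field k] {V : Type uV} {E : Type uE} {Q : SkewedGentleQuiver V E}
  {w x y z Z t t' s s' m m' B C A' B' C' R T X core P P' : List (Letter V E)} {p q r r' : V × ℤˣ} {e : E}
  {l : Letter V E}

/-! ### Notation -/

/-- Words in the letters of a quiver. -/
notation "Word" V:max E:max => List (Letter V E)

/-- The positions of the diagram of a word. -/
notation "Pos" x:max => Fin (numVertices x)

/-- The position in which an arrow of the diagram ends. The arrow is given by the position of its
letter and its direction. -/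
notation "hTgt" h:max p:max => hTarget h p.1 p.2

/-- The position in which an arrow of the diagram starts. -/
notation "hSrc" h:max p:max => hSource h p.1 p.2

/-- There is a special loop at the polarized vertex `p`. -/
notation "Loop" Q:max p:max =>
  ∃ e ∈ PolarizedQuiver.special (SkewedGentleQuiver.toPolarizedQuiver Q),
    PolarizedQuiver.source (SkewedGentleQuiver.toPolarizedQuiver Q) e = p

/-! ### Minimal presentations -/

section

variable {R : Type uX} [Ring R]

variable {M : Type uM}

/-- Fitting's argument for a projective module `P`: among the submodules which, together with
`ker g`, span `P`, a minimal one is a direct summand with a complement inside `ker g`. -/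
lemma exists_minimal_projection {P : Type uX} [AddCommGroup P] [Module R P] [AddCommGroup M]
    [Module R M] [IsNoetherian R P] [IsArtinian R P] [Module.Projective R P] (g : P →ₗ[R] M)
    (N : Submodule R P) (hN : LinearMap.ker g ⊔ N = ⊤) : ∃ π : P →ₗ[R] P, π ∘ₗ π = π ∧ g ∘ₗ π = g ∧
    LinearMap.range π ≤ N ∧ ∀ N' ≤ LinearMap.range π, LinearMap.ker g ⊔ N' = ⊤ → N' =
    LinearMap.range π := by
  obtain ⟨N₀, ⟨hle, h0⟩, hmin⟩ := WellFounded.has_min (wellFounded_lt (α := Submodule R P))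
    {N' | N' ≤ N ∧ LinearMap.ker g ⊔ N' = ⊤} ⟨N, le_rfl, hN⟩
  have hmin' : ∀ N' ≤ N₀, LinearMap.ker g ⊔ N' = ⊤ → N' = N₀ := fun N' h1 h2 => by
    by_contra h3
    exact hmin N' ⟨h1.trans hle, h2⟩ (lt_of_le_of_ne h1 h3)
  have hdec : ∀ x : P, ∃ n ∈ N₀, g n = g x := fun x => by
    have : x ∈ LinearMap.ker g ⊔ N₀ := h0 ▸ Submodule.mem_top
    obtain ⟨a, ha, n, hn, rfl⟩ := Submodule.mem_sup.1 this
    exact ⟨n, hn, by rw [map_add, LinearMap.mem_ker.1 ha, zero_add]⟩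
  have hsup : ∀ N' : Submodule R P, (∀ x, ∃ n ∈ N', g n = g x) → LinearMap.ker g ⊔ N' = ⊤ := by
    refine fun N' h => eq_top_iff.2 fun x _ => ?_
    obtain ⟨n, hn, h⟩ := h x
    exact Submodule.mem_sup.2 ⟨x - n, by simp [h], n, hn, by simp⟩
  obtain ⟨h, hh⟩ := Module.projective_lifting_property (g.rangeRestrict ∘ₗ N₀.subtype)
    g.rangeRestrict (by
      rintro ⟨_, x, rfl⟩
      obtain ⟨n, hn, h⟩ := hdec x
      exact ⟨⟨n, hn⟩, Subtype.ext h⟩)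
  have hgh : ∀ x, g (h x) = g x := fun x => congrArg Subtype.val (LinearMap.congr_fun hh x)
  have hsurj : Function.Surjective (h ∘ₗ N₀.subtype) := by
    have h1 : N₀.map (N₀.subtype ∘ₗ h) = N₀ := by
      refine hmin' _ ?_ (hsup _ fun x => ?_)
      · rintro _ ⟨x, -, rfl⟩
        exact (h x).2
      · obtain ⟨n, hn, e⟩ := hdec x
        exact ⟨h n, ⟨n, hn, rfl⟩, (hgh n).trans e⟩
    rintro ⟨y, hy⟩
    rw [← h1] at hy
    obtain ⟨x, hx, e⟩ := hy
    exact ⟨⟨x, hx⟩, Subtype.ext e⟩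
  let e : N₀ ≃ₗ[R] N₀ := LinearEquiv.ofBijective (h ∘ₗ N₀.subtype)
    ⟨IsNoetherian.injective_of_surjective_endomorphism _ hsurj, hsurj⟩
  have he : ∀ y : N₀, e y = h y := fun y => rfl
  have hge : ∀ y : N₀, g (e.symm y) = g y := fun y => by
    rw [← hgh (e.symm y), ← he, LinearEquiv.apply_symm_apply]
  let π : P →ₗ[R] P := N₀.subtype ∘ₗ e.symm.toLinearMap ∘ₗ h
  have hr : LinearMap.range π = N₀ := by
    refine hmin' _ ?_ (hsup _ fun x => ⟨π x, ⟨x, rfl⟩, (hge _).trans (hgh x)⟩)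
    rintro _ ⟨x, rfl⟩
    exact (e.symm (h x)).2
  refine ⟨π, ?_, LinearMap.ext fun x => (hge _).trans (hgh x), hr ▸ hle, hr ▸ hmin'⟩
  refine LinearMap.ext fun x => ?_
  change ((e.symm (h (e.symm (h x)))) : P) = e.symm (h x)
  rw [← he, LinearEquiv.apply_symm_apply]

variable (k) [Algebra k R]

/-- The Auslander-Reiten translate may be computed from a presentation `f : P₁ → P₀` which is not
minimal, as long as no non-zero direct summand of `P₁` lies in the kernel of `f`: such a
presentation is the direct sum of a minimal one and of an isomorphism `P → P`, and the latter does
not contribute to the cokernel of `Hom(f, R)`. -/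
lemma isARTranslate_of_presentation {P₁ P₀ : Type uX} {N : Type uN} [AddCommGroup P₁] [Module R P₁]
    [AddCommGroup P₀] [Module R P₀] [AddCommGroup M] [Module R M] [AddCommGroup N] [Module k N]
    [Module R N] [IsNoetherian R P₁] [IsArtinian R P₁] [IsNoetherian R P₀] [IsArtinian R P₀]
    [Module.Projective R P₁] [Module.Projective R P₀] (f : P₁ →ₗ[R] P₀) (g : P₀ →ₗ[R] M)
    (hg : Function.Surjective g) (hfg : LinearMap.range f = LinearMap.ker g)
    (hf : ∀ π : P₁ →ₗ[R] P₁, π ∘ₗ π = π → f ∘ₗ π = 0 → π = 0) (φ : N ≃ₗ[k] Module.Dual k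
    ((P₁ →ₗ[R] R) ⧸ LinearMap.range (homDual k f))) (hφ : ∀ (r : R) (n : N) (h : P₁ →ₗ[R] R),
    φ (r • n) (Submodule.Quotient.mk h) = φ n (Submodule.Quotient.mk (rightMul h r))) :
    IsARTranslate k (R := R) M N := by
  obtain ⟨π, hπ, hgπ, -, hmin⟩ := exists_minimal_projection g ⊤ (sup_top_eq _)
  have hππ : ∀ x, π (π x) = π x := fun x => LinearMap.congr_fun hπ x
  have hgπ' : ∀ x, g (π x) = g x := fun x => LinearMap.congr_fun hgπ x
  let q : P₀ →ₗ[R] LinearMap.ker π := (LinearMap.id - π).codRestrict _ fun x => by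
    simp [LinearMap.mem_ker, hππ]
  have hq : ∀ x, (q x : P₀) = x - π x := fun x => rfl
  have hqi : ∀ b : LinearMap.ker π, q b = b := fun b => Subtype.ext (by
    rw [hq, LinearMap.mem_ker.1 b.2, sub_zero])
  have hpB : Module.Projective R (LinearMap.ker π) :=
    Module.Projective.of_split (LinearMap.ker π).subtype q (LinearMap.ext hqi)
  have hqf : Function.Surjective (q ∘ₗ f) := fun b => by
    have : (b : P₀) ∈ LinearMap.range f := by
      rw [hfg, LinearMap.mem_ker, ← hgπ', LinearMap.mem_ker.1 b.2, map_zero]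
    obtain ⟨y, hy⟩ := this
    exact ⟨y, by rw [LinearMap.comp_apply, hy, hqi]⟩
  obtain ⟨s, hs⟩ := Module.projective_lifting_property (q ∘ₗ f) LinearMap.id hqf
  have hs' : ∀ b, q (f (s b)) = b := fun b => LinearMap.congr_fun hs b
  let A₁ := LinearMap.ker (q ∘ₗ f)
  let A₀ := LinearMap.range π
  let p : P₁ →ₗ[R] A₁ := (LinearMap.id - s ∘ₗ q ∘ₗ f).codRestrict _ fun x => by
    simp [A₁, hs']
  have hp : ∀ x, (p x : P₁) = x - s (q (f x)) := fun x => rfl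
  have hpi : ∀ a : A₁, p a = a := fun a => Subtype.ext (by
    rw [hp, show q (f a) = 0 from LinearMap.mem_ker.1 a.2, map_zero, sub_zero])
  have hpA₁ : Module.Projective R A₁ :=
    Module.Projective.of_split A₁.subtype p (LinearMap.ext hpi)
  have hπi : ∀ a : A₀, π a = a := by
    rintro ⟨_, x, rfl⟩
    exact hππ x
  have hpA₀ : Module.Projective R A₀ :=
    Module.Projective.of_split A₀.subtype π.rangeRestrict
      (LinearMap.ext fun a => Subtype.ext (hπi a))
  let f₁ : A₁ →ₗ[R] A₀ := π.rangeRestrict ∘ₗ f ∘ₗ A₁.subtype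
  have hf₁ : ∀ a : A₁, (f₁ a : P₀) = f a := fun a => by
    have h1 : q (f a) = 0 := by grind
    have h2 := congrArg Subtype.val h1
    rw [hq] at h2
    exact (sub_eq_zero.1 h2).symm
  let g₀ : A₀ →ₗ[R] M := g ∘ₗ A₀.subtype
  have hfg' : ∀ x, g (f x) = 0 := fun x =>
    LinearMap.mem_ker.1 (hfg ▸ LinearMap.mem_range_self f x)
  -- restriction to the summand `A₁` identifies the cokernels of the dual maps
  let E : ((A₁ →ₗ[R] R) ⧸ LinearMap.range (homDual k f₁)) →ₗ[k]
      ((P₁ →ₗ[R] R) ⧸ LinearMap.range (homDual k f)) :=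
    Submodule.mapQ _ _ (homDual k p) (by
      rintro _ ⟨h, rfl⟩
      refine ⟨h ∘ₗ π.rangeRestrict ∘ₗ (LinearMap.id - f ∘ₗ s ∘ₗ q), LinearMap.ext fun x => ?_⟩
      change h _ = h _
      congr 1
      refine Subtype.ext ?_
      rw [hf₁, hp]
      change π (f x - f (s (q (f x)))) = _
      grind)
  have hE : ∀ h, E (Submodule.Quotient.mk h) = Submodule.Quotient.mk (h ∘ₗ p) := fun h => rfl
  have hEb : Function.Bijective E := by
    constructor
    · refine (injective_iff_map_eq_zero _).2 fun y hy => ?_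
      obtain ⟨h, rfl⟩ := Submodule.Quotient.mk_surjective _ y
      rw [hE, Submodule.Quotient.mk_eq_zero] at hy
      obtain ⟨H, hH⟩ := hy
      rw [Submodule.Quotient.mk_eq_zero]
      refine ⟨H ∘ₗ A₀.subtype, LinearMap.ext fun a => ?_⟩
      have h1 : H (f a) = h (p a) := LinearMap.congr_fun hH (a : P₁)
      rw [hpi] at h1
      rw [← h1]
      exact congrArg H (hf₁ a)
    · intro y
      obtain ⟨h, rfl⟩ := Submodule.Quotient.mk_surjective _ y
      refine ⟨Submodule.Quotient.mk (h ∘ₗ A₁.subtype), ?_⟩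
      rw [hE, Submodule.Quotient.eq]
      refine ⟨-(h ∘ₗ s ∘ₗ q), LinearMap.ext fun x => ?_⟩
      change -h (s (q (f x))) = h (p x) - h x
      rw [hp, map_sub]
      abel
  let e := LinearEquiv.ofBijective E hEb
  refine ⟨A₁, A₀, inferInstance, inferInstance, inferInstance, inferInstance, f₁, g₀,
    ⟨inferInstance, inferInstance, hpA₁, hpA₀, ?_, ?_, ?_, ?_⟩, φ.trans e.dualMap, ?_⟩
  · intro m
    obtain ⟨x, rfl⟩ := hg m
    exact ⟨⟨π x, x, rfl⟩, hgπ' x⟩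
  · ext a
    constructor
    · rintro ⟨x, rfl⟩
      exact LinearMap.mem_ker.2 ((congrArg g (hf₁ x)).trans (hfg' x))
    · intro ha
      have : (a : P₀) ∈ LinearMap.range f := by
        rw [hfg]
        exact ha
      obtain ⟨y, hy⟩ := this
      have hy0 : q (f y) = 0 := Subtype.ext (by rw [hq, hy, hπi, sub_self]; rfl)
      exact ⟨⟨y, hy0⟩, Subtype.ext ((hf₁ _).trans hy)⟩
  · intro N' hN'
    have h1 := hmin (N'.map A₀.subtype) (Submodule.map_subtype_le _ _) (by
      refine eq_top_iff.2 fun x _ => ?_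
      have h2 : (⟨π x, x, rfl⟩ : A₀) ∈ LinearMap.ker g₀ ⊔ N' := hN' ▸ Submodule.mem_top
      obtain ⟨a, ha, n, hn, h3⟩ := Submodule.mem_sup.1 h2
      have h4 : (a : P₀) + n = π x := congrArg Subtype.val h3
      refine Submodule.mem_sup.2 ⟨x - π x + a, ?_, n, ⟨n, hn, rfl⟩, by rw [add_assoc, h4]; abel⟩
      have h5 : g a = 0 := ha
      simp [hgπ', h5])
    refine eq_top_iff.2 fun a _ => ?_
    have h2 : (a : P₀) ∈ N'.map A₀.subtype := h1 ▸ a.2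
    obtain ⟨b, hb, h3⟩ := h2
    rwa [← Subtype.ext h3]
  · intro N' hN'
    obtain ⟨ρ, hρ, hfρ, hle, -⟩ := exists_minimal_projection f₁ N' hN'
    have h0 := hf (A₁.subtype ∘ₗ (LinearMap.id - ρ) ∘ₗ p) (by
      refine LinearMap.ext fun x => ?_
      have h1 : ∀ a, ρ (ρ a) = ρ a := fun a => LinearMap.congr_fun hρ a
      simp [hpi, h1]) (by
      refine LinearMap.ext fun x => ?_
      have h1 : f₁ (ρ (p x)) = f₁ (p x) := LinearMap.congr_fun hfρ _
      have h2 := congrArg Subtype.val h1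
      rw [hf₁, hf₁] at h2
      simp [h2])
    refine eq_top_iff.2 fun a _ => hle ⟨a, ?_⟩
    have h1 : (((a : A₁) - ρ a : A₁) : P₁) = 0 := by
      have := LinearMap.congr_fun h0 (a : P₁)
      simpa [hpi] using this
    exact (sub_eq_zero.1 (Subtype.ext h1)).symm
  · intro r n h
    change φ (r • n) (e (Submodule.Quotient.mk h)) =
      φ n (e (Submodule.Quotient.mk (rightMul h r)))
    exact hφ r n (h ∘ₗ p)

end

/-! ### The basis of admissible paths -/

/-- A special arrow is a loop at a polarized vertex. -/
lemma loop_ends (he : e ∈ Q.special) : Q.source e = Q.target e :=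
  special_source_eq_target Q he

lemma eq_or_eq_flip (h : p.1 = q.1) : p = q ∨ p = flip q := by
  rcases Int.units_eq_one_or p.2 with h1 | h1 <;> rcases Int.units_eq_one_or q.2 with h2 | h2
  · grind
  · exact .inr (Prod.ext h (by rw [h1]; change 1 = -q.2; rw [h2]; rfl))
  · exact .inr (Prod.ext h (by rw [h1]; change -1 = -q.2; rw [h2]))
  · grind

section

variable (k) [Fintype V] (Q)

/-- The algebra `kQ`, with its presentation hidden: the quotient construction is only used through
`QAlg.mk` and `QAlg.lift`. -/
def QAlg : Type (max uk uV uE) := PathAlg k Q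

instance : Ring (QAlg k Q) := inferInstanceAs (Ring (PathAlg k Q))

instance : Algebra k (QAlg k Q) := inferInstanceAs (Algebra k (PathAlg k Q))

/-- The projection of the free algebra onto `kQ`. -/
def QAlg.mk : FreeAlgebra k (V ⊕ E) →ₐ[k] QAlg k Q := RingQuot.mkAlgHom k (PathRel k Q)

variable {k Q} in
lemma QAlg.mk_rel {u v : FreeAlgebra k (V ⊕ E)} (h : PathRel k Q u v) : QAlg.mk k Q u = QAlg.mk k Q
    v := RingQuot.mkAlgHom_rel k h

lemma QAlg.mk_surjective : Function.Surjective (QAlg.mk k Q) :=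
  RingQuot.mkAlgHom_surjective k (PathRel k Q)

variable {B : Type*} {i j : V} {a b : E} {l : List E}

/-- The universal property of `kQ`. -/
def QAlg.lift [Semiring B] [Algebra k B] (f : FreeAlgebra k (V ⊕ E) →ₐ[k] B)
    (hf : ∀ u v, PathRel k Q u v → f u = f v) : QAlg k Q →ₐ[k] B :=
  RingQuot.liftAlgHom k ⟨f, fun {u v} h => hf u v h⟩

lemma QAlg.lift_mk [Semiring B] [Algebra k B] (f : FreeAlgebra k (V ⊕ E) →ₐ[k] B)
    (hf : ∀ u v, PathRel k Q u v → f u = f v) (u : FreeAlgebra k (V ⊕ E)) : QAlg.lift k Q f hf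
    (QAlg.mk k Q u) = f u :=
  RingQuot.liftAlgHom_mkAlgHom_apply k f (fun {u v} h => hf u v h) u

/-- The trivial path `e_i` as an element of `kQ`. -/
def vtx (i : V) : QAlg k Q := QAlg.mk k Q (FreeAlgebra.ι k (.inl i))

/-- An arrow as an element of `kQ`. -/
def arr (a : E) : QAlg k Q := QAlg.mk k Q (FreeAlgebra.ι k (.inr a))

lemma vtx_mul_self (i : V) : vtx k Q i * vtx k Q i = vtx k Q i := by
  have h := QAlg.mk_rel (PathRel.idem (k := k) (Q := Q) i); rwa [map_mul] at h

lemma vtx_mul_vtx (h : i ≠ j) : vtx k Q i * vtx k Q j = 0 := by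
  have h := QAlg.mk_rel (PathRel.orth (k := k) (Q := Q) i j h); rwa [map_mul, map_zero] at h

lemma sum_vtx : ∑ i : V, vtx k Q i = 1 := by
  have h := QAlg.mk_rel (PathRel.one (k := k) (Q := Q)); rwa [map_sum, map_one] at h

lemma vtx_mul_arr (a : E) : vtx k Q (Q.target a).1 * arr k Q a = arr k Q a := by
  have h := QAlg.mk_rel (PathRel.target (k := k) (Q := Q) a); rwa [map_mul] at h

lemma arr_mul_vtx (a : E) : arr k Q a * vtx k Q (Q.source a).1 = arr k Q a := by
  have h := QAlg.mk_rel (PathRel.source (k := k) (Q := Q) a); rwa [map_mul] at h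

lemma arr_mul_arr (ha : a ∉ Q.special) (hb : b ∉ Q.special) (h : Q.source a = Q.target b) :
    arr k Q a * arr k Q b = 0 := by
  have h := QAlg.mk_rel (PathRel.ordinary (k := k) (Q := Q) a b ha hb h)
  rwa [map_mul, map_zero] at h

lemma arr_special (he : e ∈ Q.special) : arr k Q e * arr k Q e = vtx k Q (Q.source e).1 := by
  have h := QAlg.mk_rel (PathRel.special (k := k) (Q := Q) e he); rwa [map_mul] at h

lemma arr_mul_vtx_of_ne (h : (Q.source a).1 ≠ i) : arr k Q a * vtx k Q i = 0 := by
  rw [← arr_mul_vtx, mul_assoc, vtx_mul_vtx k Q h, mul_zero]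

lemma vtx_mul_arr_of_ne (h : (Q.target a).1 ≠ i) : vtx k Q i * arr k Q a = 0 := by
  rw [← vtx_mul_arr, ← mul_assoc, vtx_mul_vtx k Q h.symm, zero_mul]

/-- Induction principle: `kQ` is generated by the trivial paths and the arrows. -/
lemma pathAlg_induction {P : QAlg k Q → Prop} (hv : ∀ i, P (vtx k Q i)) (ha : ∀ a, P (arr k Q a))
    (hc : ∀ c : k, P (algebraMap k _ c)) (hadd : ∀ x y, P x → P y → P (x + y))
    (hmul : ∀ x y, P x → P y → P (x * y)) (r : QAlg k Q) : P r := by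
  obtain ⟨u, rfl⟩ := QAlg.mk_surjective k Q r
  induction u using FreeAlgebra.induction with
  | grade0 c => rw [AlgHom.commutes]; exact hc c
  | grade1 x =>
    cases x with
    | inl i => exact hv i
    | inr a => exact ha a
  | mul x y hx hy => rw [map_mul]; exact hmul _ _ hx hy
  | add x y hx hy => rw [map_add]; exact hadd _ _ hx hy

variable {k Q}

variable (Q)

/-- `l` is a (possibly trivial) admissible path which starts at the vertex `i`. -/
def IsPathFrom (i : V) (l : List E) : Prop :=
  l.IsChain (fun a b => Q.source a = flip (Q.target b)) ∧ ∀ a ∈ l.getLast?, (Q.source a).1 = i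

/-- The paths which index the standard basis of `kQ`: pairs of a vertex and an admissible path
which starts there. -/
abbrev PathIx := {p : V × List E // IsPathFrom Q p.1 p.2}

variable {Q}

lemma isPathFrom_nil (i : V) : IsPathFrom Q i [] := ⟨List.isChain_nil, by simp⟩

lemma isPathFrom_singleton (h : (Q.source a).1 = i) : IsPathFrom Q i [a] :=
  ⟨List.isChain_singleton a, by simpa using h⟩

lemma isPathFrom_cons_cons : IsPathFrom Q i (a :: b :: l) ↔ Q.source a = flip (Q.target b)
    ∧ IsPathFrom Q i (b :: l) := by
  simp only [IsPathFrom, List.isChain_cons_cons, List.getLast?_cons_cons, and_assoc]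

lemma IsPathFrom.tail (h : IsPathFrom Q i (b :: l)) : IsPathFrom Q i l := by
  cases l with
  | nil => exact isPathFrom_nil i
  | cons c l => exact (isPathFrom_cons_cons.1 h).2

variable (k Q)

/-- The product of the arrows of a path, as an element of `kQ`. -/
def pathEl (i : V) : List E → QAlg k Q
  | [] => vtx k Q i
  | a :: l => arr k Q a * pathEl i l

lemma pathEl_mul_vtx (i : V) (l : List E) : pathEl k Q i l * vtx k Q i = pathEl k Q i l := by
  induction l with
  | nil => exact vtx_mul_self k Q i
  | cons a l ih => rw [pathEl, mul_assoc, ih]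

lemma pathEl_mul_arr (h : (Q.target a).1 = i) (l : List E) : pathEl k Q i l * arr k Q a = pathEl k Q
    (Q.source a).1 (l ++ [a]) := by
  induction l with
  | nil =>
    subst h; change vtx k Q _ * arr k Q a = arr k Q a * vtx k Q _; rw [vtx_mul_arr, arr_mul_vtx]
  | cons b l ih => rw [List.cons_append, pathEl, pathEl, mul_assoc, ih]

/-- The vertex at which a path ends. -/
def pathEnd (i : V) : List E → V
  | [] => i
  | a :: _ => (Q.target a).1

lemma vtx_mul_pathEl (i : V) (l : List E) : vtx k Q (pathEnd Q i l) * pathEl k Q i l = pathEl k Q i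
    l := by
  cases l with
  | nil => exact vtx_mul_self k Q i
  | cons a l => rw [pathEl, ← mul_assoc, pathEnd, vtx_mul_arr]

open Classical in
/-- The product of an arrow and a path, as a path (`none` stands for zero). -/
def arrowMul (a : E) (p : PathIx Q) : Option (PathIx Q) := match p with
  | ⟨(i, []), _⟩ => if h : (Q.source a).1 = i then some ⟨(i, [a]), isPathFrom_singleton h⟩ else none
  | ⟨(i, b :: l), hp⟩ =>
    if h : Q.source a = flip (Q.target b) then
      some ⟨(i, a :: b :: l), isPathFrom_cons_cons.2 ⟨h, hp⟩⟩
    else if a ∈ Q.special ∧ a = b then some ⟨(i, l), hp.tail⟩ else none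

variable {Q}

lemma pathEnd_of_special (h : IsPathFrom Q i (b :: l)) : pathEnd Q i l = (Q.source b).1 := by
  cases l with
  | nil => exact (h.2 b (by simp)).symm
  | cons c l => exact (congrArg Prod.fst (isPathFrom_cons_cons.1 h).1).symm

lemma eq_of_source_eq_target (h : Q.source a = Q.target b) (hab : a ∈ Q.special ∨ b ∈ Q.special) :
    a = b := by
  rcases hab with h1 | h1
  exacts [Q.target_injective ((loop_ends h1).symm.trans h),
    Q.source_injective (h.trans (loop_ends h1).symm)]

lemma arr_mul_pathEl (a : E) (p : PathIx Q) : arr k Q a * pathEl k Q p.1.1 p.1.2 = (arrowMul Q a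
    p).elim 0 fun q => pathEl k Q q.1.1 q.1.2 := by
  obtain ⟨⟨i, l⟩, hp⟩ := p
  cases l with
  | nil =>
    simp only [arrowMul, pathEl]; split_ifs with h
    · rfl
    · exact arr_mul_vtx_of_ne k Q h
  | cons b l =>
    simp only [arrowMul]; split_ifs with h1 h2
    · rfl
    · obtain ⟨h2, rfl⟩ := h2; change arr k Q a * (arr k Q a * pathEl k Q i l) = pathEl k Q i l
      rw [← mul_assoc, arr_special k Q h2, ← pathEnd_of_special hp, vtx_mul_pathEl]
    · change arr k Q a * (arr k Q b * pathEl k Q i l) = 0; rw [← mul_assoc]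
      by_cases h3 : (Q.source a).1 = (Q.target b).1
      · have h4 := (eq_or_eq_flip h3).resolve_right h1; rw [arr_mul_arr k Q _ _ h4, zero_mul]
        · exact fun h5 => h2 ⟨h5, eq_of_source_eq_target h4 (.inl h5)⟩
        · intro h5; have h6 := eq_of_source_eq_target h4 (.inr h5); grind
      · rw [← arr_mul_vtx k Q a, mul_assoc (arr k Q a), vtx_mul_arr_of_ne k Q (Ne.symm h3),
          mul_zero, zero_mul]

lemma vtx_mul_pathEl_of_ne (h : pathEnd Q i l ≠ j) : vtx k Q j * pathEl k Q i l = 0 := by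
  rw [← vtx_mul_pathEl, ← mul_assoc, vtx_mul_vtx k Q h.symm, zero_mul]

/-- The paths span `kQ`. -/
lemma span_pathEl : Submodule.span k (Set.range fun p : PathIx Q => pathEl k Q p.1.1 p.1.2)
    = ⊤ := by
  set S := Submodule.span k (Set.range fun p : PathIx Q => pathEl k Q p.1.1 p.1.2) with hS
  have key : ∀ r : QAlg k Q, ∀ y ∈ S, r * y ∈ S := by
    intro r
    induction r using pathAlg_induction with
    | hv i =>
      intro y hy
      induction hy using Submodule.span_induction with
      | mem y hy =>
        obtain ⟨p, rfl⟩ := hy; by_cases h : pathEnd Q p.1.1 p.1.2 = i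
        · subst h; dsimp only; rw [vtx_mul_pathEl]; exact Submodule.subset_span ⟨p, rfl⟩
        · dsimp only; rw [vtx_mul_pathEl_of_ne k h]; exact S.zero_mem
      | zero => rw [mul_zero]; exact S.zero_mem
      | add y z _ _ hy hz => rw [mul_add]; exact S.add_mem hy hz
      | smul c y _ hy => rw [mul_smul_comm]; exact S.smul_mem c hy
    | ha a =>
      intro y hy
      induction hy using Submodule.span_induction with
      | mem y hy =>
        obtain ⟨p, rfl⟩ := hy; dsimp only; rw [arr_mul_pathEl]
        cases arrowMul Q a p with
        | none => exact S.zero_mem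
        | some q => exact Submodule.subset_span ⟨q, rfl⟩
      | zero => rw [mul_zero]; exact S.zero_mem
      | add y z _ _ hy hz => rw [mul_add]; exact S.add_mem hy hz
      | smul c y _ hy => rw [mul_smul_comm]; exact S.smul_mem c hy
    | hc c =>
      intro y hy; rw [← Algebra.smul_def]; exact S.smul_mem c hy
    | hadd x y hx hy => intro z hz; rw [add_mul]; exact S.add_mem (hx z hz) (hy z hz)
    | hmul x y hx hy => intro z hz; rw [mul_assoc]; exact hx _ (hy z hz)
  refine eq_top_iff.2 fun r _ => ?_
  rw [← mul_one r]; refine key r 1 ?_; rw [← sum_vtx]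
  exact S.sum_mem fun i _ => Submodule.subset_span ⟨⟨(i, []), isPathFrom_nil i⟩, rfl⟩

/-- A path or zero as a vector of the regular representation. -/
def pathVec (o : Option (PathIx Q)) : PathIx Q →₀ k := o.elim 0 fun p => Finsupp.single p 1

/-- The linear extension of a partial map on paths. -/
def pathOp (f : PathIx Q → Option (PathIx Q)) : Module.End k (PathIx Q →₀ k) :=
  Finsupp.linearCombination k fun p => pathVec k (f p)

lemma pathOp_pathVec (f : PathIx Q → Option (PathIx Q)) (o : Option (PathIx Q)) :
    pathOp k f (pathVec k o) = pathVec k (o.bind f) := by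
  cases o with
  | none => exact map_zero _
  | some p =>
    simp only [pathVec, pathOp, Option.elim_some, Finsupp.linearCombination_single, one_smul,
      Option.bind_some]

lemma pathOp_ext {f g : Module.End k (PathIx Q →₀ k)} (h : ∀ p, f (pathVec k (some p)) = g
    (pathVec k (some p))) : f = g :=
  Finsupp.lhom_ext fun p c => by
    have h1 : Finsupp.single p c = c • pathVec k (some p) := by simp [pathVec]
    rw [h1, map_smul, map_smul, h p]

open Classical in
/-- The product of a trivial path and a path, as a path (`none` stands for zero). -/
def vertexMul (i : V) (p : PathIx Q) : Option (PathIx Q) :=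
  if pathEnd Q p.1.1 p.1.2 = i then some p else none

/-- The action of the generators of `kQ` on the regular representation. -/
def pathGen : V ⊕ E → Module.End k (PathIx Q →₀ k) :=
  Sum.elim (fun i => pathOp k (vertexMul i)) (fun a => pathOp k (arrowMul Q a))

lemma vertexMul_arrowMul (a : E) (p : PathIx Q) : (arrowMul Q a p).bind (vertexMul (Q.target a).1)
    = arrowMul Q a p := by
  obtain ⟨⟨i, l⟩, hp⟩ := p
  cases l with
  | nil => simp only [arrowMul]; split_ifs <;> simp [vertexMul, pathEnd]
  | cons b l =>
    simp only [arrowMul]; split_ifs with h1 h2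
    · simp [vertexMul, pathEnd]
    · obtain ⟨h2, rfl⟩ := h2; simp [vertexMul, pathEnd_of_special hp, loop_ends h2]
    · rfl

lemma arrowMul_eq_none {p : PathIx Q} (h : pathEnd Q p.1.1 p.1.2 ≠ (Q.source a).1) : arrowMul Q a p
    = none := by
  obtain ⟨⟨i, l⟩, hp⟩ := p
  cases l with
  | nil => exact dif_neg fun h1 => h h1.symm
  | cons b l =>
    have h1 : Q.source a ≠ flip (Q.target b) := fun h1 => h (congrArg Prod.fst h1).symm
    have h2 : ¬ (a ∈ Q.special ∧ a = b) := by
      rintro ⟨h2, rfl⟩; exact h (congrArg Prod.fst (loop_ends h2)).symm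
    simp only [arrowMul]; grind

lemma arrowMul_cons_eq_none (hp : IsPathFrom Q i (b :: l)) (h1 : Q.source a ≠ flip (Q.target b))
    (h2 : a ∉ Q.special) : arrowMul Q a ⟨(i, b :: l), hp⟩ = none := by simp only [arrowMul]; grind

lemma arrowMul_arrowMul (ha : a ∉ Q.special) (hb : b ∉ Q.special) (hab : Q.source a = Q.target b)
    (p : PathIx Q) : (arrowMul Q b p).bind (arrowMul Q a) = none := by
  obtain ⟨⟨i, l⟩, hp⟩ := p
  have h1 : Q.source a ≠ flip (Q.target b) := by rw [hab]; exact (flip_ne _).symm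
  cases l with
  | nil =>
    rw [arrowMul]; split_ifs
    · exact arrowMul_cons_eq_none (isPathFrom_singleton ‹_›) h1 ha
    · rfl
  | cons c l =>
    rw [arrowMul]; split_ifs with h2 h3
    · exact arrowMul_cons_eq_none (isPathFrom_cons_cons.2 ⟨h2, hp⟩) h1 ha
    · exact absurd h3.1 hb
    · rfl

lemma arrowMul_special (he : e ∈ Q.special) (p : PathIx Q) : (arrowMul Q e p).bind (arrowMul Q e)
    = vertexMul (Q.source e).1 p := by
  have hst := loop_ends he; by_cases h : pathEnd Q p.1.1 p.1.2 = (Q.source e).1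
  · have h0 : Q.source e ≠ flip (Q.target e) := by rw [hst]; exact (flip_ne _).symm
    rw [vertexMul, if_pos h]; obtain ⟨⟨i, l⟩, hp⟩ := p
    cases l with
    | nil =>
      have h : i = (Q.source e).1 := h; simp [arrowMul, h.symm, h0, he]
    | cons b l =>
      by_cases h1 : Q.source e = flip (Q.target b)
      · simp [arrowMul, h1, he, hst.symm.trans h1, (flip_ne _).symm]
      · have h2 := (eq_or_eq_flip h.symm).resolve_right h1
        obtain rfl := eq_of_source_eq_target h2 (.inl he)
        have h3 : arrowMul Q e ⟨(i, e :: l), hp⟩ = some ⟨(i, l), hp.tail⟩ := by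
          simp only [arrowMul]; grind
        rw [h3]; change arrowMul Q e ⟨(i, l), hp.tail⟩ = _
        cases l with
        | nil => exact dif_pos (hp.2 e (by simp))
        | cons c l => exact dif_pos (isPathFrom_cons_cons.1 hp).1
  · rw [arrowMul_eq_none (fun h1 => h h1), vertexMul, if_neg h]; rfl

lemma pathGen_rel (u v : FreeAlgebra k (V ⊕ E)) (h : PathRel k Q u v) : FreeAlgebra.lift k
    (pathGen (Q := Q) k) u = FreeAlgebra.lift k (pathGen (Q := Q) k) v := by
  classical
  cases h <;> simp only [map_mul, map_zero, map_one, map_sum, FreeAlgebra.lift_ι_apply, pathGen,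
    Sum.elim_inl, Sum.elim_inr] <;> refine pathOp_ext k fun p => ?_ <;>
    try simp only [Module.End.mul_apply, pathOp_pathVec]
  case idem i =>
    simp only [Option.bind_some, vertexMul]; split_ifs with h <;> simp [h, vertexMul]
  case orth i i' h =>
    simp only [Option.bind_some, vertexMul]; split_ifs with h1
    · simp [h1, h.symm, pathVec, vertexMul]
    · rfl
  case one =>
    rw [LinearMap.sum_apply]; simp only [pathOp_pathVec, Option.bind_some, vertexMul]
    rw [Finset.sum_eq_single (pathEnd Q p.1.1 p.1.2)]
    · simp
    · intro i _ h; rw [if_neg h.symm]; rfl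
    · intro h; exact absurd (Finset.mem_univ _) h
  case target a => rw [Option.bind_some, vertexMul_arrowMul]
  case source a =>
    simp only [Option.bind_some, vertexMul]; split_ifs with h
    · rfl
    · rw [arrowMul_eq_none h]; rfl
  case ordinary a b ha hb hab =>
    rw [Option.bind_some, arrowMul_arrowMul ha hb hab]; rfl
  case special e he => rw [Option.bind_some, Option.bind_some, arrowMul_special he]

/-- The regular representation of `kQ` on the space with basis the paths. -/
def regRep : QAlg k Q →ₐ[k] Module.End k (PathIx Q →₀ k) :=
  QAlg.lift k Q (FreeAlgebra.lift k (pathGen k)) (pathGen_rel k)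

lemma regRep_arr (a : E) : regRep k (arr k Q a) = pathOp k (arrowMul Q a) := by
  simp [regRep, arr, pathGen, QAlg.lift_mk]

lemma regRep_vtx (i : V) : regRep k (vtx k Q i) = pathOp k (vertexMul (Q := Q) i) := by
  simp [regRep, vtx, pathGen, QAlg.lift_mk]

lemma regRep_pathEl (hl : IsPathFrom Q i l) : regRep k (pathEl k Q i l)
    (pathVec k (some ⟨(i, []), isPathFrom_nil i⟩)) = pathVec k (some ⟨(i, l), hl⟩) := by
  induction l with
  | nil =>
    exact (LinearMap.congr_fun (regRep_vtx k i) _).trans ((pathOp_pathVec k _ _).trans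
      (congrArg (pathVec k) ((Option.bind_some _ _).trans (if_pos rfl))))
  | cons a l ih =>
    rw [pathEl, map_mul, Module.End.mul_apply, ih hl.tail, regRep_arr, pathOp_pathVec,
      Option.bind_some]
    cases l with
    | nil =>
      rw [arrowMul, dif_pos (hl.2 a (by simp))]
    | cons b l =>
      rw [arrowMul, dif_pos (isPathFrom_cons_cons.1 hl).1]

lemma linearIndependent_pathEl : LinearIndependent k fun p : PathIx Q => pathEl k Q p.1.1
    p.1.2 := by
  let G : QAlg k Q →ₗ[k] (PathIx Q →₀ k) := ∑ i : V,
    (LinearMap.applyₗ (pathVec k (some ⟨(i, []), isPathFrom_nil i⟩)) ∘ₗ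
      (regRep (Q := Q) k).toLinearMap) ∘ₗ LinearMap.mulRight k (vtx k Q i)
  have hG : ∀ p : PathIx Q, G (pathEl k Q p.1.1 p.1.2) = Finsupp.single p 1 := by
    rintro ⟨⟨i, l⟩, hl⟩; rw [LinearMap.sum_apply, Finset.sum_eq_single i]
    · change regRep k (pathEl k Q i l * vtx k Q i) _ = _; rw [pathEl_mul_vtx, regRep_pathEl k hl]
      rfl
    · intro j _ hj; change regRep k (pathEl k Q i l * vtx k Q j) _ = 0
      rw [← pathEl_mul_vtx, mul_assoc, vtx_mul_vtx k Q hj.symm, mul_zero, map_zero]; rfl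
    · grind
  refine LinearIndependent.of_comp G ?_
  have : (G ∘ fun p : PathIx Q => pathEl k Q p.1.1 p.1.2) = fun p => Finsupp.single p 1 := funext hG
  rw [this]; exact Finsupp.linearIndependent_single_one k _

variable (Q) in
/-- The basis of `kQ` which consists of the paths. -/
def pathBasis : Module.Basis (PathIx Q) k (QAlg k Q) :=
  Module.Basis.mk (linearIndependent_pathEl k) (span_pathEl k).ge

lemma pathBasis_apply (p : PathIx Q) : pathBasis k Q p = pathEl k Q p.1.1 p.1.2 :=
  Module.Basis.mk_apply _ _ p

instance finite_pathIx : Finite (PathIx Q) := by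
  have h : (insert [] {l : List E | Q.IsAdmissiblePath l}).Finite := Q.finite_paths.insert _
  have : Finite ↥(insert [] {l : List E | Q.IsAdmissiblePath l}) := h
  refine Finite.of_injective (β := V × ↥(insert [] {l : List E | Q.IsAdmissiblePath l}))
    (fun p => (p.1.1, ⟨p.1.2, ?_⟩)) ?_
  · by_cases h1 : p.1.2 = []
    exacts [Set.mem_insert_iff.2 (.inl h1), Set.mem_insert_iff.2 (.inr ⟨h1, p.2.1⟩)]
  · intro p q h; simp only [Prod.mk.injEq, Subtype.mk.injEq] at h
    exact Subtype.ext (Prod.ext h.1 h.2)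

instance finite_pathAlg : Module.Finite k (QAlg k Q) := Module.Finite.of_basis (pathBasis k Q)

instance isArtinian_pathAlg : IsArtinianRing (QAlg k Q) := isArtinian_of_tower k inferInstance

instance isNoetherian_pathAlg : IsNoetherianRing (QAlg k Q) := isNoetherian_of_tower k inferInstance

end

section

variable (k) [Fintype V]

variable {a : E} {i j : V} {l : List E} {n m : ℕ} {x : QAlg k Q}

lemma isPathFrom_append_singleton : IsPathFrom Q i (l ++ [a]) ↔ (Q.source a).1 = i ∧ l.IsChain
    (fun a b => Q.source a = flip (Q.target b)) ∧ ∀ c ∈ l.getLast?, Q.source c = flip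
    (Q.target a) := by simp [IsPathFrom, List.isChain_append]; tauto

lemma pathEl_mul_arr_cases (hl : IsPathFrom Q j l) (a : E) : ((Q.target a).1 = j ∧ IsPathFrom Q
    (Q.source a).1 (l ++ [a]) ∧ pathEl k Q j l * arr k Q a = pathEl k Q (Q.source a).1 (l ++ [a])) ∨
    (¬ ((Q.target a).1 = j ∧ IsPathFrom Q (Q.source a).1 (l ++ [a])) ∧
    ((a ∈ Q.special ∧ ∃ l', l = l' ++ [a] ∧ IsPathFrom Q j l' ∧ pathEl k Q j l * arr k Q a = pathEl
    k Q j l') ∨ pathEl k Q j l * arr k Q a = 0)) := by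
  by_cases hj : (Q.target a).1 = j
  · by_cases h : IsPathFrom Q (Q.source a).1 (l ++ [a])
    · exact .inl ⟨hj, h, pathEl_mul_arr k Q hj l⟩
    · refine .inr ⟨fun h1 => h h1.2, ?_⟩; rcases List.eq_nil_or_concat l with rfl | ⟨l', c, rfl⟩
      · exact absurd (isPathFrom_singleton rfl) h
      · rw [List.concat_eq_append] at hl h ⊢
        obtain ⟨h1, h2, h3⟩ := isPathFrom_append_singleton.1 hl
        have h4 : Q.source c = Q.target a := (eq_or_eq_flip (h1.trans hj.symm)).resolve_right
          fun h4 => h (isPathFrom_append_singleton.2 ⟨rfl, hl.1, by simpa using h4⟩)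
        rw [pathEl_mul_arr k Q hj]; by_cases h5 : c ∈ Q.special ∨ a ∈ Q.special
        · obtain rfl := eq_of_source_eq_target h4 h5; replace h5 := h5.elim id id
          have h6 : IsPathFrom Q j l' := ⟨h2, fun d hd => by
            rw [← h1, h3 d hd, loop_ends h5]; rfl⟩
          refine .inl ⟨h5, l', rfl, h6, ?_⟩
          rw [← pathEl_mul_arr k Q (by rw [← loop_ends h5]),
            ← pathEl_mul_arr k Q (i := j) (by rw [hj]), mul_assoc, arr_special k Q h5, h1,
            pathEl_mul_vtx]
        · push Not at h5
          refine .inr ?_; rw [← pathEl_mul_arr k Q (congrArg Prod.fst h4).symm]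
          rw [← pathEl_mul_arr k Q rfl, mul_assoc, arr_mul_arr k Q h5.1 h5.2 h4, mul_zero]
  · refine .inr ⟨fun h => hj h.1, .inr ?_⟩
    rw [← pathEl_mul_vtx, mul_assoc, vtx_mul_arr_of_ne k Q hj, mul_zero]

open Classical in
/-- The coefficient of a path in an element of `kQ` (zero if `l` is not a path from `i`). -/
def coef (i : V) (l : List E) : QAlg k Q →ₗ[k] k :=
  if h : IsPathFrom Q i l then (pathBasis k Q).coord ⟨(i, l), h⟩ else 0

lemma coef_pathEl_self (h : IsPathFrom Q i l) : coef k i l (pathEl k Q i l) = 1 := by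
  rw [coef, dif_pos h, ← pathBasis_apply k ⟨(i, l), h⟩]; simp

lemma coef_pathEl_of_ne {l' : List E} (h' : IsPathFrom Q j l') (hne : (j, l') ≠ (i, l)) :
    coef k i l (pathEl k Q j l') = 0 := by
  classical
  rw [coef]
  split_ifs with h
  · rw [← pathBasis_apply k ⟨(j, l'), h'⟩]
    rw [Module.Basis.coord_apply, Module.Basis.repr_self, Finsupp.single_apply, if_neg]
    grind
  · rfl

/-- Two linear maps on `kQ` which agree on all paths are equal. -/
lemma linearMap_ext_path {W : Type*} [AddCommGroup W] [Module k W] {f g : QAlg k Q →ₗ[k] W}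
    (h : ∀ i l, IsPathFrom Q i l → f (pathEl k Q i l) = g (pathEl k Q i l)) (r : QAlg k Q) :
    f r = g r :=
  LinearMap.congr_fun ((pathBasis k Q).ext fun p => by rw [pathBasis_apply]; exact h _ _ p.2) r

lemma coef_mul_vtx (i : V) (l : List E) (r : QAlg k Q) : coef k i l (r * vtx k Q i) = coef k i l
    r := by
  refine linearMap_ext_path k (f := coef k i l ∘ₗ LinearMap.mulRight k (vtx k Q i))
    (g := coef k i l) (fun j l' hl' => ?_) r
  change coef k i l (pathEl k Q j l' * vtx k Q i) = _; by_cases h : j = i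
  · rw [h, pathEl_mul_vtx]
  · rw [← pathEl_mul_vtx, mul_assoc, vtx_mul_vtx k Q h, mul_zero, map_zero, pathEl_mul_vtx,
      coef_pathEl_of_ne k hl']
    grind

lemma coef_mul_arr (hl : IsPathFrom Q (Q.source a).1 (l ++ [a])) (r : QAlg k Q) :
    coef k (Q.source a).1 (l ++ [a]) (r * arr k Q a) = coef k (Q.target a).1 l r := by
  refine linearMap_ext_path k
    (f := coef k (Q.source a).1 (l ++ [a]) ∘ₗ LinearMap.mulRight k (arr k Q a))
    (g := coef k (Q.target a).1 l) (fun j l' hl' => ?_) r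
  change coef k _ (l ++ [a]) (pathEl k Q j l' * arr k Q a) = _
  rcases pathEl_mul_arr_cases k hl' a with ⟨h1, h2, h3⟩ | ⟨h1, h2⟩
  · subst h1; rw [h3]; by_cases h : l' = l
    · subst h; rw [coef_pathEl_self k h2, coef_pathEl_self k hl']
    · rw [coef_pathEl_of_ne k h2, coef_pathEl_of_ne k hl']
      · grind
      · exact fun h1 => h (List.append_cancel_right (congrArg Prod.snd h1))
  · rw [coef_pathEl_of_ne k hl' (l := l)]
    · rcases h2 with ⟨h2, l'', rfl, h3, h4⟩ | h2
      · rw [h4, coef_pathEl_of_ne k h3]; intro h5; obtain ⟨rfl, rfl⟩ := Prod.mk.inj h5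
        exact h1 ⟨by rw [← loop_ends h2], isPathFrom_append_singleton.2
          ⟨rfl, hl'.1, by have := (isPathFrom_append_singleton.1 hl').2.2 a (by simp); grind⟩⟩
      · rw [h2, map_zero]
    · intro h2; obtain ⟨rfl, rfl⟩ := Prod.mk.inj h2; exact h1 ⟨rfl, hl⟩

lemma coef_mul_ordinary (ha : a ∉ Q.special) (i : V) (l : List E) (hl : a ∉ l.getLast?)
    (r : QAlg k Q) : coef k i l (r * arr k Q a) = 0 := by
  refine linearMap_ext_path k (f := coef k i l ∘ₗ LinearMap.mulRight k (arr k Q a))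
    (g := 0) (fun j l' hl' => ?_) r
  change coef k _ l (pathEl k Q j l' * arr k Q a) = 0
  rcases pathEl_mul_arr_cases k hl' a with ⟨h1, h2, h3⟩ | ⟨-, ⟨h2, -⟩ | h2⟩
  · rw [h3, coef_pathEl_of_ne k h2]; grind
  · exact absurd h2 ha
  · rw [h2, map_zero]

lemma coef_mul_special (he : e ∈ Q.special) (hl : IsPathFrom Q (Q.source e).1 (l ++ [e]))
    (r : QAlg k Q) : coef k (Q.source e).1 l (r * arr k Q e) = coef k (Q.source e).1 (l ++ [e])
    r := by
  have h := coef_mul_arr k hl (r * arr k Q e)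
  rw [mul_assoc, arr_special k Q he, coef_mul_vtx, ← loop_ends he] at h
  exact h.symm

/-! ### The filtration by the number of ordinary arrows -/

open Classical in
/-- The number of ordinary arrows of a path. -/
def ordLength (Q : SkewedGentleQuiver V E) (l : List E) : ℕ :=
  l.countP fun a => decide (a ∉ Q.special)

/-- The span of the paths with at least `n` ordinary arrows. -/
def pathFiltration (n : ℕ) : Submodule k (QAlg k Q) :=
  Submodule.span k {r | ∃ p : PathIx Q, n ≤ ordLength Q p.1.2 ∧ r = pathEl k Q p.1.1 p.1.2}

lemma ordLength_cons (a : E) (l : List E) [Decidable (a ∈ Q.special)] : ordLength Q (a :: l)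
    = ordLength Q l + if a ∈ Q.special then 0 else 1 := by
  simp only [ordLength, List.countP_cons, decide_eq_true_eq]; grind

lemma ordLength_arrowMul {p q : PathIx Q} (h : arrowMul Q a p = some q) : ordLength Q q.1.2 =
    ordLength Q (a :: p.1.2) := by
  classical
  obtain ⟨⟨i, l⟩, hp⟩ := p
  cases l with
  | nil =>
    rw [arrowMul] at h
    grind
  | cons b l =>
    rw [arrowMul] at h
    split_ifs at h with h1 h2
    · grind
    · obtain ⟨h2, rfl⟩ := h2
      rw [← Option.some.inj h]
      simp [ordLength_cons, h2]

lemma arr_mul_mem_pathFiltration (a : E) (hx : x ∈ pathFiltration k n) [Decidable (a ∈ Q.special)] :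
    arr k Q a * x ∈ pathFiltration k (n + if a ∈ Q.special then 0 else 1) := by
  induction hx using Submodule.span_induction with
  | mem x hx =>
    obtain ⟨p, hp, rfl⟩ := hx; rw [arr_mul_pathEl]
    cases h : arrowMul Q a p with
    | none => exact zero_mem _
    | some q =>
      refine Submodule.subset_span ⟨q, ?_, rfl⟩; rw [ordLength_arrowMul h, ordLength_cons]; grind
  | zero => rw [mul_zero]; exact zero_mem _
  | add y z _ _ hy hz => rw [mul_add]; exact Submodule.add_mem _ hy hz
  | smul c y _ hy => rw [mul_smul_comm]; exact Submodule.smul_mem _ c hy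

lemma vtx_mul_mem_pathFiltration (i : V) (hx : x ∈ pathFiltration k n) : vtx k Q i * x ∈
    pathFiltration k n := by
  induction hx using Submodule.span_induction with
  | mem x hx =>
    obtain ⟨p, hp, rfl⟩ := hx; by_cases h : pathEnd Q p.1.1 p.1.2 = i
    · rw [← h, vtx_mul_pathEl]; exact Submodule.subset_span ⟨p, hp, rfl⟩
    · rw [vtx_mul_pathEl_of_ne k h]; exact zero_mem _
  | zero => rw [mul_zero]; exact zero_mem _
  | add y z _ _ hy hz => rw [mul_add]; exact Submodule.add_mem _ hy hz
  | smul c y _ hy => rw [mul_smul_comm]; exact Submodule.smul_mem _ c hy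

lemma pathEl_mul_mem_pathFiltration (i : V) (l : List E) (hx : x ∈ pathFiltration k n) :
    pathEl k Q i l * x ∈ pathFiltration k (ordLength Q l + n) := by
  classical
  induction l with
  | nil => simpa [pathEl, ordLength] using vtx_mul_mem_pathFiltration k i hx
  | cons a l ih =>
    rw [pathEl, mul_assoc, ordLength_cons, add_right_comm]; exact arr_mul_mem_pathFiltration k a ih

lemma pathFiltration_antitone (h : m ≤ n) : pathFiltration (Q := Q) k n ≤ pathFiltration k m :=
  Submodule.span_mono fun _ ⟨p, hp, hr⟩ => ⟨p, h.trans hp, hr⟩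

lemma mul_mem_pathFiltration {y : QAlg k Q} (hx : x ∈ pathFiltration k m) (hy : y ∈ pathFiltration k
    n) : x * y ∈ pathFiltration k (m + n) := by
  induction hx using Submodule.span_induction with
  | mem x hx =>
    obtain ⟨p, hp, rfl⟩ := hx
    exact pathFiltration_antitone k (Nat.add_le_add_right hp n)
      (pathEl_mul_mem_pathFiltration k _ _ hy)
  | zero => rw [zero_mul]; exact zero_mem _
  | add y z _ _ hy hz => rw [add_mul]; exact Submodule.add_mem _ hy hz
  | smul c y _ hy => rw [smul_mul_assoc]; exact Submodule.smul_mem _ c hy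

lemma mem_pathFiltration_zero (x : QAlg k Q) : x ∈ pathFiltration k 0 := by
  have h := span_pathEl (Q := Q) k; have h1 : x ∈ (⊤ : Submodule k (QAlg k Q)) := Submodule.mem_top
  rw [← h] at h1; refine Submodule.span_mono ?_ h1; rintro _ ⟨p, rfl⟩; grind

variable (Q) in
lemma exists_pathFiltration_eq_bot : ∃ n, pathFiltration (Q := Q) k n = ⊥ := by
  have := Fintype.ofFinite (PathIx Q)
  refine ⟨(Finset.univ.sup fun p : PathIx Q => ordLength Q p.1.2) + 1, ?_⟩
  refine Submodule.span_eq_bot.2 ?_; rintro _ ⟨p, hp, -⟩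
  have h := Finset.le_sup (f := fun p : PathIx Q => ordLength Q p.1.2) (Finset.mem_univ p); omega

/-- An element lies in the span of the paths with an ordinary arrow if no trivial path and no
special loop occurs in it. -/
lemma mem_pathFiltration_one (h : ∀ i l, IsPathFrom Q i l → ordLength Q l = 0 → coef k i l x = 0) :
    x ∈ pathFiltration k 1 := by
  have := Fintype.ofFinite (PathIx Q); rw [← (pathBasis k Q).sum_repr x]
  refine Submodule.sum_mem _ fun p _ => ?_
  by_cases hp : ordLength Q p.1.2 = 0
  · have h1 := h _ _ p.2 hp; rw [coef, dif_pos p.2] at h1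
    have h2 : (pathBasis k Q).repr x p = 0 := h1; rw [h2, zero_smul]; exact zero_mem _
  · refine Submodule.smul_mem _ _ (Submodule.subset_span ⟨p, Nat.one_le_iff_ne_zero.2 hp, ?_⟩)
    exact pathBasis_apply k p

/-- A path without ordinary arrows is trivial or a special loop. -/
lemma eq_nil_or_special_of_ordLength (h : IsPathFrom Q i l) (h0 : ordLength Q l = 0) : l = []
    ∨ ∃ e ∈ Q.special, l = [e] ∧ (Q.source e).1 = i := by
  classical
  match l, h, h0 with
  | [], _, _ => exact .inl rfl
  | [e], h, h0 =>
    refine .inr ⟨e, ?_, rfl, h.2 e (by simp)⟩; by_contra he; rw [ordLength_cons, if_neg he] at h0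
    omega
  | a :: b :: l, h, h0 =>
    rw [ordLength_cons, ordLength_cons] at h0
    have ha : a ∈ Q.special := by by_contra ha; rw [if_neg ha] at h0; omega
    have hb : b ∈ Q.special := by by_contra hb; rw [if_neg hb] at h0; omega
    have h1 := congrArg Prod.snd (isPathFrom_cons_cons.1 h).1
    have h2 : (Q.source a).2 = -(Q.target b).2 := h1
    rw [(Q.special_polarity a ha).1, (Q.special_polarity b hb).2] at h2; exact absurd h2 (by decide)

end

section

variable {R : Type uX} [Ring R] {ι : Type} [Fintype ι]

/-- The projective module `∏ R eᵢ`, for a family of idempotents `eᵢ`. -/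
def idemModule (e : ι → R) : Submodule R (ι → R) where
  carrier := {y | ∀ i, y i * e i = y i}
  add_mem' hx hy i := by rw [Pi.add_apply, add_mul, hx i, hy i]
  zero_mem' i := by simp
  smul_mem' r x hx i := by rw [Pi.smul_apply, smul_eq_mul, mul_assoc, hx i]

lemma projective_idemModule (e : ι → R) (he : ∀ i, e i * e i = e i) : Module.Projective R
    (idemModule e) := by
  let p : (ι → R) →ₗ[R] idemModule e :=
    { toFun := fun y => ⟨fun i => y i * e i, fun i => by rw [mul_assoc, he]⟩
      map_add' := fun y z => Subtype.ext (funext fun i => add_mul _ _ _)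
      map_smul' := fun r y => Subtype.ext (funext fun i => mul_assoc _ _ _) }
  exact Module.Projective.of_split (idemModule e).subtype p
    (LinearMap.ext fun y => Subtype.ext (funext fun i => y.2 i))

variable [DecidableEq ι]

variable {e : ι → R} {Z : Type*}

/-- The generator `eᵢ` of the summand `R eᵢ` of `∏ R eᵢ`. -/
def idemGen (he : ∀ i, e i * e i = e i) (i : ι) : idemModule e := ⟨Pi.single i (e i), fun j => by
    by_cases h : j = i
    · subst h; simp [he]
    · simp [h]⟩

lemma idemGen_apply (he : ∀ i, e i * e i = e i) (i j : ι) : (idemGen he i : ι → R) j = if j = i then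
    e i else 0 := by simp [idemGen, Pi.single_apply]

lemma sum_smul_idemGen (he : ∀ i, e i * e i = e i) (y : idemModule e) : ∑ i, (y : ι → R)
    i • idemGen he i = y := by
  refine Subtype.ext (funext fun j => ?_)
  rw [AddSubmonoidClass.coe_finsetSum, Finset.sum_apply, Finset.sum_eq_single j]
  · simp [idemGen_apply, y.2 j]
  · intro i _ hij; simp [idemGen_apply, hij.symm]
  · grind

lemma idem_smul_idemGen (he : ∀ i, e i * e i = e i) (i : ι) : e i • idemGen he i = idemGen he i :=
  Subtype.ext (funext fun j => by
    change e i * (idemGen he i : ι → R) j = _; rw [idemGen_apply]; split_ifs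
    · exact he i
    · exact mul_zero _)

/-- The linear map from `∏ R eᵢ` given by the images of the generators. -/
def idemLift (e : ι → R) [AddCommGroup Z] [Module R Z] (z : ι → Z) : idemModule e →ₗ[R] Z where
  toFun y := ∑ i, (y : ι → R) i • z i
  map_add' x y := by
    rw [← Finset.sum_add_distrib]
    exact Finset.sum_congr rfl fun i _ => add_smul _ _ _
  map_smul' r y := by
    rw [Finset.smul_sum]
    exact Finset.sum_congr rfl fun i _ => mul_smul _ _ _

lemma idemLift_idemGen (he : ∀ i, e i * e i = e i) [AddCommGroup Z] [Module R Z] (z : ι → Z)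
    (i : ι) : idemLift e z (idemGen he i) = e i • z i := by
  change ∑ j, (idemGen he i : ι → R) j • z j = _; rw [Finset.sum_eq_single i]
  · simp [idemGen_apply]
  · intro j _ hij; simp [idemGen_apply, hij]
  · grind

/-- The coordinate functions on `∏ R eᵢ`. -/
def idemCoord (e : ι → R) (i : ι) : idemModule e →ₗ[R] R :=
  LinearMap.proj i ∘ₗ (idemModule e).subtype

end

/-! ### The common diagram of a word and of its translate -/

section

/-- What a position of a word meets on one of its two sides: an arrow which leaves the position, an
arrow which arrives there, a puncture with the given special loop, or nothing. -/
inductive Side (K : Type) (E : Type uE) where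
  | out (κ : K)
  | inn (κ : K)
  | pun (e : E)
  | free

/-- The diagram which contains both the diagram of a word `x` and that of its translate `y`. The
positions form the set `J`, the arrows between them the set `K`; `true` stands for the right hand
side of a position, and `false` for the left hand side. The positions in `isM` are those of `x`,
the positions in `isN` are those of `y`. The positions of `y` which are not in `x` form tails of
arrows which all point towards `x`, and the outer ends of these tails satisfy `top`; the positions
of `x` which are not in `y` form tails of arrows which all point away from `y`. The last field says
that special arrows are oriented as in an admissible word. -/
structure Diagram (Q : SkewedGentleQuiver V E) (J K : Type) where
  src : K → J
  tgt : K → J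
  ar : K → E
  pol : J → Bool → V × ℤˣ
  side : J → Bool → Side K E
  srcSide : K → Bool
  isM : J → Prop
  isN : J → Prop
  top : J → Prop
  pol_not : ∀ j b, pol j (!b) = flip (pol j b)
  side_src : ∀ κ, side (src κ) (srcSide κ) = .out κ
  side_tgt : ∀ κ, side (tgt κ) (!srcSide κ) = .inn κ
  of_out : ∀ {j b κ}, side j b = .out κ → src κ = j ∧ srcSide κ = b ∧ Q.source (ar κ) = pol j b
  of_inn : ∀ {j b κ}, side j b = .inn κ → tgt κ = j ∧ srcSide κ = !b ∧ Q.target (ar κ) = pol j b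
  of_pun : ∀ {j b e}, side j b = .pun e → e ∈ Q.special ∧ Q.source e = pol j b
  isM_edge : ∀ κ, isM (tgt κ) → isM (src κ)
  isM_ordinary : ∀ κ, isM (src κ) → ¬ isM (tgt κ) → ar κ ∉ Q.special
  isM_free : ∀ {j b}, isM j → side j b = .free → ∀ a, Q.source a ≠ pol j b
  isM_tail : ∀ j, ¬ isM j → ¬ top j → ∃ κ, tgt κ = j ∧ ¬ isM (src κ)
  isM_pun : ∀ {j b e}, side j b = .pun e → isM j
  isM_two : ∀ {j b κ κ'}, side j b = .inn κ → side j (!b) = .inn κ' → isM (src κ) ∨ isM (src κ')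
  top_isM : ∀ j, top j → ¬ isM j
  top_isN : ∀ j, top j → isN j
  top_tgt : ∀ κ, top (tgt κ) → isM (src κ)
  top_side : ∀ {j b}, top j → side j b ≠ .free → side j (!b) = .free
  top_exists : ∀ j, top j → ∃ b, side j b ≠ .free
  top_free : ∀ {j b}, top j → side j b = .free → ∀ a, Q.target a ≠ pol j b
  isN_full : ∀ {j b}, isN j → ¬ top j → side j b ≠ .free
  isN_pun : ∀ {j b e}, side j b = .pun e → isN j
  isN_down : ∀ {j b}, ¬ isN j → ((∃ κ, side j b = .inn κ) ∨ ∃ κ, side j b = .out κ ∧ isN (tgt κ)) →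
    side j (!b) = .free ∨ ∃ κ, side j (!b) = .out κ ∧ ¬ isN (tgt κ)
  orient : ∀ {κ κ'}, ar κ ∈ Q.special → side (src κ) (!srcSide κ) = .out κ' →
    ∃ κ'', side (tgt κ) (srcSide κ) = .out κ''

variable {J K : Type}

namespace Diagram

variable (G : Diagram Q J K)

lemma pol_fst (j : J) (b : Bool) : (G.pol j (!b)).1 = (G.pol j b).1 := by rw [G.pol_not]; rfl

lemma pol_fst_eq (j : J) (b b' : Bool) : (G.pol j b).1 = (G.pol j b').1 := by
  cases b <;> cases b' <;> first | rfl | exact (G.pol_fst j _).symm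

/-- The vertex of the quiver at a position. -/
def vert (j : J) : V := (G.pol j true).1

lemma pol_fst_vert (j : J) (b : Bool) : (G.pol j b).1 = G.vert j := G.pol_fst_eq j b true

lemma source_ar (κ : K) : Q.source (G.ar κ) = G.pol (G.src κ) (G.srcSide κ) :=
  (G.of_out (G.side_src κ)).2.2

lemma target_ar (κ : K) : Q.target (G.ar κ) = G.pol (G.tgt κ) (!G.srcSide κ) :=
  (G.of_inn (G.side_tgt κ)).2.2

lemma source_ar_fst (κ : K) : (Q.source (G.ar κ)).1 = G.vert (G.src κ) := by
  rw [G.source_ar, G.pol_fst_vert]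

lemma target_ar_fst (κ : K) : (Q.target (G.ar κ)).1 = G.vert (G.tgt κ) := by
  rw [G.target_ar, G.pol_fst_vert]

variable {j : J}

/-- A polarized vertex over the vertex of a position is the polarity of one of its sides. -/
lemma exists_pol (h : p.1 = G.vert j) : ∃ b, p = G.pol j b := by
  rcases eq_or_eq_flip (h.trans (G.pol_fst_vert j true).symm) with h | h
  exacts [⟨true, h⟩, ⟨false, h.trans (G.pol_not j true).symm⟩]

/-- Consecutive arrows of the diagram are consecutive in an admissible path. -/
lemma source_eq_flip_target {κ κ' : K} (h : G.tgt κ' = G.src κ) : Q.source (G.ar κ)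
    = flip (Q.target (G.ar κ')) := by
  rw [G.source_ar, G.target_ar, ← G.pol_not, h]; congr 1; by_contra h1
  have h2 : G.srcSide κ = !G.srcSide κ' := by
    cases h3 : G.srcSide κ <;> cases h4 : G.srcSide κ' <;> simp_all
  have h3 := G.side_src κ; rw [h2, ← h, G.side_tgt] at h3; cases h3

lemma false_of_infinite_path (f : ℕ → K) (h : ∀ n, Q.source (G.ar (f n)) = flip
    (Q.target (G.ar (f (n + 1))))) : False := by
  have h1 : ∀ n m, Q.toPolarizedQuiver.IsAdmissiblePath
      ((List.range (n + 1)).map fun i => G.ar (f (i + m))) := by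
    intro n
    induction n with
    | zero => intro m; exact ⟨by simp, by simp⟩
    | succ n ih =>
      intro m; refine ⟨by simp, ?_⟩
      rw [List.range_succ_eq_map, List.map_cons, List.map_map, List.range_succ_eq_map]
      have h2 := (ih (m + 1)).2; rw [List.range_succ_eq_map] at h2
      simp only [List.map_cons, List.isChain_cons_cons, Function.comp_apply]; refine ⟨?_, ?_⟩
      · grind
      · simpa [Nat.add_comm, Nat.add_left_comm, Nat.add_assoc, Function.comp_def] using h2
  refine Set.infinite_of_injective_forall_mem (f := fun n =>
    (List.range (n + 1)).map fun i => G.ar (f (i + 0))) ?_ (fun n => h1 n 0) Q.finite_paths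
  intro m n hmn; have := congrArg List.length hmn; simpa using this

lemma false_of_infinite_path' (f : ℕ → K) (h : ∀ n, Q.source (G.ar (f (n + 1))) = flip
    (Q.target (G.ar (f n)))) : False := by
  have h1 : ∀ n, Q.toPolarizedQuiver.IsAdmissiblePath
      ((List.range (n + 1)).map fun i => G.ar (f i)).reverse := by
    intro n; refine ⟨by simp, ?_⟩
    induction n with
    | zero => simp
    | succ n ih =>
      rw [List.range_succ, List.map_append, List.reverse_append]
      rw [List.range_succ, List.map_append, List.reverse_append] at ih ⊢; grind
  refine Set.infinite_of_injective_forall_mem (f := fun n =>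
    ((List.range (n + 1)).map fun i => G.ar (f i)).reverse) ?_ h1 Q.finite_paths
  intro m n hmn; have := congrArg List.length hmn; simpa using this

/-- As there are only finitely many admissible paths, one cannot go up forever in a diagram. -/
lemma wellFounded_up : WellFounded fun κ' κ : K => G.tgt κ' = G.src κ := by
  rw [wellFounded_iff_isEmpty_descending_chain]
  exact ⟨fun f => G.false_of_infinite_path f.1 fun n => G.source_eq_flip_target (f.2 n)⟩

/-- As there are only finitely many admissible paths, one cannot go down forever in a diagram. -/
lemma wellFounded_down : WellFounded fun κ' κ : K => G.src κ' = G.tgt κ := by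
  rw [wellFounded_iff_isEmpty_descending_chain]
  exact ⟨fun f => G.false_of_infinite_path' f.1 fun n => G.source_eq_flip_target (f.2 n).symm⟩

lemma ar_ordinary_of_pol {b : Bool} {a : E} (he : e ∈ Q.special) (h1 : Q.source e = G.pol j b ∨
    Q.target e = G.pol j b) (h2 : Q.source a = G.pol j (!b) ∨ Q.target a = G.pol j (!b)) : a ∉
    Q.special := by
  intro ha
  have h3 : Q.source e = G.pol j b := h1.elim id fun h => (loop_ends he).trans h
  have h4 : Q.source a = G.pol j (!b) := h2.elim id fun h => (loop_ends ha).trans h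
  have h5 := (Q.special_polarity a ha).1; rw [h4, G.pol_not] at h5
  have h6 := (Q.special_polarity e he).1; rw [h3] at h6; have h7 : -(G.pol j b).2 = -1 := h5
  rw [h6] at h7; exact absurd h7 (by decide)

end Diagram

end

/-! ### The presentation given by a diagram -/

section

variable {R : Type uX} [Ring R] [Algebra k R] {ι : Type}

/-- The homomorphism `y ↦ ∑ vᵢ yᵢ r` on `∏ R eᵢ`, where the sum is over some of the coordinates. -/
def combMul (e : ι → R) {d : ℕ} (v : Fin d → k) (i : Fin d → ι) (r : R) : idemModule e →ₗ[R] R where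
  toFun y := ∑ c, v c • ((y : ι → R) (i c) * r)
  map_add' y z := by
    rw [← Finset.sum_add_distrib]
    exact Finset.sum_congr rfl fun c _ => by
      rw [← smul_add, ← add_mul]; rfl
  map_smul' s y := by
    rw [smul_eq_mul, Finset.mul_sum]
    exact Finset.sum_congr rfl fun c _ => by
      rw [mul_smul_comm, ← mul_assoc]; rfl

end

section

/-- The scalars by which the arrows and the punctures of a diagram act, once the space `X` has been
identified with `k ^ d` at every position: `W κ` is the matrix of the arrow `κ`, with inverse `V κ`,
and the loop at the puncture of `j` has the eigenvalues `sgn j`. -/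
structure Gauge (k : Type uk) [Field k] (J K : Type) (d : ℕ) where
  V : K → Matrix (Fin d) (Fin d) k
  W : K → Matrix (Fin d) (Fin d) k
  V_mul_W : ∀ κ, V κ * W κ = 1
  W_mul_V : ∀ κ, W κ * V κ = 1
  sgn : J → Fin d → k
  sgn_mul_self : ∀ j c, sgn j c * sgn j c = 1

variable [Fintype V] {J K : Type} [Fintype J] [Fintype K]

namespace Gauge

variable {d : ℕ} (U : Gauge k J K d)

variable {Z : Type*}

lemma sum_W_V (κ : K) [AddCommGroup Z] [Module k Z] (z : Fin d → Z) (c : Fin d) : ∑ c', U.W κ c c' •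
    ∑ c'', U.V κ c' c'' • z c'' = z c := by
  have h : ∀ c'', ∑ c', U.W κ c c' * U.V κ c' c'' = (1 : Matrix _ _ k) c c'' := fun c'' => by
    rw [← U.W_mul_V κ, Matrix.mul_apply]
  simp only [Finset.smul_sum, smul_smul]; rw [Finset.sum_comm]
  simp only [← Finset.sum_smul, h, Matrix.one_apply, ite_smul, one_smul, zero_smul]; simp

lemma sum_W_V' (κ : K) [AddCommGroup Z] [Module k Z] (z : Fin d → Z) (c : Fin d) : ∑ c',
    U.W κ c' c • ∑ c'', U.V κ c'' c' • z c'' = z c := by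
  have h : ∀ c'', ∑ c', U.V κ c'' c' * U.W κ c' c = (1 : Matrix _ _ k) c'' c := fun c'' => by
    rw [← U.V_mul_W κ, Matrix.mul_apply]
  simp only [Finset.smul_sum, smul_smul]; rw [Finset.sum_comm]
  simp only [mul_comm (U.W κ _ c), ← Finset.sum_smul, h, Matrix.one_apply, ite_smul, one_smul,
    zero_smul]
  simp

end Gauge

variable (k Q) in
/-- The idempotent `(e_i - t ε) / 2` for a puncture with loop `ε` and eigenvalue `t`. -/
def punIdem (s : Side K E) (t : k) : QAlg k Q := match s with
  | .pun e => (2⁻¹ : k) • (vtx k Q (Q.source e).1 - t • arr k Q e)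
  | _ => 0

variable {t : k}

lemma punIdem_mul_arr (he : e ∈ Q.special) (ht : t * t = 1) : punIdem k Q (.pun e : Side K E)
    t * arr k Q e = (-t) • punIdem k Q (.pun e : Side K E) t := by
  have h1 : vtx k Q (Q.source e).1 * arr k Q e = arr k Q e := by
    rw [loop_ends he, vtx_mul_arr]
  simp only [punIdem, smul_mul_assoc, sub_mul, h1, arr_special k Q he, smul_sub, smul_smul]
  have h2 : -t * (2⁻¹ * t) = -2⁻¹ := by grind
  have h3 : -t * (2⁻¹ : k) = -(2⁻¹ * t) := by ring
  rw [h2, h3, neg_smul, neg_smul]; abel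

lemma punIdem_mul_vtx (e : E) (t : k) : punIdem k Q (.pun e : Side K E) t * vtx k Q (Q.source e).1 =
    punIdem k Q (.pun e : Side K E) t := by
  simp only [punIdem, smul_mul_assoc, sub_mul, vtx_mul_self, arr_mul_vtx]

lemma punIdem_mul_self (hk : (2 : k) ≠ 0) {s : Side K E} (hs : ∀ e, s = .pun e → e ∈ Q.special)
    (ht : t * t = 1) : punIdem k Q s t * punIdem k Q s t = punIdem k Q s t := by
  cases s with
  | pun e =>
    have h1 : punIdem k Q (.pun e : Side K E) t * punIdem k Q (.pun e : Side K E) t =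
        punIdem k Q (.pun e : Side K E) t *
          ((2⁻¹ : k) • (vtx k Q (Q.source e).1 - t • arr k Q e)) := rfl
    rw [h1, mul_smul_comm, mul_sub, punIdem_mul_vtx, mul_smul_comm,
      punIdem_mul_arr (hs e rfl) ht, smul_smul, mul_neg, ht, neg_smul, one_smul, sub_neg_eq_add,
      ← two_smul k, smul_smul, inv_mul_cancel₀ hk, one_smul]
  | out κ => exact mul_zero _
  | inn κ => exact mul_zero _
  | free => exact mul_zero _

namespace Diagram

variable (G : Diagram Q J K) {d : ℕ} (U : Gauge k J K d)

/-- The idempotents of the relations: every arrow of the diagram, and every puncture, gives a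
relation for each basis vector. -/
def rowIdem : (K ⊕ J × Bool) × Fin d → QAlg k Q
  | (.inl κ, _) => vtx k Q (G.vert (G.tgt κ))
  | (.inr (j, b), c) => punIdem k Q (G.side j b) (U.sgn j c)

open Classical in
/-- The idempotents of the generators: every position which is not the outer end of a tail gives a
generator for each basis vector. -/
def colIdem (_U : Gauge k J K d) (q : J × Fin d) : QAlg k Q :=
  if G.top q.1 then 0 else vtx k Q (G.vert q.1)

lemma rowIdem_mul_self (hk : (2 : k) ≠ 0) (i : (K ⊕ J × Bool) × Fin d) : G.rowIdem U i * G.rowIdem U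
    i = G.rowIdem U i := by
  obtain ⟨κ | ⟨j, b⟩, c⟩ := i
  exacts [vtx_mul_self k Q _,
    punIdem_mul_self hk (fun e he => (G.of_pun he).1) (U.sgn_mul_self j c)]

lemma colIdem_mul_self (q : J × Fin d) : G.colIdem U q * G.colIdem U q = G.colIdem U q := by
  rw [colIdem]; split_ifs
  exacts [mul_zero _, vtx_mul_self k Q _]

/-- The contribution of one side of a position to the coefficient, at this position, of a linear
combination of relations. -/
def contr (j : J) (b : Bool) (c : Fin d) : idemModule (G.rowIdem U) →ₗ[QAlg k Q] QAlg k Q :=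
  match G.side j b with
  | .out κ => combMul (G.rowIdem U) (U.V κ c) (fun c' => (Sum.inl κ, c')) (arr k Q (G.ar κ))
  | .inn κ => idemCoord (G.rowIdem U) (Sum.inl κ, c)
  | .pun _ => idemCoord (G.rowIdem U) (Sum.inr (j, b), c)
  | .free => 0

variable {G U}

variable {b : Bool} {j : J} {κ : K}

lemma contr_out (h : G.side j b = .out κ) (c : Fin d) : G.contr U j b c = combMul (G.rowIdem U)
    (U.V κ c) (fun c' => (Sum.inl κ, c')) (arr k Q (G.ar κ)) := by rw [contr, h]

lemma contr_out_apply (h : G.side j b = .out κ) (c : Fin d) (y : idemModule (G.rowIdem U)) :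
    G.contr U j b c y = ∑ c', U.V κ c c' • (y.1 (.inl κ, c') * arr k Q (G.ar κ)) := by
  rw [contr_out h]; rfl

lemma contr_inn (h : G.side j b = .inn κ) (c : Fin d) : G.contr U j b c = idemCoord (G.rowIdem U)
    (Sum.inl κ, c) := by rw [contr, h]

lemma contr_pun (h : G.side j b = .pun e) (c : Fin d) : G.contr U j b c = idemCoord (G.rowIdem U)
    (Sum.inr (j, b), c) := by rw [contr, h]

lemma contr_free (h : G.side j b = .free) (c : Fin d) : G.contr U j b c = 0 := by rw [contr, h]

lemma contr_mul_vtx (j : J) (b : Bool) (c : Fin d) (y : idemModule (G.rowIdem U)) : G.contr U j b c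
    y * vtx k Q (G.vert j) = G.contr U j b c y := by
  match h : G.side j b with
  | .out κ =>
    rw [contr_out_apply h, Finset.sum_mul]; refine Finset.sum_congr rfl fun c' _ => ?_
    rw [smul_mul_assoc, mul_assoc, ← (G.of_out h).1, ← G.source_ar_fst, arr_mul_vtx]
  | .inn κ =>
    rw [contr_inn h, ← (G.of_inn h).1]; exact y.2 (.inl κ, c)
  | .pun e =>
    rw [contr_pun h]; have h1 := y.2 (.inr (j, b), c)
    change y.1 (.inr (j, b), c) * _ = y.1 (.inr (j, b), c); rw [← h1, mul_assoc]; congr 1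
    change punIdem k Q (G.side j b) _ * _ = punIdem k Q (G.side j b) _
    rw [h, ← G.pol_fst_vert j b, ← (G.of_pun h).2]; exact punIdem_mul_vtx e _
  | .free => rw [contr_free h]; exact zero_mul _

variable (G U)

open Classical in
/-- The presentation given by a diagram: the relation of an arrow `κ : j → j'` says that it maps
the generators at `j` to those at `j'`. -/
def presMap : idemModule (G.rowIdem U) →ₗ[QAlg k Q] idemModule (G.colIdem U) where
  toFun y := ⟨fun q => if G.top q.1 then 0 else G.contr U q.1 true q.2 y - G.contr U q.1 false q.2 y,
    fun q => by
      by_cases h : G.top q.1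
      · simp [h]
      · simp only [h, if_false, colIdem, sub_mul, contr_mul_vtx]⟩
  map_add' y z := Subtype.ext (funext fun q => by
    change (if G.top q.1 then (0 : QAlg k Q) else _) =
      (if G.top q.1 then 0 else _) + (if G.top q.1 then 0 else _)
    split_ifs
    · exact (add_zero _).symm
    · rw [map_add, map_add]; abel)
  map_smul' r y := Subtype.ext (funext fun q => by
    change (if G.top q.1 then (0 : QAlg k Q) else _) = r * (if G.top q.1 then 0 else _); split_ifs
    · exact (mul_zero _).symm
    · rw [map_smul, map_smul, mul_sub]; rfl)

variable {G U}

lemma presMap_apply (h : ¬ G.top j) (c : Fin d) (y : idemModule (G.rowIdem U)) : (G.presMap U y).1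
    (j, c) = G.contr U j true c y - G.contr U j false c y := if_neg h

lemma contr_eq_of_mem_ker {y : idemModule (G.rowIdem U)} (hy : G.presMap U y = 0) (h : ¬ G.top j)
    (b : Bool) (c : Fin d) : G.contr U j b c y = G.contr U j (!b) c y := by
  have h1 := presMap_apply (U := U) h c y; rw [hy] at h1; have h2 := sub_eq_zero.1 h1.symm; cases b
  exacts [h2.symm, h2]

end Diagram

end

/-! ### The kernel of the presentation -/

section

variable [Fintype V] {J K : Type} [Fintype J] [Fintype K]

lemma coef_mul_vtx_of_ne {i j : V} (h : j ≠ i) (l : List E) (r : QAlg k Q) :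
    coef k i l (r * vtx k Q j) = 0 := by
  rw [← coef_mul_vtx, mul_assoc, vtx_mul_vtx k Q h, mul_zero, map_zero]

lemma mul_arr_eq_of_mul_punIdem (he : e ∈ Q.special) {t : k} (ht : t * t = 1) {z : QAlg k Q}
    (hz : z * punIdem k Q (.pun e : Side K E) t = z) : z * arr k Q e = -t • z := by
  rw [← hz, mul_assoc, punIdem_mul_arr he ht, mul_smul_comm]

lemma mul_right_mem_pathFiltration {n : ℕ} {x : QAlg k Q} (h : x ∈ pathFiltration k n)
    (y : QAlg k Q) : x * y ∈ pathFiltration k n := by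
  have h1 := mul_mem_pathFiltration k h (mem_pathFiltration_zero k y); rwa [add_zero] at h1

namespace Diagram

variable {G : Diagram Q J K} {d : ℕ} {U : Gauge k J K d}

lemma row_mul_vtx (y : idemModule (G.rowIdem U)) (κ : K) (c : Fin d) : y.1 (.inl κ, c)
    * vtx k Q (G.vert (G.tgt κ)) = y.1 (.inl κ, c) := y.2 (.inl κ, c)

variable {j : J}

lemma row_mul_arr_of_pun (y : idemModule (G.rowIdem U)) {b : Bool} (h : G.side j b = .pun e)
    (c : Fin d) : y.1 (.inr (j, b), c) * arr k Q e = -U.sgn j c • y.1 (.inr (j, b), c) := by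
  refine mul_arr_eq_of_mul_punIdem (K := K) (G.of_pun h).1 (U.sgn_mul_self j c) ?_
  have h1 := y.2 (.inr (j, b), c); rwa [rowIdem, h] at h1

lemma not_top_of_isM (h : G.isM j) : ¬ G.top j := fun h1 => G.top_isM j h1 h

variable {y : idemModule (G.rowIdem U)} {κ : K}

lemma contr_flip_out (hy : G.presMap U y = 0) (h : ¬ G.top (G.src κ)) (c : Fin d) : ∑ c',
    U.V κ c c' • (y.1 (.inl κ, c') * arr k Q (G.ar κ)) = G.contr U (G.src κ) (!G.srcSide κ)
    c y := by rw [← contr_eq_of_mem_ker hy h, contr_out_apply (G.side_src κ)]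

lemma row_eq_contr (hy : G.presMap U y = 0) (h : ¬ G.top (G.tgt κ)) (c : Fin d) : y.1 (.inl κ, c)
    = G.contr U (G.tgt κ) (G.srcSide κ) c y := by
  have h1 := contr_eq_of_mem_ker hy h (!G.srcSide κ) c
  rw [Bool.not_not, contr_inn (G.side_tgt κ)] at h1; exact h1

/-- A path which ends on the given side of a position does not contribute to the terms which come
from the ordinary arrows which leave the position on the other side. -/
lemma coef_sum_mul_ordinary (y : idemModule (G.rowIdem U)) (hκ : G.ar κ ∉ Q.special) (i : V)
    (l : List E) (hl : G.ar κ ∉ l.getLast?) (c : Fin d) : coef k i l (∑ c', U.V κ c c' •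
    (y.1 (.inl κ, c') * arr k Q (G.ar κ))) = 0 := by
  rw [map_sum]
  exact Finset.sum_eq_zero fun c' _ => by rw [map_smul, coef_mul_ordinary k hκ i l hl, smul_zero]

/-- An element of the kernel of the presentation has no coefficients at the paths which can be
continued along the arrow which defines the relation. -/
lemma coef_eq_zero_of_continues (hy : G.presMap U y = 0) (κ : K) : G.isM (G.src κ) → ∀ l,
    IsPathFrom Q (Q.source (G.ar κ)).1 (l ++ [G.ar κ]) → ∀ c, coef k (Q.target (G.ar κ)).1 l
    (y.1 (.inl κ, c)) = 0 := by
  induction κ using G.wellFounded_up.induction with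
  | _ κ ih =>
  intro hM l hl; set i := (Q.source (G.ar κ)).1 with hi
  have hs : ∀ (j : J) (b : Bool) (κ' : K), j = G.src κ → b = (!G.srcSide κ) →
      G.side j b = .out κ' → G.ar κ' ≠ G.ar κ := by
    rintro _ _ κ' rfl rfl h1 h2; have h3 := (G.of_out h1).2.2; rw [h2, G.source_ar, G.pol_not] at h3
    exact flip_ne _ h3.symm
  have key : ∀ c, coef k i (l ++ [G.ar κ]) (G.contr U (G.src κ) (!G.srcSide κ) c y) = 0 := by
    intro c
    match h : G.side (G.src κ) (!G.srcSide κ) with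
    | .free => rw [contr_free h, LinearMap.zero_apply, map_zero]
    | .inn κ' =>
      obtain ⟨h1, h2, h3⟩ := G.of_inn h; have h4 := G.source_eq_flip_target h1
      have h5 : (Q.target (G.ar κ')).1 = i := by rw [hi, h4]; rfl
      rw [contr_inn h, ← h5]; refine ih κ' h1 (G.isM_edge κ' (h1 ▸ hM)) _ ?_ c
      rw [isPathFrom_append_singleton]; refine ⟨rfl, hl.1, ?_⟩; simpa using h4
    | .out κ' =>
      obtain ⟨h1, h2, h3⟩ := G.of_out h; rw [contr_out_apply h]; by_cases hsp : G.ar κ' ∈ Q.special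
      · have h6 : G.isM (G.tgt κ') := by by_contra h7; exact G.isM_ordinary κ' (h1 ▸ hM) h7 hsp
        -- the orientation of special arrows yields an ordinary arrow at the other end of `κ'`
        obtain ⟨κ'', h8⟩ := G.orient (κ := κ') (κ' := κ) hsp (by
          rw [h1, h2, Bool.not_not]; exact G.side_src κ)
        have h9 : G.ar κ'' ∉ Q.special := by
          refine G.ar_ordinary_of_pol hsp (.inr (G.target_ar κ')) (.inl ?_); rw [Bool.not_not]
          exact (G.of_out h8).2.2
        have h10 : G.ar κ'' ≠ G.ar κ' := fun h11 => h9 (h11 ▸ hsp)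
        rw [map_sum]; refine Finset.sum_eq_zero fun c' _ => ?_
        have h12 : (Q.source (G.ar κ')).1 = i := by rw [hi, G.source_ar_fst, G.source_ar_fst, h1]
        rw [map_smul, ← h12, coef_mul_special k hsp, row_eq_contr hy (not_top_of_isM h6),
          contr_out_apply h8, coef_sum_mul_ordinary y h9, smul_zero]
        · simpa using h10.symm
        · rw [isPathFrom_append_singleton]; refine ⟨rfl, hl.1, ?_⟩
          have h13 : Q.source (G.ar κ) = flip (Q.source (G.ar κ')) := by
            rw [h3, G.source_ar, ← G.pol_not, Bool.not_not]
          rw [loop_ends hsp] at h13; simpa using h13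
      · exact coef_sum_mul_ordinary y hsp _ _ (by simpa using (hs _ _ _ rfl rfl h).symm) c
    | .pun e =>
      obtain ⟨h1, h2⟩ := G.of_pun h
      have h3 : G.ar κ ∉ Q.special := by
        refine G.ar_ordinary_of_pol h1 (.inl h2) (.inl ?_); rw [Bool.not_not, G.source_ar]
      have h4 : G.ar κ ≠ e := fun h5 => h3 (h5 ▸ h1)
      have h5 : (Q.source e).1 = i := by rw [h2, hi, G.source_ar, G.pol_fst]
      have h6 : IsPathFrom Q (Q.source e).1 ((l ++ [G.ar κ]) ++ [e]) := by
        rw [isPathFrom_append_singleton]; refine ⟨rfl, hl.1, ?_⟩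
        have h7 : Q.source (G.ar κ) = flip (Q.source e) := by
          rw [h2, G.source_ar, ← G.pol_not, Bool.not_not]
        rw [loop_ends h1] at h7; simpa using h7
      have h8 := coef_mul_special k h1 h6 (G.contr U (G.src κ) (!G.srcSide κ) c y)
      have h9 : coef k (Q.source e).1 ((l ++ [G.ar κ]) ++ [e])
          (G.contr U (G.src κ) (!G.srcSide κ) c y) = 0 := by
        rw [← contr_flip_out hy (not_top_of_isM hM)]
        exact coef_sum_mul_ordinary y h3 _ _ (by simpa using h4.symm) c
      rw [h9, contr_pun h] at h8
      change coef k _ _ (y.1 (Sum.inr (G.src κ, !G.srcSide κ), c) * arr k Q e) = 0 at h8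
      rw [row_mul_arr_of_pun y h, map_smul, h5, smul_eq_mul] at h8
      have h10 : U.sgn (G.src κ) c ≠ 0 := left_ne_zero_of_mul_eq_one (U.sgn_mul_self _ c)
      rw [contr_pun h]; exact (mul_eq_zero.1 h8).resolve_left (neg_ne_zero.2 h10)
  intro c; rw [← U.sum_W_V κ (fun c => coef k (Q.target (G.ar κ)).1 l (y.1 (.inl κ, c))) c]
  refine Finset.sum_eq_zero fun c' _ => ?_
  have h1 := key c'; rw [← contr_flip_out hy (not_top_of_isM hM), map_sum] at h1
  simp only [map_smul, hi, coef_mul_arr k hl] at h1; rw [h1, smul_zero]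

lemma row_mem_pathFiltration_of_isM (hy : G.presMap U y = 0) (hM : G.isM (G.src κ)) (c : Fin d) :
    y.1 (.inl κ, c) ∈ pathFiltration k 1 := by
  refine mem_pathFiltration_one k fun i l hl h0 => ?_
  by_cases hi : G.vert (G.tgt κ) = i; swap
  · rw [← row_mul_vtx, coef_mul_vtx_of_ne hi]
  rw [← G.target_ar_fst] at hi
  rcases eq_nil_or_special_of_ordLength hl h0 with rfl | ⟨e, he, rfl, h1⟩
  · rw [← hi]; exact coef_eq_zero_of_continues hy κ hM [] (isPathFrom_singleton rfl) c
  have hst := loop_ends he; rcases eq_or_eq_flip (h1.trans hi.symm) with h2 | h2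
  · -- the arrow is the special loop itself: one has to look at the other side of its target
    have h3 : e = G.ar κ := Q.target_injective (hst.symm.trans h2); subst h3
    have hM' : G.isM (G.tgt κ) := by by_contra h7; exact G.isM_ordinary κ hM h7 he
    rw [row_eq_contr hy (not_top_of_isM hM')]
    match h : G.side (G.tgt κ) (G.srcSide κ) with
    | .free => rw [contr_free h, LinearMap.zero_apply, map_zero]
    | .inn κ' =>
      obtain ⟨h4, h5, h6⟩ := G.of_inn h
      rw [contr_inn h, ← hi, G.target_ar_fst, ← h4, ← G.target_ar_fst]
      refine coef_eq_zero_of_continues hy κ' (G.isM_edge κ' (h4 ▸ hM')) _ ?_ c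
      rw [isPathFrom_append_singleton]; refine ⟨rfl, List.isChain_singleton _, ?_⟩
      have h8 : Q.source (G.ar κ) = flip (Q.target (G.ar κ')) := by
        rw [h2, h6, G.target_ar, G.pol_not]
      simpa using h8
    | .out κ' =>
      have h4 : G.ar κ' ∉ Q.special := by
        refine G.ar_ordinary_of_pol he (.inr (G.target_ar κ)) (.inl ?_); rw [Bool.not_not]
        exact (G.of_out h).2.2
      rw [contr_out_apply h]; refine coef_sum_mul_ordinary y h4 _ _ ?_ c; intro h5
      simp only [List.getLast?_singleton, Option.mem_def, Option.some.injEq] at h5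
      exact h4 (h5 ▸ he)
    | .pun e' =>
      obtain ⟨h4, h5⟩ := G.of_pun h
      refine absurd h4 (G.ar_ordinary_of_pol he (.inr (G.target_ar κ)) (.inl ?_)); rw [Bool.not_not]
      exact h5
  · rw [← hi]; refine coef_eq_zero_of_continues hy κ hM [e] ?_ c; rw [isPathFrom_append_singleton]
    grind

lemma sum_mem_pathFiltration (h : ∀ c, y.1 (.inl κ, c) ∈ pathFiltration k 1) (c : Fin d) : ∑ c',
    U.V κ c c' • (y.1 (.inl κ, c') * arr k Q (G.ar κ)) ∈ pathFiltration k 1 := by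
  refine Submodule.sum_mem _ fun c' _ => Submodule.smul_mem _ _ ?_
  exact mul_right_mem_pathFiltration (h c') (arr k Q (G.ar κ))

lemma row_mem_pathFiltration (hy : G.presMap U y = 0) (κ : K) : ∀ c, y.1 (.inl κ, c)
    ∈ pathFiltration k 1 := by
  induction κ using G.wellFounded_down.induction with
  | _ κ ih =>
  intro c; by_cases hM : G.isM (G.src κ)
  · exact row_mem_pathFiltration_of_isM hy hM c
  · have h1 : ¬ G.isM (G.tgt κ) := fun h => hM (G.isM_edge κ h)
    rw [row_eq_contr hy (fun h => hM (G.top_tgt κ h))]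
    match h : G.side (G.tgt κ) (G.srcSide κ) with
    | .free => rw [contr_free h]; exact zero_mem _
    | .inn κ' =>
      rw [contr_inn h]; refine row_mem_pathFiltration_of_isM hy ?_ c
      exact (G.isM_two (G.side_tgt κ) (by rwa [Bool.not_not])).resolve_left hM
    | .out κ' =>
      rw [contr_out_apply h]; exact sum_mem_pathFiltration (ih κ' (G.of_out h).1) c
    | .pun e => exact absurd (G.isM_pun h) h1

/-- The kernel of the presentation is contained in the submodule generated by the ordinary
arrows. -/
lemma mem_pathFiltration_of_mem_ker (hy : G.presMap U y = 0) (i : (K ⊕ J × Bool) × Fin d) :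
    y.1 i ∈ pathFiltration k 1 := by
  obtain ⟨κ | ⟨j, b⟩, c⟩ := i
  · exact row_mem_pathFiltration hy κ c
  have h0 := y.2 (.inr (j, b), c); rw [← h0]
  match h : G.side j b with
  | .free | .inn κ | .out κ =>
    have h1 : G.rowIdem U (.inr (j, b), c) = 0 := by rw [rowIdem, h]; rfl
    rw [h1, mul_zero]; exact zero_mem _
  | .pun e =>
    rw [h0]
    have h1 : y.1 (.inr (j, b), c) = G.contr U j (!b) c y := by
      rw [← contr_eq_of_mem_ker hy (not_top_of_isM (G.isM_pun h)), contr_pun h]; rfl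
    rw [h1]
    match h' : G.side j (!b) with
    | .free => rw [contr_free h']; exact zero_mem _
    | .inn κ => rw [contr_inn h']; exact row_mem_pathFiltration hy κ c
    | .out κ =>
      rw [contr_out_apply h']; exact sum_mem_pathFiltration (row_mem_pathFiltration hy κ) c
    | .pun e' =>
      obtain ⟨h4, h5⟩ := G.of_pun h
      exact absurd (G.of_pun h').1 (G.ar_ordinary_of_pol h4 (.inl h5) (.inl (G.of_pun h').2))

/-- No direct summand of the source of the presentation is contained in its kernel. -/
lemma eq_zero_of_presMap_comp (hk : (2 : k) ≠ 0) (π : idemModule (G.rowIdem U) →ₗ[QAlg k Q]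
    idemModule (G.rowIdem U)) (hπ : π ∘ₗ π = π) (h : G.presMap U ∘ₗ π = 0) : π = 0 := by
  classical
  have h1 : ∀ n : ℕ, ∀ y i, (π y).1 i ∈ pathFiltration k n := by
    intro n
    induction n with
    | zero => exact fun y i => mem_pathFiltration_zero k _
    | succ n ih =>
      intro y i
      have h2 : π y = ∑ i, (π y).1 i • π (idemGen (G.rowIdem_mul_self U hk) i) := by
        conv_lhs => rw [← hπ, LinearMap.comp_apply, ← sum_smul_idemGen
          (G.rowIdem_mul_self U hk) (π y), map_sum]
        simp only [map_smul]
      rw [h2, AddSubmonoidClass.coe_finsetSum, Finset.sum_apply]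
      refine Submodule.sum_mem _ fun i' _ => ?_
      refine mul_mem_pathFiltration k (ih y i') (mem_pathFiltration_of_mem_ker ?_ i)
      exact LinearMap.congr_fun h _
  obtain ⟨n, hn⟩ := exists_pathFiltration_eq_bot (Q := Q) k
  refine LinearMap.ext fun y => Subtype.ext (funext fun i => ?_)
  have h2 := h1 n y i; rw [hn] at h2; exact h2

end Diagram

end

/-! ### The cokernel of the presentation -/

section

variable [Fintype V] {J K : Type} [Fintype J] [Fintype K]

namespace Diagram

variable (G : Diagram Q J K) {d : ℕ} (U : Gauge k J K d)

open Classical in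
/-- The generator of the presentation for a position and a basis vector. -/
def colGen (j : J) (c : Fin d) : idemModule (G.colIdem U) := idemGen (G.colIdem_mul_self U) (j, c)

open Classical in
/-- The relation of the presentation for an arrow or a puncture and a basis vector. -/
def rowGen (hk : (2 : k) ≠ 0) (i : (K ⊕ J × Bool) × Fin d) : idemModule (G.rowIdem U) :=
  idemGen (G.rowIdem_mul_self U hk) i

variable {G U} (hk : (2 : k) ≠ 0)

lemma rowGen_apply_self (i : (K ⊕ J × Bool) × Fin d) : (G.rowGen U hk i).1 i = G.rowIdem U i := by
  classical
  rw [rowGen, idemGen_apply, if_pos rfl]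

lemma rowGen_apply_of_ne {i i' : (K ⊕ J × Bool) × Fin d} (h : i' ≠ i) : (G.rowGen U hk i).1 i' =
    0 := by
  classical
  rw [rowGen, idemGen_apply, if_neg h]

variable {j : J} {b : Bool}

lemma colGen_of_top (h : G.top j) (c : Fin d) : G.colGen U j c = 0 := by
  classical
  refine Subtype.ext (funext fun q => ?_)
  rw [colGen, idemGen_apply]
  split_ifs
  · rw [colIdem, if_pos h]; rfl
  · rfl

lemma vtx_smul_colGen (j : J) (c : Fin d) : vtx k Q (G.vert j) • G.colGen U j c = G.colGen U j
    c := by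
  classical
  by_cases h : G.top j
  · rw [colGen_of_top h, smul_zero]
  · have h1 := idem_smul_idemGen (G.colIdem_mul_self U) (j, c)
    have h2 : G.colIdem U (j, c) = vtx k Q (G.vert j) := if_neg h
    rw [h2] at h1
    exact h1

lemma sum_smul_colGen (x : idemModule (G.colIdem U)) : ∑ j, ∑ c, x.1 (j, c) • G.colGen U j c =
    x := by
  classical
  rw [← Fintype.sum_prod_type' (f := fun j c => x.1 (j, c) • G.colGen U j c)]
  exact sum_smul_idemGen (G.colIdem_mul_self U) x

lemma sum_smul_rowGen (y : idemModule (G.rowIdem U)) : ∑ i, y.1 i • G.rowGen U hk i = y := by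
  classical
  exact sum_smul_idemGen (G.rowIdem_mul_self U hk) y

variable {Z : Type uM} [AddCommGroup Z] [Module (QAlg k Q) Z]

lemma apply_presMap (h : idemModule (G.colIdem U) →ₗ[QAlg k Q] Z) (y : idemModule (G.rowIdem U)) :
    h (G.presMap U y) = (∑ j, ∑ c, G.contr U j true c y • h (G.colGen U j c)) - ∑ j, ∑ c,
    G.contr U j false c y • h (G.colGen U j c) := by
  conv_lhs => rw [← sum_smul_colGen (G.presMap U y), map_sum]
  rw [← Finset.sum_sub_distrib]; refine Finset.sum_congr rfl fun j _ => ?_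
  rw [map_sum, ← Finset.sum_sub_distrib]; refine Finset.sum_congr rfl fun c _ => ?_
  rw [map_smul]; by_cases ht : G.top j
  · rw [colGen_of_top ht, map_zero, smul_zero, smul_zero, smul_zero, sub_zero]
  · rw [presMap_apply ht, sub_smul]

lemma contr_rowGen_edge (κ : K) (c : Fin d) [DecidableEq J] (j : J) (b : Bool) (c' : Fin d) :
    G.contr U j b c' (G.rowGen U hk (.inl κ, c)) = (if j = G.src κ ∧ b = G.srcSide κ then U.V κ c' c
    • arr k Q (G.ar κ) else 0) + if j = G.tgt κ ∧ b = (!G.srcSide κ) ∧ c' = c then vtx k Q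
    (G.vert (G.tgt κ)) else 0 := by
  classical
  match h : G.side j b with
  | .free =>
    rw [contr_free h, if_neg, if_neg, add_zero]; rfl
    · rintro ⟨rfl, rfl, rfl⟩; rw [G.side_tgt] at h; cases h
    · rintro ⟨rfl, rfl⟩; rw [G.side_src] at h; cases h
  | .pun e =>
    rw [contr_pun h, if_neg, if_neg, add_zero]
    · change (G.rowGen U hk (.inl κ, c)).1 (Sum.inr (j, b), c') = 0
      exact rowGen_apply_of_ne hk (by simp)
    · rintro ⟨rfl, rfl, rfl⟩; rw [G.side_tgt] at h; cases h
    · rintro ⟨rfl, rfl⟩; rw [G.side_src] at h; cases h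
  | .inn κ' =>
    obtain ⟨rfl, h2, h3⟩ := G.of_inn h; have h4 : b = !G.srcSide κ' := by rw [h2, Bool.not_not]
    rw [contr_inn h, if_neg, zero_add]
    · change (G.rowGen U hk _).1 (Sum.inl κ', c') = _
      by_cases h5 : (Sum.inl κ', c') = ((Sum.inl κ, c) : (K ⊕ J × Bool) × Fin d)
      · simp only [Prod.mk.injEq, Sum.inl.injEq] at h5; obtain ⟨rfl, rfl⟩ := h5
        rw [rowGen_apply_self, if_pos ⟨rfl, h4, rfl⟩]; rfl
      · rw [rowGen_apply_of_ne hk h5, if_neg]; rintro ⟨h6, h7, rfl⟩; rw [h6, h7, G.side_tgt] at h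
        cases h; exact h5 rfl
    · rintro ⟨h6, h7⟩; rw [h6, h7, G.side_src] at h; cases h
  | .out κ' =>
    obtain ⟨rfl, rfl, h3⟩ := G.of_out h; rw [contr_out_apply h, if_neg (c := _ ∧ _ ∧ _), add_zero]
    · by_cases h5 : κ' = κ
      · subst h5; rw [if_pos ⟨rfl, rfl⟩, Finset.sum_eq_single c]
        · rw [rowGen_apply_self]; change _ • (vtx k Q (G.vert (G.tgt κ')) * _) = _
          rw [← G.target_ar_fst, vtx_mul_arr]
        · intro c'' _ hc; rw [rowGen_apply_of_ne hk (by simpa using hc), zero_mul, smul_zero]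
        · intro hc; exact absurd (Finset.mem_univ c) hc
      · rw [if_neg]
        · refine Finset.sum_eq_zero fun c'' _ => ?_
          rw [rowGen_apply_of_ne hk (by simp [h5]), zero_mul, smul_zero]
        · rintro ⟨h6, h7⟩; rw [h6, h7, G.side_src] at h; cases h; exact h5 rfl
    · rintro ⟨h6, h7, -⟩; rw [h6, h7, G.side_tgt] at h; cases h

lemma contr_rowGen_pun (h : G.side j b = .pun e) (c : Fin d) [DecidableEq J] (j' : J) (b' : Bool)
    (c' : Fin d) : G.contr U j' b' c' (G.rowGen U hk (.inr (j, b), c)) = if j' = j ∧ b' = b ∧ c' = c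
    then punIdem k Q (.pun e : Side K E) (U.sgn j c) else 0 := by
  classical
  match h' : G.side j' b' with
  | .free =>
    rw [contr_free h', if_neg]; rfl; rintro ⟨rfl, rfl, rfl⟩; rw [h] at h'; cases h'
  | .inn κ =>
    rw [contr_inn h', if_neg]
    · change (G.rowGen U hk (.inr (j, b), c)).1 (Sum.inl κ, c') = 0
      exact rowGen_apply_of_ne hk (by simp)
    · rintro ⟨rfl, rfl, rfl⟩; rw [h] at h'; cases h'
  | .out κ =>
    rw [contr_out_apply h', if_neg]
    · refine Finset.sum_eq_zero fun c'' _ => ?_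
      rw [rowGen_apply_of_ne hk (by simp), zero_mul, smul_zero]
    · rintro ⟨rfl, rfl, rfl⟩; rw [h] at h'; cases h'
  | .pun e' =>
    rw [contr_pun h']; change (G.rowGen U hk _).1 (Sum.inr (j', b'), c') = _
    by_cases h5 : j' = j ∧ b' = b ∧ c' = c
    · obtain ⟨rfl, rfl, rfl⟩ := h5; rw [rowGen_apply_self, if_pos ⟨rfl, rfl, rfl⟩, rowIdem, h]
    · rw [if_neg h5, rowGen_apply_of_ne hk]; simpa [and_assoc] using h5

variable [Module k Z] [IsScalarTower k (QAlg k Q) Z]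

lemma apply_presMap_edge_aux (h : idemModule (G.colIdem U) →ₗ[QAlg k Q] Z) (κ : K) (c : Fin d)
    (b : Bool) : ∑ j, ∑ c', G.contr U j b c' (G.rowGen U hk (.inl κ, c)) • h (G.colGen U j c')
    = (if b = G.srcSide κ then ∑ c', U.V κ c' c • arr k Q (G.ar κ) • h (G.colGen U (G.src κ) c')
    else 0) + if b = (!G.srcSide κ) then h (G.colGen U (G.tgt κ) c) else 0 := by
  classical
  simp only [contr_rowGen_edge, add_smul, Finset.sum_add_distrib]
  congr 1
  · rw [Finset.sum_eq_single (G.src κ)]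
    · by_cases h2 : b = G.srcSide κ
      · simp only [h2, and_self, if_true, smul_assoc]
      · simp [h2]
    · intro j _ hj
      simp [hj]
    · grind
  · rw [Finset.sum_eq_single (G.tgt κ), Finset.sum_eq_single c]
    · by_cases h2 : b = !G.srcSide κ
      · rw [if_pos ⟨rfl, h2, rfl⟩, if_pos h2, ← map_smul, vtx_smul_colGen]
      · rw [if_neg fun h3 => h2 h3.2.1, if_neg h2, zero_smul]
    · intro c' _ hc
      rw [if_neg fun h3 => hc h3.2.2, zero_smul]
    · grind
    · intro j _ hj
      refine Finset.sum_eq_zero fun c' _ => ?_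
      rw [if_neg fun h3 => hj h3.1, zero_smul]
    · grind

lemma apply_presMap_edge (h : idemModule (G.colIdem U) →ₗ[QAlg k Q] Z) (κ : K) (c : Fin d) :
    h (G.presMap U (G.rowGen U hk (.inl κ, c))) = 0 ↔ ∑ c', U.V κ c' c • arr k Q (G.ar κ)
    • h (G.colGen U (G.src κ) c') = h (G.colGen U (G.tgt κ) c) := by
  rw [apply_presMap, apply_presMap_edge_aux hk h, apply_presMap_edge_aux hk h]
  cases h2 : G.srcSide κ
  · grind
  · grind

lemma apply_presMap_pun_aux (h : idemModule (G.colIdem U) →ₗ[QAlg k Q] Z) (hs : G.side j b = .pun e)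
    (c : Fin d) (b' : Bool) : ∑ j', ∑ c', G.contr U j' b' c' (G.rowGen U hk (.inr (j, b), c))
    • h (G.colGen U j' c') = if b' = b then punIdem k Q (.pun e : Side K E) (U.sgn j c)
    • h (G.colGen U j c) else 0 := by
  classical
  simp only [contr_rowGen_pun hk hs]
  rw [Finset.sum_eq_single j, Finset.sum_eq_single c]
  · by_cases h2 : b' = b
    · grind
    · rw [if_neg fun h3 => h2 h3.2.1, if_neg h2, zero_smul]
  · intro c' _ hc
    rw [if_neg fun h3 => hc h3.2.2, zero_smul]
  · grind
  · intro j' _ hj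
    refine Finset.sum_eq_zero fun c' _ => ?_
    rw [if_neg fun h3 => hj h3.1, zero_smul]
  · grind

lemma apply_presMap_pun (h : idemModule (G.colIdem U) →ₗ[QAlg k Q] Z) (hs : G.side j b = .pun e)
    (c : Fin d) : h (G.presMap U (G.rowGen U hk (.inr (j, b), c))) = 0 ↔ arr k Q e • h (G.colGen U j
    c) = U.sgn j c • h (G.colGen U j c) := by
  rw [apply_presMap, apply_presMap_pun_aux hk h hs, apply_presMap_pun_aux hk h hs]
  have h1 : ((if true = b then punIdem k Q (.pun e : Side K E) (U.sgn j c) • h (G.colGen U j c)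
      else 0) - if false = b then
        punIdem k Q (.pun e : Side K E) (U.sgn j c) • h (G.colGen U j c) else 0) = 0 ↔
      punIdem k Q (.pun e : Side K E) (U.sgn j c) • h (G.colGen U j c) = 0 := by cases b <;> simp
  have h2 : vtx k Q (Q.source e).1 • h (G.colGen U j c) = h (G.colGen U j c) := by
    rw [(G.of_pun hs).2, G.pol_fst_vert, ← map_smul, vtx_smul_colGen]
  rw [h1, punIdem, smul_assoc, smul_eq_zero_iff_right (inv_ne_zero hk), sub_smul, h2, smul_assoc,
    sub_eq_zero]
  constructor
  · intro h3
    conv_rhs => rw [h3, smul_smul, U.sgn_mul_self, one_smul]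
  · intro h3; rw [h3, smul_smul, U.sgn_mul_self, one_smul]

end Diagram
end

/-! ### Modules described by a diagram -/

section

lemma exists_cokernel (k : Type uk) [Field k] {R : Type uX} [Ring R] [Algebra k R] {P₁ P₀ : Type uX}
    {M : Type uM} [AddCommGroup P₁] [Module R P₁] [AddCommGroup P₀] [Module R P₀] [AddCommGroup M]
    [Module R M] (f : P₁ →ₗ[R] P₀) (g : P₀ →ₗ[R] M) (h : ∀ y, g (f y) = 0) : ∃ (Z : Type uX)
    (_ : AddCommGroup Z) (_ : Module k Z) (_ : Module R Z) (_ : IsScalarTower k R Z)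
    (π : P₀ →ₗ[R] Z) (g' : Z →ₗ[R] M), (∀ y, π (f y) = 0) ∧ (∀ x, π x = 0 → x ∈ LinearMap.range f)
    ∧ ∀ x, g' (π x) = g x :=
  ⟨P₀ ⧸ LinearMap.range f, inferInstance, Module.compHom _ (algebraMap k R), inferInstance,
    letI : Module k (P₀ ⧸ LinearMap.range f) := Module.compHom _ (algebraMap k R)
    IsScalarTower.of_algebraMap_smul fun _ _ => rfl,
    (LinearMap.range f).mkQ, (LinearMap.range f).liftQ g (by rintro _ ⟨y, rfl⟩; exact h y),
    fun y => (Submodule.Quotient.mk_eq_zero _).2 ⟨y, rfl⟩,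
    fun _ hx => (Submodule.Quotient.mk_eq_zero _).1 hx, fun _ => rfl⟩

end

section

variable [Fintype V] {J K : Type} [Fintype J] [Fintype K]

namespace Diagram

/-- The module `M` is described by the positions in `isM` of the diagram: it has a basis which
consists of `d` vectors at each of these positions, on which the arrows act as prescribed. -/
structure Describes (G : Diagram Q J K) {d : ℕ} (U : Gauge k J K d) (M : Type uM) [AddCommGroup M]
    [Module k M] [Module (QAlg k Q) M] where
  vec : J → Fin d → M
  vec_eq_zero : ∀ j c, ¬ G.isM j → vec j c = 0
  vtx_smul : ∀ j c, vtx k Q (G.vert j) • vec j c = vec j c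
  arr_smul : ∀ κ c, ∑ c', U.V κ c' c • arr k Q (G.ar κ) • vec (G.src κ) c' = vec (G.tgt κ) c
  pun_smul : ∀ {j b e} c, G.side j b = .pun e → arr k Q e • vec j c = U.sgn j c • vec j c
  indep : LinearIndependent k fun p : {j // G.isM j} × Fin d => vec p.1 p.2
  span : Submodule.span (QAlg k Q) (Set.range fun p : J × Fin d => vec p.1 p.2) = ⊤

variable {G : Diagram Q J K} {d : ℕ} {U : Gauge k J K d} {Z : Type uM} [AddCommGroup Z] [Module k Z]
  [Module (QAlg k Q) Z] [IsScalarTower k (QAlg k Q) Z]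

section

variable (z : J → Fin d → Z) (hv : ∀ j c, vtx k Q (G.vert j) • z j c = z j c)
  (ht : ∀ j c, G.top j → z j c = 0) (ha : ∀ κ c, ∑ c', U.V κ c' c • arr k Q (G.ar κ) • z (G.src κ)
  c' = z (G.tgt κ) c) (hp : ∀ {j b e} c, G.side j b = .pun e → arr k Q e • z j c = U.sgn j c • z j
  c)

include ha ht

lemma src_eq_zero_of_not_isM (κ : K) : ¬ G.isM (G.src κ) → ∀ c, z (G.src κ) c = 0 := by
  induction κ using G.wellFounded_up.induction with
  | _ κ ih =>
  intro h c; by_cases h1 : G.top (G.src κ)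
  · exact ht _ _ h1
  · obtain ⟨κ', h2, h3⟩ := G.isM_tail _ h h1; rw [← h2, ← ha]
    exact Finset.sum_eq_zero fun c' _ => by rw [ih κ' h2 h3, smul_zero, smul_zero]

lemma eq_zero_of_not_isM {j : J} (h : ¬ G.isM j) (c : Fin d) : z j c = 0 := by
  by_cases h1 : G.top j
  · exact ht _ _ h1
  · obtain ⟨κ', h2, h3⟩ := G.isM_tail _ h h1; rw [← h2, ← ha]
    exact Finset.sum_eq_zero fun c' _ => by
      rw [src_eq_zero_of_not_isM z ht ha κ' h3, smul_zero, smul_zero]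

include hv hp

lemma arr_smul_mem_span (a : E) (j : J) (c : Fin d) : arr k Q a • z j c ∈ Submodule.span k
    (Set.range fun p : {j // G.isM j} × Fin d => z p.1 p.2) := by
  set S := Submodule.span k (Set.range fun p : {j // G.isM j} × Fin d => z p.1 p.2)
  have hS : ∀ j c, z j c ∈ S := fun j c => by
    by_cases h : G.isM j
    · exact Submodule.subset_span ⟨(⟨j, h⟩, c), rfl⟩
    · rw [eq_zero_of_not_isM z ht ha h]; exact zero_mem _
  by_cases h : G.isM j; swap
  · rw [eq_zero_of_not_isM z ht ha h, smul_zero]; exact zero_mem _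
  by_cases h1 : (Q.source a).1 = G.vert j; swap
  · rw [← hv, ← mul_smul, arr_mul_vtx_of_ne k Q h1, zero_smul]; exact zero_mem _
  obtain ⟨b, hb⟩ := G.exists_pol h1
  match hs : G.side j b with
  | .free => exact absurd hb (G.isM_free h hs a)
  | .pun e =>
    have h2 : a = e := Q.source_injective (hb.trans (G.of_pun hs).2.symm); rw [h2, hp c hs]
    exact Submodule.smul_mem _ _ (hS _ _)
  | .out κ =>
    obtain ⟨rfl, rfl, h4⟩ := G.of_out hs
    have h2 : a = G.ar κ := Q.source_injective (hb.trans h4.symm); subst h2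
    have h5 := U.sum_W_V' κ (fun c => arr k Q (G.ar κ) • z (G.src κ) c) c; rw [← h5]
    refine Submodule.sum_mem _ fun c' _ => Submodule.smul_mem _ _ ?_
    have h6 := ha κ c'; exact h6 ▸ hS _ _
  | .inn κ =>
    obtain ⟨rfl, h3, h4⟩ := G.of_inn hs
    have h5 : Q.source a = Q.target (G.ar κ) := hb.trans h4.symm; rw [← ha, Finset.smul_sum]
    refine Submodule.sum_mem _ fun c' _ => ?_
    have h8 : arr k Q a • U.V κ c' c • arr k Q (G.ar κ) • z (G.src κ) c' =
        U.V κ c' c • (arr k Q a * arr k Q (G.ar κ)) • z (G.src κ) c' := by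
      have : SMulCommClass k (QAlg k Q) Z := IsScalarTower.to_smulCommClass
      rw [smul_comm, mul_smul]
    rw [h8]; refine Submodule.smul_mem _ _ ?_; by_cases h6 : a ∈ Q.special ∨ G.ar κ ∈ Q.special
    · have h7 := eq_of_source_eq_target h5 h6; rw [h7, or_self] at h6
      rw [h7, arr_special k Q h6, G.source_ar_fst, hv]; exact hS _ _
    · rw [not_or] at h6; rw [arr_mul_arr k Q h6.1 h6.2 h5, zero_smul]; exact zero_mem _

lemma smul_mem_span_of_relations (r : QAlg k Q) (x : Z) (hx : x ∈ Submodule.span k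
    (Set.range fun p : {j // G.isM j} × Fin d => z p.1 p.2)) : r • x ∈ Submodule.span k
    (Set.range fun p : {j // G.isM j} × Fin d => z p.1 p.2) := by
  have : SMulCommClass k (QAlg k Q) Z := IsScalarTower.to_smulCommClass
  induction r using pathAlg_induction generalizing x with
  | hv i =>
    induction hx using Submodule.span_induction with
    | mem x hx =>
      obtain ⟨p, rfl⟩ := hx; dsimp only; rw [← hv, ← mul_smul]; by_cases h : i = G.vert p.1
      · rw [h, vtx_mul_self, hv]; exact Submodule.subset_span ⟨p, rfl⟩
      · rw [vtx_mul_vtx k Q h, zero_smul]; exact zero_mem _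
    | zero => rw [smul_zero]; exact zero_mem _
    | add x y _ _ h1 h2 => rw [smul_add]; exact Submodule.add_mem _ h1 h2
    | smul t x _ h1 => rw [smul_comm]; exact Submodule.smul_mem _ _ h1
  | ha a =>
    induction hx using Submodule.span_induction with
    | mem x hx =>
      obtain ⟨p, rfl⟩ := hx; exact arr_smul_mem_span z hv ht ha hp a _ _
    | zero => rw [smul_zero]; exact zero_mem _
    | add x y _ _ h1 h2 => rw [smul_add]; exact Submodule.add_mem _ h1 h2
    | smul t x _ h1 => rw [smul_comm]; exact Submodule.smul_mem _ _ h1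
  | hc t => rw [algebraMap_smul]; exact Submodule.smul_mem _ _ hx
  | hadd r s h1 h2 => rw [add_smul]; exact Submodule.add_mem _ (h1 x hx) (h2 x hx)
  | hmul r s h1 h2 => rw [mul_smul]; exact h1 _ (h2 x hx)

end

variable {M : Type uM} [AddCommGroup M] [Module k M] [Module (QAlg k Q) M]
  [IsScalarTower k (QAlg k Q) M]

/-- The map from the generators of the presentation to a module described by the diagram. -/
def Describes.map (D : G.Describes U M) : idemModule (G.colIdem U) →ₗ[QAlg k Q] M :=
  idemLift (G.colIdem U) fun q => D.vec q.1 q.2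

lemma Describes.map_colGen (D : G.Describes U M) (j : J) (c : Fin d) : D.map (G.colGen U j c)
    = D.vec j c := by
  classical
  by_cases h : G.top j
  · rw [colGen_of_top h, map_zero, D.vec_eq_zero _ _ (G.top_isM j h)]
  · have h1 := idemLift_idemGen (G.colIdem_mul_self U) (fun q => D.vec q.1 q.2) (j, c)
    have h2 : G.colIdem U (j, c) = vtx k Q (G.vert j) := if_neg h
    rw [h2, D.vtx_smul] at h1
    exact h1

lemma Describes.map_surjective (D : G.Describes U M) : Function.Surjective D.map := by
  rw [← LinearMap.range_eq_top, eq_top_iff, ← D.span, Submodule.span_le]; rintro _ ⟨p, rfl⟩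
  exact ⟨_, D.map_colGen p.1 p.2⟩

lemma Describes.map_presMap (D : G.Describes U M) (hk : (2 : k) ≠ 0)
    (y : idemModule (G.rowIdem U)) : D.map (G.presMap U y) = 0 := by
  rw [← sum_smul_rowGen hk y, map_sum, map_sum]; refine Finset.sum_eq_zero fun i _ => ?_
  rw [map_smul, map_smul]; obtain ⟨κ | ⟨j, b⟩, c⟩ := i
  · rw [(apply_presMap_edge hk D.map κ c).2, smul_zero]; simp only [D.map_colGen]
    exact D.arr_smul κ c
  · match h : G.side j b with
    | .free | .inn κ | .out κ =>
      have h1 : G.rowGen U hk (.inr (j, b), c) = 0 := by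
        refine Subtype.ext (funext fun i => ?_); by_cases h2 : i = (.inr (j, b), c)
        · rw [h2, rowGen_apply_self, rowIdem, h]; rfl
        · exact rowGen_apply_of_ne hk h2
      rw [h1, map_zero, map_zero, smul_zero]
    | .pun e =>
      rw [(apply_presMap_pun hk D.map h c).2, smul_zero]; rw [D.map_colGen]; exact D.pun_smul c h

/-- The cokernel of the presentation is the module described by the diagram. -/
lemma Describes.range_presMap (D : G.Describes U M) (hk : (2 : k) ≠ 0) : LinearMap.range
    (G.presMap U) = LinearMap.ker D.map := by
  refine le_antisymm ?_ fun u hu => ?_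
  · rintro _ ⟨y, rfl⟩
    exact D.map_presMap hk y
  obtain ⟨Z, _, _, _, _, π, g, hπ, hπ', hgπ⟩ :=
    exists_cokernel k (R := QAlg k Q) (P₁ := idemModule (G.rowIdem U))
      (P₀ := idemModule (G.colIdem U)) (M := M) (G.presMap U) D.map (D.map_presMap hk)
  let z : J → Fin d → Z := fun j c => π (G.colGen U j c)
  have hgz : ∀ j c, g (z j c) = D.vec j c := fun j c => (hgπ _).trans (D.map_colGen j c)
  have hmem : ∀ r : QAlg k Q, ∀ x ∈ Submodule.span k
      (Set.range fun p : {j // G.isM j} × Fin d => z p.1 p.2), r • x ∈ Submodule.span k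
      (Set.range fun p : {j // G.isM j} × Fin d => z p.1 p.2) := by
    refine smul_mem_span_of_relations (G := G) (U := U) z (fun j c => ?_) (fun j c h => ?_)
      (fun κ c => ?_) (fun {j b e} c h => ?_)
    · change vtx k Q _ • π _ = π _
      rw [← map_smul, vtx_smul_colGen]
    · change π _ = 0
      rw [colGen_of_top h, map_zero]
    exacts [(apply_presMap_edge hk π κ c).1 (hπ _), (apply_presMap_pun hk π h c).1 (hπ _)]
  have hz0 : ∀ j c, ¬ G.isM j → z j c = 0 := fun j c h =>
    eq_zero_of_not_isM (G := G) (U := U) z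
      (fun j c h => by change π _ = 0; rw [colGen_of_top h, map_zero])
      (fun κ c => (apply_presMap_edge hk π κ c).1 (hπ _)) h c
  have hu' : π u ∈ Submodule.span k (Set.range fun p : {j // G.isM j} × Fin d => z p.1 p.2) := by
    rw [← sum_smul_colGen u, map_sum]
    refine Submodule.sum_mem _ fun j _ => ?_
    rw [map_sum]
    refine Submodule.sum_mem _ fun c _ => ?_
    rw [map_smul]
    refine hmem _ _ ?_
    by_cases h : G.isM j
    · exact Submodule.subset_span ⟨(⟨j, h⟩, c), rfl⟩
    · have := hz0 j c h
      change z j c ∈ _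
      rw [this]; exact zero_mem _
  classical
  rw [Submodule.mem_span_range_iff_exists_fun] at hu'
  obtain ⟨t, ht⟩ := hu'
  have h1 : g (π u) = 0 := (hgπ u).trans hu
  rw [← ht, map_sum] at h1
  simp only [LinearMap.map_smul_of_tower, hgz] at h1
  have h2 := Fintype.linearIndependent_iff.1 D.indep t h1
  simp only [h2, zero_smul, Finset.sum_const_zero] at ht
  exact hπ' u ht.symm

end Diagram
end

/-! ### The transpose of the presentation -/

section

variable (k) {R : Type uX} [Ring R] [Algebra k R] {P P' : Type uX} [AddCommGroup P] [Module R P]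
  [AddCommGroup P'] [Module R P']

/-- Right multiplication by an element of `R` as a `k`-linear map on `Hom_R(P, R)`. -/
def homMul (r : R) : (P →ₗ[R] R) →ₗ[k] (P →ₗ[R] R) where
  toFun h := rightMul h r
  map_add' g h := LinearMap.ext fun p => add_mul (g p) (h p) r
  map_smul' c h := LinearMap.ext fun p => smul_mul_assoc c (h p) r

lemma homMul_apply (r : R) (h : P →ₗ[R] R) (p : P) : homMul k r h p = h p * r := rfl

lemma homMul_mul (r s : R) (h : P →ₗ[R] R) : homMul k (r * s) h = homMul k s (homMul k r h) :=
  LinearMap.ext fun p => (mul_assoc (h p) r s).symm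

/-- The homomorphisms `P → R` which factor through `f`. -/
def factorRange (f : P →ₗ[R] P') : Submodule k (P →ₗ[R] R) := LinearMap.range (homDual k f)

lemma homMul_mem_factorRange {f : P →ₗ[R] P'} (r : R) {h : P →ₗ[R] R} (hh : h ∈ factorRange k f) :
    homMul k r h ∈ factorRange k f := by obtain ⟨g, rfl⟩ := hh; exact ⟨rightMul g r, rfl⟩

variable {k} in
lemma combMul_eq_sum {ι : Type} (e : ι → R) {d : ℕ} (v : Fin d → k) (i : Fin d → ι) (r : R) :
    combMul e v i r = ∑ c, v c • homMul k r (idemCoord e (i c)) :=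
  LinearMap.ext fun y => by rw [LinearMap.sum_apply]; rfl

end

section

variable [Fintype V] {J K : Type} [Fintype J] [Fintype K]

namespace Diagram

variable (G : Diagram Q J K) {d : ℕ} (U : Gauge k J K d)

/-- The homomorphisms to the algebra which are, up to homomorphisms which factor through the
presentation, linear combinations of the coefficients at the positions in `isN`. -/
def contrSpan : Submodule k (idemModule (G.rowIdem U) →ₗ[QAlg k Q] QAlg k Q) :=
  factorRange k (G.presMap U) ⊔ Submodule.span k {h | ∃ j b c, G.isN j ∧ h = G.contr U j b c}

variable {G U}

variable {j : J} {b : Bool}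

lemma contr_sub_mem_factorRange (h : ¬ G.top j) (b b' : Bool) (c : Fin d) : G.contr U j b c -
    G.contr U j b' c ∈ factorRange k (G.presMap U) := by
  have h1 : G.contr U j true c - G.contr U j false c ∈ factorRange k (G.presMap U) :=
    ⟨idemCoord (G.colIdem U) (j, c), LinearMap.ext fun y => presMap_apply h c y⟩
  cases b <;> cases b'
  · rw [sub_self]; exact zero_mem _
  · rw [← neg_sub]; exact Submodule.neg_mem _ h1
  · exact h1
  · rw [sub_self]; exact zero_mem _

lemma contr_mem_of_contr_mem {S : Submodule k (idemModule (G.rowIdem U) →ₗ[QAlg k Q] QAlg k Q)}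
    (hS : factorRange k (G.presMap U) ≤ S) (h : ¬ G.top j) {b' : Bool} {c : Fin d}
    (h' : G.contr U j b' c ∈ S) : G.contr U j b c ∈ S := by
  rw [← sub_add_cancel (G.contr U j b c) (G.contr U j b' c)]
  exact Submodule.add_mem _ (hS (contr_sub_mem_factorRange h b b' c)) h'

lemma not_top_of_not_isN (h : ¬ G.isN j) : ¬ G.top j := fun h1 => h (G.top_isN j h1)

variable {κ : K}

lemma contr_out_eq_sum (h : G.side j b = .out κ) (c : Fin d) : G.contr U j b c = ∑ c', U.V κ c c' •
    homMul k (arr k Q (G.ar κ)) (idemCoord (G.rowIdem U) (.inl κ, c')) := by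
  rw [contr_out h, combMul_eq_sum]

lemma contr_out_mem_factorRange (h : G.side j b = .out κ) (h' : ∀ c, idemCoord (G.rowIdem U)
    (.inl κ, c) ∈ factorRange k (G.presMap U)) (c : Fin d) : G.contr U j b c ∈ factorRange k
    (G.presMap U) := by
  rw [contr_out_eq_sum h]
  exact Submodule.sum_mem _ fun c' _ =>
    Submodule.smul_mem _ _ (homMul_mem_factorRange k _ (h' c'))

/-- The coefficients at the positions which are not in `isN` factor through the presentation. -/
lemma idemCoord_mem_factorRange (κ : K) : ¬ G.isN (G.tgt κ) → ∀ c, idemCoord (G.rowIdem U)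
    (.inl κ, c) ∈ factorRange k (G.presMap U) := by
  induction κ using G.wellFounded_down.induction with
  | _ κ ih =>
  intro h c; rw [← contr_inn (G.side_tgt κ)]
  refine contr_mem_of_contr_mem le_rfl (not_top_of_not_isN h) (b' := !!G.srcSide κ) ?_
  rcases G.isN_down h (.inl ⟨κ, G.side_tgt κ⟩) with h1 | ⟨κ', h1, h2⟩
  · rw [contr_free h1]; exact zero_mem _
  · exact contr_out_mem_factorRange h1 (ih κ' (G.of_out h1).1 h2) c

lemma contr_mem_factorRange_of_not_isN (h : ¬ G.isN j) (b : Bool) (c : Fin d) : G.contr U j b c ∈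
    factorRange k (G.presMap U) := by
  match hs : G.side j b with
  | .free => rw [contr_free hs]; exact zero_mem _
  | .pun e => exact absurd (G.isN_pun hs) h
  | .inn κ =>
    rw [contr_inn hs]; exact idemCoord_mem_factorRange κ (by rwa [(G.of_inn hs).1]) c
  | .out κ =>
    by_cases h1 : G.isN (G.tgt κ)
    · refine contr_mem_of_contr_mem le_rfl (not_top_of_not_isN h) (b' := !b) ?_
      rcases G.isN_down h (.inr ⟨κ, hs, h1⟩) with h1 | ⟨κ', h1, h2⟩
      · rw [contr_free h1]; exact zero_mem _
      · exact contr_out_mem_factorRange h1 (idemCoord_mem_factorRange κ' h2) c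
    · exact contr_out_mem_factorRange hs (idemCoord_mem_factorRange κ h1) c

lemma factorRange_le_contrSpan : factorRange k (G.presMap U) ≤ G.contrSpan U := le_sup_left

lemma contr_mem_contrSpan (j : J) (b : Bool) (c : Fin d) : G.contr U j b c ∈ G.contrSpan U := by
  by_cases h : G.isN j
  exacts [Submodule.mem_sup_right (Submodule.subset_span ⟨j, b, c, h, rfl⟩),
    factorRange_le_contrSpan (contr_mem_factorRange_of_not_isN h b c)]

lemma homMul_vtx_contr (j : J) (b : Bool) (c : Fin d) : homMul k (vtx k Q (G.vert j))
    (G.contr U j b c) = G.contr U j b c :=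
  LinearMap.ext fun y => contr_mul_vtx j b c y

lemma homMul_arr_contr_mem {a : E} (hb : Q.target a = G.pol j b) (hs : G.side j b ≠ .free)
    (c : Fin d) : homMul k (arr k Q a) (G.contr U j b c) ∈ G.contrSpan U := by
  match h : G.side j b with
  | .free => exact absurd h hs
  | .pun e =>
    obtain ⟨h1, h2⟩ := G.of_pun h
    have h3 : a = e := Q.target_injective (hb.trans (h2.symm.trans (loop_ends h1)))
    subst h3
    have h4 : homMul k (arr k Q a) (G.contr U j b c) = -U.sgn j c • G.contr U j b c := by
      rw [contr_pun h]; exact LinearMap.ext fun y => row_mul_arr_of_pun y h c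
    rw [h4]; exact Submodule.smul_mem _ _ (contr_mem_contrSpan _ _ _)
  | .inn κ =>
    obtain ⟨-, -, h2⟩ := G.of_inn h; have h3 : a = G.ar κ := Q.target_injective (hb.trans h2.symm)
    subst h3
    have h4 := U.sum_W_V κ (fun c => homMul k (arr k Q (G.ar κ))
      (idemCoord (G.rowIdem U) (.inl κ, c))) c
    rw [contr_inn h, ← h4]; refine Submodule.sum_mem _ fun c' _ => Submodule.smul_mem _ _ ?_
    rw [← contr_out_eq_sum (G.side_src κ)]; exact contr_mem_contrSpan _ _ _
  | .out κ =>
    obtain ⟨h1, -, h2⟩ := G.of_out h; have h3 : Q.source (G.ar κ) = Q.target a := h2.trans hb.symm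
    rw [contr_out_eq_sum h, map_sum]; refine Submodule.sum_mem _ fun c' _ => ?_
    rw [map_smul, ← homMul_mul]; refine Submodule.smul_mem _ _ ?_
    by_cases h6 : G.ar κ ∈ Q.special ∨ a ∈ Q.special
    · have h7 := eq_of_source_eq_target h3 h6; rw [← h7, or_self] at h6
      rw [← h7, arr_special k Q h6, loop_ends h6, G.target_ar_fst,
        ← contr_inn (G.side_tgt κ), homMul_vtx_contr]
      exact contr_mem_contrSpan _ _ _
    · rw [not_or] at h6; rw [arr_mul_arr k Q h6.1 h6.2 h3]
      have h7 : homMul k (0 : QAlg k Q) (idemCoord (G.rowIdem U) (Sum.inl κ, c')) = 0 :=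
        LinearMap.ext fun y => mul_zero _
      rw [h7]; exact zero_mem _

lemma homMul_mem_contrSpan (r : QAlg k Q) (h : idemModule (G.rowIdem U) →ₗ[QAlg k Q] QAlg k Q)
    (hh : h ∈ G.contrSpan U) : homMul k r h ∈ G.contrSpan U := by
  have key : ∀ r : QAlg k Q, (∀ j b c, G.isN j → homMul k r (G.contr U j b c) ∈ G.contrSpan U) →
      ∀ h ∈ G.contrSpan U, homMul k r h ∈ G.contrSpan U := by
    intro r hr h hh
    have h1 : G.contrSpan U ≤ (G.contrSpan U).comap (homMul k r) := by
      refine sup_le (fun h hh => ?_) (Submodule.span_le.2 ?_)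
      · exact factorRange_le_contrSpan (homMul_mem_factorRange k r hh)
      · rintro _ ⟨j, b, c, hj, rfl⟩; exact hr j b c hj
    exact h1 hh
  induction r using pathAlg_induction generalizing h with
  | hv i =>
    refine key _ (fun j b c hj => ?_) h hh; rw [← homMul_vtx_contr, ← homMul_mul]
    by_cases h1 : G.vert j = i
    · rw [h1, vtx_mul_self, ← h1, homMul_vtx_contr]; exact contr_mem_contrSpan _ _ _
    · rw [vtx_mul_vtx k Q h1]
      have h7 : homMul k (0 : QAlg k Q) (G.contr U j b c) = 0 := LinearMap.ext fun y => mul_zero _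
      rw [h7]; exact zero_mem _
  | ha a =>
    refine key _ (fun j b c hj => ?_) h hh; by_cases h1 : (Q.target a).1 = G.vert j
    · obtain ⟨b', hb'⟩ := G.exists_pol h1; by_cases ht : G.top j
      · by_cases hs : G.side j b = .free
        · rw [contr_free hs, map_zero]; exact zero_mem _
        · have h2 : b' = b := by
            by_contra h3; have h4 : b' = !b := by cases b <;> cases b' <;> simp_all
            exact G.top_free ht (G.top_side ht hs) a (h4 ▸ hb')
          subst h2; exact homMul_arr_contr_mem hb' hs c
      · have h2 := homMul_arr_contr_mem (U := U) hb' (G.isN_full hj ht) c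
        have h3 := factorRange_le_contrSpan (homMul_mem_factorRange k (arr k Q a)
          (contr_sub_mem_factorRange (U := U) ht b b' c))
        rw [map_sub] at h3
        rw [← sub_add_cancel (homMul k (arr k Q a) (G.contr U j b c))
          (homMul k (arr k Q a) (G.contr U j b' c))]
        exact Submodule.add_mem _ h3 h2
    · rw [← homMul_vtx_contr, ← homMul_mul, vtx_mul_arr_of_ne k Q h1]
      have h7 : homMul k (0 : QAlg k Q) (G.contr U j b c) = 0 := LinearMap.ext fun y => mul_zero _
      rw [h7]; exact zero_mem _
  | hc t =>
    have h1 : homMul k (algebraMap k (QAlg k Q) t) h = t • h := LinearMap.ext fun y => by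
        rw [homMul_apply, ← Algebra.commutes, ← Algebra.smul_def]; rfl
    rw [h1]; exact Submodule.smul_mem _ _ hh
  | hadd r s h1 h2 =>
    have h3 : homMul k (r + s) h = homMul k r h + homMul k s h :=
      LinearMap.ext fun y => mul_add _ _ _
    rw [h3]; exact Submodule.add_mem _ (h1 h hh) (h2 h hh)
  | hmul r s h1 h2 =>
    rw [homMul_mul]; exact h2 _ (h1 h hh)

lemma contrSpan_eq_top (hk : (2 : k) ≠ 0) : G.contrSpan U = ⊤ := by
  refine eq_top_iff.2 fun h _ => ?_
  have h1 : h = ∑ i, homMul k (h (G.rowGen U hk i)) (idemCoord (G.rowIdem U) i) := by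
    refine LinearMap.ext fun y => ?_
    conv_lhs => rw [← sum_smul_rowGen hk y, map_sum]
    rw [LinearMap.sum_apply]; exact Finset.sum_congr rfl fun i _ => by rw [map_smul]; rfl
  rw [h1]; refine Submodule.sum_mem _ fun i _ => homMul_mem_contrSpan _ _ ?_
  obtain ⟨κ | ⟨j, b⟩, c⟩ := i
  · rw [← contr_inn (G.side_tgt κ)]; exact contr_mem_contrSpan _ _ _
  · match hs : G.side j b with
    | .pun e =>
      rw [← contr_pun hs]; exact contr_mem_contrSpan _ _ _
    | .free | .inn κ | .out κ =>
      have h2 : idemCoord (G.rowIdem U) (Sum.inr (j, b), c) = 0 := by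
        refine LinearMap.ext fun y => ?_
        have h3 := y.2 (.inr (j, b), c); rw [rowIdem, hs] at h3; exact h3.symm.trans (mul_zero _)
      rw [h2]; exact zero_mem _

end Diagram
end

/-! ### The translate of a described module -/

section

variable [Fintype V] {J K : Type} [Fintype J] [Fintype K]

namespace Diagram

/-- The module `N` is described by the positions in `isN` of the diagram: it has a coordinate system
which consists of `d` functions for each of these positions, on which the arrows act as
prescribed. The loops at the punctures act by the negatives of the prescribed scalars. -/
structure CoDescribes (G : Diagram Q J K) {d : ℕ} (U : Gauge k J K d) (N : Type uN) [AddCommGroup N]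
    [Module k N] [Module (QAlg k Q) N] where
  form : J → Fin d → N →ₗ[k] k
  form_eq_zero : ∀ j c, ¬ G.isN j → form j c = 0
  form_vtx : ∀ j c n, form j c (vtx k Q (G.vert j) • n) = form j c n
  form_arr : ∀ κ c n, ∑ c', U.V κ c c' * form (G.tgt κ) c' (arr k Q (G.ar κ) • n) =
    form (G.src κ) c n
  form_pun : ∀ {j b e} c n, G.side j b = .pun e → form j c (arr k Q e • n) = -U.sgn j c * form j c n
  eq_zero : ∀ n, (∀ j c, form j c n = 0) → n = 0
  exists_form : ∀ t : J → Fin d → k, ∃ n, ∀ j c, G.isN j → form j c n = t j c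

variable {G : Diagram Q J K} {d : ℕ} {U : Gauge k J K d} {N : Type uN} [AddCommGroup N] [Module k N]
  [Module (QAlg k Q) N] [IsScalarTower k (QAlg k Q) N]

namespace CoDescribes

variable (D : G.CoDescribes U N)

/-- The coordinate function which belongs to a relation. -/
def rowForm : (K ⊕ J × Bool) × Fin d → N →ₗ[k] k
  | (.inl κ, c) => D.form (G.tgt κ) c
  | (.inr (j, _), c) => D.form j c

/-- The pairing between `N` and the homomorphisms from the source of the presentation to `kQ`. -/
def pairing (hk : (2 : k) ≠ 0) : N →ₗ[k] (idemModule (G.rowIdem U) →ₗ[QAlg k Q] QAlg k Q) →ₗ[k] k :=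
  LinearMap.mk₂ k (fun n h => ∑ i, D.rowForm i (h (G.rowGen U hk i) • n))
    (fun n n' h => by simp only [smul_add, map_add, Finset.sum_add_distrib])
    (fun c n h => by
      have : SMulCommClass k (QAlg k Q) N := IsScalarTower.to_smulCommClass
      simp only [smul_comm _ c n, map_smul, Finset.smul_sum])
    (fun n h h' => by simp only [LinearMap.add_apply, add_smul, map_add, Finset.sum_add_distrib])
    (fun c n h => by simp only [LinearMap.smul_apply, smul_assoc, map_smul, Finset.smul_sum])

variable (hk : (2 : k) ≠ 0)

lemma pairing_apply (n : N) (h : idemModule (G.rowIdem U) →ₗ[QAlg k Q] QAlg k Q) : D.pairing hk n h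
    = ∑ i, D.rowForm i (h (G.rowGen U hk i) • n) := rfl

lemma pairing_smul (r : QAlg k Q) (n : N) (h : idemModule (G.rowIdem U) →ₗ[QAlg k Q] QAlg k Q) :
    D.pairing hk (r • n) h = D.pairing hk n (rightMul h r) := by
  simp only [pairing_apply, ← mul_smul]; rfl

lemma pairing_homMul_idemCoord (i : (K ⊕ J × Bool) × Fin d) (r : QAlg k Q) (n : N) : D.pairing hk n
    (homMul k r (idemCoord (G.rowIdem U) i)) = D.rowForm i (G.rowIdem U i • r • n) := by
  rw [pairing_apply, Finset.sum_eq_single i]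
  · rw [homMul_apply, mul_smul]; congr 2; exact rowGen_apply_self hk i
  · intro i' _ hi
    have h1 : idemCoord (G.rowIdem U) i (G.rowGen U hk i') = 0 := rowGen_apply_of_ne hk hi.symm
    rw [homMul_apply, h1, zero_mul, zero_smul, map_zero]
  · grind

lemma pairing_idemCoord (i : (K ⊕ J × Bool) × Fin d) (n : N) : D.pairing hk n
    (idemCoord (G.rowIdem U) i) = D.rowForm i (G.rowIdem U i • n) := by
  have h1 := D.pairing_homMul_idemCoord hk i 1 n
  have h2 : homMul k 1 (idemCoord (G.rowIdem U) i) = idemCoord (G.rowIdem U) i :=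
    LinearMap.ext fun y => mul_one _
  rwa [h2, one_smul] at h1

variable {j : J}

lemma pairing_contr {b : Bool} (hs : G.side j b ≠ .free) (c : Fin d) (n : N) : D.pairing hk n
    (G.contr U j b c) = D.form j c n := by
  match h : G.side j b with
  | .free => exact absurd h hs
  | .inn κ =>
    obtain ⟨rfl, -, -⟩ := G.of_inn h; rw [contr_inn h, pairing_idemCoord]; exact D.form_vtx _ c n
  | .out κ =>
    obtain ⟨rfl, -, -⟩ := G.of_out h; rw [contr_out_eq_sum h, map_sum, ← D.form_arr]
    refine Finset.sum_congr rfl fun c' _ => ?_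
    rw [map_smul, pairing_homMul_idemCoord, smul_eq_mul]; congr 1; exact D.form_vtx _ c' _
  | .pun e =>
    rw [contr_pun h, pairing_idemCoord]
    have h1 : G.rowIdem U (Sum.inr (j, b), c) =
        (2⁻¹ : k) • (vtx k Q (Q.source e).1 - U.sgn j c • arr k Q e) := by rw [rowIdem, h]; rfl
    change D.form j c (G.rowIdem U (Sum.inr (j, b), c) • n) = _
    rw [h1, smul_assoc, map_smul, sub_smul, map_sub, (G.of_pun h).2,
      G.pol_fst_vert, D.form_vtx, smul_assoc, map_smul, D.form_pun c n h, smul_eq_mul, smul_eq_mul]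
    have h2 : (2⁻¹ : k) * 2 = 1 := inv_mul_cancel₀ hk
    linear_combination D.form j c n * h2 + 2⁻¹ * D.form j c n * U.sgn_mul_self j c

lemma pairing_homMul_contr (j : J) (b : Bool) (c : Fin d) (r : QAlg k Q) (n : N) : D.pairing hk n
    (homMul k r (G.contr U j b c)) = D.pairing hk (r • n) (G.contr U j b c) := (D.pairing_smul hk r
    n _).symm

/-- The pairing vanishes on the homomorphisms which factor through the presentation. -/
lemma pairing_factorRange (n : N) {h : idemModule (G.rowIdem U) →ₗ[QAlg k Q] QAlg k Q}
    (hh : h ∈ factorRange k (G.presMap U)) : D.pairing hk n h = 0 := by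
  obtain ⟨g, rfl⟩ := hh
  have h1 : homDual k (G.presMap U) g =
      (∑ j, ∑ c, homMul k (g (G.colGen U j c)) (G.contr U j true c)) -
        ∑ j, ∑ c, homMul k (g (G.colGen U j c)) (G.contr U j false c) := by
    refine LinearMap.ext fun y => ?_
    refine (apply_presMap g y).trans ?_; simp only [LinearMap.sub_apply, LinearMap.sum_apply]; rfl
  rw [h1, map_sub, map_sum, map_sum, sub_eq_zero]; refine Finset.sum_congr rfl fun j _ => ?_
  rw [map_sum, map_sum]; refine Finset.sum_congr rfl fun c _ => ?_
  rw [pairing_homMul_contr, pairing_homMul_contr]; by_cases ht : G.top j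
  · rw [colGen_of_top ht, map_zero, zero_smul, map_zero]; rfl
  by_cases hN : G.isN j
  · rw [D.pairing_contr hk (G.isN_full hN ht), D.pairing_contr hk (G.isN_full hN ht)]
  · have h2 : ∀ b, D.pairing hk (g (G.colGen U j c) • n) (G.contr U j b c) = 0 := fun b => by
      by_cases hs : G.side j b = .free
      · rw [contr_free hs, map_zero]
      · rw [D.pairing_contr hk hs, D.form_eq_zero _ _ hN]; rfl
    rw [h2, h2]

lemma _root_.SkewedGentle.Diagram.exists_side_ne_free (h : G.isN j) : ∃ b, G.side j b ≠ .free := by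
  by_cases ht : G.top j
  exacts [G.top_exists j ht, ⟨true, G.isN_full h ht⟩]

lemma eq_zero_of_pairing (n : N) (h : ∀ f, D.pairing hk n f = 0) : n = 0 := by
  refine D.eq_zero n fun j c => ?_
  by_cases hN : G.isN j
  · obtain ⟨b, hb⟩ := exists_side_ne_free hN; rw [← D.pairing_contr hk hb, h]
  · rw [D.form_eq_zero _ _ hN]; rfl

lemma exists_pairing_eq (φ : (idemModule (G.rowIdem U) →ₗ[QAlg k Q] QAlg k Q) →ₗ[k] k)
    (hφ : ∀ h ∈ factorRange k (G.presMap U), φ h = 0) : ∃ n, D.pairing hk n = φ := by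
  classical
  have h0 : ∀ j, ∃ b, G.isN j → G.side j b ≠ .free := fun j => by
    by_cases h : G.isN j
    · obtain ⟨b, hb⟩ := exists_side_ne_free h; grind
    · exact ⟨true, fun h1 => absurd h1 h⟩
  choose b hb using h0; obtain ⟨n, hn⟩ := D.exists_form fun j c => φ (G.contr U j (b j) c)
  refine ⟨n, sub_eq_zero.1 (LinearMap.ker_eq_top.1 (eq_top_iff.2 ?_))⟩
  rw [← contrSpan_eq_top (G := G) (U := U) hk, contrSpan]
  refine sup_le (fun h hh => ?_) (Submodule.span_le.2 ?_)
  · rw [LinearMap.mem_ker, LinearMap.sub_apply, D.pairing_factorRange hk n hh, hφ h hh, sub_self]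
  · rintro _ ⟨j, b', c, hj, rfl⟩
    rw [SetLike.mem_coe, LinearMap.mem_ker, LinearMap.sub_apply, sub_eq_zero]
    by_cases hs : G.side j b' = .free
    · rw [contr_free hs, map_zero, map_zero]
    · rw [D.pairing_contr hk hs, hn j c hj]; by_cases hbb : b' = b j
      · rw [hbb]
      · have ht : ¬ G.top j := fun ht => by
          have h1 : b j = !b' := by revert hbb; cases b' <;> cases b j <;> simp
          exact hb j hj (h1 ▸ G.top_side ht hs)
        have h1 := hφ _ (contr_sub_mem_factorRange (U := U) ht b' (b j) c); grind

end CoDescribes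

variable {M : Type uM} [AddCommGroup M] [Module k M] [Module (QAlg k Q) M]
  [IsScalarTower k (QAlg k Q) M]

/-- The modules which are described by the two parts of a diagram are related by the
Auslander-Reiten translation. -/
lemma isARTranslate (hk : (2 : k) ≠ 0) (D : G.Describes U M) (D' : G.CoDescribes U N) :
    IsARTranslate k (R := QAlg k Q) M N := by
  have h1 := projective_idemModule (G.rowIdem U) (G.rowIdem_mul_self U hk)
  have h2 := projective_idemModule (G.colIdem U) (G.colIdem_mul_self U)
  have := isArtinian_pathAlg (Q := Q) k; have := isNoetherian_pathAlg (Q := Q) k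
  let B : N →ₗ[k] Module.Dual k ((idemModule (G.rowIdem U) →ₗ[QAlg k Q] QAlg k Q) ⧸
      LinearMap.range (homDual k (G.presMap U))) :=
    { toFun := fun n => Submodule.liftQ _ (D'.pairing hk n)
        fun h hh => D'.pairing_factorRange hk n hh
      map_add' := fun n n' => Submodule.linearMap_qext _ (by
        ext h; exact LinearMap.congr_fun (map_add (D'.pairing hk) n n') h)
      map_smul' := fun c n => Submodule.linearMap_qext _ (by
        ext h; exact LinearMap.congr_fun (map_smul (D'.pairing hk) c n) h) }
  have hB : ∀ n h, B n (Submodule.Quotient.mk h) = D'.pairing hk n h := fun n h => rfl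
  have hbij : Function.Bijective B := by
    refine ⟨(injective_iff_map_eq_zero B).2 fun n hn => D'.eq_zero_of_pairing hk n fun h => ?_,
      fun φ => ?_⟩
    · rw [← hB, hn]; rfl
    · obtain ⟨n, hn⟩ := D'.exists_pairing_eq hk
        (φ ∘ₗ (LinearMap.range (homDual k (G.presMap U))).mkQ) fun h hh => by
          have h3 : (LinearMap.range (homDual k (G.presMap U))).mkQ h = 0 :=
            (Submodule.Quotient.mk_eq_zero _).2 hh
          rw [LinearMap.comp_apply, h3, map_zero]
      exact ⟨n, Submodule.linearMap_qext _ (LinearMap.ext fun h => LinearMap.congr_fun hn h)⟩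
  refine isARTranslate_of_presentation k (G.presMap U) D.map D.map_surjective
    (D.range_presMap hk) (fun π hπ h => eq_zero_of_presMap_comp hk π hπ h)
    (LinearEquiv.ofBijective B hbij) fun r n h => ?_
  exact D'.pairing_smul hk r n h

end Diagram
end

/-! ### The diagram of a word -/

section

/-- The edges of the diagram of a word: the positions of its direct and inverse letters, where
`true` stands for a direct letter and `false` for an inverse letter. -/
abbrev WordEdge (z : Word V E) : Type :=
  {p : Fin z.length × Bool // ∃ a : E, z[p.1] = if p.2 then Letter.dir a else Letter.inv a}

/-- The arrow of an edge of the diagram of a word. -/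
def WordEdge.arrow (κ : WordEdge z) : E := Classical.choose κ.2

lemma WordEdge.letter (κ : WordEdge z) : z[κ.1.1] = if κ.1.2 then Letter.dir κ.arrow else Letter.inv
    κ.arrow := Classical.choose_spec κ.2

lemma WordEdge.letter_of_eq (κ : WordEdge z) {i : Fin z.length} {d : Bool} (h : κ.1 = (i, d)) : z[i]
    = if d then Letter.dir κ.arrow else Letter.inv κ.arrow := by
  obtain ⟨⟨i', d'⟩, hκ⟩ := κ; cases h; exact WordEdge.letter ⟨(i, d), hκ⟩

lemma WordEdge.isHArrow (κ : WordEdge z) : IsHArrow Q z κ.arrow κ.1 := by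
  have h := κ.letter; change (z[κ.1.1]).IsArrow Q κ.1.2 κ.arrow; rw [h]; cases κ.1.2
  exacts [⟨rfl, .inl rfl⟩, ⟨rfl, .inl rfl⟩]

/-- The position in the word of the letter on the given side of a position of the diagram. -/
def letterIx (hz : IsHatWord Q z) (j : Pos z) (b : Bool) : Fin z.length :=
  if b then ⟨rightLetter z j, (compat_at hz j.2).2.1⟩ else ⟨leftLetter z j, (compat_at hz j.2).1⟩

open Classical in
/-- What a position of the diagram of a word meets on the given side. -/
def wordSide (hz : IsHatWord Q z) (j : Pos z) (b : Bool) : Side (WordEdge z) E :=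
  match h : z[letterIx hz j b] with
  | .dir a => if b then .inn ⟨(letterIx hz j b, true), a, h⟩ else .out ⟨(letterIx hz j b, true), a, h⟩
  | .inv a =>
    if b then .out ⟨(letterIx hz j b, false), a, h⟩ else .inn ⟨(letterIx hz j b, false), a, h⟩
  | .triv p => if h : Loop Q p then .pun (Classical.choose h) else .free
  | .trivInv p => if h : Loop Q p then .pun (Classical.choose h) else .free
  | .special _ => .free

/-- The polarized vertex on the given side of a position of the diagram of a word. -/
def wordPol (hz : IsHatWord Q z) (j : Pos z) (b : Bool) : V × ℤˣ :=
  if b then Classical.choose (exists_pol hz j) else flip (Classical.choose (exists_pol hz j))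

variable (hz : IsHatWord Q z)

lemma wordPol_not (j : Pos z) (b : Bool) : wordPol hz j (!b) = flip (wordPol hz j b) := by
  cases b
  · exact (flip_flip _).symm
  · rfl

lemma wordPol_fst (j : Pos z) : (wordPol hz j true).1 = hVertex hz j :=
    (Classical.choose_spec (exists_pol hz j)).1.symm

lemma tgt_right (j : Pos z) : (z[letterIx hz j true]).tgt Q = some (wordPol hz j true) :=
  (Classical.choose_spec (exists_pol hz j)).2.1 _ rfl

lemma src_left (j : Pos z) : (z[letterIx hz j false]).src Q = some (wordPol hz j false) :=
  (Classical.choose_spec (exists_pol hz j)).2.2 _ rfl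

lemma hTarget_letterIx (j : Pos z) (b : Bool) : hTarget hz (letterIx hz j b) b = j := by
  cases b
  exacts [Fin.ext (rightEnd_leftLetter j.2), Fin.ext (leftEnd_rightLetter _)]

lemma letterIx_hTarget_true (i : Fin z.length) (h : ∀ p, z[i] ≠ .trivInv p) :
    letterIx hz (hTarget hz i true) true = i :=
  Fin.ext (rightLetter_leftEnd hz i.2 h)

lemma letterIx_hTarget_false (i : Fin z.length) (h : ∀ p, z[i] ≠ .triv p) :
    letterIx hz (hTarget hz i false) false = i :=
  Fin.ext (leftLetter_rightEnd hz i.2 h)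

variable {a : E} {b : Bool} {j : Pos z}

lemma wordSide_dir (h : z[letterIx hz j b] = .dir a) : wordSide hz j b = if b then .inn
    ⟨(letterIx hz j b, true), a, h⟩ else .out ⟨(letterIx hz j b, true), a, h⟩ := by
  unfold wordSide; grind

lemma wordSide_inv (h : z[letterIx hz j b] = .inv a) : wordSide hz j b = if b then .out
    ⟨(letterIx hz j b, false), a, h⟩ else .inn ⟨(letterIx hz j b, false), a, h⟩ := by
  unfold wordSide; grind

variable {κ : WordEdge z}

lemma wordSide_out (h : wordSide hz j b = .out κ) : κ.1 = (letterIx hz j b, !b) := by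
  unfold wordSide at h; split at h
  · cases b
    · cases h; rfl
    · cases h
  · cases b
    · cases h
    · cases h; rfl
  · split_ifs at h
  · split_ifs at h
  · cases h

lemma wordSide_inn (h : wordSide hz j b = .inn κ) : κ.1 = (letterIx hz j b, b) := by
  unfold wordSide at h; split at h
  · cases b
    · cases h
    · cases h; rfl
  · cases b
    · cases h; rfl
    · cases h
  · split_ifs at h
  · split_ifs at h
  · cases h

/-- The two cases of a side without edges: the letter is trivial and belongs to the polarity of
this side. -/
lemma letter_eq_of_wordSide (h : ∀ κ, wordSide hz j b ≠ .out κ) (h' : ∀ κ, wordSide hz j b ≠ .inn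
    κ) : z[letterIx hz j b] = if b then Letter.triv (wordPol hz j b) else .trivInv
    (wordPol hz j b) := by
  have h3 := isHatWord_valid hz (letterIx hz j b); cases b
  · have h4 := src_left hz j; generalize h5 : z[letterIx hz j false] = l at h3 h4
    cases l with
    | dir a => exact absurd (wordSide_dir hz h5) (h _)
    | inv a => exact absurd (wordSide_inv hz h5) (h' _)
    | special e => exact absurd h3 (by simp [Letter.IsValid, SkewedGentleQuiver.hat])
    | triv p => simp [Letter.src] at h4
    | trivInv p =>
      simp only [Letter.src, Option.some.injEq] at h4; rw [h4]; rfl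
  · have h4 := tgt_right hz j; generalize h5 : z[letterIx hz j true] = l at h3 h4
    cases l with
    | dir a => exact absurd (wordSide_dir hz h5) (h' _)
    | inv a => exact absurd (wordSide_inv hz h5) (h _)
    | special e => exact absurd h3 (by simp [Letter.IsValid, SkewedGentleQuiver.hat])
    | trivInv p => simp [Letter.tgt] at h4
    | triv p =>
      simp only [Letter.tgt, Option.some.injEq] at h4; rw [h4]; rfl

lemma wordSide_trivial (h : z[letterIx hz j b] = if b then Letter.triv p else .trivInv p) :
    (∃ e ∈ Q.special, Q.source e = p ∧ wordSide hz j b = .pun e) ∨ (∀ e ∈ Q.special, Q.source e ≠ p)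
    ∧ wordSide hz j b = .free := by
  classical
  have key : wordSide hz j b =
      if h : Loop Q p then .pun (Classical.choose h) else .free := by
    unfold wordSide; cases b <;> split <;> rename_i h' <;> rw [h] at h' <;> cases h' <;> rfl
  by_cases h1 : Loop Q p
  · grind
  · grind

lemma wordSide_pun (h : wordSide hz j b = .pun e) : e ∈ Q.special ∧ Q.source e = wordPol hz j
    b := by
  have h1 := letter_eq_of_wordSide hz (fun κ h2 => by rw [h] at h2; cases h2)
    (fun κ h2 => by rw [h] at h2; cases h2)
  rcases wordSide_trivial hz h1 with ⟨e', h2, h3, h4⟩ | ⟨-, h3⟩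
  · grind
  · grind

lemma wordSide_src (κ : WordEdge z) : wordSide hz (hSrc hz κ.1) (!κ.1.2) = .out κ := by
  obtain ⟨⟨i, d⟩, a, h⟩ := κ; cases d
  · have h1 : letterIx hz (hTarget hz i true) true = i :=
      letterIx_hTarget_true hz i fun p => by simp [h]
    have h2 : z[letterIx hz (hTarget hz i true) true] = .inv a := by grind
    refine (wordSide_inv hz h2).trans ?_; grind
  · have h1 : letterIx hz (hTarget hz i false) false = i :=
      letterIx_hTarget_false hz i fun p => by simp [h]
    have h2 : z[letterIx hz (hTarget hz i false) false] = .dir a := by grind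
    refine (wordSide_dir hz h2).trans ?_; grind

lemma wordSide_tgt (κ : WordEdge z) : wordSide hz (hTgt hz κ.1) κ.1.2 = .inn κ := by
  obtain ⟨⟨i, d⟩, a, h⟩ := κ; cases d
  · have h1 : letterIx hz (hTarget hz i false) false = i :=
      letterIx_hTarget_false hz i fun p => by simp [h]
    have h2 : z[letterIx hz (hTarget hz i false) false] = .inv a := by grind
    refine (wordSide_inv hz h2).trans ?_; grind
  · have h1 : letterIx hz (hTarget hz i true) true = i :=
      letterIx_hTarget_true hz i fun p => by simp [h]
    have h2 : z[letterIx hz (hTarget hz i true) true] = .dir a := by grind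
    refine (wordSide_dir hz h2).trans ?_; grind

lemma wordSide_of_out (h : wordSide hz j b = .out κ) : hSrc hz κ.1 = j ∧ (!κ.1.2) = b ∧ Q.source
    κ.arrow = wordPol hz j b := by
  have h1 := wordSide_out hz h; have h2 := κ.letter_of_eq h1; rw [h1]
  refine ⟨?_, Bool.not_not b, ?_⟩
  · rw [hSource, Bool.not_not, hTarget_letterIx]
  · cases b
    · have h3 := src_left hz j; rw [show z[letterIx hz j false] = .dir κ.arrow from h2] at h3
      exact Option.some.inj h3
    · have h3 := tgt_right hz j; rw [show z[letterIx hz j true] = .inv κ.arrow from h2] at h3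
      exact Option.some.inj h3

lemma wordSide_of_inn (h : wordSide hz j b = .inn κ) : hTgt hz κ.1 = j ∧ κ.1.2 = b ∧ Q.target
    κ.arrow = wordPol hz j b := by
  have h1 := wordSide_inn hz h; have h2 := κ.letter_of_eq h1; rw [h1]
  refine ⟨hTarget_letterIx hz j b, rfl, ?_⟩; cases b
  · have h3 := src_left hz j; rw [show z[letterIx hz j false] = .inv κ.arrow from h2] at h3
    exact Option.some.inj h3
  · have h3 := tgt_right hz j; rw [show z[letterIx hz j true] = .dir κ.arrow from h2] at h3
    exact Option.some.inj h3

end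

/-! ### Intervals of a string -/

section

/-- The condition on the neighbours of a special letter which holds in an admissible word. -/
def IsOriented (hz : IsHatWord Q z) : Prop := ∀ {κ κ' : WordEdge z}, κ.arrow ∈ Q.special →
    wordSide hz (hSrc hz κ.1) κ.1.2 = .out κ' → ∃ κ'', wordSide hz (hTgt hz κ.1) (!κ.1.2) = .out κ''

/-- The diagram of a word, together with subsets `isM`, `isN` and `top`. -/
def wordDiagram (hz : IsHatWord Q z) (isM isN top : Pos z → Prop) (isM_edge : ∀ κ : WordEdge z, isM
    (hTgt hz κ.1) → isM (hSrc hz κ.1)) (isM_ordinary : ∀ κ : WordEdge z, isM (hSrc hz κ.1)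
    → ¬ isM (hTgt hz κ.1) → κ.arrow ∉ Q.special) (isM_free : ∀ {j b}, isM j → wordSide hz j b =
    .free → ∀ a, Q.source a ≠ wordPol hz j b) (isM_tail : ∀ j, ¬ isM j → ¬ top j → ∃ κ : WordEdge z,
    hTgt hz κ.1 = j ∧ ¬ isM (hSrc hz κ.1)) (isM_pun : ∀ {j b e}, wordSide hz j b = .pun e → isM j)
    (isM_two : ∀ {j b κ κ'}, wordSide hz j b = .inn κ → wordSide hz j (!b) = .inn κ' → isM
    (hSrc hz κ.1) ∨ isM (hSrc hz κ'.1)) (top_isM : ∀ j, top j → ¬ isM j)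
    (top_isN : ∀ j, top j → isN j) (top_tgt : ∀ κ : WordEdge z, top (hTgt hz κ.1) → isM
    (hSrc hz κ.1)) (top_side : ∀ {j b}, top j → wordSide hz j b ≠ .free → wordSide hz j (!b)
    = .free) (top_exists : ∀ j, top j → ∃ b, wordSide hz j b ≠ .free)
    (top_free : ∀ {j b}, top j → wordSide hz j b = .free → ∀ a, Q.target a ≠ wordPol hz j b)
    (isN_full : ∀ {j b}, isN j → ¬ top j → wordSide hz j b ≠ .free) (isN_pun : ∀ {j b e}, wordSide
    hz j b = .pun e → isN j) (isN_down : ∀ {j b}, ¬ isN j → ((∃ κ, wordSide hz j b = .inn κ) ∨ ∃ κ,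
    wordSide hz j b = .out κ ∧ isN (hTgt hz κ.1)) → wordSide hz j (!b) = .free ∨ ∃ κ, wordSide hz j
    (!b) = .out κ ∧ ¬ isN (hTgt hz κ.1)) (orient : IsOriented hz) : Diagram Q (Pos z)
    (WordEdge z) where
  src κ := hSrc hz κ.1
  tgt κ := hTgt hz κ.1
  ar κ := κ.arrow
  pol := wordPol hz
  side := wordSide hz
  srcSide κ := !κ.1.2
  isM := isM
  isN := isN
  top := top
  pol_not := wordPol_not hz
  side_src := wordSide_src hz
  side_tgt κ := by rw [Bool.not_not]; exact wordSide_tgt hz κ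
  of_out h := wordSide_of_out hz h
  of_inn h := by
    have h1 := wordSide_of_inn hz h
    exact ⟨h1.1, by rw [h1.2.1], h1.2.2⟩
  of_pun h := wordSide_pun hz h
  isM_edge := isM_edge
  isM_ordinary := isM_ordinary
  isM_free := isM_free
  isM_tail := isM_tail
  isM_pun := isM_pun
  isM_two := isM_two
  top_isM := top_isM
  top_isN := top_isN
  top_tgt := top_tgt
  top_side := top_side
  top_exists := top_exists
  top_free := top_free
  isN_full := isN_full
  isN_pun := isN_pun
  isN_down := isN_down
  orient {κ κ'} h h' := orient h (by rwa [Bool.not_not] at h')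

/-- The diagram of a word without unpunctured ends, which is the diagram of its translate as well. -/
def fullDiagram (hz : IsHatWord Q z) (hfree : ∀ j b, wordSide hz j b ≠ .free)
    (orient : IsOriented hz) : Diagram Q (Pos z) (WordEdge z) :=
  wordDiagram hz (fun _ => True) (fun _ => True) (fun _ => False)
    (fun _ _ => trivial) (fun _ _ h => absurd trivial h) (fun {j b} _ h => absurd h (hfree j b))
    (fun _ h => absurd trivial h) (fun _ => trivial) (fun _ _ => .inl trivial)
    (fun _ h => h.elim) (fun _ h => h.elim) (fun _ h => h.elim) (fun h => h.elim)
    (fun _ h => h.elim) (fun h => h.elim) (fun {j b} _ _ => hfree j b) (fun _ => trivial)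
    (fun h => absurd trivial h) orient

end

section

/-- The positions `a, …, b` of the string `z` belong to the word `x`, and the positions `c, …, d`
to its translate `y`. At each end, either `y` is longer than `x`, by an ordinary arrow towards the
rest of the word and a maximal tail of arrows which come from the end, or `x` is longer than `y`,
by an ordinary arrow towards `y` and a maximal tail of arrows which go to the end, or the end is
punctured. -/
structure Interval (Q : SkewedGentleQuiver V E) (z : Word V E) (a b c d : ℕ) : Prop where
  isString : IsString Q.hat z
  le_ab : a ≤ b
  le_cd : c ≤ d
  le_b : b + 2 ≤ z.length
  le_d : d + 2 ≤ z.length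
  left : ∃ p, z[0]? = some (.trivInv p) ∧
    ((c = 0 ∧ 0 < a ∧ (∃ e ∉ Q.special, z[a]? = some (.dir e)) ∧
        (∀ i, 0 < i → i < a → ∃ e, z[i]? = some (.inv e)) ∧ ∀ e, Q.target e ≠ p) ∨
      (a = 0 ∧ 0 < c ∧ (∃ e ∉ Q.special, z[c]? = some (.inv e)) ∧
        (∀ i, 0 < i → i < c → ∃ e, z[i]? = some (.dir e)) ∧ ∀ e, Q.source e ≠ p) ∨
      (a = 0 ∧ c = 0 ∧ Loop Q p))
  right : ∃ p, z[z.length - 1]? = some (.triv p) ∧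
    ((d + 2 = z.length ∧ b + 2 < z.length ∧ (∃ e ∉ Q.special, z[b + 1]? = some (.inv e)) ∧
        (∀ i, b + 1 < i → i + 1 < z.length → ∃ e, z[i]? = some (.dir e)) ∧
        ∀ e, Q.target e ≠ p) ∨
      (b + 2 = z.length ∧ d + 2 < z.length ∧ (∃ e ∉ Q.special, z[d + 1]? = some (.dir e)) ∧
        (∀ i, d + 1 < i → i + 1 < z.length → ∃ e, z[i]? = some (.inv e)) ∧
        ∀ e, Q.source e ≠ p) ∨
      (b + 2 = z.length ∧ d + 2 = z.length ∧ Loop Q p))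
  orient_dir : ∀ i, ∀ e ∈ Q.special, z[i + 1]? = some (.dir e) → (∃ f, z[i + 2]? = some (.inv f)) →
    ∃ f, z[i]? = some (.dir f)
  orient_inv : ∀ i, ∀ e ∈ Q.special, z[i + 1]? = some (.inv e) → (∃ f, z[i]? = some (.dir f)) →
    ∃ f, z[i + 2]? = some (.inv f)

lemma IsString.startsTrivial (h : IsString Q z) : startsTrivial z = true := by
  obtain ⟨-, ⟨p, hp⟩, -⟩ := h
  cases z with
  | nil => simp at hp
  | cons l t =>
    simp only [List.head?_cons, Option.some.injEq] at hp; subst hp; rfl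

lemma IsString.numVertices_add_one (h : IsString Q.hat z) : numVertices z + 1 = z.length := by
  rcases isHatWord_cases (.inl h) with ⟨h1, h2, -⟩ | ⟨h1, -⟩
  · simp only [numVertices, h1, if_true]; omega
  · rw [h.startsTrivial] at h1; cases h1

variable {i : ℕ}

lemma IsString.pos_of_arrow (h : IsString Q z) (hi : z[i]? = some (.dir e) ∨ z[i]? = some
    (.inv e)) : 0 < i ∧ i + 1 < z.length := by
  obtain ⟨-, ⟨p, hp⟩, ⟨q, hq⟩⟩ := h; rw [List.head?_eq_getElem?] at hp; grind

lemma WordEdge.getElem?_eq (κ : WordEdge z) : z[(κ.1.1 : ℕ)]? = some (if κ.1.2 then Letter.dir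
    κ.arrow else Letter.inv κ.arrow) := by
  rw [List.getElem?_eq_getElem κ.1.1.2]; exact congrArg some κ.letter

lemma WordEdge.pos_of_string (h : IsString Q.hat z) (κ : WordEdge z) : 0 < (κ.1.1 : ℕ) ∧ (κ.1.1 : ℕ)
    + 1 < z.length :=
  h.pos_of_arrow (e := κ.arrow) (by rw [κ.getElem?_eq]; cases κ.1.2 <;> simp)

lemma WordEdge.exists_dir (κ : WordEdge z) (h : κ.1.2 = true) : z[(κ.1.1 : ℕ)]? = some
    (.dir κ.arrow) := by rw [κ.getElem?_eq, h]; rfl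

lemma WordEdge.exists_inv (κ : WordEdge z) (h : κ.1.2 = false) : z[(κ.1.1 : ℕ)]? = some
    (.inv κ.arrow) := by rw [κ.getElem?_eq, h]; rfl

lemma WordEdge.hTarget_eq (h : IsString Q.hat z) (hz : IsHatWord Q z) (κ : WordEdge z) :
    (hTgt hz κ.1 : ℕ) = if κ.1.2 then (κ.1.1 : ℕ) - 1 else κ.1.1 := by
  have h1 := κ.pos_of_string h
  cases h2 : κ.1.2 <;> simp only [hTarget, leftEnd, rightEnd, h.startsTrivial, if_true,
    Bool.false_eq_true, if_false]
  omega

lemma WordEdge.hSource_eq (h : IsString Q.hat z) (hz : IsHatWord Q z) (κ : WordEdge z) :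
    (hSrc hz κ.1 : ℕ) = if κ.1.2 then (κ.1.1 : ℕ) else κ.1.1 - 1 := by
  have h1 := κ.pos_of_string h
  cases h2 : κ.1.2 <;> simp only [hSource, hTarget, leftEnd, rightEnd, h.startsTrivial, if_true,
    Bool.false_eq_true, if_false, Bool.not_true, Bool.not_false]
  omega

lemma letterIx_eq (h : IsString Q.hat z) (hz : IsHatWord Q z) (j : Pos z) (b : Bool) :
    (letterIx hz j b : ℕ) = if b then (j : ℕ) + 1 else j := by
  cases b <;> simp [letterIx, rightLetter, leftLetter, h.startsTrivial]

/-- The possibilities for a side of a position in a string. -/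
lemma wordSide_cases (h : IsString Q.hat z) (hz : IsHatWord Q z) (j : Pos z) (b : Bool) :
    (∃ κ : WordEdge z, (κ.1.1 : ℕ) = (if b then (j : ℕ) + 1 else j) ∧
    ((wordSide hz j b = .out κ ∧ κ.1.2 = !b) ∨ (wordSide hz j b = .inn κ ∧ κ.1.2 = b))) ∨
    ((∀ κ, wordSide hz j b ≠ .out κ) ∧ (∀ κ, wordSide hz j b ≠ .inn κ) ∧
    ((b = false ∧ (j : ℕ) = 0 ∧ z[0]? = some (.trivInv (wordPol hz j b))) ∨
    (b = true ∧ (j : ℕ) + 2 = z.length ∧ z[z.length - 1]? = some (.triv (wordPol hz j b))))) := by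
  by_cases h1 : ∃ κ, wordSide hz j b = .out κ
  · obtain ⟨κ, h1⟩ := h1; have h2 := wordSide_out hz h1
    exact .inl ⟨κ, by rw [h2]; exact letterIx_eq h hz j b, .inl ⟨h1, by rw [h2]⟩⟩
  by_cases h2 : ∃ κ, wordSide hz j b = .inn κ
  · obtain ⟨κ, h2⟩ := h2; have h3 := wordSide_inn hz h2
    exact .inl ⟨κ, by rw [h3]; exact letterIx_eq h hz j b, .inr ⟨h2, by rw [h3]⟩⟩
  push Not at h1 h2
  refine .inr ⟨h1, h2, ?_⟩; have h3 := letter_eq_of_wordSide hz h1 h2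
  have h4 := letterIx_eq h hz j b
  have h5 : z[(letterIx hz j b : ℕ)]? = some z[letterIx hz j b] := by grind
  rw [h3, h4] at h5; have h6 := j.2; have h7 := h.numVertices_add_one
  have hchain := List.isChain_iff_getElem.1 h.1.2; cases b
  · simp only [Bool.false_eq_true, if_false] at h5
    have h8 : (j : ℕ) = 0 := by
      by_contra h8; have h9 := hchain (j - 1) (by omega); obtain ⟨q, -, h10⟩ := h9
      have e : (j : ℕ) - 1 + 1 = j := by omega
      simp only [e] at h10; rw [List.getElem?_eq_getElem (by omega), Option.some.injEq] at h5
      rw [h5] at h10; simp [Letter.tgt] at h10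
    grind
  · simp only [if_true] at h5
    have h8 : (j : ℕ) + 2 = z.length := by
      by_contra h8; have h9 := hchain (j + 1) (by omega); obtain ⟨q, h10, -⟩ := h9
      rw [List.getElem?_eq_getElem (by omega), Option.some.injEq] at h5; rw [h5] at h10
      simp [Letter.src] at h10
    grind

lemma wordSide_trivial_of_not (hz : IsHatWord Q z) {j : Pos z} {b : Bool} (h : ∀ κ, wordSide hz j b
    ≠ .out κ) (h' : ∀ κ, wordSide hz j b ≠ .inn κ) : (∃ e ∈ Q.special, Q.source e = wordPol hz j b ∧
    wordSide hz j b = .pun e) ∨ (∀ e ∈ Q.special, Q.source e ≠ wordPol hz j b) ∧ wordSide hz j b =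
    .free :=
  wordSide_trivial hz (letter_eq_of_wordSide hz h h')

/-- Being oriented is a condition on the letters on both sides of a special letter. -/
lemma isOriented_of_letters (hz : IsHatWord Q z) (h1 : ∀ i, ∀ e ∈ Q.special, z[i] = .dir e → ∀ f,
    z[letterIx hz (hTarget hz i false) true] = .inv f → ∃ g, z[letterIx hz (hTarget hz i true)
    false] = .dir g) (h2 : ∀ i, ∀ e ∈ Q.special, z[i] = .inv e → ∀ f,
    z[letterIx hz (hTarget hz i true) false] = .dir f → ∃ g, z[letterIx hz (hTarget hz i false)
    true] = .inv g) : IsOriented hz := by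
  suffices key : ∀ (i : Fin z.length) (b : Bool) (e f : E), e ∈ Q.special →
      z[i] = (if b then Letter.dir e else .inv e) →
      z[letterIx hz (hSource hz i b) b] = (if !b then Letter.dir f else .inv f) →
      ∃ κ'', wordSide hz (hTarget hz i b) (!b) = .out κ'' from fun {κ κ'} he hs =>
    key _ _ _ _ he κ.letter (κ'.letter_of_eq (wordSide_out hz hs))
  intro i b e f he hi hj; cases b
  · obtain ⟨g, hg⟩ := h2 i e he hi f hj; exact ⟨_, wordSide_inv hz hg⟩
  · obtain ⟨g, hg⟩ := h1 i e he hi f hj; exact ⟨_, wordSide_dir hz hg⟩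

lemma IsString.neighbours (h : IsString Q.hat z) (hz : IsHatWord Q z) {i : Fin z.length}
    (hi : z[i] = .dir e ∨ z[i] = .inv e) : ∃ j, (i : ℕ) = j + 1 ∧ z[j]? = some z[letterIx hz
    (hTarget hz i true) false] ∧ z[j + 1]? = some z[i] ∧ z[j + 2]? = some
    z[letterIx hz (hTarget hz i false) true] := by
  have h1 : z[(i : ℕ)]? = some z[i] := by grind
  have h2 := h.pos_of_arrow (i := i) (e := e) (by simpa [h1] using hi)
  obtain ⟨j, hj⟩ : ∃ j, (i : ℕ) = j + 1 := ⟨i - 1, by omega⟩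
  refine ⟨j, hj, ?_, hj ▸ h1, ?_⟩ <;> rw [Fin.getElem_fin, ← List.getElem?_eq_getElem] <;>
    simp [letterIx, hTarget, leftLetter, rightLetter, leftEnd, rightEnd, h.startsTrivial, hj]
  grind

lemma isOriented_of_string (h : IsString Q.hat z) (hz : IsHatWord Q z) (h1 : ∀ i, ∀ e ∈ Q.special,
    z[i + 1]? = some (.dir e) → (∃ f, z[i + 2]? = some (.inv f)) → ∃ f, z[i]? = some (.dir f))
    (h2 : ∀ i, ∀ e ∈ Q.special, z[i + 1]? = some (.inv e) → (∃ f, z[i]? = some (.dir f)) → ∃ f,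
    z[i + 2]? = some (.inv f)) : IsOriented hz := by
  refine isOriented_of_letters hz (fun i e he hi f hf => ?_) fun i e he hi f hf => ?_
  · obtain ⟨j, -, g1, g2, g3⟩ := h.neighbours hz (.inl hi)
    simpa [g1] using h1 j e he (by rw [g2, hi]) ⟨f, by rw [g3, hf]⟩
  · obtain ⟨j, -, g1, g2, g3⟩ := h.neighbours hz (.inr hi)
    simpa [g3] using h2 j e he (by rw [g2, hi]) ⟨f, by rw [g1, hf]⟩

end

/-! ### The modules of words as modules described by a diagram -/

section

variable [Fintype V]

variable {a : E} {σ : WordType}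

lemma arrow_unique_source {x : Word V E} (hx : IsHatWord Q x) {p q : Fin x.length × Bool}
    (hp : IsHArrow Q x a p) (hq : IsHArrow Q x a q) (h : hSrc hx p = hSrc hx q) : hTgt hx p = hTgt
    hx q := by
  by_cases ha : a ∈ Q.special
  · obtain ⟨d, h1, h2, h3, -⟩ := exists_reverse hx ha hp
    obtain ⟨d', h1', h2', h3', -⟩ := exists_reverse hx ha hq
    have := arrow_unique hx h1 h1' (h2.trans (h.trans h2'.symm)); grind
  · obtain ⟨P, -, h2, h3⟩ := exists_pol hx (hSrc hx q)
    rcases arrow_out hx ha hp h h2 h3 with ⟨a1, -, a2, a3⟩ | ⟨a1, -, a2, a3⟩ <;>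
      rcases arrow_out hx ha hq rfl h2 h3 with ⟨b1, -, b2, b3⟩ | ⟨b1, -, b2, b3⟩
    · grind
    · exact absurd (a3.trans b3.symm) (flip_ne P)
    · exact absurd (b3.trans a3.symm) (flip_ne P)
    · grind

variable {σ : WordType} {x : AdmWord Q} {X : Type uX} [AddCommGroup X] [Module k X]
  [Module (WordAlg k σ) X] [IsScalarTower k (WordAlg k σ) X]

instance : Module (QAlg k Q) (WordModule k σ x X) :=
  inferInstanceAs (Module (PathAlg k Q) (WordModule k σ x X))

instance : IsScalarTower k (QAlg k Q) (WordModule k σ x X) :=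
  inferInstanceAs (IsScalarTower k (PathAlg k Q) (WordModule k σ x X))

lemma vtx_smul_wordModule (i : V) (m : WordModule k σ x X) : vtx k Q i • m = vertexAct k σ x X i
    m := by
  have : pathRep k σ x X (vtx k Q i : QAlg k Q) = vertexAct k σ x X i := by
    change pathRep k σ x X (RingQuot.mkAlgHom k (PathRel k Q) (FreeAlgebra.ι k (.inl i))) = _
    rw [pathRep, RingQuot.liftAlgHom_mkAlgHom_apply, FreeAlgebra.lift_ι_apply]; rfl
  exact congrArg (fun f => f m) this

lemma arr_smul_wordModule (a : E) (m : WordModule k σ x X) : arr k Q a • m = arrowAct k σ x X a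
    m := by
  have : pathRep k σ x X (arr k Q a : QAlg k Q) = arrowAct k σ x X a := by
    change pathRep k σ x X (RingQuot.mkAlgHom k (PathRel k Q) (FreeAlgebra.ι k (.inr a))) = _
    rw [pathRep, RingQuot.liftAlgHom_mkAlgHom_apply, FreeAlgebra.lift_ι_apply]; rfl
  exact congrArg (fun f => f m) this

variable {p : Fin x.1.length × Bool}

lemma arr_smul_apply (hp : IsHArrow Q x.1 a p) (m : WordModule k σ x X) : (arr k Q a • m)
    (hTgt x.2.isHatWord p) = arrowUnit k σ x.1 p • m (hSrc x.2.isHatWord p) := by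
  rw [arr_smul_wordModule]; exact arrowActFun_eq k σ x X a m p hp

lemma arr_smul_apply_eq_zero {j : Pos x.1} (h : ∀ p, IsHArrow Q x.1 a p → hTgt x.2.isHatWord p ≠ j)
    (m : WordModule k σ x X) : (arr k Q a • m) j = 0 := by
  rw [arr_smul_wordModule]
  exact arrowActFun_eq_zero k σ x X a m j fun p hp hj => absurd hj (h p hp)

lemma vtx_smul_apply (j : Pos x.1) (m : WordModule k σ x X) : (vtx k Q (hVertex x.2.isHatWord j) •
    m) j = m j := by rw [vtx_smul_wordModule]; exact if_pos rfl

variable (k σ x) in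
/-- An element of the copy of `X` at the position `i` as an element of `M°_x(X)`. -/
def atPos (i : Pos x.1) : X →ₗ[k] WordModule k σ x X := LinearMap.single k (fun _ : Pos x.1 => X) i

lemma atPos_apply (i j : Pos x.1) (v : X) : atPos k σ x i v j = if j = i then v else 0 := by
  change Pi.single (M := fun _ : Pos x.1 => X) i v j = _; rw [Pi.single_apply]

lemma vtx_smul_atPos (i : Pos x.1) (v : X) : vtx k Q (hVertex x.2.isHatWord i) • atPos k σ x i v =
    atPos k σ x i v := by
  classical
  rw [vtx_smul_wordModule]
  funext j
  change (if _ then atPos k σ x i v j else 0) = _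
  rw [atPos_apply]
  grind

lemma arr_smul_atPos (hp : IsHArrow Q x.1 a p) (v : X) : arr k Q a • atPos k σ x (hSrc x.2.isHatWord
    p) v = atPos k σ x (hTgt x.2.isHatWord p) (arrowUnit k σ x.1 p • v) := by
  funext j; rw [atPos_apply]; split_ifs with h
  · rw [h, arr_smul_apply hp, atPos_apply, if_pos rfl]
  · rw [arr_smul_wordModule]; refine arrowActFun_eq_zero k σ x X a _ j fun q hq hj => ?_
    rw [atPos_apply, if_neg]; intro h1
    exact h (hj.symm.trans (arrow_unique_source x.2.isHatWord hq hp h1))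

lemma arr_smul_atPos_eq_zero {i : Pos x.1} (h : ∀ p, IsHArrow Q x.1 a p → hSrc x.2.isHatWord p ≠ i)
    (v : X) : arr k Q a • atPos k σ x i v = 0 := by
  rw [arr_smul_wordModule]; funext j; refine arrowActFun_eq_zero k σ x X a _ j fun q hq hj => ?_
  rw [atPos_apply, if_neg (h q hq)]

variable (k) in
/-- The element of `A_x` by which the special loop of a punctured end acts: the right end for
`true`, and the left end for `false`. -/
def eta (σ : WordType) (b : Bool) : WordAlg k σ :=
  if b then WordAlg.etaOne k σ else WordAlg.etaZero k σ

lemma eta_mul_self (σ : WordType) (b : Bool) : eta k σ b * eta k σ b = 1 := by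
  cases b
  exacts [WordAlg.etaZero_mul_self k σ, WordAlg.etaOne_mul_self k σ]

variable {J K : Type} [Fintype J] [Fintype K]

/-- An identification of the positions of the word `x` with the positions in `P` of a diagram,
which is compatible with the arrows. -/
structure Embedding (G : Diagram Q J K) (P : J → Prop) (k : Type uk) [Field k]
    (unit : K → WordAlg k σ) (x : AdmWord Q) where
  ι : Pos x.1 → J
  injective : Function.Injective ι
  mem : ∀ j, P j ↔ ∃ i, ι i = j
  vertex : ∀ i, hVertex x.2.isHatWord i = G.vert (ι i)
  edge : ∀ κ i i', G.src κ = ι i → G.tgt κ = ι i' → ∃ p, IsHArrow Q x.1 (G.ar κ) p ∧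
    hSrc x.2.isHatWord p = i ∧ hTgt x.2.isHatWord p = i' ∧
    arrowUnit k σ x.1 p = unit κ
  no_out : ∀ κ i, G.src κ = ι i → ¬ P (G.tgt κ) → ∀ p, IsHArrow Q x.1 (G.ar κ) p →
    hSrc x.2.isHatWord p ≠ i
  no_inn : ∀ κ i, G.tgt κ = ι i → ¬ P (G.src κ) → ∀ p, IsHArrow Q x.1 (G.ar κ) p →
    hTgt x.2.isHatWord p ≠ i
  pun : ∀ i b e, G.side (ι i) b = .pun e → ∃ p, IsHArrow Q x.1 e p ∧
    hSrc x.2.isHatWord p = i ∧ hTgt x.2.isHatWord p = i ∧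
    arrowUnit k σ x.1 p = eta k σ b

/-- A basis of `X` at each position of a diagram, which consists of eigenvectors for the action of
the puncture at this position if there is one, and inverses of the units of `A_x` which belong to
the arrows. -/
structure Frame (G : Diagram Q J K) (k : Type uk) [Field k] (unit : K → WordAlg k σ) (X : Type uX)
    [AddCommGroup X] [Module k X] [Module (WordAlg k σ) X] (d : ℕ) where
  inv : K → WordAlg k σ
  unit_mul_inv : ∀ κ, unit κ * inv κ = 1
  inv_mul_unit : ∀ κ, inv κ * unit κ = 1
  bas : J → Module.Basis (Fin d) k X
  sgn : J → Fin d → k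
  sgn_mul_self : ∀ j c, sgn j c * sgn j c = 1
  eta_smul : ∀ j b e c, G.side j b = .pun e → eta k σ b • bas j c = sgn j c • bas j c

/-- Multiplication by an element of `A_x` as a `k`-linear map. -/
def algSmul (u : WordAlg k σ) : X →ₗ[k] X where
  toFun v := u • v
  map_add' v w := smul_add _ _ _
  map_smul' c v := by
    have : SMulCommClass k (WordAlg k σ) X := IsScalarTower.to_smulCommClass
    exact (smul_comm c u v).symm

namespace Frame

variable {G : Diagram Q J K} {unit : K → WordAlg k σ} {d : ℕ} (F : Frame G k unit X d)

/-- The matrices of the units of `A_x` which belong to the arrows. -/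
def gauge : Gauge k J K d where
  V κ := LinearMap.toMatrix (F.bas (G.tgt κ)) (F.bas (G.src κ)) (algSmul (F.inv κ))
  W κ := LinearMap.toMatrix (F.bas (G.src κ)) (F.bas (G.tgt κ)) (algSmul (unit κ))
  V_mul_W κ := by
    rw [← LinearMap.toMatrix_comp, ← LinearMap.toMatrix_id (F.bas (G.src κ))]
    congr 1
    refine LinearMap.ext fun v => ?_
    change F.inv κ • unit κ • v = v
    rw [smul_smul, F.inv_mul_unit, one_smul]
  W_mul_V κ := by
    rw [← LinearMap.toMatrix_comp, ← LinearMap.toMatrix_id (F.bas (G.tgt κ))]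
    congr 1
    refine LinearMap.ext fun v => ?_
    change unit κ • F.inv κ • v = v
    rw [smul_smul, F.unit_mul_inv, one_smul]
  sgn := F.sgn
  sgn_mul_self := F.sgn_mul_self

variable {P : J → Prop} {a : E}

open Classical in
/-- The basis vectors of `M°_x(X)`. -/
def vec (e : Embedding G P k unit x) (j : J) (c : Fin d) : WordModule k σ x X :=
  if h : ∃ i, e.ι i = j then atPos k σ x (Classical.choose h) (F.bas j c) else 0

lemma vec_ι (e : Embedding G P k unit x) (i : Pos x.1) (c : Fin d) : F.vec e (e.ι i) c = atPos k σ x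
    i (F.bas (e.ι i) c) := by
  have h : ∃ i', e.ι i' = e.ι i := ⟨i, rfl⟩
  rw [vec, dif_pos h, e.injective (Classical.choose_spec h)]

variable {j : J}

lemma vec_eq_zero (e : Embedding G P k unit x) (hj : ¬ P j) (c : Fin d) : F.vec e j c = 0 := dif_neg
    fun h => hj ((e.mem j).2 h)

lemma linearIndependent_vec (e : Embedding G P k unit x) : LinearIndependent k fun p : {j // P j}
    × Fin d => F.vec e p.1 p.2 := by
  choose g hg using fun j : {j // P j} => (e.mem j.1).1 j.2
  have h := (Pi.basis fun i : Pos x.1 => F.bas (e.ι i)).linearIndependent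
  have hinj : Function.Injective fun p : {j // P j} × Fin d =>
      (⟨g p.1, p.2⟩ : Σ _ : Pos x.1, Fin d) := by rintro ⟨j, c⟩ ⟨j', c'⟩ h; grind
  have h2 := h.comp _ hinj
  have h3 : (fun p : {j // P j} × Fin d => F.vec e p.1 p.2) = fun p =>
      (Pi.basis fun i : Pos x.1 => F.bas (e.ι i)) ⟨g p.1, p.2⟩ := by
    funext p; obtain ⟨j, c⟩ := p; have h4 := F.vec_ι e (g j) c; rw [hg j] at h4; refine h4.trans ?_
    rw [Pi.basis_apply]
    change atPos k σ x (g j) (F.bas j c) = atPos k σ x (g j) (F.bas (e.ι (g j)) c); rw [hg j]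
  rw [h3]; exact h2

lemma span_vec (e : Embedding G P k unit x) : Submodule.span (QAlg k Q) (Set.range fun p : J × Fin d
    => F.vec e p.1 p.2) = (⊤ : Submodule (QAlg k Q) (WordModule k σ x X)) := by
  rw [eq_top_iff]; intro n _
  have h1 : n = ∑ i, ∑ c, (F.bas (e.ι i)).repr (n i) c • F.vec e (e.ι i) c := by
    have h2 : ∀ i, ∑ c, (F.bas (e.ι i)).repr (n i) c • F.vec e (e.ι i) c = atPos k σ x i (n i) := by
      intro i; simp only [F.vec_ι]; rw [← (F.bas (e.ι i)).sum_repr (n i)]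
      simp only [map_sum, map_smul, Module.Basis.repr_self]
      refine Finset.sum_congr rfl fun c _ => ?_
      simp
    simp only [h2]; funext j
    have : (∑ i, atPos k σ x i (n i)) j = ∑ i, atPos k σ x i (n i) j :=
      Finset.sum_apply j Finset.univ fun i => (atPos k σ x i (n i) : Fin _ → X)
    rw [this]
    rw [Finset.sum_eq_single j (fun i _ hi => by rw [atPos_apply, if_neg hi.symm])
      (fun h => absurd (Finset.mem_univ _) h), atPos_apply, if_pos rfl]
  rw [h1]; refine Submodule.sum_mem _ fun i _ => Submodule.sum_mem _ fun c _ => ?_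
  exact Submodule.smul_of_tower_mem _ _ (Submodule.subset_span ⟨(e.ι i, c), rfl⟩)

lemma sum_V_smul (κ : K) (c : Fin d) : ∑ c', F.gauge.V κ c' c • F.bas (G.src κ) c' = F.inv κ • F.bas
    (G.tgt κ) c := by
  have h := (F.bas (G.src κ)).sum_repr (F.inv κ • F.bas (G.tgt κ) c)
  refine (Finset.sum_congr rfl fun c' _ => ?_).trans h
  exact congrArg (· • F.bas (G.src κ) c') (LinearMap.toMatrix_apply (F.bas (G.tgt κ))
    (F.bas (G.src κ)) (algSmul (F.inv κ)) c' c)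

lemma sum_V_mul_repr (κ : K) (c : Fin d) (v : X) : ∑ c', F.gauge.V κ c c' * (F.bas (G.tgt κ)).repr v
    c' = (F.bas (G.src κ)).repr (F.inv κ • v) c := by
  have h := congrFun (LinearMap.toMatrix_mulVec_repr (F.bas (G.tgt κ)) (F.bas (G.src κ))
    (algSmul (F.inv κ)) v) c
  exact h

/-- `M°_x(X)` is described by a diagram in which the positions of `x` are those in `isM`. -/
def describes (e : Embedding G G.isM k unit x) : G.Describes F.gauge (WordModule k σ x X) where
  vec := F.vec e
  vec_eq_zero j c h := F.vec_eq_zero e h c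
  vtx_smul j c := by
    by_cases h : G.isM j
    · obtain ⟨i, rfl⟩ := (e.mem j).1 h
      rw [F.vec_ι, ← e.vertex, vtx_smul_atPos]
    · rw [F.vec_eq_zero e h, smul_zero]
  arr_smul κ c := by
    by_cases hs : G.isM (G.src κ)
    · obtain ⟨i, hi⟩ := (e.mem _).1 hs
      have h1 : ∀ c', F.vec e (G.src κ) c' = atPos k σ x i (F.bas (G.src κ) c') := fun c' => by
        rw [← hi]; exact F.vec_ι e i c'
      by_cases ht : G.isM (G.tgt κ)
      · obtain ⟨i', hi'⟩ := (e.mem _).1 ht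
        obtain ⟨p, hp, h2, h3, h4⟩ := e.edge κ i i' hi.symm hi'.symm
        have h5 : ∀ c', arr k Q (G.ar κ) • F.vec e (G.src κ) c' =
            atPos k σ x i' (algSmul (k := k) (unit κ) (F.bas (G.src κ) c')) := fun c' => by
          rw [h1, ← h2, arr_smul_atPos hp, h3, h4]; rfl
        have h6 : F.vec e (G.tgt κ) c = atPos k σ x i' (F.bas (G.tgt κ) c) := by
          rw [← hi']; exact F.vec_ι e i' c
        simp only [h5, ← map_smul, ← map_sum]
        rw [F.sum_V_smul, h6]
        refine congrArg _ ?_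
        change unit κ • F.inv κ • F.bas (G.tgt κ) c = _
        rw [smul_smul, F.unit_mul_inv, one_smul]
      · rw [F.vec_eq_zero e ht]
        refine Finset.sum_eq_zero fun c' _ => ?_
        rw [h1, arr_smul_atPos_eq_zero (e.no_out κ i hi.symm ht), smul_zero]
    · rw [F.vec_eq_zero e fun h => hs (G.isM_edge κ h)]
      refine Finset.sum_eq_zero fun c' _ => ?_
      rw [F.vec_eq_zero e hs, smul_zero, smul_zero]
  pun_smul {j b f} c h := by
    obtain ⟨i, rfl⟩ := (e.mem j).1 (G.isM_pun h)
    obtain ⟨p, hp, h1, h2, h3⟩ := e.pun i b f h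
    have h4 : arr k Q f • atPos k σ x i (F.bas (e.ι i) c) =
        atPos k σ x i (eta k σ b • F.bas (e.ι i) c) := by
      have h5 := arr_smul_atPos (k := k) (σ := σ) hp (F.bas (e.ι i) c)
      rwa [h1, h2, h3] at h5
    rw [F.vec_ι, h4, F.eta_smul _ _ _ _ h, map_smul]
    rfl
  indep := F.linearIndependent_vec e
  span := F.span_vec e

variable (k σ x) in
/-- The component at a position of an element of `M°_y(X^χ)`, as an element of `X`. -/
def atPosTwist (i : Pos x.1) : WordModule k σ x (ChiTwist k σ X) →ₗ[k] X :=
  LinearMap.proj (φ := fun _ : Pos x.1 => X) i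

lemma atPosTwist_arr_smul {p : Fin x.1.length × Bool} (hp : IsHArrow Q x.1 a p)
    (n : WordModule k σ x (ChiTwist k σ X)) : atPosTwist k σ x (hTgt x.2.isHatWord p)
    (arr k Q a • n) = WordAlg.chi k σ (arrowUnit k σ x.1 p) • atPosTwist k σ x (hSrc x.2.isHatWord
    p) n :=
  arr_smul_apply hp n

lemma atPosTwist_arr_smul_eq_zero {j : Pos x.1} (h : ∀ p, IsHArrow Q x.1 a p → hTgt x.2.isHatWord p
    ≠ j) (n : WordModule k σ x (ChiTwist k σ X)) : atPosTwist k σ x j (arr k Q a • n) = (0 : X) :=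
  arr_smul_apply_eq_zero h n

lemma atPosTwist_vtx_smul (j : Pos x.1) (n : WordModule k σ x (ChiTwist k σ X)) : atPosTwist k σ x j
    (vtx k Q (hVertex x.2.isHatWord j) • n) = (atPosTwist k σ x j n : X) :=
  vtx_smul_apply j n

open Classical in
/-- The coordinates of the elements of `M°_y(X^χ)`. -/
def form (e : Embedding G P k unit x) (j : J) (c : Fin d) : WordModule k σ x (ChiTwist k σ X) →ₗ[k]
    k :=
  if h : ∃ i, e.ι i = j then
    ((F.bas j).coord c).comp (atPosTwist k σ x (Classical.choose h))
  else 0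

lemma form_ι (e : Embedding G P k unit x) (i : Pos x.1) (c : Fin d)
    (n : WordModule k σ x (ChiTwist k σ X)) : F.form e (e.ι i) c n = (F.bas (e.ι i)).repr
    (atPosTwist k σ x i n) c := by
  have h : ∃ i', e.ι i' = e.ι i := ⟨i, rfl⟩; rw [form, dif_pos h]
  have h1 := e.injective (Classical.choose_spec h)
  change (F.bas (e.ι i)).repr (atPosTwist k σ x (Classical.choose h) n) c = _; rw [h1]

lemma form_eq_zero (e : Embedding G P k unit x) (hj : ¬ P j) (c : Fin d) : F.form e j c = 0 :=
    dif_neg fun h => hj ((e.mem j).2 h)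

lemma repr_eta_smul {b : Bool} {f : E} (h : G.side j b = .pun f) (v : X) (c : Fin d) :
    (F.bas j).repr (eta k σ b • v) c = F.sgn j c * (F.bas j).repr v c := by
  have h6 : eta k σ b • v = ∑ c', ((F.bas j).repr v c' * F.sgn j c') • F.bas j c' := by
    conv_lhs => rw [← (F.bas j).sum_repr v]
    change algSmul (k := k) (eta k σ b) _ = _; rw [map_sum]
    refine Finset.sum_congr rfl fun c' _ => ?_
    rw [map_smul, mul_smul, ← F.eta_smul _ _ _ _ h]; rfl
  rw [h6, Module.Basis.repr_sum_self, mul_comm]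

/-- `M°_y(X^χ)` is described by a diagram in which the positions of `y` are those in `isN`. -/
def coDescribes (e : Embedding G G.isN k unit x) (hchi : ∀ κ, WordAlg.chi k σ (unit κ) = unit κ)
    (heta : ∀ j b f, G.side j b = .pun f → WordAlg.chi k σ (eta k σ b) = - eta k σ b)
    (hN : ∀ κ, G.isN (G.src κ) → G.isN (G.tgt κ)) : G.CoDescribes F.gauge (WordModule k σ x
    (ChiTwist k σ X)) where
  form := F.form e
  form_eq_zero j c h := F.form_eq_zero e h c
  form_vtx j c n := by
    by_cases h : G.isN j
    · obtain ⟨i, rfl⟩ := (e.mem j).1 h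
      rw [F.form_ι, F.form_ι, ← e.vertex, atPosTwist_vtx_smul]
    · rw [F.form_eq_zero e h]; rfl
  form_arr κ c n := by
    by_cases ht : G.isN (G.tgt κ)
    · obtain ⟨i', hi'⟩ := (e.mem _).1 ht
      have h1 : ∀ c' n, F.form e (G.tgt κ) c' n =
          (F.bas (G.tgt κ)).repr (atPosTwist k σ x i' n) c' := fun c' n => by
        rw [← hi']; exact F.form_ι e i' c' n
      by_cases hs : G.isN (G.src κ)
      · obtain ⟨i, hi⟩ := (e.mem _).1 hs
        obtain ⟨p, hp, h2, h3, h4⟩ := e.edge κ i i' hi.symm hi'.symm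
        have h5 : (atPosTwist k σ x i' (arr k Q (G.ar κ) • n) : X) =
            unit κ • atPosTwist k σ x i n := by
          have h6 := atPosTwist_arr_smul (X := X) hp n
          rwa [h2, h3, h4, hchi] at h6
        have h6 : F.form e (G.src κ) c n = (F.bas (G.src κ)).repr (atPosTwist k σ x i n) c := by
          rw [← hi]; exact F.form_ι e i c n
        have h7 := F.sum_V_mul_repr κ c (unit κ • atPosTwist k σ x i n)
        rw [smul_smul, F.inv_mul_unit, one_smul, ← h6] at h7
        rw [← h7]
        refine Finset.sum_congr rfl fun c' _ => ?_
        rw [h1, h5]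
      · rw [F.form_eq_zero e hs]
        refine Finset.sum_eq_zero fun c' _ => ?_
        rw [h1, atPosTwist_arr_smul_eq_zero (e.no_inn κ i' hi'.symm hs), map_zero]
        exact mul_zero _
    · rw [F.form_eq_zero e fun h => ht (hN κ h)]
      refine Finset.sum_eq_zero fun c' _ => ?_
      rw [F.form_eq_zero e ht]
      exact mul_zero _
  form_pun {j b f} c n h := by
    obtain ⟨i, rfl⟩ := (e.mem j).1 (G.isN_pun h)
    obtain ⟨p, hp, h1, h2, h3⟩ := e.pun i b f h
    rw [F.form_ι, F.form_ι]
    have h4 : (atPosTwist k σ x i (arr k Q f • n) : X) = -(eta k σ b • atPosTwist k σ x i n) := by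
      have h5 := atPosTwist_arr_smul (X := X) hp n
      rw [h1, h2, h3, heta _ _ _ h] at h5
      exact h5.trans (neg_smul _ _)
    rw [h4, map_neg]
    change -((F.bas (e.ι i)).repr (eta k σ b • atPosTwist k σ x i n) c) = _
    rw [F.repr_eta_smul h]
    exact (neg_mul _ _).symm
  eq_zero n h := by
    funext i
    refine (F.bas (e.ι i)).repr.injective (Finsupp.ext fun c => ?_)
    have h1 := h (e.ι i) c
    rw [F.form_ι] at h1
    refine h1.trans ?_
    change (0 : k) = (F.bas (e.ι i)).repr (0 : X) c
    rw [map_zero]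
    rfl
  exists_form t := by
    let n : WordModule k σ x (ChiTwist k σ X) := fun i => (∑ c, t (e.ι i) c • F.bas (e.ι i) c : X)
    refine ⟨n, fun j c hj => ?_⟩
    obtain ⟨i, rfl⟩ := (e.mem j).1 hj
    rw [F.form_ι]
    exact congrFun (Module.Basis.repr_sum_self (F.bas (e.ι i)) (t (e.ι i))) c

end Frame

/-- An involution is diagonalizable over a field of characteristic different from two. -/
lemma exists_eigenbasis (hk : (2 : k) ≠ 0) {X : Type*} [AddCommGroup X] [Module k X]
    [FiniteDimensional k X] (T : X →ₗ[k] X) (hT : ∀ v, T (T v) = v) :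
    ∃ (b : Module.Basis (Fin (Module.finrank k X)) k X) (s : Fin (Module.finrank k X) → k),
    (∀ c, s c * s c = 1) ∧ ∀ c, T (b c) = s c • b c := by
  let p := LinearMap.ker (T - LinearMap.id); let q := LinearMap.ker (T + LinearMap.id)
  have hp : ∀ v, v ∈ p ↔ T v = v := fun v => by
    simp only [p, LinearMap.mem_ker, LinearMap.sub_apply, LinearMap.id_apply, sub_eq_zero]
  have hq : ∀ v, v ∈ q ↔ T v = -v := fun v => by
    simp only [q, LinearMap.mem_ker, LinearMap.add_apply, LinearMap.id_apply, add_eq_zero_iff_eq_neg]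
  have hpq : IsCompl p q := by
    refine IsCompl.of_eq ?_ ?_
    · rw [eq_bot_iff]; intro v hv; have h1 := (hp v).1 hv.1; have h2 := (hq v).1 hv.2
      have h3 : (2 : k) • v = 0 := by rw [two_smul]; grind
      exact (smul_eq_zero.1 h3).resolve_left hk
    · rw [eq_top_iff]; intro v _
      have h1 : v = (2⁻¹ : k) • (v + T v) + (2⁻¹ : k) • (v - T v) := by
        rw [← smul_add, add_add_sub_cancel, ← two_smul k, smul_smul, inv_mul_cancel₀ hk, one_smul]
      rw [h1]
      refine Submodule.add_mem_sup (Submodule.smul_mem _ _ ((hp _).2 ?_))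
        (Submodule.smul_mem _ _ ((hq _).2 ?_))
      · grind
      · grind
  let b := ((Module.finBasis k p).prod (Module.finBasis k q)).map (p.prodEquivOfIsCompl q hpq)
  let e : Fin (Module.finrank k p) ⊕ Fin (Module.finrank k q) ≃ Fin (Module.finrank k X) :=
    Fintype.equivOfCardEq (by rw [Fintype.card_fin, ← Module.finrank_eq_card_basis b])
  refine ⟨b.reindex e, fun c => Sum.elim (fun _ => 1) (fun _ => -1) (e.symm c), fun c => ?_,
    fun c => ?_⟩
  · dsimp only; generalize e.symm c = i; cases i <;> simp
  · dsimp only; rw [Module.Basis.reindex_apply]; generalize e.symm c = i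
    cases i with
    | inl i =>
      have h : b (Sum.inl i) = (Module.finBasis k p i : X) := by simp [b]
      rw [h, (hp _).1 (Module.finBasis k p i).2]; simp
    | inr i =>
      have h : b (Sum.inr i) = (Module.finBasis k q i : X) := by simp [b]
      rw [h, (hq _).1 (Module.finBasis k q i).2]; simp

/-- If the words `x` and `y` are both embedded in a diagram, which describes their relative
position, then `M°_y(X^χ)` is the translate of `M°_x(X)`. -/
lemma isARTranslate_of_embedding (hk : (2 : k) ≠ 0) [FiniteDimensional k X] {y : AdmWord Q}
    (G : Diagram Q J K) (unit inv : K → WordAlg k σ) (unit_mul_inv : ∀ κ, unit κ * inv κ = 1)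
    (inv_mul_unit : ∀ κ, inv κ * unit κ = 1) (hchi : ∀ κ, WordAlg.chi k σ (unit κ) = unit κ)
    (heta : ∀ j b f, G.side j b = .pun f → WordAlg.chi k σ (eta k σ b) = - eta k σ b)
    (hN : ∀ κ, G.isN (G.src κ) → G.isN (G.tgt κ)) (e : Embedding G G.isM k unit x)
    (e' : Embedding G G.isN k unit y) : IsARTranslate k (R := PathAlg k Q) (WordModule k σ x X)
    (WordModule k σ y (ChiTwist k σ X)) := by
  classical
  have h : ∀ j, ∃ (b : Module.Basis (Fin (Module.finrank k X)) k X)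
      (s : Fin (Module.finrank k X) → k), (∀ c, s c * s c = 1) ∧
      ∀ d f c, G.side j d = .pun f → eta k σ d • b c = s c • b c := by
    intro j; by_cases h : ∃ d f, G.side j d = .pun f
    · obtain ⟨d, f, h⟩ := h
      obtain ⟨b, s, h1, h2⟩ := exists_eigenbasis hk (algSmul (k := k) (X := X) (eta k σ d))
        fun v => by change eta k σ d • eta k σ d • v = v; rw [smul_smul, eta_mul_self, one_smul]
      refine ⟨b, s, h1, fun d' f' c h' => ?_⟩
      -- only one side of a position is punctured, since special loops have polarity `-1`
      have h3 : d' = d := by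
        by_contra h3; have h4 : d' = !d := by cases d <;> cases d' <;> simp_all
        subst h4; obtain ⟨h5, h6⟩ := G.of_pun h; obtain ⟨h7, h8⟩ := G.of_pun h'
        rw [G.pol_not] at h8; have h9 := (Q.special_polarity f h5).1
        have h10 := (Q.special_polarity f' h7).1; rw [h6] at h9; rw [h8] at h10
        change -(G.pol j d).2 = -1 at h10; rw [h9] at h10; exact absurd h10 (by decide)
      subst h3; exact h2 c
    · push Not at h
      exact ⟨Module.finBasis k X, fun _ => 1, fun _ => one_mul 1,
        fun d f c hd => absurd hd (h d f)⟩
  choose b s h1 h2 using h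
  let F : Frame G k unit X (Module.finrank k X) :=
    { inv := inv
      unit_mul_inv := unit_mul_inv
      inv_mul_unit := inv_mul_unit
      bas := b
      sgn := s
      sgn_mul_self := h1
      eta_smul := fun j d f c => h2 j d f c }
  have h3 : IsARTranslate k (R := QAlg k Q) (WordModule k σ x X)
      (WordModule k σ y (ChiTwist k σ X)) :=
    Diagram.isARTranslate hk (F.describes e) (F.coDescribes e' hchi heta hN)
  exact h3

end

/-! ### The diagram of an interval -/

section

/-- The place of a letter in the order of the letters with a given target: direct letters come
first, and inverse letters last. -/
def Letter.key : Letter V E → ℕ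
  | .dir _ => 0
  | .inv _ => 2
  | _ => 1

/-- The key of the letter at position `i` of a word. -/
def keyAt (z : Word V E) (i : ℕ) : ℕ := (z[i]?).elim 1 Letter.key

variable {i : ℕ}

lemma keyAt_of_eq (h : z[i]? = some l) : keyAt z i = l.key := by rw [keyAt, h]; rfl

lemma WordEdge.view (h : IsString Q.hat z) (hz : IsHatWord Q z) (κ : WordEdge z) : 0 < (κ.1.1 : ℕ)
    ∧ (κ.1.1 : ℕ) + 1 < z.length ∧ ((κ.1.2 = true ∧ z[(κ.1.1 : ℕ)]? = some (.dir κ.arrow) ∧ keyAt z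
    κ.1.1 = 0 ∧ (hSrc hz κ.1 : ℕ) = κ.1.1 ∧ (hTgt hz κ.1 : ℕ) + 1 = κ.1.1) ∨
    (κ.1.2 = false ∧ z[(κ.1.1 : ℕ)]? = some (.inv κ.arrow) ∧ keyAt z κ.1.1 = 2 ∧ (hSrc hz κ.1 : ℕ) +
    1 = κ.1.1 ∧ (hTgt hz κ.1 : ℕ) = κ.1.1)) := by
  obtain ⟨h1, h2⟩ := κ.pos_of_string h; refine ⟨h1, h2, ?_⟩; have h3 := κ.hSource_eq h hz
  have h4 := κ.hTarget_eq h hz; cases h5 : κ.1.2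
  · have h6 := κ.exists_inv h5; simp only [h5, Bool.false_eq_true, if_false] at h3 h4
    exact .inr ⟨rfl, h6, keyAt_of_eq h6, by omega, by omega⟩
  · have h6 := κ.exists_dir h5; simp only [h5, if_true] at h3 h4
    exact .inl ⟨rfl, h6, keyAt_of_eq h6, by omega, by omega⟩

lemma wordSide_left_view (h : IsString Q.hat z) (hz : IsHatWord Q z) (j : Pos z) :
    (∃ κ, wordSide hz j false = .out κ ∧ keyAt z j = 0 ∧ 0 < (j : ℕ) ∧ (hTgt hz κ.1 : ℕ) + 1 = j)
    ∨ (∃ κ, wordSide hz j false = .inn κ ∧ keyAt z j = 2 ∧ 0 < (j : ℕ) ∧ (hSrc hz κ.1 : ℕ) + 1 = j)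
    ∨ ((j : ℕ) = 0 ∧ z[0]? = some (.trivInv (wordPol hz j false)) ∧
    ((∃ e ∈ Q.special, Q.source e = wordPol hz j false ∧ wordSide hz j false = .pun e) ∨
    (∀ e ∈ Q.special, Q.source e ≠ wordPol hz j false) ∧ wordSide hz j false = .free)) := by
  rcases wordSide_cases h hz j false with ⟨κ, h1, h2⟩ | ⟨h1, h2, ⟨-, h3, h4⟩ | ⟨h3, -⟩⟩
  · have h3 := κ.view h hz; grind
  · exact .inr (.inr ⟨h3, h4, wordSide_trivial_of_not hz h1 h2⟩)
  · cases h3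

lemma wordSide_right_view (h : IsString Q.hat z) (hz : IsHatWord Q z) (j : Pos z) :
    (∃ κ, wordSide hz j true = .out κ ∧ keyAt z (j + 1) = 2 ∧ (j : ℕ) + 2 < z.length ∧
    (hTgt hz κ.1 : ℕ) = j + 1) ∨ (∃ κ, wordSide hz j true = .inn κ ∧ keyAt z (j + 1) = 0 ∧ (j : ℕ)
    + 2 < z.length ∧ (hSrc hz κ.1 : ℕ) = j + 1) ∨ ((j : ℕ) + 2 = z.length ∧ z[z.length - 1]? = some
    (.triv (wordPol hz j true)) ∧ ((∃ e ∈ Q.special, Q.source e = wordPol hz j true ∧ wordSide hz j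
    true = .pun e) ∨ (∀ e ∈ Q.special, Q.source e ≠ wordPol hz j true) ∧ wordSide hz j true =
    .free)) := by
  rcases wordSide_cases h hz j true with ⟨κ, h1, h2⟩ | ⟨h1, h2, ⟨h3, -⟩ | ⟨-, h3, h4⟩⟩
  · have h3 := κ.view h hz; grind
  · cases h3
  · exact .inr (.inr ⟨h3, h4, wordSide_trivial_of_not hz h1 h2⟩)

lemma exists_wordEdge_dir (h : IsString Q.hat z) (hz : IsHatWord Q z) (hi : z[i]? = some (.dir e)) :
    ∃ κ : WordEdge z, (κ.1.1 : ℕ) = i ∧ (hSrc hz κ.1 : ℕ) = i ∧ (hTgt hz κ.1 : ℕ) + 1 = i := by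
  obtain ⟨h1, h2⟩ := List.getElem?_eq_some_iff.1 hi; let κ : WordEdge z := ⟨(⟨i, h1⟩, true), e, h2⟩
  have h3 := κ.view h hz; refine ⟨κ, rfl, ?_⟩; grind

lemma exists_wordEdge_inv (h : IsString Q.hat z) (hz : IsHatWord Q z) (hi : z[i]? = some (.inv e)) :
    ∃ κ : WordEdge z, (κ.1.1 : ℕ) = i ∧ (hSrc hz κ.1 : ℕ) + 1 = i ∧ (hTgt hz κ.1 : ℕ) = i := by
  obtain ⟨h1, h2⟩ := List.getElem?_eq_some_iff.1 hi; let κ : WordEdge z := ⟨(⟨i, h1⟩, false), e, h2⟩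
  have h3 := κ.view h hz; refine ⟨κ, rfl, ?_⟩; grind

namespace Interval

variable {a b c d : ℕ}

/-- The shape of the left end, in terms of keys. -/
lemma left_keys (I : Interval Q z a b c d) : (c = 0 ∧ 0 < a ∧ keyAt z a = 0 ∧ ∀ i, 0 < i → i < a →
    keyAt z i = 2) ∨ (a = 0 ∧ 0 < c ∧ keyAt z c = 2 ∧ ∀ i, 0 < i → i < c → keyAt z i = 0) ∨
    (a = 0 ∧ c = 0) := by
  obtain ⟨p, -, ⟨h1, h2, ⟨e, -, h3⟩, h4, -⟩ | ⟨h1, h2, ⟨e, -, h3⟩, h4, -⟩ | ⟨h1, h2, -⟩⟩ := I.left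
  · refine .inl ⟨h1, h2, keyAt_of_eq h3, fun i hi hi' => ?_⟩; obtain ⟨f, hf⟩ := h4 i hi hi'
    exact keyAt_of_eq hf
  · refine .inr (.inl ⟨h1, h2, keyAt_of_eq h3, fun i hi hi' => ?_⟩); obtain ⟨f, hf⟩ := h4 i hi hi'
    exact keyAt_of_eq hf
  · grind

/-- The shape of the right end, in terms of keys. -/
lemma right_keys (I : Interval Q z a b c d) : (d + 2 = z.length ∧ b + 2 < z.length ∧ keyAt z (b + 1)
    = 2 ∧ ∀ i, b + 1 < i → i + 1 < z.length → keyAt z i = 0) ∨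
    (b + 2 = z.length ∧ d + 2 < z.length ∧ keyAt z (d + 1) = 0 ∧ ∀ i, d + 1 < i → i + 1 < z.length →
    keyAt z i = 2) ∨ (b + 2 = z.length ∧ d + 2 = z.length) := by
  obtain ⟨p, -, ⟨h1, h2, ⟨e, -, h3⟩, h4, -⟩ | ⟨h1, h2, ⟨e, -, h3⟩, h4, -⟩ | ⟨h1, h2, -⟩⟩ := I.right
  · refine .inl ⟨h1, h2, keyAt_of_eq h3, fun i hi hi' => ?_⟩; obtain ⟨f, hf⟩ := h4 i hi hi'
    exact keyAt_of_eq hf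
  · refine .inr (.inl ⟨h1, h2, keyAt_of_eq h3, fun i hi hi' => ?_⟩); obtain ⟨f, hf⟩ := h4 i hi hi'
    exact keyAt_of_eq hf
  · grind

lemma isM_edge (I : Interval Q z a b c d) (hz : IsHatWord Q z) (κ : WordEdge z)
    (h : a ≤ (hTgt hz κ.1 : ℕ) ∧ (hTgt hz κ.1 : ℕ) ≤ b) : a ≤ (hSrc hz κ.1 : ℕ) ∧ (hSrc hz κ.1 : ℕ)
    ≤ b := by
  have h1 := κ.view I.isString hz; have h2 := I.left_keys; have h3 := I.right_keys; grind

lemma isN_edge (I : Interval Q z a b c d) (hz : IsHatWord Q z) (κ : WordEdge z)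
    (h : c ≤ (hSrc hz κ.1 : ℕ) ∧ (hSrc hz κ.1 : ℕ) ≤ d) : c ≤ (hTgt hz κ.1 : ℕ) ∧ (hTgt hz κ.1 : ℕ)
    ≤ d := by
  have h1 := κ.view I.isString hz; have h2 := I.left_keys; have h3 := I.right_keys; grind

lemma isM_ordinary (I : Interval Q z a b c d) (hz : IsHatWord Q z) (κ : WordEdge z)
    (h : a ≤ (hSrc hz κ.1 : ℕ) ∧ (hSrc hz κ.1 : ℕ) ≤ b)
    (h' : ¬ (a ≤ (hTgt hz κ.1 : ℕ) ∧ (hTgt hz κ.1 : ℕ) ≤ b)) : κ.arrow ∉ Q.special := by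
  obtain ⟨h1, h2, h3⟩ := κ.view I.isString hz; obtain ⟨p, -, hl⟩ := I.left
  obtain ⟨q, -, hr⟩ := I.right; grind

/-- A side without arrows is an end of the word. -/
lemma left_end (I : Interval Q z a b c d) (h : z[0]? = some (.trivInv p)) :
    (c = 0 ∧ 0 < a ∧ ∀ e, Q.target e ≠ p) ∨ (a = 0 ∧ 0 < c ∧ ∀ e, Q.source e ≠ p)
    ∨ (a = 0 ∧ c = 0 ∧ Loop Q p) := by obtain ⟨p', h1, h2⟩ := I.left; grind

lemma right_end (I : Interval Q z a b c d) (h : z[z.length - 1]? = some (.triv p)) :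
    (d + 2 = z.length ∧ b + 2 < z.length ∧ ∀ e, Q.target e ≠ p) ∨ (b + 2 = z.length ∧ d + 2 <
    z.length ∧ ∀ e, Q.source e ≠ p) ∨ (b + 2 = z.length ∧ d + 2 = z.length ∧ ∃ e ∈ Q.special,
    Q.source e = p) := by obtain ⟨p', h1, h2⟩ := I.right; grind

variable {j : Pos z} {s : Bool}

/-- A side without an arrow lies at an end of the word, where the three shapes of an end are
distinguished by the membership in `x` and in `y`. -/
lemma end_view (I : Interval Q z a b c d) (hz : IsHatWord Q z) (h : ∀ κ, wordSide hz j s ≠ .out κ)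
    (h' : ∀ κ, wordSide hz j s ≠ .inn κ) : ((s = false ∧ (j : ℕ) = 0 ∧ c = 0 ∧ 0 < a) ∨
    (s = true ∧ (j : ℕ) + 2 = z.length ∧ d + 2 = z.length ∧ b + 2 < z.length)) ∧
    (∀ e, Q.target e ≠ wordPol hz j s) ∧ wordSide hz j s = .free ∨
    ((s = false ∧ (j : ℕ) = 0 ∧ a = 0 ∧ 0 < c) ∨ (s = true ∧ (j : ℕ) + 2 = z.length ∧ b + 2 =
    z.length ∧ d + 2 < z.length)) ∧ (∀ e, Q.source e ≠ wordPol hz j s) ∧ wordSide hz j s = .free ∨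
    ((s = false ∧ (j : ℕ) = 0 ∧ a = 0 ∧ c = 0) ∨ (s = true ∧ (j : ℕ) + 2 = z.length ∧ b + 2 =
    z.length ∧ d + 2 = z.length)) ∧ ∃ e, wordSide hz j s = .pun e := by
  have key : ∀ {P : V × ℤˣ}, ((∃ e ∈ Q.special, Q.source e = P ∧ wordSide hz j s = .pun e) ∨
      (∀ e ∈ Q.special, Q.source e ≠ P) ∧ wordSide hz j s = .free) →
      ((∀ e, Q.target e ≠ P) → wordSide hz j s = .free) ∧
      ((∀ e, Q.source e ≠ P) → wordSide hz j s = .free) ∧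
      ((Loop Q P) → ∃ e, wordSide hz j s = .pun e) := by
    rintro P (⟨e, he, h1, h2⟩ | ⟨h1, h2⟩)
    · exact ⟨fun h3 => absurd ((loop_ends he).symm.trans h1) (h3 e),
        fun h3 => absurd h1 (h3 e), fun _ => ⟨e, h2⟩⟩
    · grind
  cases s
  · rcases wordSide_left_view I.isString hz j with ⟨κ, h1, -⟩ | ⟨κ, h1, -⟩ | ⟨h1, h2, h3⟩
    · grind
    · grind
    · obtain ⟨k1, k2, k3⟩ := key h3
      rcases I.left_end h2 with ⟨h4, h5, h6⟩ | ⟨h4, h5, h6⟩ | ⟨h4, h5, h6⟩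
      · grind
      · grind
      · grind
  · rcases wordSide_right_view I.isString hz j with ⟨κ, h1, -⟩ | ⟨κ, h1, -⟩ | ⟨h1, h2, h3⟩
    · grind
    · grind
    · obtain ⟨k1, k2, k3⟩ := key h3
      rcases I.right_end h2 with ⟨h4, h5, h6⟩ | ⟨h4, h5, h6⟩ | ⟨h4, h5, h6⟩
      · grind
      · grind
      · grind

lemma free_view (I : Interval Q z a b c d) (hz : IsHatWord Q z) (h : wordSide hz j s = .free) :
    ((s = false ∧ (j : ℕ) = 0 ∧ c = 0 ∧ 0 < a) ∨ (s = true ∧ (j : ℕ) + 2 = z.length ∧ d + 2 =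
    z.length ∧ b + 2 < z.length)) ∧ (∀ e, Q.target e ≠ wordPol hz j s) ∨
    ((s = false ∧ (j : ℕ) = 0 ∧ a = 0 ∧ 0 < c) ∨ (s = true ∧ (j : ℕ) + 2 = z.length ∧ b + 2 =
    z.length ∧ d + 2 < z.length)) ∧ (∀ e, Q.source e ≠ wordPol hz j s) := by
  rcases I.end_view hz (fun κ h1 => by rw [h] at h1; cases h1)
    (fun κ h1 => by rw [h] at h1; cases h1) with h1 | h1 | ⟨-, e, h1⟩
  · grind
  · grind
  · grind

lemma pun_view (I : Interval Q z a b c d) (hz : IsHatWord Q z) (h : wordSide hz j s = .pun e) :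
    (s = false ∧ (j : ℕ) = 0 ∧ a = 0 ∧ c = 0) ∨ (s = true ∧ (j : ℕ) + 2 = z.length ∧ b + 2 =
    z.length ∧ d + 2 = z.length) := by
  rcases I.end_view hz (fun κ h1 => by rw [h] at h1; cases h1)
    (fun κ h1 => by rw [h] at h1; cases h1) with h1 | h1 | h1
  · grind
  · grind
  · exact h1.1

lemma le_of_fin (I : Interval Q z a b c d) (j : Pos z) : (j : ℕ) + 2 ≤ z.length := by
  have := I.isString.numVertices_add_one; omega

lemma isM_tail (I : Interval Q z a b c d) (hz : IsHatWord Q z) (j : Pos z)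
    (h : ¬ (a ≤ (j : ℕ) ∧ (j : ℕ) ≤ b))
    (h' : ¬ (¬ (a ≤ (j : ℕ) ∧ (j : ℕ) ≤ b) ∧ ((j : ℕ) = 0 ∨ (j : ℕ) + 2 = z.length))) : ∃ κ :
    WordEdge z, hTgt hz κ.1 = j ∧ ¬ (a ≤ (hSrc hz κ.1 : ℕ) ∧ (hSrc hz κ.1 : ℕ) ≤ b) := by
  obtain ⟨p, -, hl⟩ := I.left; obtain ⟨q, -, hr⟩ := I.right; have hj := I.le_of_fin j
  by_cases h1 : (j : ℕ) < a
  · rcases hl with ⟨-, -, -, hl, -⟩ | ⟨hl, -⟩ | ⟨hl, -⟩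
    · obtain ⟨e, he⟩ := hl j (by omega) h1
      obtain ⟨κ, -, h2, h3⟩ := exists_wordEdge_inv I.isString hz he; grind
    · omega
    · omega
  · rcases hr with ⟨-, -, -, hr, -⟩ | ⟨hr, -⟩ | ⟨hr, -⟩
    · obtain ⟨e, he⟩ := hr (j + 1) (by omega) (by omega)
      obtain ⟨κ, -, h2, h3⟩ := exists_wordEdge_dir I.isString hz he; grind
    · omega
    · omega

lemma isM_two (I : Interval Q z a b c d) (hz : IsHatWord Q z) {κ κ' : WordEdge z}
    (h : wordSide hz j s = .inn κ) (h' : wordSide hz j (!s) = .inn κ') :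
    (a ≤ (hSrc hz κ.1 : ℕ) ∧ (hSrc hz κ.1 : ℕ) ≤ b) ∨ (a ≤ (hSrc hz κ'.1 : ℕ) ∧ (hSrc hz κ'.1 : ℕ) ≤
    b) := by
  have key : ∀ {κ κ' : WordEdge z}, wordSide hz j false = .inn κ → wordSide hz j true = .inn κ' →
      (a ≤ (hSrc hz κ.1 : ℕ) ∧ (hSrc hz κ.1 : ℕ) ≤ b) ∨
      (a ≤ (hSrc hz κ'.1 : ℕ) ∧ (hSrc hz κ'.1 : ℕ) ≤ b) := by
    intro κ κ' h h'; have h1 := I.left_keys; have h2 := I.right_keys; have h0 := I.le_ab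
    rcases wordSide_left_view I.isString hz j with
      ⟨κ1, h3, -⟩ | ⟨κ1, h3, h4, h5, h6⟩ | ⟨-, -, ⟨e, -, -, h3⟩ | ⟨-, h3⟩⟩ <;> rw [h] at h3
    · cases h3
    · rcases wordSide_right_view I.isString hz j with
        ⟨κ2, h7, -⟩ | ⟨κ2, h7, h8, h9, h10⟩ | ⟨-, -, ⟨e, -, -, h7⟩ | ⟨-, h7⟩⟩ <;> rw [h'] at h7
      · cases h7
      · cases h3; cases h7; grind
      · cases h7
      · cases h7
    · cases h3
    · cases h3
  cases s
  · exact key h h'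
  · grind

lemma top_tgt (I : Interval Q z a b c d) (hz : IsHatWord Q z) (κ : WordEdge z)
    (h : ¬ (a ≤ (hTgt hz κ.1 : ℕ) ∧ (hTgt hz κ.1 : ℕ) ≤ b) ∧
    ((hTgt hz κ.1 : ℕ) = 0 ∨ (hTgt hz κ.1 : ℕ) + 2 = z.length)) : a ≤ (hSrc hz κ.1 : ℕ) ∧
    (hSrc hz κ.1 : ℕ) ≤ b := by
  have h1 := κ.view I.isString hz; have h2 := I.left_keys; have h3 := I.right_keys
  have h0 := I.le_ab; grind

lemma isN_down (I : Interval Q z a b c d) (hz : IsHatWord Q z) (h : ¬ (c ≤ (j : ℕ) ∧ (j : ℕ) ≤ d))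
    (h' : (∃ κ, wordSide hz j s = .inn κ) ∨ ∃ κ, wordSide hz j s = .out κ ∧
    (c ≤ (hTgt hz κ.1 : ℕ) ∧ (hTgt hz κ.1 : ℕ) ≤ d)) : wordSide hz j (!s) = .free ∨ ∃ κ, wordSide hz
    j (!s) = .out κ ∧ ¬ (c ≤ (hTgt hz κ.1 : ℕ) ∧ (hTgt hz κ.1 : ℕ) ≤ d) := by
  have h1 := I.left_keys; have h2 := I.right_keys; have h0 := I.le_cd
  have hp : ∀ s e, wordSide hz j s ≠ .pun e := by
    intro s e he; rcases I.pun_view hz he with h3 | h3 <;> omega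
  cases s
  · have h3 : ¬ (j : ℕ) < c := by
      intro h3; rcases h' with ⟨κ, h4⟩ | ⟨κ, h4, h5⟩
      · rcases wordSide_left_view I.isString hz j with
          ⟨κ1, h6, -⟩ | ⟨κ1, h6, h7, h8, h9⟩ | ⟨-, -, ⟨e, -, -, h6⟩ | ⟨-, h6⟩⟩ <;> rw [h4] at h6
        · cases h6
        · grind
        · cases h6
        · cases h6
      · rcases wordSide_left_view I.isString hz j with
          ⟨κ1, h6, h7, h8, h9⟩ | ⟨κ1, h6, -⟩ | ⟨-, -, ⟨e, -, -, h6⟩ | ⟨-, h6⟩⟩ <;> rw [h4] at h6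
        · cases h6; omega
        · cases h6
        · cases h6
        · cases h6
    rcases wordSide_right_view I.isString hz j with
      ⟨κ1, h6, h7, h8, h9⟩ | ⟨κ1, h6, h7, h8, h9⟩ | ⟨-, -, ⟨e, -, -, h6⟩ | ⟨-, h6⟩⟩
    · grind
    · grind
    · grind
    · exact .inl h6
  · have h3 : (j : ℕ) < c := by
      by_contra h3; rcases h' with ⟨κ, h4⟩ | ⟨κ, h4, h5⟩
      · rcases wordSide_right_view I.isString hz j with
          ⟨κ1, h6, -⟩ | ⟨κ1, h6, h7, h8, h9⟩ | ⟨-, -, ⟨e, -, -, h6⟩ | ⟨-, h6⟩⟩ <;> rw [h4] at h6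
        · cases h6
        · grind
        · cases h6
        · cases h6
      · rcases wordSide_right_view I.isString hz j with
          ⟨κ1, h6, h7, h8, h9⟩ | ⟨κ1, h6, -⟩ | ⟨-, -, ⟨e, -, -, h6⟩ | ⟨-, h6⟩⟩ <;> rw [h4] at h6
        · cases h6; omega
        · cases h6
        · cases h6
        · cases h6
    rcases wordSide_left_view I.isString hz j with
      ⟨κ1, h6, h7, h8, h9⟩ | ⟨κ1, h6, h7, h8, h9⟩ | ⟨-, -, ⟨e, -, -, h6⟩ | ⟨-, h6⟩⟩
    · grind
    · grind
    · grind
    · exact .inl h6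

/-- The diagram which contains the diagrams of the word `x` and of its translate `y`. -/
def diagram (I : Interval Q z a b c d) : Diagram Q (Pos z) (WordEdge z) :=
  wordDiagram (.inl I.isString) (fun j => a ≤ (j : ℕ) ∧ (j : ℕ) ≤ b)
    (fun j => c ≤ (j : ℕ) ∧ (j : ℕ) ≤ d)
    (fun j => ¬ (a ≤ (j : ℕ) ∧ (j : ℕ) ≤ b) ∧ ((j : ℕ) = 0 ∨ (j : ℕ) + 2 = z.length))
    (I.isM_edge _) (I.isM_ordinary _)
    (fun {j s} h h' e => by
      rcases I.free_view _ h' with ⟨h1, h2⟩ | ⟨h1, h2⟩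
      · omega
      · exact h2 e)
    (I.isM_tail _)
    (fun {j s e} h => by
      have h0 := I.le_ab
      have h1 := I.pun_view _ h
      omega)
    (I.isM_two _) (fun _ h => h.1)
    (fun j h => by
      have h1 := I.left_keys
      have h2 := I.right_keys
      have h3 := I.le_ab
      have h4 := I.le_b
      have h5 := I.le_cd
      have h6 := I.le_of_fin j
      omega)
    (I.top_tgt _)
    (fun {j s} h h' => by
      have h3 := I.le_ab
      have h4 := I.le_b
      by_contra h5
      have key : ∀ s, wordSide (.inl I.isString) j s = .free ∨
          (s = false ∧ 0 < (j : ℕ)) ∨ (s = true ∧ (j : ℕ) + 2 < z.length) := by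
        intro s
        cases s
        · rcases wordSide_left_view I.isString (.inl I.isString) j with
            ⟨_, -, -, h6, -⟩ | ⟨_, -, -, h6, -⟩ | ⟨-, -, ⟨e, -, -, h6⟩ | ⟨-, h6⟩⟩
          · exact .inr (.inl ⟨rfl, h6⟩)
          · exact .inr (.inl ⟨rfl, h6⟩)
          · have h7 := I.pun_view _ h6
            omega
          · exact .inl h6
        · rcases wordSide_right_view I.isString (.inl I.isString) j with
            ⟨_, -, -, h6, -⟩ | ⟨_, -, -, h6, -⟩ | ⟨-, -, ⟨e, -, -, h6⟩ | ⟨-, h6⟩⟩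
          · exact .inr (.inr ⟨rfl, h6⟩)
          · exact .inr (.inr ⟨rfl, h6⟩)
          · have h7 := I.pun_view _ h6
            omega
          · exact .inl h6
      have h6 := (key s).resolve_left h'
      have h7 := (key (!s)).resolve_left h5
      cases s <;> simp at h6 h7 <;> omega)
    (fun j h => by
      have h3 := I.le_ab
      have h4 := I.le_b
      rcases h.2 with h5 | h5
      · refine ⟨true, fun h6 => ?_⟩
        rcases I.free_view _ h6 with ⟨h7, -⟩ | ⟨h7, -⟩ <;> simp at h7 <;> omega
      · refine ⟨false, fun h6 => ?_⟩
        rcases I.free_view _ h6 with ⟨h7, -⟩ | ⟨h7, -⟩ <;> simp at h7 <;> omega)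
    (fun {j s} h h' e => by
      have h3 := I.le_ab
      have h4 := I.le_b
      rcases I.free_view _ h' with ⟨h1, h2⟩ | ⟨h1, h2⟩
      · exact h2 e
      · omega)
    (fun {j s} h h' h'' => by
      have h3 := I.le_ab
      have h4 := I.le_b
      have h5 := I.le_cd
      rcases I.free_view _ h'' with ⟨h1, h2⟩ | ⟨h1, h2⟩ <;> omega)
    (fun {j s e} h => by
      have h0 := I.le_cd
      have h1 := I.pun_view _ h
      omega)
    (I.isN_down _)
    (isOriented_of_string I.isString _ I.orient_dir I.orient_inv)

end Interval

end

/-! ### Words inside the diagram of a longer word -/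

section

lemma IsString.isHatWord {Q : SkewedGentleQuiver V E} {z : Word V E} (h : IsString Q.hat z) :
    IsHatWord Q z := Or.inl h

lemma wordType_of_left (hx : startsTrivial x = true) (h : ∃ l, x.head? = some l ∧ l.IsPunctured Q) :
    wordType Q x = .pu ∨ wordType Q x = .pp := by
  unfold wordType; rw [if_pos hx, if_pos h]; split_ifs
  exacts [.inr rfl, .inl rfl]

lemma wordType_of_right (hx : startsTrivial x = true) (h : ∃ l, x.getLast? = some l ∧ l.IsPunctured
    Q) : wordType Q x = .up ∨ wordType Q x = .pp := by
  unfold wordType; rw [if_pos hx, if_pos h]; split_ifs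
  exacts [.inr rfl, .inl rfl]

lemma isBand_src_tgt (hx : IsBand Q.hat x) (i : Fin x.length) : (∃ p, (x[i]).src Q = some p) ∧ ∃ p,
    (x[i]).tgt Q = some p := by
  have hi := i.2; have h := List.isChain_iff_getElem.1 hx.2.2; constructor
  · obtain ⟨p, h1, -⟩ := h i (by simp; omega)
    rw [List.getElem_append_left hi, hat_src] at h1; exact ⟨p, h1⟩
  · obtain ⟨p, -, h1⟩ := h (i + x.length - 1) (by simp; omega)
    have e : (i : ℕ) + x.length - 1 + 1 = i + x.length := by omega
    simp only [e] at h1; rw [List.getElem_append_right (by omega), hat_tgt] at h1; grind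

variable {j : Pos x} {s : Bool}

/-- A trivial letter beside a position only occurs in strings, at the end on this side. -/
lemma isString_of_letter (hx : IsHatWord Q x) (h : x[letterIx hx j s] = if s then Letter.triv p else
    .trivInv p) : startsTrivial x = true ∧ if s then x.getLast? = some (.triv p) else x.head? = some
    (.trivInv p) := by
  rcases hx with hx | hx
  · refine ⟨hx.startsTrivial, ?_⟩; have h1 := letterIx_eq hx hx.isHatWord j s
    have h2 := wordSide_cases hx hx.isHatWord j s
    have h3 : x[(letterIx hx.isHatWord j s : ℕ)]? = some (if s then Letter.triv p else .trivInv p) := by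
      grind
    rw [h1] at h3; rcases h2 with ⟨κ, h4, -⟩ | ⟨-, -, ⟨rfl, h4, h5⟩ | ⟨rfl, h4, h5⟩⟩
    · grind
    · simp only [Bool.false_eq_true, if_false] at h3 ⊢; rw [List.head?_eq_getElem?, ← h3, h4]
    · grind
  · exfalso; obtain ⟨⟨p1, h1⟩, ⟨p2, h2⟩⟩ := isBand_src_tgt hx (letterIx (.inr hx) j s)
    rw [h] at h1 h2; cases s
    · simp [Letter.tgt] at h2
    · simp [Letter.src] at h1

lemma chi_gen {σ : WordType} (g : σ.Gen) : WordAlg.chi k σ (WordAlg.gen k g) = WordAlg.chiGen k σ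
    g := by
  rw [WordAlg.chi, WordAlg.gen, RingQuot.liftAlgHom_mkAlgHom_apply, FreeAlgebra.lift_ι_apply]

lemma chi_bandUnit (b : Bool) (σ : WordType) : WordAlg.chi k σ (WordAlg.bandUnit k b σ)
    = WordAlg.bandUnit k b σ := by
  cases σ <;> cases b
  case b.true => exact chi_gen _
  case b.false => exact chi_gen _
  all_goals exact map_one _

lemma chi_eta (hx : IsHatWord Q x) (he : e ∈ Q.special) (h : x[letterIx hx j s] = if s then
    Letter.triv (Q.source e) else .trivInv (Q.source e)) : WordAlg.chi k (wordType Q x)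
    (eta k (wordType Q x) s) = - eta k (wordType Q x) s := by
  obtain ⟨h1, h2⟩ := isString_of_letter hx h; cases s
  · rcases wordType_of_left h1 ⟨_, h2, e, he, rfl⟩ with h3 | h3 <;> rw [h3] <;> exact chi_gen _
  · rcases wordType_of_right h1 ⟨_, h2, e, he, rfl⟩ with h3 | h3 <;> rw [h3] <;> exact chi_gen _

/-- The loop at a punctured end. -/
lemma exists_loop (σ : WordType) (hx : IsHatWord Q x) (he : e ∈ Q.special) (h : x[letterIx hx j s] =
    if s then Letter.triv (Q.source e) else .trivInv (Q.source e)) : ∃ p, IsHArrow Q x e p ∧ hSrc hx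
    p = j ∧ hTgt hx p = j ∧ arrowUnit k σ x p = eta k σ s := by
  have h1 := hTarget_letterIx hx j s; refine ⟨(letterIx hx j s, s), ?_, ?_, h1, ?_⟩
  · change (x[letterIx hx j s]).IsArrow Q s e; rw [h]; cases s <;> exact ⟨rfl, he, rfl⟩
  · cases s
    exacts [(Fin.ext (ends_eq_of_trivInv hx (letterIx hx j false).2 h)).trans h1,
      (Fin.ext (ends_eq_of_triv hx (letterIx hx j true).2 h)).symm.trans h1]
  · unfold arrowUnit; dsimp only; rw [h]; cases s <;> rfl

end

section

variable [Fintype V]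

/-- A word without unpunctured ends fills its own diagram. -/
def fullEmbedding (x : AdmWord Q) (σ : WordType) (hfree : ∀ j b, wordSide x.2.isHatWord j b ≠ .free)
    (orient : IsOriented x.2.isHatWord) : Embedding (fullDiagram x.2.isHatWord hfree orient)
    (fun _ => True) k (fun κ => arrowUnit k σ x.1 κ.1) x where
  ι := id
  injective := Function.injective_id
  mem j := ⟨fun _ => ⟨j, rfl⟩, fun _ => trivial⟩
  vertex i := (wordPol_fst x.2.isHatWord i).symm
  edge κ i i' h h' := ⟨κ.1, κ.isHArrow, h, h', rfl⟩
  no_out κ i _ h := absurd trivial h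
  no_inn κ i _ h := absurd trivial h
  pun i b e h := by
    have h : wordSide x.2.isHatWord i b = .pun e := h
    obtain ⟨h1, h2⟩ := wordSide_pun x.2.isHatWord h
    refine exists_loop σ x.2.isHatWord h1 ?_
    rw [h2]
    exact letter_eq_of_wordSide _ (fun κ h3 => by rw [h] at h3; cases h3)
      (fun κ h3 => by rw [h] at h3; cases h3)

/-- `M°_x(X^χ)` is the translate of `M°_x(X)` if both ends of `x` are punctured, or if `x` is a
band. -/
lemma isARTranslate_self (hk : (2 : k) ≠ 0) (x : AdmWord Q) {X : Type uX} [AddCommGroup X]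
    [Module k X] [Module (WordAlg k (wordType Q x.1)) X]
    [IsScalarTower k (WordAlg k (wordType Q x.1)) X] [FiniteDimensional k X]
    (hfree : ∀ j b, wordSide x.2.isHatWord j b ≠ .free) (orient : IsOriented x.2.isHatWord) :
    IsARTranslate k (R := PathAlg k Q) (WordModule k (wordType Q x.1) x X)
    (WordModule k (wordType Q x.1) x (ChiTwist k (wordType Q x.1) X)) := by
  classical
  have hletter : ∀ κ : WordEdge x.1, (∃ a, (x.1)[κ.1.1] = .dir a) ∨ ∃ a, (x.1)[κ.1.1] = .inv a := by
    grind
  refine isARTranslate_of_embedding hk (fullDiagram x.2.isHatWord hfree orient)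
    (fun κ => arrowUnit k (wordType Q x.1) x.1 κ.1)
    (fun κ => arrowUnit k (wordType Q x.1) x.1 (κ.1.1, !κ.1.2))
    (fun κ => arrowUnit_mul_reverse k _ _ _ _ (.inl rfl))
    (fun κ => ?_) (fun κ => ?_) (fun j b e h => ?_) (fun _ h => h) (fullEmbedding x _ hfree orient)
    (fullEmbedding x _ hfree orient)
  · have h := arrowUnit_mul_reverse k (wordType Q x.1) x.1 (κ.1.1, !κ.1.2) κ.1.2
      (.inl (Bool.not_not _).symm)
    exact h
  · unfold arrowUnit; rcases hletter κ with ⟨a, h⟩ | ⟨a, h⟩ <;> rw [h] <;> dsimp only <;> split_ifs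
    exacts [chi_bandUnit _ _, map_one _, chi_bandUnit _ _, map_one _]
  · have h : wordSide x.2.isHatWord j b = .pun e := h
    obtain ⟨h1, h2⟩ := wordSide_pun x.2.isHatWord h; refine chi_eta x.2.isHatWord (j := j) h1 ?_
    rw [h2]
    exact letter_eq_of_wordSide _ (fun κ h3 => by rw [h] at h3; cases h3)
      (fun κ h3 => by rw [h] at h3; cases h3)

end

section

/-- The string `x` agrees with the letters of the string `z` between the positions `a` and `b`, up
to the orientation of special arrows. -/
structure IsSubword (Q : SkewedGentleQuiver V E) (x z : Word V E) (a b : ℕ) : Prop where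
  isString : IsString Q.hat x
  length : x.length + a = b + 2
  letters : ∀ i, 0 < i → i + 1 < x.length →
    ∃ l l', x[i]? = some l ∧ z[a + i]? = some l' ∧ l.F Q = l'.F Q
  tgt : ∃ l l', x[1]? = some l ∧ z[a + 1]? = some l' ∧ l.tgt Q = l'.tgt Q

lemma F_src (h : l.src Q = some p) : (l.F Q).src Q = some p := by
  cases l with
  | dir e | inv e =>
    simp only [Letter.F]; split_ifs with h1
    · simpa only [Letter.src, loop_ends h1] using h
    · exact h
  | special e => exact h
  | triv q => simp [Letter.src] at h
  | trivInv q =>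
    simp only [Letter.F]; split_ifs with h1
    · rw [← h]; exact congrArg some (Classical.choose_spec h1).2
    · exact h

/-- The letters over the same letter of `Q` carry the same arrow, in the same direction if the
arrow is ordinary. -/
lemma isArrow_of_F {d : Bool} (hl : (∃ p, l.src Q = some p)) (hl' : ∃ p, l.tgt Q = some p)
    (hv : l.IsValid Q.hat) (h : l.F Q = (if d then Letter.dir e else .inv e).F Q) : l.IsArrow Q d e
    ∧ ((∃ a, l = .dir a) ∨ ∃ a, l = .inv a) := by
  obtain ⟨p, hl⟩ := hl; obtain ⟨q, hl'⟩ := hl'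
  cases l with
  | triv q => simp [Letter.src] at hl
  | trivInv q => simp [Letter.tgt] at hl'
  | special e => exact absurd hv (by simp [Letter.IsValid, SkewedGentleQuiver.hat])
  | dir a | inv a =>
    refine ⟨?_, by simp⟩
    cases d <;> simp only [Letter.F, Bool.false_eq_true, if_false, if_true] at h <;>
      split_ifs at h <;> cases h <;> simp_all [Letter.IsArrow]

namespace IsSubword

variable {a b : ℕ}

lemma numVertices_add (S : IsSubword Q x z a b) : numVertices x + a = b + 1 := by
  have h1 := S.length; have h2 := S.isString.numVertices_add_one; omega

lemma lt (S : IsSubword Q x z a b) (hz : IsString Q.hat z) (hb : b + 2 ≤ z.length) (i : Pos x) :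
    a + i < numVertices z := by
  have h1 := S.numVertices_add; have h2 := hz.numVertices_add_one; have := i.2; omega

/-- The position of `z` which corresponds to a position of `x`. -/
def ι (S : IsSubword Q x z a b) (hz : IsString Q.hat z) (hb : b + 2 ≤ z.length) (i : Pos x) :
    Pos z := ⟨a + i, S.lt hz hb i⟩

lemma wordPol_eq (S : IsSubword Q x z a b) (hz : IsString Q.hat z) (hb : b + 2 ≤ z.length)
    (i : Pos x) (s : Bool) : wordPol S.isString.isHatWord i s = wordPol hz.isHatWord (S.ι hz hb i)
    s := by
  have key : wordPol S.isString.isHatWord i true = wordPol hz.isHatWord (S.ι hz hb i) true := by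
    obtain ⟨i, hi⟩ := i; have hx1 := S.isString.numVertices_add_one
    cases i with
    | zero =>
      obtain ⟨l, l', h1, h2, h3⟩ := S.tgt
      have h4 := tgt_right S.isString.isHatWord (⟨0, hi⟩ : Pos x)
      have h5 := tgt_right hz.isHatWord (S.ι hz hb ⟨0, hi⟩)
      have h6 := letterIx_eq S.isString S.isString.isHatWord (⟨0, hi⟩ : Pos x) true
      have h7 := letterIx_eq hz hz.isHatWord (S.ι hz hb ⟨0, hi⟩) true
      simp only [if_true, ι] at h6 h7
      have h8 : x[letterIx S.isString.isHatWord (⟨0, hi⟩ : Pos x) true] = l := by grind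
      have h9 : z[letterIx hz.isHatWord (S.ι hz hb ⟨0, hi⟩) true] = l' := by
        have : z[(letterIx hz.isHatWord (S.ι hz hb ⟨0, hi⟩) true : ℕ)]? = some l' := by
          rw [show (letterIx hz.isHatWord (S.ι hz hb ⟨0, hi⟩) true : ℕ) = a + 1 from h7]; exact h2
        grind
      grind
    | succ i =>
      obtain ⟨l, l', h1, h2, h3⟩ := S.letters (i + 1) (by omega) (by omega)
      have h4 := src_left S.isString.isHatWord (⟨i + 1, hi⟩ : Pos x)
      have h5 := src_left hz.isHatWord (S.ι hz hb ⟨i + 1, hi⟩)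
      have h6 := letterIx_eq S.isString S.isString.isHatWord (⟨i + 1, hi⟩ : Pos x) false
      have h7 := letterIx_eq hz hz.isHatWord (S.ι hz hb ⟨i + 1, hi⟩) false
      simp only [Bool.false_eq_true, if_false, ι] at h6 h7
      have h8 : x[letterIx S.isString.isHatWord (⟨i + 1, hi⟩ : Pos x) false] = l := by grind
      have h9 : z[letterIx hz.isHatWord (S.ι hz hb ⟨i + 1, hi⟩) false] = l' := by
        have : z[(letterIx hz.isHatWord (S.ι hz hb ⟨i + 1, hi⟩) false : ℕ)]? = some l' := by
          rw [show (letterIx hz.isHatWord (S.ι hz hb ⟨i + 1, hi⟩) false : ℕ) = a + (i + 1) from h7]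
          exact h2
        grind
      rw [h8] at h4; rw [h9] at h5; have h10 := F_src h4
      rw [h3, F_src h5, Option.some.injEq] at h10; have h11 := congrArg flip h10
      rw [← wordPol_not, ← wordPol_not] at h11; exact h11.symm
  cases s
  · have h1 := congrArg flip key; rw [← wordPol_not, ← wordPol_not] at h1; exact h1
  · exact key

lemma hTarget_val (hx : IsString Q.hat x) {m : ℕ} (h0 : 0 < m) (h1 : m + 1 < x.length) (d : Bool) :
    (hTarget hx.isHatWord (⟨m, by omega⟩ : Fin x.length) d : ℕ) = if d then m - 1 else m := by
  cases d <;> simp only [hTarget, leftEnd, rightEnd, hx.startsTrivial, if_true,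
    Bool.false_eq_true, if_false]
  omega

lemma exists_hArrow (S : IsSubword Q x z a b) (hz : IsString Q.hat z) (hb : b + 2 ≤ z.length)
    (σ : WordType) (κ : WordEdge z) (i i' : Pos x) (h : hSrc hz.isHatWord κ.1 = S.ι hz hb i)
    (h' : hTgt hz.isHatWord κ.1 = S.ι hz hb i') : ∃ p, IsHArrow Q x κ.arrow p ∧ hSrc
    S.isString.isHatWord p = i ∧ hTgt S.isString.isHatWord p = i' ∧ arrowUnit k σ x p = 1 := by
  have hx := S.isString; have hx1 := hx.numVertices_add_one; have h1 := congrArg Fin.val h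
  have h2 := congrArg Fin.val h'; simp only [ι] at h1 h2
  obtain ⟨m, hm0, hm1, hm, h3, h4⟩ : ∃ m : ℕ, 0 < m ∧ m + 1 < x.length ∧ (κ.1.1 : ℕ) = a + m ∧
      (if κ.1.2 then m else m - 1) = i ∧ (if κ.1.2 then m - 1 else m) = i' := by
    have h5 := κ.view hz hz.isHatWord
    rcases h5 with ⟨-, -, ⟨h5, -, -, h6, h7⟩ | ⟨h5, -, -, h6, h7⟩⟩
    · exact ⟨i, by omega, by omega, by omega, by rw [h5]; simp, by rw [h5]; simp; omega⟩
    · exact ⟨i', by omega, by omega, by omega, by rw [h5]; simp; omega, by rw [h5]; simp⟩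
  have hm2 : m < x.length := by omega
  have hlet : ((x[m]).IsArrow Q κ.1.2 κ.arrow) ∧ ((∃ e, x[m] = .dir e) ∨ ∃ e, x[m] = .inv e) := by
    obtain ⟨l, l', g1, g2, g3⟩ := S.letters m hm0 hm1
    rw [List.getElem?_eq_getElem hm2, Option.some.injEq] at g1
    rw [← hm, κ.getElem?_eq, Option.some.injEq] at g2; subst g1 g2
    have hc := List.isChain_iff_getElem.1 hx.1.2
    refine isArrow_of_F ?_ ?_ (hx.1.1 _ (List.getElem_mem hm2)) g3
    · obtain ⟨p, g4, -⟩ := hc m (by omega); exact ⟨p, (hat_src _).symm.trans g4⟩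
    · obtain ⟨p, -, g4⟩ := hc (m - 1) (by omega); have e : m - 1 + 1 = m := by omega
      simp only [e] at g4; exact ⟨_, (hat_tgt _).symm.trans g4⟩
  refine ⟨(⟨m, hm2⟩, κ.1.2), hlet.1, Fin.ext ?_, Fin.ext ?_, ?_⟩
  · refine (hTarget_val hx hm0 hm1 (!κ.1.2)).trans ?_; grind
  · rw [hTarget_val hx hm0 hm1, ← h4]
  · unfold arrowUnit; grind

lemma letter_end (hx : IsString Q.hat x) {i : Pos x} {s : Bool} (h : if s then (i : ℕ) + 2 =
    x.length else (i : ℕ) = 0) : x[letterIx hx.isHatWord i s] = if s then Letter.triv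
    (wordPol hx.isHatWord i s) else .trivInv (wordPol hx.isHatWord i s) := by
  have h1 := letterIx_eq hx hx.isHatWord i s; have h2 := letterIx hx.isHatWord i s; have h3 := i.2
  have h4 := hx.numVertices_add_one; obtain ⟨-, ⟨p, hp⟩, ⟨q, hq⟩⟩ := id hx
  refine letter_eq_of_wordSide hx.isHatWord (fun κ h5 => ?_) (fun κ h5 => ?_)
  · have h6 := κ.pos_of_string hx; rw [wordSide_out _ h5] at h6; grind
  · have h6 := κ.pos_of_string hx; rw [wordSide_inn _ h5] at h6; grind

lemma no_out (S : IsSubword Q x z a b) (hz : IsString Q.hat z) (hb : b + 2 ≤ z.length)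
    (κ : WordEdge z) (i : Pos x) (h : hSrc hz.isHatWord κ.1 = S.ι hz hb i)
    (h' : ¬ (a ≤ (hTgt hz.isHatWord κ.1 : ℕ) ∧ (hTgt hz.isHatWord κ.1 : ℕ) ≤ b))
    (ha : κ.arrow ∉ Q.special) (p : Fin x.length × Bool) (hp : IsHArrow Q x κ.arrow p) :
    hSrc S.isString.isHatWord p ≠ i := by
  intro h0; have hx := S.isString; have hlen := S.length; have hx1 := hx.numVertices_add_one
  have h1 := congrArg Fin.val h; have h2 := κ.view hz hz.isHatWord; have hi := i.2
  have hs := (wordSide_of_out hz.isHatWord (wordSide_src hz.isHatWord κ)).2.2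
  rw [h, ← S.wordPol_eq hz hb] at hs
  have hend : if (!κ.1.2) then (i : ℕ) + 2 = x.length else (i : ℕ) = 0 := by
    simp only [ι] at h1; grind
  have hl := letter_end hx hend
  obtain ⟨g1, g2, g3⟩ := Classical.choose_spec (exists_pol hx.isHatWord i)
  have e1 : wordPol hx.isHatWord i true = Classical.choose (exists_pol hx.isHatWord i) := rfl
  rw [← e1] at g2 g3
  rcases arrow_out hx.isHatWord ha hp h0 g2 g3 with ⟨-, k1, k2, k3⟩ | ⟨-, k1, k2, k3⟩
  · cases hd : κ.1.2
    · rw [hd] at hs; exact flip_ne _ (k3.trans hs)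
    · rw [hd] at hl; have e2 : letterIx hx.isHatWord i (!true) = p.1 := Fin.ext k2.symm; grind
  · cases hd : κ.1.2
    · rw [hd] at hl; have e2 : letterIx hx.isHatWord i (!false) = p.1 := Fin.ext k2.symm; grind
    · rw [hd] at hs
      have h3 : wordPol hx.isHatWord i (!true) = flip (wordPol hx.isHatWord i true) :=
        wordPol_not _ _ _
      rw [hs, h3] at k3; exact flip_ne _ k3.symm

lemma no_inn (S : IsSubword Q x z a b) (hz : IsString Q.hat z) (hb : b + 2 ≤ z.length)
    (κ : WordEdge z) (i : Pos x) (h : hTgt hz.isHatWord κ.1 = S.ι hz hb i)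
    (h' : ¬ (a ≤ (hSrc hz.isHatWord κ.1 : ℕ) ∧ (hSrc hz.isHatWord κ.1 : ℕ) ≤ b))
    (ha : κ.arrow ∉ Q.special) (p : Fin x.length × Bool) (hp : IsHArrow Q x κ.arrow p) :
    hTgt S.isString.isHatWord p ≠ i := by
  intro h0; have hx := S.isString; have hlen := S.length; have hx1 := hx.numVertices_add_one
  have h1 := congrArg Fin.val h; have h2 := κ.view hz hz.isHatWord; have hi := i.2
  have hs := (wordSide_of_inn hz.isHatWord (wordSide_tgt hz.isHatWord κ)).2.2
  rw [h, ← S.wordPol_eq hz hb] at hs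
  have hend : if κ.1.2 then (i : ℕ) + 2 = x.length else (i : ℕ) = 0 := by simp only [ι] at h1; grind
  have hl := letter_end hx hend
  obtain ⟨g1, g2, g3⟩ := Classical.choose_spec (exists_pol hx.isHatWord i)
  have e1 : wordPol hx.isHatWord i true = Classical.choose (exists_pol hx.isHatWord i) := rfl
  rw [← e1] at g2 g3; have hp' : (x[p.1]).IsArrow Q p.2 κ.arrow := hp
  have h3 : wordPol hx.isHatWord i false = flip (wordPol hx.isHatWord i true) :=
    wordPol_not _ i true
  rcases arrow_in hx.isHatWord hp h0 g2 g3 with ⟨-, k2, k3⟩ | ⟨-, k2, k3⟩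
  · cases hd : κ.1.2
    · rw [hd, h3] at hs; exact flip_ne _ (hs.symm.trans k3.symm)
    · rw [hd] at hl; have e2 : letterIx hx.isHatWord i true = p.1 := Fin.ext k2.symm
      have hl' := (congrArg (fun m : Fin x.length => x[m]) e2).symm.trans hl; rw [hl'] at hp'
      exact ha hp'.2.1
  · cases hd : κ.1.2
    · rw [hd] at hl; have e2 : letterIx hx.isHatWord i false = p.1 := Fin.ext k2.symm
      have hl' := (congrArg (fun m : Fin x.length => x[m]) e2).symm.trans hl; rw [hl'] at hp'
      exact ha hp'.2.1
    · rw [hd] at hs; exact flip_ne _ (k3.trans hs)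

end IsSubword

variable [Fintype V]

variable {a b c d : ℕ} {x : AdmWord Q}

/-- A string which agrees with a part of `z` is embedded in the diagram of `z`, if it contains the
punctured ends of `z`, and if only ordinary arrows leave it. -/
def IsSubword.embedding (I : Interval Q z a b c d) {a' b' : ℕ} (S : IsSubword Q x.1 z a' b')
    (hb : b' + 2 ≤ z.length) (σ : WordType) (hout : ∀ κ : WordEdge z,
    (a' ≤ (hSrc I.isString.isHatWord κ.1 : ℕ) ∧ (hSrc I.isString.isHatWord κ.1 : ℕ) ≤ b')
    → ¬ (a' ≤ (hTgt I.isString.isHatWord κ.1 : ℕ) ∧ (hTgt I.isString.isHatWord κ.1 : ℕ) ≤ b')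
    → κ.arrow ∉ Q.special) (hinn : ∀ κ : WordEdge z, (a' ≤ (hTgt I.isString.isHatWord κ.1 : ℕ) ∧
    (hTgt I.isString.isHatWord κ.1 : ℕ) ≤ b') → ¬ (a' ≤ (hSrc I.isString.isHatWord κ.1 : ℕ)
    ∧ (hSrc I.isString.isHatWord κ.1 : ℕ) ≤ b') → κ.arrow ∉ Q.special)
    (hpun : ∀ (j : Pos z) (s : Bool) (e : E), wordSide I.isString.isHatWord j s = .pun e →
    (s = false ∧ (j : ℕ) = 0 ∧ a' = 0) ∨ (s = true ∧ (j : ℕ) + 2 = z.length ∧ b' + 2 = z.length)) :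
    Embedding I.diagram (fun j => a' ≤ (j : ℕ) ∧ (j : ℕ) ≤ b') k (fun _ => (1 : WordAlg k σ))
    x where
  ι := S.ι I.isString hb
  injective i i' h := by
    have h1 := congrArg Fin.val h
    simp only [IsSubword.ι] at h1
    exact Fin.ext (by omega)
  mem j := by
    have h1 := S.numVertices_add
    constructor
    · intro h
      exact ⟨⟨j - a', by omega⟩, Fin.ext (by simp only [IsSubword.ι]; omega)⟩
    · rintro ⟨i, rfl⟩
      have := i.2
      simp only [IsSubword.ι]
      omega
  vertex i := by
    rw [← wordPol_fst]
    exact congrArg Prod.fst (S.wordPol_eq I.isString hb i true)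
  edge κ i i' h h' := S.exists_hArrow I.isString hb σ κ i i' h h'
  no_out κ i h h' p hp := by
    refine S.no_out I.isString hb κ i h h' (hout κ ?_ h') p hp
    have h1 := congrArg Fin.val h
    have h2 := S.numVertices_add
    have h3 := i.2
    have h4 : (hSrc I.isString.isHatWord κ.1 : ℕ) = a' + i := h1
    omega
  no_inn κ i h h' p hp := by
    refine S.no_inn I.isString hb κ i h h' (hinn κ ?_ h') p hp
    have h1 := congrArg Fin.val h
    have h2 := S.numVertices_add
    have h3 := i.2
    have h4 : (hTgt I.isString.isHatWord κ.1 : ℕ) = a' + i := h1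
    omega
  pun i s e h := by
    have h : wordSide I.isString.isHatWord (S.ι I.isString hb i) s = .pun e := h
    obtain ⟨h1, h2⟩ := wordSide_pun _ h
    have h3 := hpun _ _ _ h
    have h4 := S.numVertices_add
    have h5 := S.isString.numVertices_add_one
    refine exists_loop σ S.isString.isHatWord h1 ?_
    rw [h2, ← S.wordPol_eq I.isString hb]
    refine IsSubword.letter_end S.isString ?_
    simp only [IsSubword.ι] at h3
    have := i.2
    rcases h3 with ⟨rfl, h6, h7⟩ | ⟨rfl, h6, h7⟩ <;> simp <;> omega

lemma Interval.isN_ordinary (I : Interval Q z a b c d) (hz : IsHatWord Q z) (κ : WordEdge z)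
    (h : c ≤ (hTgt hz κ.1 : ℕ) ∧ (hTgt hz κ.1 : ℕ) ≤ d)
    (h' : ¬ (c ≤ (hSrc hz κ.1 : ℕ) ∧ (hSrc hz κ.1 : ℕ) ≤ d)) : κ.arrow ∉ Q.special := by
  obtain ⟨h1, h2, h3⟩ := κ.view I.isString hz; obtain ⟨p, -, hl⟩ := I.left
  obtain ⟨q, -, hr⟩ := I.right; grind

/-- The module of the string `y` is the translate of the module of `x` if both are parts of a word
`z` in the relative position given by `Interval`. -/
lemma Interval.isARTranslate (hk : (2 : k) ≠ 0) (I : Interval Q z a b c d) {y : AdmWord Q}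
    (S : IsSubword Q x.1 z a b) (S' : IsSubword Q y.1 z c d) {X : Type uX} [AddCommGroup X]
    [Module k X] [Module (WordAlg k (wordType Q x.1)) X]
    [IsScalarTower k (WordAlg k (wordType Q x.1)) X] [FiniteDimensional k X] : IsARTranslate k
    (R := PathAlg k Q) (WordModule k (wordType Q x.1) x X) (WordModule k (wordType Q x.1) y
    (ChiTwist k (wordType Q x.1) X)) := by
  classical
  refine isARTranslate_of_embedding hk I.diagram (fun _ => 1) (fun _ => 1) (fun _ => one_mul 1)
    (fun _ => one_mul 1) (fun _ => map_one _) (fun j s e h => ?_) (I.isN_edge I.isString.isHatWord)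
    (S.embedding I I.le_b _ (I.isM_ordinary _) (fun κ h h' => absurd (I.isM_edge _ κ h) h')
      fun j s e h => ?_)
    (S'.embedding I I.le_d _ (fun κ h h' => absurd (I.isN_edge _ κ h) h') (I.isN_ordinary _)
      fun j s e h => ?_)
  · have h : wordSide I.isString.isHatWord j s = .pun e := h; obtain ⟨h1, h2⟩ := wordSide_pun _ h
    have h3 := I.pun_view I.isString.isHatWord h; have h4 := S.numVertices_add
    have h5 := S.isString.numVertices_add_one
    have h6 : a ≤ (j : ℕ) ∧ (j : ℕ) ≤ b := by have := I.le_ab; omega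
    let i : Pos x.1 := ⟨j - a, by omega⟩
    have hi : S.ι I.isString I.le_b i = j := Fin.ext (by simp only [IsSubword.ι, i]; omega)
    refine chi_eta (j := i) S.isString.isHatWord h1 ?_
    rw [h2, ← hi, ← S.wordPol_eq I.isString I.le_b]; refine IsSubword.letter_end S.isString ?_
    grind
  · rcases I.pun_view I.isString.isHatWord h with h1 | h1
    · grind
    · grind
  · rcases I.pun_view I.isString.isHatWord h with h1 | h1
    · grind
    · grind

end

/-! ### The order on words -/

section

/-- The sequence `A` is smaller than `B` in the lexicographic order, and `m` is the first place where
they differ. -/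
def FirstLt (m : ℕ) (A B : List ℕ) : Prop :=
  A.take m = B.take m ∧ ∃ x y, A[m]? = some x ∧ B[m]? = some y ∧ x < y

variable {A B P : List ℕ} {m n : ℕ}

lemma FirstLt.irrefl : ¬ FirstLt m A A := by rintro ⟨-, x, y, h1, h2, h3⟩; grind

lemma take_eq_of_le (h : n ≤ m) (h' : A.take m = B.take m) : A.take n = B.take n := by
  have := congrArg (List.take n) h'; grind

lemma getElem?_eq_of_lt (h : n < m) (h' : A.take m = B.take m) : A[n]? = B[n]? := by
  have := congrArg (fun l => l[n]?) h'; grind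

lemma FirstLt.trans {C : List ℕ} (h : FirstLt m A B) (h' : FirstLt n B C) : ∃ l, FirstLt l A C := by
  obtain ⟨h1, x, y, h2, h3, h4⟩ := h; obtain ⟨g1, x', y', g2, g3, g4⟩ := h'
  rcases Nat.lt_trichotomy m n with h5 | rfl | h5
  · exact ⟨m, h1.trans (take_eq_of_le h5.le g1), x, y, h2,
      (getElem?_eq_of_lt h5 g1).symm.trans h3, h4⟩
  · rw [h3] at g2; cases g2; exact ⟨m, h1.trans g1, x, y', h2, g3, by omega⟩
  · exact ⟨n, (take_eq_of_le h5.le h1).trans g1, x', y', (getElem?_eq_of_lt h5 h1).trans g2, g3, g4⟩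

lemma FirstLt.asymm (h : FirstLt m A B) (h' : FirstLt n B A) : False := by
  obtain ⟨l, hl⟩ := h.trans h'; exact hl.irrefl

lemma firstLt_append : FirstLt m (P ++ A) (P ++ B) ↔ ∃ m', m = P.length + m' ∧ FirstLt m' A B := by
  constructor
  · rintro ⟨h1, x, y, h2, h3, h4⟩; by_cases hm : m < P.length
    · grind
    · refine ⟨m - P.length, by omega, ?_, x, y, ?_, ?_, h4⟩
      · rw [List.take_append, List.take_append] at h1; exact List.append_cancel_left h1
      · grind
      · grind
  · rintro ⟨m', rfl, h1, x, y, h2, h3, h4⟩; refine ⟨?_, x, y, ?_, ?_, h4⟩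
    · rw [List.take_length_add_append, List.take_length_add_append, h1]
    · grind
    · grind

lemma firstLt_take (h : FirstLt m (A.take n) (B.take n)) : m < n ∧ FirstLt m A B := by
  obtain ⟨h1, x, y, h2, h3, h4⟩ := h
  have hm : m < n := by grind
  refine ⟨hm, ?_, x, y, ?_, ?_, h4⟩
  · grind
  · grind
  · grind

lemma FirstLt.cons (x : ℕ) (h : FirstLt m A B) : FirstLt (m + 1) (x :: A) (x :: B) := by
  have := (firstLt_append (P := [x])).2 ⟨m, rfl, h⟩; grind

lemma firstLt_zero {x y : ℕ} (h : x < y) (A B : List ℕ) : FirstLt 0 (x :: A) (y :: B) :=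
  ⟨rfl, x, y, rfl, rfl, h⟩

lemma firstLt_trichotomy (h : A.length = B.length) : A = B ∨ (∃ m, FirstLt m A B) ∨ ∃ m,
    FirstLt m B A := by
  induction A generalizing B with
  | nil => exact .inl (List.length_eq_zero_iff.1 h.symm).symm
  | cons x A ih =>
    cases B with
    | nil => cases h
    | cons y B =>
      rcases Nat.lt_trichotomy x y with h1 | rfl | h1
      · exact .inr (.inl ⟨0, firstLt_zero h1 A B⟩)
      · rcases ih (by simpa using h) with rfl | ⟨m, h1⟩ | ⟨m, h1⟩
        exacts [.inl rfl, .inr (.inl ⟨_, h1.cons x⟩), .inr (.inr ⟨_, h1.cons x⟩)]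
      · exact .inr (.inr ⟨0, firstLt_zero h1 B A⟩)

/-- Translation by a non-trivial common prefix makes two sequences agree up to their first
difference, so it cannot reverse their position relative to each other. -/
lemma not_firstLt_of_prefix (hP : P ≠ []) (h : FirstLt m A B) (h1 : ∀ n ≤ m, ¬ FirstLt n (P ++ A) B)
    (h2 : ∀ n ≤ m, ¬ FirstLt n A (P ++ B)) : False := by
  have hl : 0 < P.length := by grind
  obtain ⟨h3, x, y, h4, h5, h6⟩ := id h; have hA : m < A.length := by grind
  have hB : m < B.length := by grind
  have hC : (P ++ A).take (m + 1) = (P ++ B).take (m + 1) := by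
    rw [List.take_append, List.take_append, take_eq_of_le (by omega) h3]
  have hab : FirstLt m (A.take (m + 1)) (B.take (m + 1)) := by
    refine ⟨?_, x, y, ?_, ?_, h6⟩
    · grind
    · grind
    · grind
  have k1 : (P ++ A).take (m + 1) = B.take (m + 1) ∨
      ∃ n, FirstLt n (B.take (m + 1)) ((P ++ A).take (m + 1)) := by
    rcases firstLt_trichotomy (A := (P ++ A).take (m + 1)) (B := B.take (m + 1))
      (by simp; omega) with h7 | ⟨n, h7⟩ | h7
    · exact .inl h7
    · obtain ⟨h8, h9⟩ := firstLt_take h7; grind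
    · exact .inr h7
  have k2 : (P ++ A).take (m + 1) = A.take (m + 1) ∨
      ∃ n, FirstLt n ((P ++ A).take (m + 1)) (A.take (m + 1)) := by
    rcases firstLt_trichotomy (A := (P ++ A).take (m + 1)) (B := A.take (m + 1))
      (by simp; omega) with h7 | h7 | ⟨n, h7⟩
    · exact .inl h7
    · exact .inr h7
    · rw [hC] at h7; obtain ⟨h8, h9⟩ := firstLt_take h7; grind
  rcases k1 with k1 | ⟨n1, k1⟩ <;> rcases k2 with k2 | ⟨n2, k2⟩
  · rw [← k1, ← k2] at hab; exact hab.irrefl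
  · rw [k1] at k2; exact hab.asymm k2
  · rw [k2] at k1; exact hab.asymm k1
  · obtain ⟨n, k3⟩ := k1.trans k2; exact hab.asymm k3

end

section

/-- The sequence of keys of a word. -/
def keys (t : Word V E) : List ℕ := t.map Letter.key

/-- Words which start at the polarized vertex `p` and are right inextensible. -/
inductive Tail (Q : SkewedGentleQuiver V E) : V × ℤˣ → Word V E → Prop
  | triv (p : V × ℤˣ) : Tail Q p [.triv p]
  | cons {p q : V × ℤˣ} {l : Letter V E} {t : Word V E} :
      l.tgt Q = some p → l.src Q = some q → Tail Q (flip q) t → Tail Q p (l :: t)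

/-- In the set `S` of letters, a letter is determined by its target and its key. -/
def Separates (Q : SkewedGentleQuiver V E) (S : Letter V E → Prop) : Prop :=
  ∀ ⦃l l' : Letter V E⦄ ⦃p : V × ℤˣ⦄, S l → S l' → l.tgt Q = some p → l'.tgt Q = some p →
    l.key = l'.key → l = l'

/-- The letters which occur in the words of the associated gentle quiver without punctured ends, or
as the middle letter of a symmetric string. -/
def Letter.IsMixed (Q : SkewedGentleQuiver V E) : Letter V E → Prop
  | .triv p => ∀ e ∈ Q.special, Q.source e ≠ p
  | .trivInv p => ∀ e ∈ Q.special, Q.source e ≠ p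
  | .special e => e ∈ Q.special
  | _ => True

lemma separates_isMixed : Separates Q (Letter.IsMixed Q) := by
  intro l l' p h h' hp hp' hk
  cases l <;> cases l' <;>
    simp only [Letter.key, Letter.tgt, Letter.IsMixed, Option.some.injEq, reduceCtorEq,
      OfNat.zero_ne_ofNat, OfNat.ofNat_ne_zero, zero_ne_one, one_ne_zero, OfNat.ofNat_ne_one,
      OfNat.one_ne_ofNat] at h h' hp hp' hk
  · exact congrArg _ (Q.target_injective (hp.trans hp'.symm))
  · exact congrArg _ (Q.source_injective (hp.trans hp'.symm))
  · exact congrArg _ (Q.target_injective (hp.trans hp'.symm))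
  · exact absurd ((loop_ends h).trans (hp.trans hp'.symm)) (h' _ h)
  · exact absurd ((loop_ends h').trans (hp'.trans hp.symm)) (h _ h')
  · grind

lemma Letter.IsValid.isMixed (h : l.IsValid Q) : l.IsMixed Q := by cases l <;> trivial

lemma separates_isValid : Separates Q (Letter.IsValid Q) :=
  fun _ _ _ h h' => separates_isMixed h.isMixed h'.isMixed

lemma separates_isValid_hat : Separates Q (Letter.IsValid Q.hat) := by
  intro l l' p h h' hp hp' hk; rw [← hat_tgt] at hp hp'; exact separates_isValid h h' hp hp' hk

variable {l' : Letter V E} {S : Letter V E → Prop}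

lemma Letter.Lt.key_lt (h : Letter.Lt Q l l') : l.key < l'.key := by
  obtain ⟨-, h⟩ := h; cases l <;> cases l' <;> simp [Letter.key] at h ⊢

lemma Letter.lt_of_key_lt (hl : l.IsValid Q) (hl' : l'.IsValid Q) (h : l.tgt Q = some p)
    (h' : l'.tgt Q = some p) (hk : l.key < l'.key) : Letter.Lt Q l l' := by
  refine ⟨h.trans h'.symm, ?_⟩
  cases l <;> cases l' <;> simp only [Letter.key, Letter.tgt, Letter.IsValid, Option.some.injEq,
    reduceCtorEq, Nat.lt_irrefl, Nat.not_lt_zero, Nat.lt_one_iff, OfNat.ofNat_ne_zero] at hl hl' h h' hk ⊢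
  · exact hl (by rwa [Q.target_injective (h.trans h'.symm)])
  · exact hl' (by
      rwa [Q.source_injective (h'.trans (h.symm.trans (loop_ends hl).symm))])

lemma WordLt.exists_firstLt {v : Word V E} (h : WordLt Q v w) : ∃ m, FirstLt m (keys v)
    (keys w) := by
  obtain ⟨u, x, y, v', w', rfl, rfl, h⟩ := h; refine ⟨u.length, ?_⟩
  have h1 := (firstLt_append (P := keys u)).2 ⟨0, rfl, firstLt_zero h.key_lt (keys v') (keys w')⟩
  simpa [keys] using h1

lemma Tail.ne_nil (h : Tail Q p t) : t ≠ [] := by cases h <;> simp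

/-- Two right inextensible words with the same start either agree or differ at some place in their
keys. -/
lemma Tail.trichotomy (hS : Separates Q S) (h : Tail Q p t) (h' : Tail Q p t') (ht : ∀ l ∈ t, S l)
    (ht' : ∀ l ∈ t', S l) : t = t' ∨ (∃ m, FirstLt m (keys t) (keys t')) ∨ ∃ m, FirstLt m (keys t')
    (keys t) := by
  have key : ∀ {l l' : Letter V E} {q : V × ℤˣ} (t t' : Word V E), S l → S l' →
      l.tgt Q = some q → l'.tgt Q = some q →
      l = l' ∨ (∃ m, FirstLt m (keys (l :: t)) (keys (l' :: t'))) ∨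
        ∃ m, FirstLt m (keys (l' :: t')) (keys (l :: t)) := by
    intro l l' q t t' hl hl' hq hq'; rcases Nat.lt_trichotomy l.key l'.key with h1 | h1 | h1
    exacts [.inr (.inl ⟨0, firstLt_zero h1 _ _⟩), .inl (hS hl hl' hq hq' h1), .inr (.inr ⟨0,
      firstLt_zero h1 _ _⟩)]
  induction h generalizing t' with
  | triv p =>
    cases h' with
    | triv _ => exact .inl rfl
    | @cons p q l t' h1 h2 h3 =>
      rcases key [] t' (ht (.triv p) (by simp)) (ht' l (by simp)) rfl h1 with rfl | h4
      · simp [Letter.src] at h2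
      · exact .inr h4
  | @cons p q l t h1 h2 h3 ih =>
    cases h' with
    | triv _ =>
      rcases key t [] (ht l (by simp)) (ht' (.triv p) (by simp)) h1 rfl with rfl | h4
      · simp [Letter.src] at h2
      · exact .inr h4
    | @cons p q' l' t' h1' h2' h3' =>
      rcases key t t' (ht l (by simp)) (ht' l' (by simp)) h1 h1' with rfl | h4
      · rw [h2] at h2'; cases h2'
        rcases ih h3' (fun l hl => ht l (by simp [hl])) (fun l hl => ht' l (by simp [hl])) with
          rfl | ⟨m, h4⟩ | ⟨m, h4⟩
        exacts [.inl rfl, .inr (.inl ⟨_, h4.cons _⟩), .inr (.inr ⟨_, h4.cons _⟩)]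
      · exact .inr h4

/-- The first difference of two right inextensible words with the same start. -/
lemma Tail.exists_split (hS : Separates Q S) (h : Tail Q p t) (h' : Tail Q p t') (ht : ∀ l ∈ t, S l)
    (ht' : ∀ l ∈ t', S l) {m : ℕ} (hm : FirstLt m (keys t) (keys t')) : ∃ Z x y t₂ t₂' q,
    t = Z ++ x :: t₂ ∧ t' = Z ++ y :: t₂' ∧ Z.length = m ∧ x.key < y.key ∧ x.tgt Q = some q ∧ y.tgt
    Q = some q := by
  have hd : ∀ {q : V × ℤˣ} {t : Word V E}, Tail Q q t → ∃ l s, t = l :: s ∧ l.tgt Q = some q := by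
    intro q t h
    cases h with
    | triv _ => exact ⟨_, _, rfl, rfl⟩
    | cons h1 _ _ => exact ⟨_, _, rfl, h1⟩
  induction m generalizing p t t' with
  | zero =>
    obtain ⟨l, s, rfl, h1⟩ := hd h; obtain ⟨l', s', rfl, h1'⟩ := hd h'
    obtain ⟨-, x, y, h2, h3, h4⟩ := hm
    simp only [keys, List.map_cons, List.getElem?_cons_zero, Option.some.injEq] at h2 h3
    exact ⟨[], l, l', s, s', p, rfl, rfl, rfl, by omega, h1, h1'⟩
  | succ m ih =>
    obtain ⟨h1, x, y, h2, h3, h4⟩ := hm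
    cases h with
    | triv _ => simp [keys] at h2
    | @cons _ q l t g1 g2 g3 =>
      cases h' with
      | triv _ => simp [keys] at h3
      | @cons _ q' l' t' g1' g2' g3' =>
        simp only [keys, List.map_cons, List.take_succ_cons, List.cons.injEq,
          List.getElem?_cons_succ] at h1 h2 h3
        have e := hS (ht l (by simp)) (ht' l' (by simp)) g1 g1' h1.1; subst e; rw [g2] at g2'
        cases g2'
        obtain ⟨Z, a, b, t₂, t₂', r, rfl, rfl, h5, h6⟩ := ih g3 g3'
          (fun l hl => ht l (by simp [hl])) (fun l hl => ht' l (by simp [hl]))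
          ⟨h1.2, x, y, h2, h3, h4⟩
        grind

/-- The order on words is the lexicographic order on the sequences of keys. -/
lemma Tail.wordLt_iff (h : Tail Q p t) (h' : Tail Q p t') (ht : ∀ l ∈ t, l.IsValid Q)
    (ht' : ∀ l ∈ t', l.IsValid Q) : WordLt Q t t' ↔ ∃ m, FirstLt m (keys t) (keys t') := by
  refine ⟨WordLt.exists_firstLt, fun ⟨m, hm⟩ => ?_⟩
  obtain ⟨Z, x, y, t₂, t₂', q, rfl, rfl, -, h1, h2, h3⟩ :=
    h.exists_split separates_isValid h' ht ht' hm
  exact ⟨Z, x, y, t₂, t₂', rfl, rfl,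
    Letter.lt_of_key_lt (ht x (by simp)) (ht' y (by simp)) h2 h3 h1⟩

end

/-! ### Orientations of the special letters of a string -/

section

lemma Letter.symm_symm (l : Letter V E) : l.symm.symm = l := by cases l <;> rfl

lemma Letter.IsMixed.symm_src (h : l.IsMixed Q) : l.symm.src Q = l.tgt Q := by
  cases l with
  | special e => exact congrArg some (loop_ends h)
  | _ => rfl

lemma Letter.IsMixed.symm_tgt (h : l.IsMixed Q) : l.symm.tgt Q = l.src Q := by
  cases l with
  | special e => exact congrArg some (loop_ends h).symm
  | _ => rfl

lemma Letter.IsMixed.symm (h : l.IsMixed Q) : l.symm.IsMixed Q := by cases l <;> exact h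

lemma Letter.IsValid.symm (h : l.IsValid Q) : l.symm.IsValid Q := by cases l <;> exact h

lemma winv_append (u v : Word V E) : winv (u ++ v) = winv v ++ winv u := by simp [winv]

lemma winv_cons (l : Letter V E) (v : Word V E) : winv (l :: v) = winv v ++ [l.symm] := by
  simp [winv]

lemma winv_winv (u : Word V E) : winv (winv u) = u := by
  simp [winv, Function.comp_def, Letter.symm_symm]

lemma length_winv (u : Word V E) : (winv u).length = u.length := by simp [winv]

variable {u : Word V E} {S : Letter V E → Prop}

lemma mem_winv : l ∈ winv u ↔ l.symm ∈ u := by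
  simp only [winv, List.mem_reverse, List.mem_map]
  exact ⟨fun ⟨a, h, h'⟩ => by rwa [← h', a.symm_symm], fun h => ⟨_, h, l.symm_symm⟩⟩

lemma winv_split (u v : Word V E) (l : Letter V E) : winv (u ++ l :: v) = winv v ++ l.symm ::
    winv u := by simp [winv]

/-- Strings, with letters in a given set `S`. -/
structure IsStringIn (Q : SkewedGentleQuiver V E) (S : Letter V E → Prop) (X : Word V E) :
    Prop where
  mem : ∀ l ∈ X, S l
  chain : X.IsChain (Letter.Compat Q)
  head : ∃ p, X.head? = some (.trivInv p)
  last : ∃ p, X.getLast? = some (.triv p)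

lemma isString_iff : IsString Q X ↔ IsStringIn Q (Letter.IsValid Q) X :=
  ⟨fun h => ⟨h.1.1, h.1.2, h.2.1, h.2.2⟩, fun h => ⟨⟨h.mem, h.chain⟩, h.head, h.last⟩⟩

lemma compat_hat (x y : Letter V E) : Letter.Compat Q.hat x y ↔ Letter.Compat Q x y := by
  simp only [Letter.Compat, hat_src, hat_tgt]

lemma isStringIn_hat : IsStringIn Q.hat S X ↔ IsStringIn Q S X := by
  have h : Letter.Compat Q.hat = Letter.Compat Q := by funext x y; exact propext (compat_hat x y)
  constructor <;> rintro ⟨h1, h2, h3, h4⟩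
  exacts [⟨h1, h ▸ h2, h3, h4⟩, ⟨h1, h.symm ▸ h2, h3, h4⟩]

lemma Letter.Compat.symm {x y : Letter V E} (hx : x.symm.tgt Q = x.src Q) (hy : y.symm.src Q = y.tgt
    Q) (h : Letter.Compat Q x y) : Letter.Compat Q y.symm x.symm := by
  obtain ⟨p, h1, h2⟩ := h; exact ⟨flip p, hy.trans h2, hx.trans (h1.trans (by rw [flip_flip]))⟩

lemma isStringIn_winv (hS : ∀ l, S l → S l.symm) (hs : ∀ l, S l → l.symm.src Q = l.tgt Q)
    (ht : ∀ l, S l → l.symm.tgt Q = l.src Q) (h : IsStringIn Q S X) : IsStringIn Q S (winv X) := by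
  obtain ⟨h1, h2, ⟨p, h3⟩, ⟨q, h4⟩⟩ := h; refine ⟨fun l hl => ?_, ?_, ⟨q, ?_⟩, ⟨p, ?_⟩⟩
  · have := hS _ (h1 _ (mem_winv.1 hl)); rwa [l.symm_symm] at this
  · unfold winv; rw [List.isChain_reverse, List.isChain_map]
    refine List.IsChain.imp_of_mem_imp ?_ h2; intro a b ha hb hab
    exact hab.symm (ht a (h1 a ha)) (hs b (h1 b hb))
  · simp [winv, List.head?_reverse, List.getLast?_map, h4, Letter.symm]
  · simp [winv, List.head?_map, h3, Letter.symm]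

lemma isString_winv (h : IsString Q X) : IsString Q (winv X) :=
  isString_iff.2 (isStringIn_winv (fun _ h => h.symm) (fun _ h => h.isMixed.symm_src)
    (fun _ h => h.isMixed.symm_tgt) (isString_iff.1 h))

lemma tail_of_isChain (h : (l :: t).IsChain (Letter.Compat Q)) (hl : l.src Q = some p)
    (ht : ∃ q, (l :: t).getLast? = some (.triv q)) : Tail Q (flip p) t := by
  induction t generalizing l p with
  | nil =>
    obtain ⟨q, hq⟩ := ht; simp only [List.getLast?_singleton, Option.some.injEq] at hq; subst hq
    cases hl
  | cons l' t ih =>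
    rw [List.isChain_cons_cons] at h; obtain ⟨⟨p', h1, h2⟩, h3⟩ := h; rw [hl] at h1; cases h1
    obtain ⟨q, hq⟩ := ht; rw [List.getLast?_cons_cons] at hq
    cases h4 : l'.src Q with
    | none =>
      cases l' with
      | triv r =>
        cases t with
        | nil =>
          cases h2; exact .triv _
        | cons l'' t =>
          rw [List.isChain_cons_cons] at h3; obtain ⟨_, h5, -⟩ := h3.1; cases h5
      | _ => cases h4
    | some r => exact .cons h2 h4 (ih h3 h4 ⟨q, hq⟩)

lemma IsStringIn.tail {v : Word V E} (h : IsStringIn Q S (u ++ l :: v)) (hl : l.src Q = some p) :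
    Tail Q (flip p) v := by
  refine tail_of_isChain (List.IsChain.right_of_append h.chain) hl ?_; obtain ⟨q, hq⟩ := h.last
  grind

end

section

/-- The sequence of keys of the image of a word under `F`. -/
def keysF (Q : SkewedGentleQuiver V E) (t : Word V E) : List ℕ := keys (t.map (Letter.F Q))

lemma keys_append (u v : Word V E) : keys (u ++ v) = keys u ++ keys v := List.map_append

lemma keysF_append (u v : Word V E) : keysF Q (u ++ v) = keysF Q u ++ keysF Q v := by
  simp [keysF, keys]

lemma keysF_cons (l : Letter V E) (v : Word V E) : keysF Q (l :: v) = (l.F Q).key :: keysF Q v :=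
    rfl

/-- The letter `l` lies over the special letter of `e`. -/
lemma F_of_special (he : e ∈ Q.special) (h : l = .dir e ∨ l = .special e ∨ l = .inv e) :
    l.F Q = .special e := by rcases h with rfl | rfl | rfl <;> simp [Letter.F, he]

lemma Letter.IsMixed.cases (h : l.IsMixed Q) : l.F Q = l ∨ ∃ e ∈ Q.special, l = .dir e ∨ l =
    .special e ∨ l = .inv e := by
  cases l with
  | dir e | inv e =>
    by_cases he : e ∈ Q.special
    · grind
    · exact .inl (by simp [Letter.F, he])
  | special e => exact .inl rfl
  | triv p => exact .inl (dif_neg (by rintro ⟨e, he, h1⟩; exact h e he h1))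
  | trivInv p => exact .inl (dif_neg (by rintro ⟨e, he, h1⟩; exact h e he h1))

lemma Letter.IsMixed.F_isValid (h : l.IsMixed Q) : (l.F Q).IsValid Q := by
  cases l with
  | dir e | inv e =>
    by_cases he : e ∈ Q.special <;> simp [Letter.F, he, Letter.IsValid]
  | special e => exact h
  | triv p =>
    rw [show Letter.F Q (.triv p) = .triv p from
      dif_neg (by rintro ⟨e, he, h1⟩; exact h e he h1)]
    exact h
  | trivInv p =>
    rw [show Letter.F Q (.trivInv p) = .trivInv p from
      dif_neg (by rintro ⟨e, he, h1⟩; exact h e he h1)]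
    exact h

lemma Letter.IsMixed.F_tgt (h : l.IsMixed Q) : (l.F Q).tgt Q = l.tgt Q := by
  rcases h.cases with h1 | ⟨e, he, h1⟩
  · rw [h1]
  · rw [F_of_special he h1]; rcases h1 with rfl | rfl | rfl
    · rfl
    · rfl
    · exact congrArg some (loop_ends he).symm

lemma Letter.IsMixed.F_src (h : l.IsMixed Q) : (l.F Q).src Q = l.src Q := by
  rcases h.cases with h1 | ⟨e, he, h1⟩
  · rw [h1]
  · rw [F_of_special he h1]; rcases h1 with rfl | rfl | rfl
    · rfl
    · rfl
    · exact congrArg some (loop_ends he)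

lemma Letter.IsMixed.F_symm (h : l.IsMixed Q) : l.symm.F Q = (l.F Q).symm := by
  rcases h.cases with h1 | ⟨e, he, h1⟩
  · rw [h1]; rcases h.symm.cases with h2 | ⟨e, he, h2⟩
    · exact h2
    · rw [F_of_special he h2, ← h1]
      rcases h2 with h2 | h2 | h2 <;> cases l <;> simp_all [Letter.symm, Letter.F]
  · rw [F_of_special he h1, F_of_special he (e := e)]
    · rfl
    · rcases h1 with rfl | rfl | rfl <;> simp [Letter.symm]

variable {u : Word V E} {f : Word V E → List ℕ}

lemma map_F_winv (h : ∀ l ∈ u, l.IsMixed Q) : (winv u).map (Letter.F Q)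
    = winv (u.map (Letter.F Q)) := by
  unfold winv; rw [List.map_reverse, List.map_map, List.map_map]
  exact congrArg _ (List.map_congr_left fun l hl => (h l hl).F_symm)

lemma Tail.map_F (h : Tail Q p t) (ht : ∀ l ∈ t, l.IsMixed Q) : Tail Q p (t.map (Letter.F Q)) := by
  induction h with
  | triv p =>
    have := ht (.triv p) (by simp)
    rw [List.map_singleton, show Letter.F Q (.triv p) = .triv p from
      dif_neg (by rintro ⟨e, he, h1⟩; exact this e he h1)]
    exact .triv p
  | @cons p q l t h1 h2 h3 ih =>
    have := ht l (by simp)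
    exact .cons (this.F_tgt.trans h1) (this.F_src.trans h2) (ih fun l hl => ht l (by simp [hl]))

/-- At the first difference of two words, either `F` does not identify the different letters, or
these letters lie over the same special letter. -/
lemma Tail.exists_split_F (h : Tail Q p t) (h' : Tail Q p t') (ht : ∀ l ∈ t, l.IsMixed Q)
    (ht' : ∀ l ∈ t', l.IsMixed Q) {m : ℕ} (hm : FirstLt m (keys t) (keys t')) :
    (FirstLt m (keysF Q t) (keysF Q t')) ∨ ∃ Z x y t₂ t₂', ∃ e ∈ Q.special, t = Z ++ x ::
    t₂ ∧ t' = Z ++ y :: t₂' ∧ (x = .dir e ∨ x = .special e) ∧ (y = .special e ∨ y = .inv e) := by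
  obtain ⟨Z, x, y, t₂, t₂', q, rfl, rfl, h1, h2, h3, h4⟩ :=
    h.exists_split separates_isMixed h' ht ht' hm
  have hx := ht x (by simp); have hy := ht' y (by simp)
  have key : ∀ {l l' : Letter V E}, l.IsMixed Q → l.tgt Q = some q → l'.tgt Q = some q →
      ∀ e ∈ Q.special, (l' = .dir e ∨ l' = .special e ∨ l' = .inv e) →
      (l = .dir e ∨ l = .special e ∨ l = .inv e) := by
    intro l l' hl hl1 hl2 e he h5
    have h6 : Q.target e = q := by
      rw [← hy.F_tgt] at h4
      rcases h5 with rfl | rfl | rfl <;> simp only [Letter.tgt, Option.some.injEq] at hl2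
      exacts [hl2, hl2, (loop_ends he).symm.trans hl2]
    subst h6
    cases l with
    | dir a => exact .inl (by rw [Q.target_injective (Option.some.inj hl1)])
    | special a => exact .inr (.inl (by rw [Q.target_injective (Option.some.inj hl1)]))
    | inv a =>
      refine .inr (.inr ?_)
      rw [Q.source_injective ((Option.some.inj hl1).trans (loop_ends he).symm)]
    | triv a => exact absurd ((loop_ends he).trans (Option.some.inj hl1).symm) (hl e he)
    | trivInv a => cases hl1
  by_cases h5 : ∃ e ∈ Q.special, x = .dir e ∨ x = .special e ∨ x = .inv e
  · obtain ⟨e, he, h5⟩ := h5; have h6 := key hy h4 h3 e he h5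
    refine .inr ⟨Z, x, y, t₂, t₂', e, he, rfl, rfl, ?_, ?_⟩
    · rcases h5 with rfl | rfl | rfl
      · exact .inl rfl
      · exact .inr rfl
      · rcases h6 with rfl | rfl | rfl <;> simp [Letter.key] at h2
    · rcases h6 with rfl | rfl | rfl
      · simp [Letter.key] at h2
      exacts [.inl rfl, .inr rfl]
  · have h6 : x.F Q = x := by
      rcases hx.cases with h6 | h6
      exacts [h6, absurd h6 h5]
    have h7 : y.F Q = y := by
      rcases hy.cases with h7 | ⟨e, he, h7⟩
      · exact h7
      · grind
    refine .inl ?_; rw [keysF_append, keysF_append]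
    refine firstLt_append.2 ⟨0, by simp [keysF, keys, h1], ?_⟩; rw [keysF_cons, keysF_cons, h6, h7]
    exact firstLt_zero h2 _ _

/-- The special direct letters of a word are oriented correctly for the order which is given by the
sequences of keys `f`. -/
def OrientedDir (Q : SkewedGentleQuiver V E) (f : Word V E → List ℕ) (X : Word V E) : Prop :=
  ∀ e ∈ Q.special, ∀ u v, X = u ++ .dir e :: v → ∃ m, FirstLt m (f v) (f (winv u))

/-- The special inverse letters of a word are oriented correctly for the order which is given by the
sequences of keys `f`. -/
def OrientedInv (Q : SkewedGentleQuiver V E) (f : Word V E → List ℕ) (X : Word V E) : Prop :=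
  ∀ e ∈ Q.special, ∀ u v, X = u ++ .inv e :: v → ∃ m, FirstLt m (f (winv u)) (f v)

/-- Letters `ε*` only occur as the middle letter of a symmetric word. -/
def SpecialCentral (X : Word V E) : Prop := ∀ e u v, X = u ++ .special e :: v → v = winv u

lemma orientedInv_winv (h : OrientedInv Q f X) : OrientedDir Q f (winv X) := by
  intro e he u v hX; have := congrArg winv hX; rw [winv_winv, winv_split] at this
  have := h e he _ _ this; rwa [winv_winv] at this

lemma orientedDir_winv (h : OrientedDir Q f X) : OrientedInv Q f (winv X) := by
  intro e he u v hX; have := congrArg winv hX; rw [winv_winv, winv_split] at this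
  have := h e he _ _ this; rwa [winv_winv] at this

lemma specialCentral_winv (h : SpecialCentral X) : SpecialCentral (winv X) := by
  intro e u v hX; have := congrArg winv hX; rw [winv_winv, winv_split] at this
  rw [h _ _ _ this, winv_winv]

lemma IsStringIn.tails {v : Word V E} (h : IsStringIn Q (Letter.IsMixed Q) X) (he : e ∈ Q.special)
    (hX : X = u ++ .dir e :: v ∨ X = u ++ .inv e :: v) : (Tail Q (flip (Q.source e)) v ∧ Tail Q
    (flip (Q.source e)) (winv u)) ∧ (∀ l ∈ v, l.IsMixed Q) ∧ (∀ l ∈ winv u, l.IsMixed Q) := by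
  have h' := isStringIn_winv (fun _ h => h.symm) (fun _ h => h.symm_src) (fun _ h => h.symm_tgt) h
  have h1 := loop_ends he
  refine ⟨?_, fun l hl => h.mem l ?_, fun l hl => h'.mem l ?_⟩
  · rcases hX with rfl | rfl
    · refine ⟨h.tail rfl, ?_⟩; rw [winv_split] at h'; rw [h1]; exact h'.tail rfl
    · rw [winv_split] at h'; refine ⟨?_, h'.tail rfl⟩; rw [h1]; exact h.tail rfl
  · grind
  · rcases hX with rfl | rfl <;> simp [winv_split, hl]

lemma keysF_prefix {e' : E} (he : e ∈ Q.special) (he' : e' ∈ Q.special) {x y a b : Letter V E}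
    (hx : x = .dir e ∨ x = .special e ∨ x = .inv e) (hy : y = .dir e ∨ y = .special e ∨ y = .inv e)
    (ha : a = .dir e' ∨ a = .special e' ∨ a = .inv e') (hb : b = .dir e' ∨ b = .special e' ∨ b =
    .inv e') (Y Z T : Word V E) : keysF Q (Y ++ a :: (Z ++ x :: T)) = keysF Q (Y ++ b :: (Z ++ [y]))
    ++ keysF Q T := by
  rw [← keysF_append]
  simp only [List.append_assoc, List.cons_append, List.nil_append, keysF_append, keysF_cons,
    F_of_special he hx, F_of_special he hy, F_of_special he' ha, F_of_special he' hb]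

/-- If the special letters are oriented correctly for the order of the words of the gentle quiver,
then they are oriented correctly for the order of the images under `F`. The words which are compared
at a special letter first differ at some other special letter, if `F` identifies the letters at the
first difference, and the order at the other special letter is known by induction on the place
where the images differ. -/
lemma orientedDir_keysF (hX : IsStringIn Q (Letter.IsMixed Q) X) (h : OrientedDir Q keys X)
    (hc : SpecialCentral X) : OrientedDir Q (keysF Q) X := by
  have claim : ∀ m, ∀ e ∈ Q.special, ∀ u v, X = u ++ .dir e :: v →
      ¬ FirstLt m (keysF Q (winv u)) (keysF Q v) := by
    intro m
    induction m using Nat.strong_induction_on with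
    | _ m ih =>
    intro e he u v huv hm; obtain ⟨⟨hv, hu⟩, hv', hu'⟩ := hX.tails he (.inl huv)
    obtain ⟨n, hn⟩ := h e he u v huv
    rcases hv.exists_split_F hu hv' hu' hn with h1 | ⟨Z, x, y, v₂, u₂, e', he', rfl, h2, hx, hy⟩
    · exact hm.asymm h1
    have hx' : x = .dir e' ∨ x = .special e' ∨ x = .inv e' := by tauto
    have hy' : y = .dir e' ∨ y = .special e' ∨ y = .inv e' := by tauto
    have hu2 : u = winv u₂ ++ y.symm :: winv Z := by rw [← winv_winv u, h2, winv_split]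
    set P := keysF Q (winv Z ++ .dir e :: (Z ++ [y])) with hP
    have hPu : ∀ {a : Letter V E}, (a = .dir e ∨ a = .special e ∨ a = .inv e) →
        ∀ {b}, (b = .dir e' ∨ b = .special e' ∨ b = .inv e') → ∀ T,
        keysF Q (winv Z ++ a :: (Z ++ b :: T)) = P ++ keysF Q T :=
      fun ha _ hb T => keysF_prefix he' he hb hy' ha (.inl rfl) _ _ T
    rw [h2, keysF_append, keysF_append, keysF_cons, keysF_cons, F_of_special he' hx',
      F_of_special he' hy'] at hm
    obtain ⟨m₁, hm₁, hm⟩ := firstLt_append.1 hm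
    obtain ⟨m₂, hm₂, hm⟩ := (firstLt_append (P := [_]) (A := keysF Q u₂) (B := keysF Q v₂)).1 hm
    rw [List.length_singleton] at hm₂
    -- the words compared at the letters over `e'` are `P` followed by the rests `u₂` and `v₂`
    refine not_firstLt_of_prefix (P := P) (by simp [hP, keysF, keys]) hm
      (fun n hn h3 => ?_) (fun n hn h3 => ?_)
    · have hpos : X = (u ++ .dir e :: Z) ++ x :: v₂ := by grind
      have hinv : winv (u ++ .dir e :: Z) = winv Z ++ .inv e :: (Z ++ y :: u₂) := by
        rw [winv_split, h2]; rfl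
      rcases hx with rfl | rfl
      · grind
      · rw [hc _ _ _ hpos, hinv, hPu (by simp) hy'] at h3; exact h3.irrefl
    · have hpos : X = winv u₂ ++ y.symm :: (winv Z ++ .dir e :: (Z ++ x :: v₂)) := by
        rw [huv, hu2]; simp
      rcases hy with rfl | rfl
      · have h4 := hc _ _ _ hpos; rw [winv_winv] at h4; rw [← h4, hPu (by simp) hx'] at h3
        exact h3.irrefl
      · refine ih n (by omega) e' he' _ _ hpos ?_; rwa [winv_winv, hPu (by simp) hx']
  intro e he u v huv; obtain ⟨⟨hv, hu⟩, hv', hu'⟩ := hX.tails he (.inl huv)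
  have hF : ∀ {t : Word V E}, (∀ l ∈ t, l.IsMixed Q) → ∀ l ∈ t.map (Letter.F Q), l.IsValid Q := by
    intro t ht l hl; obtain ⟨l, h1, rfl⟩ := List.mem_map.1 hl; exact (ht l h1).F_isValid
  rcases (hv.map_F hv').trichotomy separates_isValid (hu.map_F hu') (hF hv') (hF hu') with
    heq | h1 | ⟨m, h1⟩
  -- if the images agree, the comparisons at the two letters over `e'` contradict each other
  · exfalso; obtain ⟨n, hn⟩ := h e he u v huv
    rcases hv.exists_split_F hu hv' hu' hn with h1 | ⟨Z, x, y, v₂, u₂, e', he', rfl, h2, hx, hy⟩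
    · rw [keysF, keysF, heq] at h1; exact h1.irrefl
    have hx' : x = .dir e' ∨ x = .special e' ∨ x = .inv e' := by tauto
    have hy' : y = .dir e' ∨ y = .special e' ∨ y = .inv e' := by tauto
    have hu2 : u = winv u₂ ++ y.symm :: winv Z := by rw [← winv_winv u, h2, winv_split]
    have heq2 : v₂.map (Letter.F Q) = u₂.map (Letter.F Q) := by
      rw [h2, List.map_append, List.map_append, List.append_cancel_left_eq] at heq; grind
    have hlen : v₂.length = u₂.length := by simpa using congrArg List.length heq2
    have hpos : X = (u ++ .dir e :: Z) ++ x :: v₂ := by grind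
    have hinv : winv (u ++ .dir e :: Z) = winv Z ++ .inv e :: (Z ++ y :: u₂) := by
      rw [winv_split, h2]; rfl
    have hpos' : X = winv u₂ ++ y.symm :: (winv Z ++ .dir e :: (Z ++ x :: v₂)) := by
      rw [huv, hu2]; simp
    rcases hx with rfl | rfl
    · rcases hy with rfl | rfl
      · have h4 := congrArg List.length (hc _ _ _ hpos'); rw [winv_winv] at h4; grind
      · have c1 := fun m => claim m e' he' _ _ hpos
        have c2 := fun m => claim m e' he' _ _ hpos'
        obtain ⟨⟨g1, g2⟩, g3, g4⟩ := hX.tails he' (.inl hpos)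
        rcases (g1.map_F g3).trichotomy separates_isValid (g2.map_F g4) (hF g3) (hF g4) with
          h5 | ⟨m, h5⟩ | ⟨m, h5⟩
        · have h6 := congrArg List.length h5; grind
        · refine c2 m ?_; rw [winv_winv]
          have h6 : keysF Q (winv Z ++ .dir e :: (Z ++ .dir e' :: v₂)) =
              keysF Q (winv (u ++ .dir e :: Z)) := by
            rw [hinv, keysF_prefix he' he (y := .dir e') (b := .dir e) (by simp) (by simp) (by simp)
              (by simp), keysF_prefix he' he (x := .inv e') (y := .dir e') (b := .dir e) (by simp)
              (by simp) (by simp) (by simp)]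
            congr 1; exact congrArg keys heq2
          rw [h6]; have h7 : keysF Q u₂ = keysF Q v₂ := congrArg keys heq2.symm; rwa [h7]
        · exact c1 m h5
    · have h4 := congrArg List.length (hc _ _ _ hpos); grind
  exacts [h1, absurd h1 (claim m e he u v huv)]

/-- If the special letters are oriented correctly for the order of the images under `F`, then they
are oriented correctly for the order of the words of the gentle quiver. -/
lemma orientedDir_of_keysF (hX : IsStringIn Q (Letter.IsMixed Q) X) (h : OrientedDir Q (keysF Q) X)
    (h' : OrientedInv Q (keysF Q) X) (hc : SpecialCentral X) : OrientedDir Q keys X := by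
  intro e he u v huv; obtain ⟨m, hm⟩ := h e he u v huv
  obtain ⟨⟨hv, hu⟩, hv', hu'⟩ := hX.tails he (.inl huv)
  rcases hv.trichotomy separates_isMixed hu hv' hu' with rfl | h1 | ⟨n, hn⟩
  · exact absurd hm FirstLt.irrefl
  · exact h1
  exfalso
  rcases hu.exists_split_F hv hu' hv' hn with h1 | ⟨Z, x, y, u₂, v₂, e', he', h2, rfl, hx, hy⟩
  · exact hm.asymm h1
  have hx' : x = .dir e' ∨ x = .special e' ∨ x = .inv e' := by tauto
  have hy' : y = .dir e' ∨ y = .special e' ∨ y = .inv e' := by tauto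
  have hu2 : u = winv u₂ ++ x.symm :: winv Z := by rw [← winv_winv u, h2, winv_split]
  set P := keysF Q (winv Z ++ .dir e :: (Z ++ [y])) with hP
  have hPu : ∀ {a : Letter V E}, (a = .dir e ∨ a = .special e ∨ a = .inv e) →
      ∀ {b}, (b = .dir e' ∨ b = .special e' ∨ b = .inv e') → ∀ T,
      keysF Q (winv Z ++ a :: (Z ++ b :: T)) = P ++ keysF Q T :=
    fun ha _ hb T => keysF_prefix he' he hb hy' ha (.inl rfl) _ _ T
  rw [h2, keysF_append, keysF_append, keysF_cons, keysF_cons, F_of_special he' hx',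
    F_of_special he' hy'] at hm
  obtain ⟨m₁, -, hm⟩ := firstLt_append.1 hm
  obtain ⟨m₂, -, hm⟩ := (firstLt_append (P := [_]) (A := keysF Q v₂) (B := keysF Q u₂)).1 hm
  refine not_firstLt_of_prefix (P := P) (by simp [hP, keysF, keys]) hm
    (fun n hn h3 => ?_) (fun n hn h3 => ?_)
  · have hpos : X = winv u₂ ++ x.symm :: (winv Z ++ .dir e :: (Z ++ y :: v₂)) := by
      rw [huv, hu2]; simp
    rcases hx with rfl | rfl
    · obtain ⟨k, h4⟩ := h' e' he' _ _ hpos; rw [winv_winv, hPu (by simp) hy'] at h4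
      exact h3.asymm h4
    · have h4 := hc _ _ _ hpos; rw [winv_winv] at h4; rw [← h4, hPu (by simp) hy'] at h3
      exact h3.irrefl
  · have hpos : X = (u ++ .dir e :: Z) ++ y :: v₂ := by grind
    have hinv : winv (u ++ .dir e :: Z) = winv Z ++ .inv e :: (Z ++ x :: u₂) := by
      rw [winv_split, h2]; rfl
    rcases hy with rfl | rfl
    · rw [hc _ _ _ hpos, hinv, hPu (by simp) hx'] at h3; exact h3.irrefl
    · obtain ⟨k, h4⟩ := h' e' he' _ _ hpos; rw [hinv, hPu (by simp) hx'] at h4; exact h3.asymm h4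

/-- The two orders define the same orientations of the special letters of a string. -/
lemma oriented_keys_iff (hX : IsStringIn Q (Letter.IsMixed Q) X) (hc : SpecialCentral X) :
    (OrientedDir Q keys X ∧ OrientedInv Q keys X) ↔ (OrientedDir Q (keysF Q) X ∧ OrientedInv Q
    (keysF Q) X) := by
  have hX' := isStringIn_winv (fun _ h => h.symm) (fun _ h => h.symm_src) (fun _ h => h.symm_tgt) hX
  constructor
  · rintro ⟨h1, h2⟩
    have h3 := orientedDir_winv (orientedDir_keysF hX' (orientedInv_winv h2) (specialCentral_winv hc))
    rw [winv_winv] at h3; exact ⟨orientedDir_keysF hX h1 hc, h3⟩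
  · rintro ⟨h1, h2⟩
    have h3 := orientedDir_winv (orientedDir_of_keysF hX' (orientedInv_winv h2) (orientedDir_winv h1) (specialCentral_winv hc))
    rw [winv_winv] at h3; exact ⟨orientedDir_of_keysF hX h1 h2 hc, h3⟩

end

/-! ### Reconstruction of a word from its image under `F` -/

section

open Classical in
/-- The letter of the gentle quiver which replaces the letter at the position `i` of `w`. The middle
letter of a symmetric string is not replaced. -/
def orientLetter (Q : SkewedGentleQuiver V E) (w : Word V E) (i : ℕ) : Letter V E → Letter V E
  | .special e =>
    if w.drop (i + 1) = winv (w.take i) then .special e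
    else if WordLt Q (w.drop (i + 1)) (winv (w.take i)) then .dir e else .inv e
  | l => l

/-- The word of the gentle quiver over a string, with the middle letter of a symmetric string left
as it is. -/
def orientMixed (Q : SkewedGentleQuiver V E) (w : Word V E) : Word V E :=
  w.mapIdx (orientLetter Q w)

lemma getElem?_orientMixed (w : Word V E) (i : ℕ) : (orientMixed Q w)[i]? = w[i]?.map (orientLetter
    Q w i) := by simp [orientMixed]

lemma length_orientMixed (w : Word V E) : (orientMixed Q w).length = w.length := by
  simp [orientMixed]

variable {i : ℕ} {α : Type*} {u v : Word V E}

lemma eq_take_cons_drop {X : List α} {l : α} (h : X[i]? = some l) : X = X.take i ++ l ::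
    X.drop (i + 1) := by
  obtain ⟨h1, rfl⟩ := List.getElem?_eq_some_iff.1 h
  simp_all

lemma split_index (u v : List α) (l : α) : (u ++ l :: v)[u.length]? = some l ∧ (u ++ l :: v).take
    u.length = u ∧ (u ++ l :: v).drop (u.length + 1) = v := by
  simp_all

lemma Letter.IsValid.F_eq (h : l.IsValid Q) : l.F Q = l := by
  rcases h.isMixed.cases with h1 | ⟨e, he, rfl | rfl | rfl⟩
  · exact h1
  · exact absurd he h
  · rfl
  · exact absurd he h

lemma Letter.IsMixed.eq_of_F {l' : Letter V E} (h : l.IsMixed Q) (h' : l.F Q = l')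
    (hl : ∀ e, l' ≠ .special e) : l = l' := by
  rcases h.cases with h1 | ⟨e, he, h1⟩
  · grind
  · exact absurd (h'.symm.trans (F_of_special he h1)) (hl e)

lemma isStringIn_mixed_iff (hX : ∀ l ∈ X, l.IsMixed Q) : IsStringIn Q (Letter.IsMixed Q)
    X ↔ IsString Q (X.map (Letter.F Q)) := by
  have hF : ∀ l ∈ X.map (Letter.F Q), l.IsValid Q := by
    intro l hl; obtain ⟨l, h1, rfl⟩ := List.mem_map.1 hl; exact (hX l h1).F_isValid
  have hc : ∀ a ∈ X, ∀ b ∈ X, Letter.Compat Q (a.F Q) (b.F Q) ↔ Letter.Compat Q a b := by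
    intro a ha b hb; simp only [Letter.Compat, (hX a ha).F_src, (hX b hb).F_tgt]
  rw [isString_iff]; constructor
  · rintro ⟨-, h2, ⟨p, h3⟩, ⟨q, h4⟩⟩
    have hp : ∀ l ∈ X, (∀ e, l ≠ .special e ∧ l ≠ .dir e ∧ l ≠ .inv e) → l.F Q = l := by
      intro l hl h; rcases (hX l hl).cases with h1 | ⟨e, -, h1 | h1 | h1⟩
      · exact h1
      · grind
      · grind
      · grind
    refine ⟨hF, ?_, ⟨p, ?_⟩, ⟨q, ?_⟩⟩
    · rw [List.isChain_map]
      exact List.IsChain.imp_of_mem_imp (fun a b ha hb h => (hc a ha b hb).2 h) h2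
    · rw [List.head?_map, h3, Option.map_some, hp _ (List.mem_of_mem_head? h3) (by simp)]
    · rw [List.getLast?_map, h4, Option.map_some, hp _ (List.mem_of_getLast? h4) (by simp)]
  · rintro ⟨-, h2, ⟨p, h3⟩, ⟨q, h4⟩⟩; rw [List.isChain_map] at h2
    rw [List.head?_map, Option.map_eq_some_iff] at h3
    rw [List.getLast?_map, Option.map_eq_some_iff] at h4; obtain ⟨l, h3, h5⟩ := h3
    obtain ⟨l', h4, h6⟩ := h4
    refine ⟨hX, List.IsChain.imp_of_mem_imp (fun a b ha hb h => (hc a ha b hb).1 h) h2, ⟨p, ?_⟩,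
      ⟨q, ?_⟩⟩
    · rw [h3, (hX l (List.mem_of_mem_head? h3)).eq_of_F h5 (by simp)]
    · rw [h4, (hX l' (List.mem_of_getLast? h4)).eq_of_F h6 (by simp)]

/-- The two words which are compared at a special letter of a string. -/
lemma IsString.tails (hw : IsString Q (u ++ .special e :: v)) : Tail Q (flip (Q.source e))
    v ∧ Tail Q (flip (Q.source e)) (winv u) ∧ (∀ l ∈ v, l.IsValid Q) ∧ ∀ l ∈ winv u,
    l.IsValid Q := by
  have h := isString_iff.1 hw; have h' := isString_iff.1 (isString_winv hw); rw [winv_split] at h'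
  exact ⟨h.tail rfl, h'.tail rfl, fun l hl => h.mem l (by simp [hl]),
    fun l hl => h'.mem l (by simp [hl])⟩

lemma IsString.special_trichotomy (hw : IsString Q (u ++ .special e :: v)) :
    (v = winv u ∧ ¬ WordLt Q v (winv u) ∧ ¬ WordLt Q (winv u) v) ∨ (WordLt Q v (winv u) ∧ v ≠ winv u
    ∧ ¬ WordLt Q (winv u) v) ∨ (WordLt Q (winv u) v ∧ v ≠ winv u ∧ ¬ WordLt Q v (winv u)) := by
  obtain ⟨h1, h2, h3, h4⟩ := hw.tails; rw [h1.wordLt_iff h2 h3 h4, h2.wordLt_iff h1 h4 h3]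
  rcases h1.trichotomy separates_isValid h2 h3 h4 with h5 | ⟨m, h5⟩ | ⟨m, h5⟩
  · refine .inl ⟨h5, ?_⟩; rw [h5]; exact ⟨fun ⟨m, h⟩ => h.irrefl, fun ⟨m, h⟩ => h.irrefl⟩
  · refine .inr (.inl ⟨⟨m, h5⟩, ?_, fun ⟨n, h⟩ => h.asymm h5⟩); intro h; rw [h] at h5
    exact h5.irrefl
  · refine .inr (.inr ⟨⟨m, h5⟩, ?_, fun ⟨n, h⟩ => h.asymm h5⟩); intro h; rw [h] at h5
    exact h5.irrefl

lemma orientLetter_special (u v : Word V E) (e : E) : (v = winv u → orientLetter Q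
    (u ++ .special e :: v) u.length (.special e) = .special e) ∧ (v ≠ winv u → WordLt Q v (winv u)
    → orientLetter Q (u ++ .special e :: v) u.length (.special e) = .dir e) ∧
    (v ≠ winv u → ¬ WordLt Q v (winv u) → orientLetter Q (u ++ .special e :: v) u.length
    (.special e) = .inv e) := by
  obtain ⟨-, h1, h2⟩ := split_index u v (Letter.special e); unfold orientLetter; grind

lemma F_orientLetter (i : ℕ) (hl : l.IsValid Q) : (orientLetter Q w i l).IsMixed Q ∧ (orientLetter Q
    w i l).F Q = l := by
  cases l with
  | special e =>
    simp only [orientLetter]; split_ifs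
    · exact ⟨hl, rfl⟩
    · exact ⟨trivial, F_of_special hl (by simp)⟩
    · exact ⟨trivial, F_of_special hl (by simp)⟩
  | dir | inv | triv | trivInv => exact ⟨hl.isMixed, hl.F_eq⟩

lemma mem_orientMixed (hw : ∀ l ∈ w, l.IsValid Q) : ∀ l ∈ orientMixed Q w, l.IsMixed Q := by
  intro l hl; obtain ⟨i, h⟩ := List.mem_iff_getElem?.1 hl
  rw [getElem?_orientMixed, Option.map_eq_some_iff] at h; obtain ⟨l', h, rfl⟩ := h
  exact (F_orientLetter i (hw l' (List.mem_of_getElem? h))).1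

lemma map_F_orientMixed (hw : ∀ l ∈ w, l.IsValid Q) : (orientMixed Q w).map (Letter.F Q) = w := by
  refine List.ext_getElem? fun i => ?_
  rw [List.getElem?_map, getElem?_orientMixed, Option.map_map]
  cases h : w[i]? with
  | none => rfl
  | some l => exact congrArg some (F_orientLetter i (hw l (List.mem_of_getElem? h))).2

lemma isStringIn_orientMixed (hw : IsString Q w) : IsStringIn Q (Letter.IsMixed Q)
    (orientMixed Q w) := by
  have h := (isString_iff.1 hw).mem
  rw [isStringIn_mixed_iff (mem_orientMixed h), map_F_orientMixed h]; exact hw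

lemma getElem?_winv (X : Word V E) {j : ℕ} (h : i + j + 1 = X.length) : (winv X)[i]? = X[j]?.map
    Letter.symm := by unfold winv; grind

lemma orientMixed_winv (hw : IsString Q w) : orientMixed Q (winv w) = winv (orientMixed Q w) := by
  refine List.ext_getElem? fun i => ?_
  rcases Nat.lt_or_ge i w.length with hi | hi; swap
  · rw [List.getElem?_eq_none (by rw [length_orientMixed, length_winv]; exact hi),
      List.getElem?_eq_none (by rw [length_winv, length_orientMixed]; exact hi)]
  obtain ⟨j, hj⟩ : ∃ j, i + j + 1 = w.length := ⟨w.length - 1 - i, by omega⟩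
  rw [getElem?_orientMixed, getElem?_winv w hj,
    getElem?_winv (orientMixed Q w) (by rw [length_orientMixed]; exact hj), getElem?_orientMixed]
  have hj' : j < w.length := by omega
  rw [List.getElem?_eq_getElem hj']; simp only [Option.map_some, Option.some.injEq]
  have h := List.getElem?_eq_getElem hj'; generalize w[j] = l at h
  cases l with
  | special e =>
    have h1 := eq_take_cons_drop h; have h2 : w = w.take j ++ .special e :: w.drop (j + 1) := h1
    have hu : (w.take j).length = j := by simp; omega
    have hv : (winv (w.drop (j + 1))).length = i := by rw [length_winv]; simp; omega
    generalize w.take j = u at h2 hu; generalize w.drop (j + 1) = v at h2 hv; subst h2 hu hv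
    have h3 := orientLetter_special (Q := Q) (winv v) (winv u) e
    have h4 := orientLetter_special (Q := Q) u v e; rw [winv_split]
    simp only [Letter.symm, winv_winv] at h3 ⊢
    rcases hw.special_trichotomy with ⟨h5, -⟩ | ⟨h5, h6, h7⟩ | ⟨h5, h6, h7⟩
    · grind
    · grind
    · grind
  | dir | inv | triv | trivInv => rfl

lemma orientMixed_oriented (hw : IsString Q w) : OrientedDir Q (keysF Q) (orientMixed Q w)
    ∧ OrientedInv Q (keysF Q) (orientMixed Q w) ∧ SpecialCentral (orientMixed Q w) := by
  have hv := (isString_iff.1 hw).mem; have hF := map_F_orientMixed hv; have hm := mem_orientMixed hv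
  have key : ∀ {u v l e}, e ∈ Q.special → (l = .dir e ∨ l = .special e ∨ l = .inv e) →
      orientMixed Q w = u ++ l :: v → w = u.map (Letter.F Q) ++ .special e :: v.map (Letter.F Q) ∧
      orientLetter Q (u.map (Letter.F Q) ++ .special e :: v.map (Letter.F Q))
        (u.map (Letter.F Q)).length (.special e) = l ∧
      (winv u).map (Letter.F Q) = winv (u.map (Letter.F Q)) := by
    intro u v l e he hl h; have h1 := hF
    rw [h, List.map_append, List.map_cons, F_of_special he hl] at h1
    refine ⟨h1.symm, ?_, map_F_winv fun l hl => hm l (by rw [h]; simp [hl])⟩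
    have h2 := congrArg (fun L => L[u.length]?) h
    simp only [getElem?_orientMixed, (split_index u v l).1] at h2; grind
  refine ⟨fun e he u v h => ?_, fun e he u v h => ?_, fun e u v h => ?_⟩
  · obtain ⟨h1, h2, h3⟩ := key he (.inl rfl) h; rw [keysF, keysF, h3]; rw [h1] at hw
    obtain ⟨h4, h5, h6⟩ := orientLetter_special (Q := Q) (u.map (Letter.F Q)) (v.map (Letter.F Q)) e
    rcases hw.special_trichotomy with ⟨g1, -⟩ | ⟨g1, -⟩ | ⟨-, g1, g2⟩
    · grind
    · exact g1.exists_firstLt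
    · grind
  · obtain ⟨h1, h2, h3⟩ := key he (.inr (.inr rfl)) h; rw [keysF, keysF, h3]; rw [h1] at hw
    obtain ⟨h4, h5, h6⟩ := orientLetter_special (Q := Q) (u.map (Letter.F Q)) (v.map (Letter.F Q)) e
    rcases hw.special_trichotomy with ⟨g1, -⟩ | ⟨g1, g2, -⟩ | ⟨g1, -⟩
    · grind
    · grind
    · exact g1.exists_firstLt
  · have he : e ∈ Q.special := hm (.special e) (by rw [h]; simp)
    obtain ⟨h1, h2, h3⟩ := key he (.inr (.inl rfl)) h
    have h8 : v.map (Letter.F Q) = winv (u.map (Letter.F Q)) := by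
      rw [h1] at hw
      obtain ⟨h4, h5, h6⟩ :=
        orientLetter_special (Q := Q) (u.map (Letter.F Q)) (v.map (Letter.F Q)) e
      grind
    have h9 : winv w = w := by rw [h1, winv_split, h8, winv_winv]; rfl
    have h10 := orientMixed_winv hw; rw [h9, h, winv_split] at h10
    have h11 : u.length = (winv v).length := by
      have := congrArg List.length h8; simpa [length_winv] using this.symm
    exact (List.cons.inj (List.append_inj_right h10 h11)).2

/-- A string with correctly oriented special letters is determined by its image under `F`. -/
lemma eq_orientMixed (hX : IsStringIn Q (Letter.IsMixed Q) X) (h : OrientedDir Q (keysF Q) X)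
    (h' : OrientedInv Q (keysF Q) X) (hc : SpecialCentral X) : X = orientMixed Q
    (X.map (Letter.F Q)) := by
  have hs := (isStringIn_mixed_iff hX.mem).1 hX; refine List.ext_getElem? fun i => ?_
  rw [getElem?_orientMixed, List.getElem?_map, Option.map_map]
  cases hi : X[i]? with
  | none => rfl
  | some l =>
    refine congrArg some ?_; have h1 := eq_take_cons_drop hi
    have h2 : (X.take i).length = i := by grind
    have hl := hX.mem l (List.mem_of_getElem? hi); generalize X.take i = u at h1 h2
    generalize X.drop (i + 1) = v at h1; subst h1 h2
    have hu : (winv u).map (Letter.F Q) = winv (u.map (Letter.F Q)) :=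
      map_F_winv fun l hl => hX.mem l (by simp [hl])
    have key : ∀ {e}, e ∈ Q.special → (l = .dir e ∨ l = .special e ∨ l = .inv e) →
        (v.map (Letter.F Q) = winv (u.map (Letter.F Q)) → l = .special e) →
        (WordLt Q (v.map (Letter.F Q)) (winv (u.map (Letter.F Q))) → l = .dir e) →
        (WordLt Q (winv (u.map (Letter.F Q))) (v.map (Letter.F Q)) → l = .inv e) →
        l = orientLetter Q ((u ++ l :: v).map (Letter.F Q)) u.length (l.F Q) := by
      intro e he hle g1 g2 g3; rw [List.map_append, List.map_cons, F_of_special he hle] at hs ⊢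
      obtain ⟨h4, h5, h6⟩ :=
        orientLetter_special (Q := Q) (u.map (Letter.F Q)) (v.map (Letter.F Q)) e
      rw [List.length_map] at h4 h5 h6
      rcases hs.special_trichotomy with ⟨k1, -⟩ | ⟨k1, k2, -⟩ | ⟨k1, k2, k3⟩
      · rw [h4 k1, g1 k1]
      · rw [h5 k2 k1, g2 k1]
      · rw [h6 k2 k3, g3 k1]
    have lt : ∀ {a b : Word V E}, WordLt Q a b → ∃ m, FirstLt m (keys a) (keys b) :=
      fun h => h.exists_firstLt
    cases l with
    | dir e =>
      by_cases he : e ∈ Q.special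
      · obtain ⟨m, hm⟩ := h e he u v rfl; rw [keysF, keysF, hu] at hm
        refine key he (.inl rfl) (fun g => ?_) (fun _ => rfl) fun g => ?_
        · rw [g] at hm; exact absurd hm FirstLt.irrefl
        · obtain ⟨n, hn⟩ := lt g; exact (hn.asymm hm).elim
      · rw [Function.comp_apply, show Letter.F Q (.dir e) = .dir e from if_neg he]; rfl
    | inv e =>
      by_cases he : e ∈ Q.special
      · obtain ⟨m, hm⟩ := h' e he u v rfl; rw [keysF, keysF, hu] at hm
        refine key he (.inr (.inr rfl)) (fun g => ?_) (fun g => ?_) fun _ => rfl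
        · rw [g] at hm; exact absurd hm FirstLt.irrefl
        · obtain ⟨n, hn⟩ := lt g; exact (hn.asymm hm).elim
      · rw [Function.comp_apply, show Letter.F Q (.inv e) = .inv e from if_neg he]; rfl
    | special e =>
      have h3 : v.map (Letter.F Q) = winv (u.map (Letter.F Q)) := by rw [hc e u v rfl, hu]
      refine key hl (.inr (.inl rfl)) (fun _ => rfl) (fun g => ?_) fun g => ?_
      · obtain ⟨n, hn⟩ := lt g; rw [h3] at hn; exact absurd hn FirstLt.irrefl
      · obtain ⟨n, hn⟩ := lt g; rw [h3] at hn; exact absurd hn FirstLt.irrefl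
    | triv p =>
      rw [Function.comp_apply, show Letter.F Q (.triv p) = .triv p from
        dif_neg (by rintro ⟨e, he, h1⟩; exact hl e he h1)]
      rfl
    | trivInv p =>
      rw [Function.comp_apply, show Letter.F Q (.trivInv p) = .trivInv p from
        dif_neg (by rintro ⟨e, he, h1⟩; exact hl e he h1)]
      rfl

end

/-! ### The words `A(w)` -/

section

lemma isString_center (hw : IsString Q w) (h : winv w = w) : ∃ u, ∃ e ∈ Q.special, w = u ++ .special
    e :: winv u := by
  have hs := isString_iff.1 hw
  have hpos : 0 < w.length := by
    obtain ⟨p, hp⟩ := hs.head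
    cases w with
    | nil => cases hp
    | cons => simp
  obtain ⟨m, hm | hm⟩ := Nat.even_or_odd' w.length
  · exfalso; have h1 : m - 1 < w.length := by omega
    have h2 : m - 1 + 1 < w.length := by omega
    have h3 := getElem?_winv w (i := m - 1 + 1) (j := m - 1) (by omega)
    rw [h, List.getElem?_eq_getElem h1, List.getElem?_eq_getElem h2, Option.map_some,
      Option.some.injEq] at h3
    obtain ⟨p, h4, h5⟩ := List.isChain_iff_getElem.1 hs.chain (m - 1) h2
    rw [h3, (hs.mem _ (List.getElem_mem h1)).isMixed.symm_tgt, h4, Option.some.injEq] at h5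
    exact flip_ne p h5.symm
  · have h1 : m < w.length := by omega
    have h3 := getElem?_winv w (i := m) (j := m) (by omega); rw [h] at h3
    have h4 := List.getElem?_eq_getElem h1; have h5 := hs.mem _ (List.getElem_mem h1)
    generalize w[m] = l at h4 h5; rw [h4, Option.map_some, Option.some.injEq] at h3
    cases l with
    | special e =>
      have h6 := eq_take_cons_drop h4
      have h7 : (w.take m).length = (winv (w.drop (m + 1))).length := by
        rw [length_winv]; simp; omega
      refine ⟨w.take m, e, h5, ?_⟩; have h8 := h; rw [h6, winv_split] at h8; grind
    | _ => cases h3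

/-- The word `x` of the gentle quiver is given by the word `X`, which may have a special letter in
its middle: then `X` is symmetric, and `x` is its left half, with a punctured end. -/
def Unfolds (Q : SkewedGentleQuiver V E) (x X : Word V E) : Prop := (x = X ∧ ∀ e, .special e ∉ X) ∨
    ∃ u, ∃ e ∈ Q.special, x = u ++ [.triv (Q.source e)] ∧ X = u ++ .special e :: winv u ∧
      ∀ e', .special e' ∉ u

lemma exists_unfolds (hX : IsStringIn Q (Letter.IsMixed Q) X) (hc : SpecialCentral X) : ∃ x,
    Unfolds Q x X := by
  by_cases h : ∃ e, .special e ∈ X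
  · obtain ⟨e, he⟩ := h; have h1 := hX.mem _ he; obtain ⟨u, v, rfl⟩ := List.append_of_mem he
    obtain rfl := hc e u v rfl
    refine ⟨u ++ [.triv (Q.source e)], .inr ⟨u, e, h1, rfl, rfl, fun e' he' => ?_⟩⟩
    obtain ⟨u₁, u₂, rfl⟩ := List.append_of_mem he'
    have h2 := congrArg List.length
      (hc e' u₁ (u₂ ++ .special e :: winv (u₁ ++ .special e' :: u₂)) (by simp))
    simp [length_winv] at h2; omega
  · exact ⟨X, .inl ⟨rfl, fun e he => h ⟨e, he⟩⟩⟩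

lemma isString_of_unfolds (hX : IsStringIn Q (Letter.IsMixed Q) X) (h : Unfolds Q x X) :
    IsString Q.hat x := by
  have hv : ∀ l : Letter V E, (∀ e, l ≠ .special e) → l.IsValid Q.hat := by
    intro l hl
    cases l with
    | special e => exact absurd rfl (hl e)
    | _ => simp [Letter.IsValid, SkewedGentleQuiver.hat]
  rw [isString_iff, isStringIn_hat]; rcases h with ⟨rfl, h⟩ | ⟨u, e, he, rfl, rfl, h⟩
  · exact ⟨fun l hl => hv l fun e he => h e (he ▸ hl), hX.chain, hX.head, hX.last⟩
  · obtain ⟨h1, h2, h3⟩ := List.isChain_append.1 hX.chain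
    refine ⟨fun l hl => hv l ?_, ?_, ?_, ⟨Q.source e, by simp⟩⟩
    · grind
    · refine List.isChain_append.2 ⟨h1, List.isChain_singleton _, fun a ha b hb => ?_⟩
      simp only [List.head?_cons, Option.mem_def, Option.some.injEq] at hb; subst hb
      obtain ⟨p, h4, h5⟩ := h3 a ha (.special e) (by simp)
      exact ⟨p, h4, (congrArg some (loop_ends he)).trans h5⟩
    · obtain ⟨p, hp⟩ := hX.head
      cases u with
      | nil => simp at hp
      | cons => exact ⟨p, by simpa using hp⟩

open Classical in
lemma wordType_eq (hx : startsTrivial x = true) (hp : x.head? = some (.trivInv p))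
    (hq : x.getLast? = some (.triv q)) : wordType Q x = if Loop Q p then
    (if Loop Q q then .pp else .pu) else if Loop Q q
    then .up else .uu := by
  unfold wordType; rw [if_pos hx, hp, hq]
  simp only [Option.some.injEq, exists_eq_left', Letter.IsPunctured]

lemma wordType_of_unfolds (hX : IsStringIn Q (Letter.IsMixed Q) X) (h : Unfolds Q x X) :
    ((∀ e, .special e ∉ X) ∧ wordType Q x = .uu) ∨ (winv X = X ∧ (∃ e, .special e ∈ X) ∧ wordType Q
    x = .up) := by
  have hx := isString_of_unfolds hX h; obtain ⟨p, hp⟩ := hX.head; obtain ⟨q, hq⟩ := hX.last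
  have hp' : ¬ Loop Q p := by
    rintro ⟨e, he, h1⟩; exact hX.mem _ (List.mem_of_mem_head? hp) e he h1
  have hq' : ¬ Loop Q q := by
    rintro ⟨e, he, h1⟩; exact hX.mem _ (List.mem_of_getLast? hq) e he h1
  rcases h with ⟨rfl, h⟩ | ⟨u, e, he, rfl, rfl, h⟩
  · refine .inl ⟨h, ?_⟩; rw [wordType_eq hx.startsTrivial hp hq, if_neg hp', if_neg hq']
  · refine .inr ⟨?_, ⟨e, by simp⟩, ?_⟩
    · rw [winv_split, winv_winv]; rfl
    · have hp2 : (u ++ [Letter.triv (Q.source e)]).head? = some (.trivInv p) := by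
        cases u with
        | nil => simp at hp
        | cons => simpa using hp
      rw [wordType_eq hx.startsTrivial hp2 (q := Q.source e) (by simp), if_neg hp',
        if_pos ⟨e, he, rfl⟩]

/-- The condition on the special letters of an admissible string. -/
def HatOriented (Q : SkewedGentleQuiver V E) (x : Word V E) : Prop := ∀ e ∈ Q.special, ∀ u v,
    (x = u ++ .dir e :: v → winv u ≠ v ∧ WordLt Q.hat v (winv u)) ∧
    (x = u ++ .inv e :: v → winv u ≠ v ∧ ¬ WordLt Q.hat v (winv u))

lemma hatOriented_iff (hx : IsString Q.hat x) : HatOriented Q x ↔ OrientedDir Q keys x ∧ OrientedInv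
    Q keys x := by
  have h := isString_iff.1 hx; have h' := isString_iff.1 (isString_winv hx)
  have key : ∀ {u v l e}, e ∈ Q.special → (l = .dir e ∨ l = .inv e) → x = u ++ l :: v →
      (WordLt Q.hat v (winv u) ↔ ∃ m, FirstLt m (keys v) (keys (winv u))) ∧
      (v = winv u ∨ (∃ m, FirstLt m (keys v) (keys (winv u))) ∨
        ∃ m, FirstLt m (keys (winv u)) (keys v)) := by
    intro u v l e he hl hu; subst hu; rw [winv_split] at h'
    have g1 : Tail Q.hat (flip (Q.source e)) v ∧ Tail Q.hat (flip (Q.source e)) (winv u) := by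
      have h1 := loop_ends he; rcases hl with rfl | rfl
      · refine ⟨h.tail rfl, ?_⟩; rw [h1]; exact h'.tail rfl
      · refine ⟨?_, h'.tail rfl⟩; rw [h1]; exact h.tail rfl
    have g2 : ∀ l ∈ v, l.IsValid Q.hat := fun l hl => h.mem l (by simp [hl])
    have g3 : ∀ l ∈ winv u, l.IsValid Q.hat := fun l hl => h'.mem l (by simp [hl])
    exact ⟨g1.1.wordLt_iff g1.2 g2 g3, g1.1.trichotomy separates_isValid g1.2 g2 g3⟩
  constructor
  · intro ho; refine ⟨fun e he u v hu => ?_, fun e he u v hu => ?_⟩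
    · exact (key he (.inl rfl) hu).1.1 ((ho e he u v).1 hu).2
    · obtain ⟨k1, k2⟩ := key he (.inr rfl) hu; obtain ⟨k3, k4⟩ := (ho e he u v).2 hu; grind
  · rintro ⟨h1, h2⟩ e he u v; refine ⟨fun hu => ?_, fun hu => ?_⟩
    · have k := h1 e he u v hu; refine ⟨?_, (key he (.inl rfl) hu).1.2 k⟩; rintro rfl
      exact k.choose_spec.irrefl
    · obtain ⟨m, k⟩ := h2 e he u v hu; refine ⟨?_, fun h3 => ?_⟩
      · rintro rfl; exact k.irrefl
      · obtain ⟨n, h3⟩ := (key he (.inr rfl) hu).1.1 h3; exact h3.asymm k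

variable {A B : List ℕ} {m : ℕ}

lemma FirstLt.append_left (h : FirstLt m A B) (R : List ℕ) : FirstLt m (A ++ R) B := by
  obtain ⟨h1, x, y, h2, h3, h4⟩ := h; have hA : m < A.length := by grind
  refine ⟨?_, x, y, ?_, h3, h4⟩
  · grind
  · grind

lemma FirstLt.append_right (h : FirstLt m A B) (R : List ℕ) : FirstLt m A (B ++ R) := by
  obtain ⟨h1, x, y, h2, h3, h4⟩ := h; have hB : m < B.length := by grind
  refine ⟨?_, x, y, h2, ?_, h4⟩
  · grind
  · grind

lemma keys_puncture : keys (t ++ .special e :: s) = keys (t ++ [.triv p]) ++ keys s := by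
  simp [keys, Letter.key]

/-- Cutting a symmetric word at its middle letter does not change the order of the words which are
compared at the other special letters. -/
lemma unfolds_oriented (hX : IsStringIn Q (Letter.IsMixed Q) X) (h : Unfolds Q x X) :
    (OrientedDir Q keys x ∧ OrientedInv Q keys x) ↔ (OrientedDir Q keys X ∧ OrientedInv Q keys
    X) := by
  have hx := isString_iff.1 (isString_of_unfolds hX h)
  rcases h with ⟨rfl, h⟩ | ⟨u, e, he, rfl, rfl, h⟩
  · rfl
  have hsymm : winv (u ++ .special e :: winv u) = u ++ .special e :: winv u := by
    rw [winv_split, winv_winv]; rfl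
  constructor
  · rintro ⟨h1, h2⟩
    have key : OrientedDir Q keys (u ++ .special e :: winv u) := by
      intro e' he' u₁ v₁ hu; rcases List.append_eq_append_iff.1 hu with ⟨a, rfl, ha⟩ | ⟨a, rfl, ha⟩
      · rcases a with - | ⟨l, a⟩
        · cases ha
        · rw [List.cons_append, List.cons.injEq] at ha; obtain ⟨rfl, ha⟩ := ha
          have h3 : u = winv v₁ ++ .inv e' :: winv a := by rw [← winv_winv u, ha, winv_split]; rfl
          obtain ⟨m, hm⟩ := h2 e' he' (winv v₁) (winv a ++ [.triv (Q.source e)]) (by rw [h3]; simp)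
          rw [winv_winv] at hm; refine ⟨m, ?_⟩; rw [winv_split]
          exact keys_puncture (p := Q.source e) ▸ hm.append_right _
      · rcases a with - | ⟨l, a⟩
        · cases ha
        · rw [List.cons_append, List.cons.injEq] at ha; obtain ⟨rfl, rfl⟩ := ha
          obtain ⟨m, hm⟩ := h1 e' he' u₁ (a ++ [.triv (Q.source e)]) (by simp)
          exact ⟨m, keys_puncture (p := Q.source e) ▸ hm.append_left _⟩
    refine ⟨key, ?_⟩; have := orientedDir_winv key; rwa [hsymm] at this
  · rintro ⟨h1, h2⟩
    have key : ∀ {u₁ v₁ l e'}, e' ∈ Q.special → (l = .dir e' ∨ l = .inv e') →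
        u ++ [.triv (Q.source e)] = u₁ ++ l :: v₁ → ∃ v₂, v₁ = v₂ ++ [.triv (Q.source e)] ∧
          u ++ .special e :: winv u = u₁ ++ l :: (v₂ ++ .special e :: winv u) ∧
          (v₁ = winv u₁ ∨ (∃ m, FirstLt m (keys v₁) (keys (winv u₁))) ∨
            ∃ m, FirstLt m (keys (winv u₁)) (keys v₁)) ∧ v₁ ≠ winv u₁ := by
      intro u₁ v₁ l e' he' hl hu; rcases List.eq_nil_or_concat v₁ with rfl | ⟨v₂, b, rfl⟩
      · have := congrArg List.getLast? hu; grind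
      have h3 : u ++ [Letter.triv (Q.source e)] = (u₁ ++ l :: v₂) ++ [b] := by rw [hu]; simp
      obtain ⟨rfl, h4⟩ := List.append_inj' h3 rfl; obtain rfl := (List.cons.inj h4).1
      have g := hX.tails he' (u := u₁) (v := v₂ ++ .special e :: winv (u₁ ++ l :: v₂)) (by grind)
      have hx' := isStringIn_hat.1 hx
      have g2 : Tail Q (flip (Q.source e')) (v₂ ++ [.triv (Q.source e)]) := by
        rw [h3, List.append_assoc, List.cons_append] at hx'; rcases hl with rfl | rfl
        · exact hx'.tail rfl
        · rw [loop_ends he']; exact hx'.tail rfl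
      have hS : ∀ l : Letter V E, l.IsMixed Q → (∀ e, l ≠ .special e) → l.IsValid Q.hat := by
        intro l _ hl
        cases l with
        | special e => exact absurd rfl (hl e)
        | _ => simp [Letter.IsValid, SkewedGentleQuiver.hat]
      refine ⟨v₂, by simp, by simp, ?_, fun h5 => ?_⟩
      · refine Tail.trichotomy separates_isValid_hat (p := flip (Q.source e'))
          (by simpa using g2) g.1.2 (fun l hl => hx'.mem l (by simp at hl ⊢; tauto)) fun l hl =>
          hS l (g.2.2 l hl) fun e'' h6 => ?_
        subst h6; rw [mem_winv] at hl; exact h e'' (by simp only [Letter.symm] at hl; simp [hl])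
      · exact g.2.2 (.triv (Q.source e)) (by rw [← h5]; simp) e he rfl
    refine ⟨fun e' he' u₁ v₁ hu => ?_, fun e' he' u₁ v₁ hu => ?_⟩
    · obtain ⟨v₂, rfl, h3, h4, h5⟩ := key he' (.inl rfl) hu; obtain ⟨n, hn⟩ := h1 e' he' _ _ h3
      rcases h4 with h4 | h4 | ⟨m, h4⟩
      exacts [absurd h4 h5, h4,
        (hn.asymm (keys_puncture (p := Q.source e) ▸ h4.append_right _)).elim]
    · obtain ⟨v₂, rfl, h3, h4, h5⟩ := key he' (.inr rfl) hu; obtain ⟨n, hn⟩ := h2 e' he' _ _ h3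
      rcases h4 with h4 | ⟨m, h4⟩ | h4
      exacts [absurd h4 h5, (hn.asymm (keys_puncture (p := Q.source e) ▸ h4.append_left _)).elim,
        h4]

end

section

lemma getElem?_orientString {i : ℕ} (h : w.drop (i + 1) = winv (w.take i) → ∀ e, w[i]? ≠ some
    (.special e)) : (orientString Q w)[i]? = (orientMixed Q w)[i]? := by
  rw [getElem?_orientMixed]; simp only [orientString, List.getElem?_mapIdx]
  cases hi : w[i]? with
  | none => rfl
  | some l =>
    cases l with
    | special e =>
      refine congrArg some ?_; have h1 : w.drop (i + 1) ≠ winv (w.take i) := by grind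
      simp only [orientLetter, if_neg h1]
    | _ => rfl

lemma A_eq_of_unfolds (hw : IsString Q w) (h : Unfolds Q x (orientMixed Q w)) : A Q w = x := by
  have hF := map_F_orientMixed (isString_iff.1 hw).mem; unfold A; rw [if_pos hw.startsTrivial]
  rcases h with ⟨rfl, h⟩ | ⟨u, e, he, rfl, h1, h2⟩
  · have h1 : winv w ≠ w := by
      intro h1; obtain ⟨u, e, he, rfl⟩ := isString_center hw h1
      refine h e (List.mem_of_getElem? (i := u.length) ?_)
      rw [getElem?_orientMixed, (split_index u (winv u) (Letter.special e)).1, Option.map_some,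
        (orientLetter_special u (winv u) e).1 rfl]
    rw [if_neg h1]; refine List.ext_getElem? fun i => getElem?_orientString fun h2 e h3 => h1 ?_
    rw [eq_take_cons_drop h3, h2, winv_split, winv_winv]; rfl
  · have hu : (winv u).map (Letter.F Q) = winv (u.map (Letter.F Q)) :=
      map_F_winv fun l hl => mem_orientMixed (isString_iff.1 hw).mem l (by rw [h1]; simp [hl])
    have hw' : w = u.map (Letter.F Q) ++ .special e :: winv (u.map (Letter.F Q)) := by
      rw [← hF, h1, List.map_append, List.map_cons, hu]; rfl
    have hl : w.length = 2 * u.length + 1 := by rw [hw']; simp [length_winv]; omega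
    have hl' : w.length / 2 = u.length := by omega
    rw [if_pos (by rw [hw', winv_split, winv_winv]; rfl), hl']
    congr 1
    · refine List.ext_getElem? fun i => ?_
      rw [List.getElem?_take]; split_ifs with hi
      · rw [getElem?_orientString, h1, List.getElem?_append_left hi]; intro h3
        have := congrArg List.length h3; simp [length_winv] at this; omega
      · grind
    · unfold punctureAt; grind

lemma unfolds_A (hw : IsString Q w) : Unfolds Q (A Q w) (orientMixed Q w) := by
  obtain ⟨x, hx⟩ := exists_unfolds (isStringIn_orientMixed hw) (orientMixed_oriented hw).2.2
  rwa [A_eq_of_unfolds hw hx]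

/-- The word `A(w)` of a string `w` is admissible. -/
lemma isAdmissibleString_A (hw : IsString Q w) : IsAdmissibleString Q (A Q w)
    ∧ ((winv w ≠ w ∧ wordType Q (A Q w) = .uu ∧ A Q w = orientMixed Q w) ∨
    (winv w = w ∧ wordType Q (A Q w) = .up)) := by
  have hX := isStringIn_orientMixed hw; have hu := unfolds_A hw; have ho := orientMixed_oriented hw
  have hs := isString_of_unfolds hX hu; have ht := wordType_of_unfolds hX hu
  refine ⟨⟨hs, (hatOriented_iff hs).2 ((unfolds_oriented hX hu).2
    ((oriented_keys_iff hX ho.2.2).2 ⟨ho.1, ho.2.1⟩)), fun h => ?_⟩, ?_⟩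
  · grind
  · rcases ht with ⟨h1, ht⟩ | ⟨h1, -, ht⟩
    · refine .inl ⟨fun h => ?_, ht, ?_⟩
      · obtain ⟨u, e, he, rfl⟩ := isString_center hw h
        refine h1 e (List.mem_of_getElem? (i := u.length) ?_)
        rw [getElem?_orientMixed, (split_index u (winv u) (Letter.special e)).1, Option.map_some,
          (orientLetter_special u (winv u) e).1 rfl]
      · rcases hu with ⟨hu, -⟩ | ⟨u, e, he, -, hu, -⟩
        · exact hu
        · grind
    · refine .inr ⟨?_, ht⟩; have h2 := congrArg (List.map (Letter.F Q)) h1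
      rwa [map_F_winv hX.mem, map_F_orientMixed (isString_iff.1 hw).mem] at h2

/-- Every admissible string whose left end is not punctured is of the form `A(w)`. -/
lemma exists_eq_A (hx : IsAdmissibleString Q x) (ht : wordType Q x = .uu ∨ wordType Q x = .up) :
    ∃ w, IsString Q w ∧ x = A Q w := by
  have hs := isStringIn_hat.1 (isString_iff.1 hx.1); obtain ⟨p, hp⟩ := hs.head
  obtain ⟨q, hq⟩ := hs.last; have hty := wordType_eq (Q := Q) hx.1.startsTrivial hp hq
  have hp' : ¬ Loop Q p := by
    intro h; rw [if_pos h] at hty; rw [hty] at ht; split_ifs at ht <;> simp at ht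
  -- trivial letters only occur at the ends of a string
  have hmem : ∀ {u l v}, x = u ++ l :: v → v ≠ [] → l.IsMixed Q := by
    intro u l v hu hv
    cases l with
    | dir | inv => trivial
    | special e =>
      have := hs.mem (.special e) (by rw [hu]; simp)
      exact absurd this (by simp [Letter.IsValid, SkewedGentleQuiver.hat])
    | triv r =>
      cases v with
      | nil => exact absurd rfl hv
      | cons b v =>
        have h1 := List.IsChain.right_of_append (hu ▸ hs.chain)
        obtain ⟨_, h2, -⟩ := (List.isChain_cons_cons.1 h1).1; cases h2
    | trivInv r =>
      rcases List.eq_nil_or_concat u with rfl | ⟨u, b, rfl⟩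
      · rw [hu] at hp
        simp only [List.nil_append, List.head?_cons, Option.some.injEq, Letter.trivInv.injEq] at hp
        subst hp; exact fun e he h1 => hp' ⟨e, he, h1⟩
      · have h1 := hs.chain; rw [hu, List.concat_eq_append, List.append_assoc] at h1
        have h1 := List.IsChain.right_of_append h1
        obtain ⟨_, -, h2⟩ := (List.isChain_cons_cons.1 h1).1; cases h2
  obtain ⟨u, rfl⟩ : ∃ u, x = u ++ [.triv q] := by
    obtain ⟨u, hu⟩ := List.getLast?_eq_some_iff.1 hq; exact ⟨u, hu⟩
  have hu : ∀ l ∈ u, l.IsMixed Q := by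
    intro l hl; obtain ⟨a, b, rfl⟩ := List.append_of_mem hl; grind
  have hu' : ∀ e, .special e ∉ u := by
    intro e he; have := hs.mem (.special e) (by simp [he])
    exact absurd this (by simp [Letter.IsValid, SkewedGentleQuiver.hat])
  -- a punctured right end is replaced by the middle letter of a symmetric word
  obtain ⟨X, hX, hc, hun⟩ : ∃ X, IsStringIn Q (Letter.IsMixed Q) X ∧ SpecialCentral X ∧
      Unfolds Q (u ++ [.triv q]) X := by
    by_cases hq' : Loop Q q
    · obtain ⟨e, he, rfl⟩ := hq'
      have hh : ∃ p, u.head? = some (.trivInv p) := by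
        cases u with
        | nil => simp at hp
        | cons => exact ⟨p, by simpa using hp⟩
      have hh' : ∃ p, (winv u).getLast? = some (.triv p) := by
        obtain ⟨p, hp⟩ := hh; exact ⟨p, by simp [winv, List.head?_map, hp, Letter.symm]⟩
      have hc1 : (u ++ [Letter.special e]).IsChain (Letter.Compat Q) := by
        obtain ⟨h1, h2, h3⟩ := List.isChain_append.1 hs.chain
        refine List.isChain_append.2 ⟨h1, List.isChain_singleton _, fun a ha b hb => ?_⟩
        simp only [List.head?_cons, Option.mem_def, Option.some.injEq] at hb; subst hb
        obtain ⟨p, h4, h5⟩ := h3 a ha (.triv (Q.source e)) (by simp)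
        exact ⟨p, h4, (congrArg some (loop_ends he).symm).trans h5⟩
      have hm1 : ∀ l ∈ u ++ [Letter.special e], l.IsMixed Q := by
        intro l hl; rcases List.mem_append.1 hl with hl | hl
        · exact hu l hl
        · rw [List.mem_singleton.1 hl]; exact he
      have hc2 : (winv (u ++ [Letter.special e])).IsChain (Letter.Compat Q) := by
        unfold winv; rw [List.isChain_reverse, List.isChain_map]
        exact List.IsChain.imp_of_mem_imp
          (fun a b ha hb hab => hab.symm (hm1 a ha).symm_tgt (hm1 b hb).symm_src) hc1
      rw [winv_append] at hc2
      refine ⟨u ++ .special e :: winv u, ⟨?_, ?_, ?_, ?_⟩, ?_, .inr ⟨u, e, he, rfl, rfl, hu'⟩⟩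
      · intro l hl; simp only [List.mem_append, List.mem_cons] at hl; rcases hl with hl | rfl | hl
        · exact hu l hl
        · exact he
        · have := (hu _ (mem_winv.1 hl)).symm; rwa [l.symm_symm] at this
      · have := hc1.append_overlap hc2 (by simp); grind
      · grind
      · grind
      · intro e' a b hab; rcases List.append_eq_append_iff.1 hab with ⟨c, rfl, hc⟩ | ⟨c, rfl, hc⟩
        · rcases c with - | ⟨l, c⟩
          · grind
          · rw [List.cons_append, List.cons.injEq] at hc
            exact absurd (mem_winv.1 (by rw [hc.2]; simp : Letter.special e' ∈ winv u)) (hu' e')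
        · rcases c with - | ⟨l, c⟩
          · grind
          · grind
    · have hne : ∀ e, .special e ∉ u ++ [.triv q] := by grind
      refine ⟨u ++ [.triv q], ⟨?_, hs.chain, hs.head, hs.last⟩, ?_, .inl ⟨rfl, hne⟩⟩
      · intro l hl; rcases List.mem_append.1 hl with hl | hl
        · exact hu l hl
        · rw [List.mem_singleton.1 hl]; exact fun e he h1 => hq' ⟨e, he, h1⟩
      · intro e a b hab; grind
  have ho := (oriented_keys_iff hX hc).1 ((unfolds_oriented hX hun).1 ((hatOriented_iff hx.1).1 hx.2.1))
  have hX' := eq_orientMixed hX ho.1 ho.2 hc; have hw := (isStringIn_mixed_iff hX.mem).1 hX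
  exact ⟨_, hw, (A_eq_of_unfolds hw (hX' ▸ hun)).symm⟩

lemma hatOriented_winv (hx : IsString Q.hat x) (h : HatOriented Q x) : HatOriented Q (winv x) := by
  obtain ⟨h1, h2⟩ := (hatOriented_iff hx).1 h
  exact (hatOriented_iff (isString_winv hx)).2 ⟨orientedInv_winv h2, orientedDir_winv h1⟩

lemma wordType_winv (hx : IsString Q.hat x) : (wordType Q x = .uu → wordType Q (winv x) = .uu)
    ∧ (wordType Q x = .up → wordType Q (winv x) = .pu) ∧ (wordType Q x = .pu → wordType Q (winv x) =
    .up) := by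
  obtain ⟨-, ⟨p, hp⟩, ⟨q, hq⟩⟩ := id hx
  have h1 : (winv x).head? = some (.trivInv q) := by
    simp [winv, List.head?_reverse, List.getLast?_map, hq, Letter.symm]
  have h2 : (winv x).getLast? = some (.triv p) := by simp [winv, List.head?_map, hp, Letter.symm]
  rw [wordType_eq hx.startsTrivial hp hq, wordType_eq (isString_winv hx).startsTrivial h1 h2]
  by_cases h3 : ∃ e ∈ Q.special, Q.source e = p <;> by_cases h4 : ∃ e ∈ Q.special, Q.source e = q <;>
    simp only [h3, h4, if_true, if_false, reduceCtorEq, implies_true, and_self, false_imp_iff]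

lemma isAdmissibleString_winv (hx : IsAdmissibleString Q x) (ht : wordType Q (winv x) ≠ .pp) :
    IsAdmissibleString Q (winv x) :=
  ⟨isString_winv hx.1, hatOriented_winv hx.1 hx.2.1, fun h => absurd h ht⟩

end

/-! ### Successors of strings -/

section

/-- The letter of an arrow or of its inverse. -/
def arrowLetter : Bool → E → Letter V E
  | true, a => .dir a
  | false, a => .inv a

/-- The polarized vertex in which the letter `arrowLetter H a` ends. -/
def arrowEnd (Q : SkewedGentleQuiver V E) : Bool → E → V × ℤˣ
  | true, a => Q.target a
  | false, a => Q.source a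

/-- `t` is the smallest (for `H = true`) or largest right inextensible word which starts at `p`: its
letters are direct (or inverse) or special, and it cannot be continued in the same direction. -/
structure ExtTail (Q : SkewedGentleQuiver V E) (H : Bool) (p : V × ℤˣ) (t : Word V E) : Prop where
  tail : Tail Q p t
  cases_mem : ∀ l ∈ t, (∃ a ∉ Q.special, l = arrowLetter H a) ∨ (∃ e ∈ Q.special, l = .special e) ∨
    ∃ r, l = .triv r ∧ ∀ a, arrowEnd Q H a ≠ r

/-- The smallest right inextensible words. -/
abbrev MinTail (Q : SkewedGentleQuiver V E) := ExtTail Q true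

/-- The largest right inextensible words. -/
abbrev MaxTail (Q : SkewedGentleQuiver V E) := ExtTail Q false

variable {H : Bool} {a : E}

lemma ExtTail.triv (h : ∀ a, arrowEnd Q H a ≠ p) : ExtTail Q H p [.triv p] :=
  ⟨.triv _, fun _ hl => .inr (.inr ⟨p, List.mem_singleton.1 hl, h⟩)⟩

lemma ExtTail.cons (h1 : l.tgt Q = some p) (h2 : l.src Q = some q)
    (hl : (∃ a ∉ Q.special, l = arrowLetter H a) ∨ ∃ e ∈ Q.special, l = .special e)
    (h : ExtTail Q H (flip q) t) : ExtTail Q H p (l :: t) :=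
  ⟨.cons h1 h2 h.tail, List.forall_mem_cons.2 ⟨hl.imp_right Or.inl, h.cases_mem⟩⟩

lemma ExtTail.isValid (h : ExtTail Q H p t) : ∀ l ∈ t, l.IsValid Q := by
  intro l hl; rcases h.cases_mem l hl with ⟨a, ha, rfl⟩ | ⟨e, he, rfl⟩ | ⟨r, rfl, hr⟩
  · cases H <;> exact ha
  · exact he
  · intro e he h1; cases H
    exacts [hr e h1, hr e ((loop_ends he).symm.trans h1)]

lemma Tail.getLast? (h : Tail Q p t) : ∃ r, t.getLast? = some (.triv r) := by
  induction h with
  | triv p => exact ⟨p, rfl⟩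
  | cons _ _ h3 ih =>
    grind

lemma Tail.isChain (h : Tail Q p t) : t.IsChain (Letter.Compat Q) ∧ ∃ l s, t = l :: s ∧ l.tgt Q =
    some p := by
  induction h with
  | triv p => exact ⟨List.isChain_singleton _, _, _, rfl, rfl⟩
  | @cons p q l t h1 h2 _ ih =>
    obtain ⟨h4, l', s, rfl, h5⟩ := ih
    exact ⟨List.isChain_cons_cons.2 ⟨⟨q, h2, h5⟩, h4⟩, _, _, rfl, h1⟩

lemma ExtTail.getLast? (h : ExtTail Q H p t) : ∃ r, t.getLast? = some (.triv r) ∧ ∀ a, arrowEnd Q H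
    a ≠ r := by
  obtain ⟨r, hr⟩ := h.tail.getLast?; refine ⟨r, hr, ?_⟩
  rcases h.cases_mem _ (List.mem_of_getLast? hr) with ⟨a, -, h1⟩ | ⟨e, -, h1⟩ | ⟨r', h1, h2⟩
  · cases H <;> cases h1
  · cases h1
  · cases h1; exact h2

variable {n : ℕ}

lemma MinTail.not_firstLt (h : MinTail Q p t) (h' : Tail Q p t') (hv : ∀ l ∈ t', l.IsValid Q)
    (hn : FirstLt n (keys t') (keys t)) : False := by
  obtain ⟨Z, x, y, t₂, t₂', r, rfl, rfl, -, h1, h2, h3⟩ :=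
    h'.exists_split separates_isValid h.tail hv h.isValid hn
  have hx := hv x (by simp)
  rcases h.cases_mem y (by simp) with ⟨a, ha, rfl⟩ | ⟨e, he, rfl⟩ | ⟨r', rfl, hr⟩
  · simp [Letter.key, arrowLetter] at h1
  · cases x <;> simp [Letter.key] at h1
    exact hx (by rwa [Q.target_injective (Option.some.inj (h2.trans h3.symm))])
  · cases x <;> simp [Letter.key] at h1; exact hr _ (Option.some.inj (h2.trans h3.symm))

lemma MaxTail.not_firstLt (h : MaxTail Q p t) (h' : Tail Q p t') (hv : ∀ l ∈ t', l.IsValid Q)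
    (hn : FirstLt n (keys t) (keys t')) : False := by
  obtain ⟨Z, x, y, t₂, t₂', r, rfl, rfl, -, h1, h2, h3⟩ :=
    h.tail.exists_split separates_isValid h' h.isValid hv hn
  have hy := hv y (by simp)
  rcases h.cases_mem x (by simp) with ⟨a, ha, rfl⟩ | ⟨e, he, rfl⟩ | ⟨r', rfl, hr⟩
  · cases y <;> simp [Letter.key, arrowLetter] at h1
  · cases y <;> simp [Letter.key] at h1; refine hy ?_
    rwa [Q.source_injective (Option.some.inj (h3.trans (h2.symm.trans
      (congrArg some (loop_ends he).symm))))]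
  · cases y <;> simp [Letter.key] at h1; exact hr _ (Option.some.inj (h3.trans h2.symm))

lemma ExtTail.unique (h : ExtTail Q H p t) (h' : ExtTail Q H p t') : t = t' := by
  rcases h.tail.trichotomy separates_isValid h'.tail h.isValid h'.isValid with
    h1 | ⟨n, h1⟩ | ⟨n, h1⟩
  · exact h1
  all_goals cases H
  exacts [(MaxTail.not_firstLt h h'.tail h'.isValid h1).elim,
    (MinTail.not_firstLt h' h.tail h.isValid h1).elim,
    (MaxTail.not_firstLt h' h.tail h.isValid h1).elim,
    (MinTail.not_firstLt h h'.tail h'.isValid h1).elim]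

lemma exists_minTail (Q : SkewedGentleQuiver V E) (p : V × ℤˣ) : ∃ t, MinTail Q p t := by
  by_contra hp; obtain ⟨N, hN⟩ := (Q.finite_paths.image List.length).bddAbove
  have key : ∀ n p, (¬ ∃ t, MinTail Q p t) → ∃ a l, l.length = n ∧ Q.target a = p ∧
      Q.IsAdmissiblePath (a :: l) := by
    intro n
    induction n with
    | zero =>
      intro p hp; by_contra h
      exact hp ⟨_, .triv fun a ha => h ⟨a, [], rfl, ha, by simp, List.isChain_singleton _⟩⟩
    | succ n ih =>
      intro p hp; by_contra h; refine hp ⟨_, .triv fun a ha => ?_⟩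
      obtain ⟨b, l, h1, h2, h3⟩ := ih (flip (Q.source a)) fun ⟨t, ht⟩ => by
        by_cases hs : a ∈ Q.special
        exacts [hp ⟨_, .cons (l := .special a) (congrArg some ha) rfl (.inr ⟨a, hs, rfl⟩) ht⟩,
          hp ⟨_, .cons (l := .dir a) (congrArg some ha) rfl (.inl ⟨a, hs, rfl⟩) ht⟩]
      exact h ⟨a, b :: l, by simp [h1], ha, by simp,
        List.isChain_cons_cons.2 ⟨by rw [h2, flip_flip], h3.2⟩⟩
  obtain ⟨a, l, h1, -, h2⟩ := key N p hp; have := hN ⟨_, h2, rfl⟩; simp at this; omega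

end

section

/-- The end `A` of a string is replaced by `C` in its successor: either a hook is added, or a cohook
is deleted. The word `B` is the longer one of `A` and `C`. -/
inductive Ext (Q : SkewedGentleQuiver V E) : Word V E → Word V E → Word V E → Prop
  | hook {a : E} {m : Word V E} : a ∉ Q.special → MinTail Q (flip (Q.target a)) m →
      Ext Q [.triv (Q.source a)] (.inv a :: m) (.inv a :: m)
  | cohook {a : E} {m : Word V E} : a ∉ Q.special → MaxTail Q (flip (Q.source a)) m →
      Ext Q (.dir a :: m) (.dir a :: m) [.triv (Q.target a)]

variable {u : Word V E}

variable {A : Word V E}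

lemma Ext.tails (h : Ext Q A B C) : ∃ r, (Tail Q r A ∧ ∀ l ∈ A, l.IsValid Q)
    ∧ (Tail Q r B ∧ ∀ l ∈ B, l.IsValid Q) ∧ Tail Q r C ∧ ∀ l ∈ C, l.IsValid Q := by
  have mem : ∀ {l : Letter V E} {m}, l.IsValid Q → (∀ l ∈ m, l.IsValid Q) →
      ∀ l' ∈ l :: m, l'.IsValid Q := fun h1 h2 => List.forall_mem_cons.2 ⟨h1, h2⟩
  cases h with
  | @hook a m ha hm =>
    refine ⟨Q.source a, ⟨.triv _, mem ?_ (by simp)⟩, ⟨.cons rfl rfl hm.tail, mem ha hm.isValid⟩,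
      .cons rfl rfl hm.tail, mem ha hm.isValid⟩
    exact fun e he h => ha (Q.source_injective h ▸ he)
  | @cohook a m ha hm =>
    refine ⟨Q.target a, ⟨.cons rfl rfl hm.tail, mem ha hm.isValid⟩,
      ⟨.cons rfl rfl hm.tail, mem ha hm.isValid⟩, .triv _, mem ?_ (by simp)⟩
    exact fun e he h =>
      ha (Q.target_injective ((loop_ends he).symm.trans h) ▸ he)

lemma IsString.replace (hw : IsString Q (s ++ A)) (hs : s ≠ []) (h : Tail Q p A) (h' : Tail Q p C)
    (hC : ∀ l ∈ C, l.IsValid Q) : IsString Q (s ++ C) := by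
  have hw := isString_iff.1 hw; obtain ⟨h1, a, A', rfl, h2⟩ := h.isChain
  obtain ⟨h3, c, C', rfl, h4⟩ := h'.isChain; obtain ⟨h5, h6, h7⟩ := List.isChain_append.1 hw.chain
  rw [isString_iff]
  refine ⟨fun l hl => ?_, List.isChain_append.2 ⟨h5, h3, fun x hx y hy => ?_⟩, ?_, ?_⟩
  · rcases List.mem_append.1 hl with hl | hl
    · exact hw.mem l (by simp [hl])
    · exact hC l hl
  · obtain ⟨q, h8, h9⟩ := h7 x hx a (by simp)
    simp only [List.head?_cons, Option.mem_def, Option.some.injEq] at hy; subst hy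
    exact ⟨q, h8, h4.trans (h2.symm.trans h9)⟩
  · obtain ⟨q, hq⟩ := hw.head
    cases s with
    | nil => exact absurd rfl hs
    | cons => exact ⟨q, by simpa using hq⟩
  · obtain ⟨q, hq⟩ := h'.getLast?; grind

lemma IsString.eq_cons (hw : IsString Q w) : ∃ p t, w = .trivInv p :: t ∧ Tail Q (flip p)
    t ∧ ∀ l ∈ t, l.IsValid Q := by
  have hw := isString_iff.1 hw; obtain ⟨p, hp⟩ := hw.head
  cases w with
  | nil => cases hp
  | cons l t =>
    simp only [List.head?_cons, Option.some.injEq] at hp; subst hp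
    exact ⟨p, t, rfl, IsStringIn.tail (u := []) hw rfl, fun l hl => hw.mem l (by simp [hl])⟩

lemma Letter.Lt.tgt {x y : Letter V E} (h : Letter.Lt Q x y) : (∃ q, x.tgt Q = some q) ∧ ∃ q,
    y.tgt Q = some q := by obtain ⟨-, h⟩ := h; cases x <;> cases y <;> simp [Letter.tgt] at h ⊢

lemma WordLt.exists_cons (h : WordLt Q (l :: w) z) (hl : l.tgt Q = none) : ∃ z', z = l ::
    z' ∧ WordLt Q w z' := by
  obtain ⟨u, x, y, v', w', h1, rfl, h3⟩ := h
  cases u with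
  | nil =>
    obtain ⟨rfl, -⟩ := List.cons.inj h1; obtain ⟨⟨q, hq⟩, -⟩ := h3.tgt; grind
  | cons a u =>
    obtain ⟨rfl, rfl⟩ := List.cons.inj h1; exact ⟨_, rfl, u, x, y, v', w', rfl, rfl, h3⟩

lemma WordLt.asymm (h : WordLt Q w z) (h' : WordLt Q z w) : False := by
  obtain ⟨m, h⟩ := h.exists_firstLt; obtain ⟨n, h'⟩ := h'.exists_firstLt; exact h.asymm h'

/-- A string between `s A` and `s C` starts with `s`. -/
lemma WordLt.exists_between (h : WordLt Q (s ++ A) z) (h' : WordLt Q z (s ++ C)) : ∃ z',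
    z = s ++ z' ∧ WordLt Q A z' ∧ ∃ m, FirstLt m (keys z') (keys C) := by
  obtain ⟨u, x, y, v', w', h1, rfl, h3⟩ := id h
  rcases List.append_eq_append_iff.1 h1 with ⟨a, rfl, ha⟩ | ⟨a, rfl, ha⟩
  · refine ⟨a ++ y :: w', by simp, ⟨a, x, y, v', w', ha, rfl, h3⟩, ?_⟩
    obtain ⟨m, hm⟩ := h'.exists_firstLt; rw [List.append_assoc, keys_append, keys_append s] at hm
    obtain ⟨m', -, hm⟩ := firstLt_append.1 hm; exact ⟨m', hm⟩
  · cases a with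
    | nil =>
      rw [List.append_nil] at h' ⊢; refine ⟨y :: w', rfl, ⟨[], x, y, v', w', ha.symm, rfl, h3⟩, ?_⟩
      obtain ⟨m, hm⟩ := h'.exists_firstLt; rw [keys_append, keys_append] at hm
      obtain ⟨m', -, hm⟩ := firstLt_append.1 hm; exact ⟨m', hm⟩
    | cons c a =>
      obtain ⟨rfl, -⟩ := List.cons.inj ha
      exact (h'.asymm ⟨u, x, y, a ++ C, w', by simp, rfl, h3⟩).elim

lemma WordLt.append (h : WordLt Q A C) (s : Word V E) : WordLt Q (s ++ A) (s ++ C) := by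
  obtain ⟨u, x, y, v', w', rfl, rfl, h3⟩ := h; exact ⟨s ++ u, x, y, v', w', by simp, by simp, h3⟩

lemma Ext.wordLt (h : Ext Q A B C) : WordLt Q A C := by
  cases h with
  | @hook a m => exact ⟨[], _, _, [], m, rfl, rfl, rfl, trivial⟩
  | @cohook a m => exact ⟨[], _, _, m, [], rfl, rfl, rfl, trivial⟩

/-- No string lies between `s A` and `s C`, since the rest `m` of `A` or `C` is extremal. -/
lemma Ext.isSucc (h : Ext Q A B C) (hs : s ≠ []) (hw : IsString Q (s ++ A)) : IsSucc Q (s ++ A)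
    (s ++ C) := by
  obtain ⟨r, ⟨h1, -⟩, -, h2, h3⟩ := h.tails
  refine ⟨hw, hw.replace hs h1 h2 h3, h.wordLt.append s, fun z hz ⟨h4, h5⟩ => ?_⟩
  obtain ⟨z', rfl, h6, m', h7⟩ := h4.exists_between h5; have hz' := isString_iff.1 hz
  cases h with
  | @hook a m ha hm =>
    obtain ⟨u, x, y, v', w', g1, rfl, g2⟩ := h6; rcases u with - | ⟨b, u⟩; swap
    · simp at g1
    obtain ⟨rfl, -⟩ := List.cons.inj g1
    cases y <;> simp only [Letter.Lt, and_false, Letter.tgt, Option.some.injEq] at g2; rename_i b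
    obtain rfl := Q.source_injective g2.1
    obtain ⟨n, -, h8⟩ := (firstLt_append (P := [2]) (A := keys w') (B := keys m)).1 h7
    exact hm.not_firstLt (hz'.tail rfl) (fun l hl => hz'.mem l (by simp [hl])) h8
  | @cohook a m ha hm =>
    obtain ⟨l, w', rfl⟩ : ∃ l w', z' = l :: w' := by
      cases z' with
      | nil =>
        obtain ⟨-, x, y, g1, -⟩ := h7; simp [keys] at g1
      | cons l w' => exact ⟨l, w', rfl⟩
    have h8 : l.key = 0 := by
      obtain ⟨-, x, y, g1, g2, g3⟩ := h7
      cases m' with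
      | zero =>
        simp only [keys, List.map_cons, List.getElem?_cons_zero, Option.some.injEq] at g1 g2
        subst g1 g2; exact Nat.lt_one_iff.1 g3
      | succ n => simp [keys] at g2
    cases l <;> simp only [Letter.key, OfNat.ofNat_ne_zero, one_ne_zero] at h8; rename_i b
    obtain ⟨u, x, y, v', w'', g1, g2, g3⟩ := h6; rcases u with - | ⟨c, u⟩
    · obtain ⟨rfl, -⟩ := List.cons.inj g1; obtain ⟨rfl, -⟩ := List.cons.inj g2; exact g3.2
    · obtain ⟨rfl, rfl⟩ := List.cons.inj g1; obtain ⟨h9, rfl⟩ := List.cons.inj g2; cases h9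
      obtain ⟨n, hn⟩ := WordLt.exists_firstLt (Q := Q) ⟨u, x, y, v', w'', rfl, rfl, g3⟩
      exact hm.not_firstLt (hz'.tail rfl)
        (fun l hl => hz'.mem l (List.mem_append_right _ (List.mem_cons_of_mem _ hl))) hn

lemma IsSucc.unique (h : IsSucc Q w u) (h' : IsSucc Q w z) : u = z := by
  obtain ⟨p, t, rfl, -, -⟩ := h.1.eq_cons; obtain ⟨u', rfl, h1⟩ := h.2.2.1.exists_cons rfl
  obtain ⟨z', rfl, h2⟩ := h'.2.2.1.exists_cons rfl; obtain ⟨p₁, t₁, h3, h4, h5⟩ := h.2.1.eq_cons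
  obtain ⟨p₂, t₂, h6, h7, h8⟩ := h'.2.1.eq_cons; cases h3; cases h6
  have hlt : ∀ {a b : Word V E}, WordLt Q a b → WordLt Q (.trivInv p :: a) (.trivInv p :: b) :=
    fun h => h.append [_]
  rcases h4.trichotomy separates_isValid h7 h5 h8 with rfl | h9 | h9
  · rfl
  exacts [(h'.2.2.2 _ h.2.1 ⟨h.2.2.1, hlt ((h4.wordLt_iff h7 h5 h8).2 h9)⟩).elim,
    (h.2.2.2 _ h'.2.1 ⟨h'.2.2.1, hlt ((h7.wordLt_iff h4 h8 h5).2 h9)⟩).elim]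

lemma Ext.next_eq (h : Ext Q A B C) (hs : s ≠ []) (hw : IsString Q (s ++ A)) : next Q (s ++ A)
    = s ++ C := by
  have h1 := h.isSucc hs hw; unfold next; rw [dif_pos ⟨_, h1⟩]
  exact (Classical.choose_spec (⟨_, h1⟩ : ∃ u, IsSucc Q (s ++ A) u)).unique h1

lemma Ext.not_isMaxString (h : Ext Q A B C) (hs : s ≠ []) (hw : IsString Q (s ++ A)) : ¬ IsMaxString
    Q (s ++ A) := fun h1 => h1.2 _ (h.isSucc hs hw).2.1 (h.isSucc hs hw).2.2.1

lemma MaxTail.isMaxString (h : MaxTail Q (flip p) t) (hw : IsString Q (.trivInv p :: t)) :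
    IsMaxString Q (.trivInv p :: t) := by
  refine ⟨hw, fun z hz hlt => ?_⟩; obtain ⟨z', rfl, h1⟩ := hlt.exists_cons rfl
  obtain ⟨q, z'', h2, h3, h4⟩ := hz.eq_cons; cases h2; obtain ⟨n, hn⟩ := h1.exists_firstLt
  exact h.not_firstLt h3 h4 hn

/-- A right inextensible word is maximal, or one of its ends can be replaced by a larger one. -/
lemma Tail.maxTail_or_ext (h : Tail Q p t) (hv : ∀ l ∈ t, l.IsValid Q) : MaxTail Q p t ∨ ∃ s A B C,
    t = s ++ A ∧ Ext Q A B C := by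
  induction h with
  | triv p =>
    by_cases h : ∃ a, Q.source a = p
    · obtain ⟨a, rfl⟩ := h; obtain ⟨m, hm⟩ := exists_minTail Q (flip (Q.target a))
      exact .inr ⟨[], _, _, _, rfl, .hook (fun ha => hv (.triv (Q.source a)) (by simp) a ha rfl) hm⟩
    · exact .inl (.triv fun a ha => h ⟨a, ha⟩)
  | @cons p q l t h1 h2 h3 ih =>
    have hl := hv l (by simp)
    rcases ih fun l hl => hv l (by simp [hl]) with h4 | ⟨s, A, B, C, rfl, h4⟩
    · cases l with
      | dir a =>
        cases h2; exact .inr ⟨[], _, _, _, rfl, .cohook hl h4⟩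
      | inv a => exact .inl (.cons h1 h2 (.inl ⟨a, hl, rfl⟩) h4)
      | special e => exact .inl (.cons h1 h2 (.inr ⟨e, hl, rfl⟩) h4)
      | triv _ => cases h2
      | trivInv _ => cases h1
    · grind

variable {H : Bool} {a : E}

lemma append_cons_eq {α : Type*} {P : α → Prop} {s s' m m' : List α} {x y : α} (hm : ∀ l ∈ m, ¬ P l)
    (hm' : ∀ l ∈ m', ¬ P l) (hx : P x) (hy : P y) (h : s ++ x :: m = s' ++ y :: m') : s = s' ∧ x = y
    ∧ m = m' := by
  rcases List.append_eq_append_iff.1 h with ⟨a, rfl, ha⟩ | ⟨a, rfl, ha⟩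
  · cases a with
    | nil => simpa using ha
    | cons b a =>
      grind
  · cases a with
    | nil => simpa [eq_comm] using ha
    | cons b a =>
      grind

lemma getLast?_append_of_some {α : Type*} {s m : List α} {x : α} (h : m.getLast? = some x) :
    (s ++ m).getLast? = some x := by rw [List.getLast?_append, h]; rfl

lemma ExtTail.unique_of_append {a' : E} (hm : ExtTail Q H p t) (hm' : ExtTail Q H r t')
    (h : s ++ arrowLetter (!H) a :: t = s' ++ arrowLetter (!H) a' :: t') : a = a' ∧ t = t' := by
  have key : ∀ {p m}, ExtTail Q H p m → ∀ l ∈ m, ¬ ∃ a, l = arrowLetter (!H) a := by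
    rintro p m h l hl ⟨b, hb⟩
    rcases h.cases_mem l hl with ⟨a, ha, rfl⟩ | ⟨e, he, rfl⟩ | ⟨r', rfl, hr⟩ <;> cases H <;> cases hb
  obtain ⟨-, h1, h2⟩ := append_cons_eq (key hm) (key hm') ⟨a, rfl⟩ ⟨a', rfl⟩ h
  exact ⟨by cases H <;> cases h1 <;> rfl, h2⟩

lemma ExtTail.append_ne (hm : ExtTail Q H p t) (h : s ++ [.triv (arrowEnd Q H a)] = s' ++ l :: t) :
    False := by obtain ⟨r, hr, h1⟩ := hm.getLast?; have h2 := congrArg List.getLast? h; grind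

lemma Ext.unique_left (h : Ext Q A B C) (h' : Ext Q A' B' C') (hs : s ++ A = s' ++ A') :
    A = A' ∧ B = B' ∧ C = C' := by
  cases h with
  | hook ha hm =>
    cases h' with
    | hook ha' hm' =>
      obtain rfl := Q.source_injective (by simpa using congrArg List.getLast? hs)
      rw [hm.unique hm']; simp
    | cohook ha' hm' => exact (hm'.append_ne hs).elim
  | cohook ha hm =>
    cases h' with
    | hook ha' hm' => exact (hm.append_ne hs.symm).elim
    | cohook ha' hm' =>
      obtain ⟨rfl, rfl⟩ := hm.unique_of_append hm' hs; simp

lemma Ext.unique_right (h : Ext Q A B C) (h' : Ext Q A' B' C') (hs : s ++ C = s' ++ C') :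
    A = A' ∧ C = C' := by
  cases h with
  | hook ha hm =>
    cases h' with
    | hook ha' hm' =>
      obtain ⟨rfl, rfl⟩ := hm.unique_of_append hm' hs; simp
    | cohook ha' hm' => exact (hm.append_ne hs.symm).elim
  | cohook ha hm =>
    cases h' with
    | hook ha' hm' => exact (hm'.append_ne hs).elim
    | cohook ha' hm' =>
      obtain rfl := Q.target_injective (by simpa using congrArg List.getLast? hs)
      rw [hm.unique hm']; simp

end

/-! ### The translate of a string -/

section

/-- The strings `w` and `t` arise from the string `Z` by cutting off some of its ends, and `t` is the
translate of `w`. In the second case, a cohook at the left end of the successor `Z` of `w` meets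
the hook at its right end. -/
inductive Step (Q : SkewedGentleQuiver V E) : Word V E → Word V E → Word V E → Prop
  | normal {A₁ B₁ C₁ A₂ B₂ C₂ mid : Word V E} : Ext Q A₁ B₁ C₁ → Ext Q A₂ B₂ C₂ →
      Step Q (winv A₁ ++ mid ++ A₂) (winv B₁ ++ mid ++ B₂) (winv C₁ ++ mid ++ C₂)
  | crossing {a : E} {m m' : Word V E} : a ∉ Q.special →
      MaxTail Q (flip (Q.source a)) m → MinTail Q (flip (Q.target a)) m' →
      Step Q (winv m ++ [.triv (Q.source a)]) (winv m ++ .inv a :: m') (.trivInv (Q.target a) :: m')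

variable {A : Word V E}

lemma ne_nil_of_tail (h : Tail Q p t) : winv t ≠ [] := by
  intro h1; have := congrArg List.length h1; rw [length_winv] at this
  exact h.ne_nil (List.length_eq_zero_iff.1 this)

lemma isString_cons (h : Tail Q (flip p) t) (hv : ∀ l ∈ t, l.IsValid Q)
    (hp : ∀ e ∈ Q.special, Q.source e ≠ p) : IsString Q (.trivInv p :: t) := by
  obtain ⟨h1, l, s, rfl, h2⟩ := h.isChain; obtain ⟨q, hq⟩ := h.getLast?
  refine isString_iff.2 ⟨fun l' hl => ?_, List.isChain_cons_cons.2 ⟨⟨p, rfl, h2⟩, h1⟩, ⟨p, rfl⟩,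
    ⟨q, by rw [List.getLast?_cons, hq]; rfl⟩⟩
  rcases List.mem_cons.1 hl with rfl | hl
  exacts [hp, hv l' hl]

lemma tau_eq (hw : IsString Q w) : (IsMaxString Q w → tau Q w = next Q (lnext Q w))
    ∧ (¬ IsMaxString Q w → tau Q w = lnext Q (next Q w)) := by
  unfold tau; rw [if_pos hw.startsTrivial]; grind

lemma winv_mid (X mid Y : Word V E) : winv (winv X ++ mid ++ Y) = winv Y ++ winv mid ++ X := by
  rw [winv_append, winv_append, winv_winv, List.append_assoc]

lemma tau_normal {A₁ B₁ C₁ A₂ B₂ C₂ mid : Word V E} (h₁ : Ext Q A₁ B₁ C₁) (h₂ : Ext Q A₂ B₂ C₂)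
    (hw : IsString Q (winv A₁ ++ mid ++ A₂)) : tau Q (winv A₁ ++ mid ++ A₂) = winv C₁ ++ mid ++ C₂ ∧
    IsString Q (winv C₁ ++ mid ++ C₂) ∧ IsString Q (winv B₁ ++ mid ++ B₂) := by
  obtain ⟨r₁, ⟨g1, -⟩, ⟨g2, g2'⟩, g3, g3'⟩ := h₁.tails
  obtain ⟨r₂, ⟨k1, -⟩, ⟨k2, k2'⟩, k3, k3'⟩ := h₂.tails
  have hs : winv A₁ ++ mid ≠ [] := by simp [ne_nil_of_tail g1]
  have h3 := h₂.next_eq hs hw; have h4 := hw.replace hs k1 k3 k3'; have h5 := isString_winv h4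
  rw [winv_mid] at h5; have hs' : winv C₂ ++ winv mid ≠ [] := by simp [ne_nil_of_tail k3]
  have hs'' : winv B₂ ++ winv mid ≠ [] := by simp [ne_nil_of_tail k2]
  refine ⟨?_, ?_, ?_⟩
  · rw [(tau_eq hw).2 (h₂.not_isMaxString hs hw), h3, lnext, winv_mid, h₁.next_eq hs' h5, winv_mid,
      winv_winv]
  · have := isString_winv (h5.replace hs' g1 g3 g3'); rwa [winv_mid, winv_winv] at this
  · have h6 := isString_winv (hw.replace hs k1 k2 k2'); rw [winv_mid] at h6
    have := isString_winv (h6.replace hs'' g1 g2 g2'); rwa [winv_mid, winv_winv] at this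

lemma Step.tau_eq (h : Step Q w Z t) (hw : IsString Q w) : tau Q w = t ∧ tau Q (winv w)
    = winv t ∧ IsString Q Z ∧ IsString Q t := by
  cases h with
  | @normal A₁ B₁ C₁ A₂ B₂ C₂ mid h₁ h₂ =>
    obtain ⟨h3, h4, h5⟩ := tau_normal h₁ h₂ hw; refine ⟨h3, ?_, h5, h4⟩; have h6 := isString_winv hw
    rw [winv_mid] at h6 ⊢; rw [(tau_normal h₂ h₁ h6).1, winv_mid]
  | @crossing a m m' ha hm hm' =>
    have hh : Ext Q _ _ _ := .hook ha hm'; have hc : Ext Q _ _ _ := .cohook ha hm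
    obtain ⟨r, ⟨g1, -⟩, -, g3, g3'⟩ := hh.tails; obtain ⟨r', ⟨k1, -⟩, -, k3, k3'⟩ := hc.tails
    have hs := ne_nil_of_tail hm.tail; have hs' := ne_nil_of_tail hm'.tail
    have h1 := hh.next_eq hs hw; have h2 := hw.replace hs g1 g3 g3'; have h3 := isString_winv h2
    have e : winv (winv m ++ .inv a :: m') = winv m' ++ .dir a :: m := by
      rw [winv_split, winv_winv]; rfl
    rw [e] at h3; have h4 := hc.next_eq hs' h3
    have e2 : winv (winv m' ++ [.triv (Q.target a)]) = .trivInv (Q.target a) :: m' := by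
      rw [winv_append, winv_winv]; rfl
    have e3 : winv (.trivInv (Q.target a) :: m') = winv m' ++ [.triv (Q.target a)] := by
      rw [winv_cons]; rfl
    have e4 : winv (winv m ++ [.triv (Q.source a)]) = .trivInv (Q.source a) :: m := by
      rw [winv_append, winv_winv]; rfl
    have h5 := isString_winv hw; refine ⟨?_, ?_, h2, ?_⟩
    · rw [(SkewedGentle.tau_eq hw).2 (hh.not_isMaxString hs hw), h1, lnext, e, h4, e2]
    · have h6 : IsMaxString Q (winv (winv m ++ [.triv (Q.source a)])) := by
        rw [e4] at h5 ⊢; exact hm.isMaxString h5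
      rw [(SkewedGentle.tau_eq h5).1 h6, lnext, winv_winv, h1, e, h4, e3]
    · have := isString_winv (h3.replace hs' k1 k3 k3'); rwa [e2] at this

lemma IsString.maxTail_or_ext (hw : IsString Q w) : (∃ p m, w = .trivInv p :: m ∧ MaxTail Q (flip p)
    m) ∨ ∃ s A B C, s ≠ [] ∧ w = s ++ A ∧ Ext Q A B C := by
  obtain ⟨p, t, rfl, h1, h2⟩ := hw.eq_cons
  rcases h1.maxTail_or_ext h2 with h3 | ⟨s, A, B, C, rfl, h3⟩
  · grind
  · grind

/-- A right end to which no hook can be added. -/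
def MaxEnd (Q : SkewedGentleQuiver V E) (w s : Word V E) (l : Letter V E) (r : V × ℤˣ)
    (m : Word V E) : Prop :=
  w = s ++ l :: m ∧ MaxTail Q r m ∧ l.src Q = some (flip r) ∧
    ((∃ a ∉ Q.special, l = .dir a) ∨ s = [] ∧ ∃ p, l = .trivInv p)

lemma special_compat_special {e' : E} (he : e ∈ Q.special) (he' : e' ∈ Q.special) : Q.target e' ≠
    flip (Q.source e) := by
  intro h; have h1 := congrArg Prod.snd h; rw [(Q.special_polarity e' he').2] at h1
  simp only [flip, (Q.special_polarity e he).1] at h1; exact absurd h1 (by decide)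

lemma MaxTail.of_special (h : MaxTail Q r (.special e :: m)) : Q.target e = r ∧ e ∈ Q.special ∧
    MaxTail Q (flip (Q.source e)) m := by
  obtain ⟨h1, h2⟩ := h; obtain ⟨h3, h4⟩ := List.forall_mem_cons.1 h2
  cases h1 with
  | cons h5 h6 h7 =>
    cases h5; cases h6; exact ⟨rfl, by simpa [arrowLetter] using h3, h7, h4⟩

lemma MaxTail.special_ne (h : MaxTail Q r m) {u : Word V E} (hm : m = l :: u)
    (hl : ∀ e, l ≠ .special e) : ∀ e ∈ Q.special, Q.source e ≠ r := by
  subst hm; intro e he h1; obtain ⟨-, l', s, h2, h3⟩ := h.tail.isChain; cases h2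
  rcases h.cases_mem l (by simp) with ⟨a, ha, rfl⟩ | ⟨e, he, rfl⟩ | ⟨r', rfl, h4⟩
  exacts [ha (Q.source_injective (h1.trans (Option.some.inj h3).symm) ▸ he), hl _ rfl,
    h4 e (h1.trans (Option.some.inj h3).symm)]

/-- If no hook can be added at either end of a string, then it is projective, or cohooks can be
deleted at both ends without interference. -/
lemma projective_or_step {l' : Letter V E} (hw : IsString Q w) (h : MaxEnd Q w s l r m)
    (h' : MaxEnd Q (winv w) s' l' r' m') : IsProjectiveString Q w ∨ ∃ Z t, Step Q w Z t := by
  obtain ⟨h1, h2, h3, h4⟩ := h; obtain ⟨h1', h2', h3', h4'⟩ := h'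
  have hv := (isString_iff.1 hw).mem; have hlv : l.IsValid Q := by grind
  have hlv' : l'.IsValid Q := (isString_iff.1 (isString_winv hw)).mem l' (by rw [h1']; simp)
  have h5 : w = winv m' ++ l'.symm :: winv s' := by rw [← winv_winv w, h1', winv_split]
  have h6 : l ≠ l'.symm := by
    rcases h4 with ⟨a, -, rfl⟩ | ⟨-, p, rfl⟩ <;> rcases h4' with ⟨a', -, rfl⟩ | ⟨-, p', rfl⟩ <;>
      simp [Letter.symm]
  have hls : ∀ e, l ≠ .special e ∧ l.symm ≠ .special e := by
    rcases h4 with ⟨a, -, rfl⟩ | ⟨-, p, rfl⟩ <;> simp [Letter.symm]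
  have hls' : ∀ e, l'.symm ≠ .special e := by
    rcases h4' with ⟨a, -, rfl⟩ | ⟨-, p, rfl⟩ <;> simp [Letter.symm]
  rcases List.append_eq_append_iff.1 (h1.symm.trans h5) with ⟨b, hb, hb'⟩ | ⟨b, hb, hb'⟩
  -- the two extremal ends overlap, in at most one letter, which is special
  · left; rcases b with - | ⟨c, b⟩
    · grind
    obtain ⟨rfl, hm⟩ := List.cons.inj hb'; replace hm : m = b ++ l'.symm :: winv s' := hm
    have hm' : m' = winv b ++ l.symm :: winv s := by rw [← winv_winv m', hb, winv_split]
    have hbs : ∀ c ∈ b, ∃ e ∈ Q.special, c = .special e := by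
      intro c hc; have g1 := h2.cases_mem c (by rw [hm]; simp [hc])
      have g2 := h2'.cases_mem c.symm (by rw [hm']; simp [mem_winv, c.symm_symm, hc])
      rcases g1 with ⟨a, ha, rfl⟩ | ⟨e, he, rfl⟩ | ⟨r, rfl, -⟩
      · simp [Letter.symm, arrowLetter] at g2
      · grind
      · simp [Letter.symm, arrowLetter] at g2
    rcases b with - | ⟨c, b⟩
    · rw [List.nil_append] at hm
      rw [show winv ([] : Word V E) = [] from rfl, List.nil_append] at hm'
      have hr' : r' = flip r := by
        obtain ⟨-, l₁, s₁, g1, g2⟩ := h2'.tail.isChain; rw [hm'] at g1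
        obtain ⟨rfl, -⟩ := List.cons.inj g1; rw [hlv.isMixed.symm_tgt, h3] at g2; grind
      subst hr'; have k1 := h2.special_ne hm hls'; have k2 := h2'.special_ne hm' fun e => (hls e).2
      have e1 : ((r.1, - -r.2) : V × ℤˣ) = r := by simp
      have e2 : flip (flip r) = r := flip_flip r; refine .inl ⟨r.1, -r.2, m', m, ?_, ?_, ?_, ?_⟩
      · intro e he h7; have h8 := (Q.special_polarity e he).1
        rcases Int.units_eq_one_or r.2 with h9 | h9
        · exact k2 e he (Prod.ext h7 (by rw [h8]; simp [flip, h9]))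
        · grind
      · rw [e1]; exact h2'.isMaxString (isString_cons h2'.tail h2'.isValid k1)
      · rw [← e2] at h2; exact h2.isMaxString (isString_cons h2.tail h2.isValid k2)
      · rw [h1, hb]; simp
    · right; obtain ⟨e, he, rfl⟩ := hbs c (by simp); rw [hm, List.cons_append] at h2
      obtain ⟨g1, -, g2⟩ := h2.of_special; rcases b with - | ⟨c, b⟩; swap
      · exfalso; obtain ⟨e', he', rfl⟩ := hbs c (by simp); obtain ⟨g3, -, -⟩ := g2.of_special
        exact special_compat_special he he' g3
      rw [List.nil_append] at g2
      have e3 : m' = .special e :: (l.symm :: winv s) := by rw [hm']; rfl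
      rw [e3] at h2'; obtain ⟨g3, -, g4⟩ := h2'.of_special; have g5 := g2.unique g4
      have e4 : flip ((Q.source e).1, (1 : ℤˣ)) = Q.target e := by
        rw [← loop_ends he]; exact Prod.ext rfl (Q.special_polarity e he).1.symm
      have g6 : MaxTail Q (flip ((Q.source e).1, (1 : ℤˣ))) (.special e :: (l.symm :: winv s)) :=
        ExtTail.cons (congrArg some e4.symm) rfl (.inr ⟨e, he, rfl⟩) g4
      refine ⟨e, he, l.symm :: winv s, g6.isMaxString (isString_cons g6.tail g6.isValid ?_), ?_⟩
      · intro e' he' h7; have h8 := (Q.special_polarity e' he').1; rw [h7] at h8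
        simp_all
      · rw [h1, hm, g5, winv_cons, winv_winv, Letter.symm_symm]; simp
  -- the two extremal ends are separated by cohooks
  · right; rcases b with - | ⟨c, mid⟩
    · grind
    obtain ⟨rfl, hm⟩ := List.cons.inj hb'; replace hm : winv s' = mid ++ l :: m := hm
    obtain ⟨a, ha, rfl⟩ : ∃ a ∉ Q.special, l = .dir a := by
      simp_all
    obtain ⟨a', ha', rfl⟩ : ∃ a ∉ Q.special, l' = .dir a := by
      rcases h4' with h4 | ⟨rfl, -⟩
      · exact h4
      · have := congrArg List.length hm; simp [winv] at this
    have hr : r = flip (Q.source a) := by rw [Option.some.inj h3, flip_flip]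
    have hr' : r' = flip (Q.source a') := by rw [Option.some.inj h3', flip_flip]
    subst hr hr'; have h7 := Step.normal (mid := mid) (Ext.cohook ha' h2') (Ext.cohook ha h2)
    have h8 : winv (.dir a' :: m') ++ mid ++ .dir a :: m = w := by rw [h1, hb, winv_cons]; simp
    grind

/-- The case that a hook can be added at the right end. -/
lemma exists_step_of_hook {a : E} (hw : IsString Q w) (hs : s ≠ []) (ha : a ∉ Q.special)
    (hm : MinTail Q (flip (Q.target a)) m) (h : w = s ++ [.triv (Q.source a)]) : ∃ Z t,
    Step Q w Z t := by
  have key : ∀ s', s' ≠ [] → ∀ A, winv w = s' ++ A → ∃ mid, w = winv A ++ mid ++ [.triv (Q.source a)] := by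
    intro s' hs' A h1; have h2 : w = winv A ++ winv s' := by rw [← winv_winv w, h1, winv_append]
    rcases List.eq_nil_or_concat (winv s') with h3 | ⟨mid, y, h3⟩
    · exact absurd (by rw [← winv_winv s', h3]; rfl) hs'
    · rw [h3, List.concat_eq_append, h, ← List.append_assoc] at h2
      obtain ⟨rfl, -⟩ := List.append_inj' h2 rfl; exact ⟨mid, h⟩
  rcases (isString_winv hw).maxTail_or_ext with ⟨p, m', h1, h2⟩ | ⟨s', A, B, C, hs', h1, h2⟩
  · have h3 : w = winv m' ++ [.triv p] := by rw [← winv_winv w, h1, winv_cons]; rfl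
    obtain ⟨-, h4⟩ := List.append_inj' (h.symm.trans h3) rfl; cases h4; rw [h3]
    exact ⟨_, _, .crossing ha h2 hm⟩
  · obtain ⟨mid, rfl⟩ := key s' hs' A h1; exact ⟨_, _, .normal h2 (.hook ha hm)⟩

lemma exists_step (hw : IsString Q w) (hp : ¬ IsProjectiveString Q w) : ∃ Z t, Step Q w Z t ∨ Step Q
    (winv w) Z t := by
  have key : ∀ {w : Word V E}, IsString Q w →
      (∃ Z t, Step Q w Z t) ∨ ∃ s l r m, MaxEnd Q w s l r m := by
    intro w hw; rcases hw.maxTail_or_ext with ⟨p, m', h1, h2⟩ | ⟨s', A, B, C, hs', h1, h2⟩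
    · exact .inr ⟨[], .trivInv p, _, m', h1, h2, by rw [flip_flip]; rfl, .inr ⟨rfl, p, rfl⟩⟩
    · cases h2 with
      | hook ha hm => exact .inl (exists_step_of_hook hw hs' ha hm h1)
      | @cohook a m ha hm =>
        exact .inr ⟨s', .dir a, _, m, h1, hm, by rw [flip_flip]; rfl, .inl ⟨a, ha, rfl⟩⟩
  rcases key hw with ⟨Z, t, h⟩ | ⟨s, l, r, m, h⟩
  · grind
  rcases key (isString_winv hw) with ⟨Z, t, h'⟩ | ⟨s', l', r', m', h'⟩
  · grind
  rcases projective_or_step hw h h' with h1 | ⟨Z, t, h1⟩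
  · exact absurd h1 hp
  · grind

lemma Step.ne_winv (h : Step Q w Z t) (hw : winv w ≠ w) : winv t ≠ t := by
  intro ht
  cases h with
  | @normal A₁ B₁ C₁ A₂ B₂ C₂ mid h₁ h₂ =>
    rw [winv_append, winv_append, winv_winv, ← List.append_assoc] at ht
    obtain ⟨rfl, rfl⟩ := h₁.unique_right h₂ ht; have h3 := List.append_cancel_right ht
    have h4 := List.append_cancel_left h3
    exact hw (by rw [winv_append, winv_append, winv_winv, h4, List.append_assoc])
  | @crossing a m m' ha hm hm' =>
    obtain ⟨r, hr, h1⟩ := hm'.getLast?; rw [winv_cons] at ht; have h2 := congrArg List.getLast? ht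
    rw [List.getLast?_cons, hr, List.getLast?_append] at h2; cases h2; exact h1 a rfl

/-- The ends of a symmetric string are replaced in the same way. -/
lemma Step.of_symm (h : Step Q w Z t) (hs : IsString Q w) (hw : winv w = w) : ∃ A B C u,
    ∃ e ∈ Q.special, Ext Q A B C ∧ w = winv A ++ u ++ .special e :: winv (winv A ++ u) ∧ Z = winv B
    ++ u ++ .special e :: winv (winv B ++ u) ∧ t = winv C ++ u ++ .special e ::
    winv (winv C ++ u) := by
  obtain ⟨U, e, he, hU⟩ := isString_center hs hw
  cases h with
  | @normal A₁ B₁ C₁ A₂ B₂ C₂ mid h₁ h₂ =>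
    have h3 := hw; rw [winv_append, winv_append, winv_winv, ← List.append_assoc] at h3
    obtain ⟨rfl, rfl, rfl⟩ := h₁.unique_left h₂ h3; have hl := congrArg List.length hU
    simp only [List.length_append, length_winv, List.length_cons] at hl
    rw [List.append_assoc] at hU
    obtain ⟨u, rfl⟩ : ∃ u, U = winv A₁ ++ u := by
      rcases List.append_eq_append_iff.1 hU with ⟨b, hb, -⟩ | ⟨b, hb, -⟩
      · exact ⟨b, hb⟩
      · have := congrArg List.length hb; simp only [List.length_append, length_winv] at this
        have hb' : b = [] := List.length_eq_zero_iff.1 (by omega); grind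
    have h4 : mid = u ++ .special e :: winv u := by
      rw [winv_append, winv_winv, List.append_assoc] at hU; have := List.append_cancel_left hU
      rw [← List.cons_append, ← List.append_assoc] at this; exact List.append_cancel_right this
    subst h4; refine ⟨A₁, B₁, C₁, u, e, he, h₁, ?_, ?_, ?_⟩ <;> simp [winv_append, winv_winv]
  | @crossing a m m' ha hm hm' =>
    exfalso; obtain ⟨r, hr, h1⟩ := hm.getLast?; rw [winv_append, winv_winv] at hw
    have h2 := congrArg List.getLast? hw
    rw [getLast?_append_of_some hr, List.getLast?_append] at h2; cases h2; exact h1 a rfl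

end

/-! ### Orientation of the ends of the successor -/

section

variable {n₁ n₂ : ℕ} {H₁ H₂ : Bool}

variable {A : Word V E}

/-- The string `Z` has an ordinary letter at the positions `n₁` and `n₂`, and extremal words
outside of these positions. -/
structure Ends (Q : SkewedGentleQuiver V E) (Z : Word V E) (n₁ n₂ : ℕ) (H₁ H₂ : Bool) : Prop where
  isString : IsString Q Z
  left : ∃ p m a s, a ∉ Q.special ∧ ExtTail Q H₁ p m ∧
    Z = winv m ++ arrowLetter H₁ a :: s ∧ m.length = n₁
  right : ∃ p s a m, a ∉ Q.special ∧ ExtTail Q H₂ p m ∧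
    Z = s ++ arrowLetter (!H₂) a :: m ∧ s.length = n₂

lemma arrowLetter_symm (b : Bool) (a : E) : (arrowLetter b a : Letter V E).symm = arrowLetter (!b)
    a := by cases b <;> rfl

variable {i : ℕ} {f : E}

lemma IsString.compat (h : IsString Q Z) {l' : Letter V E} (hl : Z[i]? = some l)
    (hl' : Z[i + 1]? = some l') : Letter.Compat Q l l' := by
  obtain ⟨h1, rfl⟩ := List.getElem?_eq_some_iff.1 hl
  obtain ⟨h2, rfl⟩ := List.getElem?_eq_some_iff.1 hl'; exact List.isChain_iff_getElem.1 h.1.2 i h2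

lemma IsString.not_triv (h : IsString Q Z) (hi : i + 1 < Z.length) : Z[i]? ≠ some (.triv p) := by
  intro h1; obtain ⟨q, h2, -⟩ := h.compat h1 (List.getElem?_eq_getElem hi); cases h2

lemma getElem?_winv_of {j : ℕ} (h : Z[j]? = some l) (hi : i + j + 1 = Z.length) : (winv Z)[i]? =
    some l.symm := by rw [getElem?_winv Z hi, h]; rfl

lemma ExtTail.index {H : Bool} {a : E} (hm : ExtTail Q H p m) (hZ : IsString Q Z)
    (h : Z = s ++ arrowLetter (!H) a :: m) : 0 < s.length ∧ s.length + 1 < Z.length ∧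
    (∃ p, Z[Z.length - 1]? = some (.triv p) ∧ ∀ e, arrowEnd Q H e ≠ p) ∧ Z[s.length]? = some
    (arrowLetter (!H) a) ∧ ∀ i, s.length < i → i + 1 < Z.length → ∃ e, Z[i]? = some (.special e)
    ∨ Z[i]? = some (arrowLetter H e) := by
  have h7 : Z[s.length]? = some (arrowLetter (!H) a) := by rw [h]; simp
  have h6 := hZ.pos_of_arrow (e := a) (by rw [h7]; cases H <;> simp [arrowLetter])
  obtain ⟨r, h2, h3⟩ := hm.getLast?; refine ⟨h6.1, h6.2, ⟨r, ?_, h3⟩, h7, fun i hi hi' => ?_⟩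
  · grind
  · have hl : Z[i]? = m[i - s.length - 1]? := by grind
    rw [List.getElem?_eq_getElem (by omega)] at hl
    rcases hm.cases_mem _ (List.mem_of_getElem? hl.symm) with ⟨e, -, he⟩ | ⟨e, -, he⟩ | ⟨q, he, -⟩
    · grind
    · grind
    · exact absurd (by rw [← he]; exact List.getElem?_eq_getElem _) (hZ.not_triv (p := q) hi')

lemma Ends.right_index (h : Ends Q Z n₁ n₂ H₁ H₂) : 0 < n₂ ∧ n₂ + 1 < Z.length ∧
    (∃ p, Z[Z.length - 1]? = some (.triv p) ∧ ∀ e, arrowEnd Q H₂ e ≠ p) ∧ (∃ a ∉ Q.special, Z[n₂]? =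
    some (arrowLetter (!H₂) a)) ∧ ∀ i, n₂ < i → i + 1 < Z.length → ∃ e, Z[i]? = some (.special e) ∨
    Z[i]? = some (arrowLetter H₂ e) := by
  obtain ⟨p, s, a, m, ha, hm, h1, rfl⟩ := h.right
  obtain ⟨h2, h3, h4, h5, h6⟩ := hm.index h.isString h1; grind

lemma Ends.left_index (h : Ends Q Z n₁ n₂ H₁ H₂) : 0 < n₁ ∧ n₁ + 1 < Z.length ∧ (∃ p, Z[0]? = some
    (.trivInv p) ∧ ∀ e, arrowEnd Q H₁ e ≠ p) ∧ (∃ a ∉ Q.special, Z[n₁]? = some (arrowLetter H₁ a)) ∧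
    ∀ i, 0 < i → i < n₁ → ∃ e, Z[i]? = some (.special e) ∨ Z[i]? = some (arrowLetter (!H₁) e) := by
  obtain ⟨p, m, a, s, ha, hm, h1, rfl⟩ := h.left
  have hl : Z.length = m.length + 1 + s.length := by rw [h1]; simp [length_winv]; omega
  obtain ⟨h2, h3, ⟨r, h4, h5⟩, -, h6⟩ := hm.index (isString_winv h.isString) (s := winv s) (a := a)
    (by rw [h1, winv_split, winv_winv, arrowLetter_symm])
  simp only [length_winv] at h2 h3 h4 h6
  have back : ∀ {i j : ℕ} {l : Letter V E}, (winv Z)[i]? = some l → i + j + 1 = Z.length →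
      Z[j]? = some l.symm := fun h h' => by
    simpa [winv_winv] using getElem?_winv_of (Z := winv Z) h (by rw [length_winv]; omega)
  refine ⟨by omega, by omega, ⟨r, back h4 (by omega), h5⟩, ⟨a, ha, ?_⟩, fun i hi hi' => ?_⟩
  · grind
  · obtain ⟨e, he | he⟩ := h6 (Z.length - 1 - i) (by omega) (by omega)
    · exact ⟨e, .inl (back he (by omega))⟩
    · exact ⟨e, .inr (arrowLetter_symm H₁ e ▸ back he (by omega))⟩

open Classical in
/-- The orientation of a special letter at the position `i`: as in `A` between the positions `n₁` and
`n₂`, and in the direction of the other letters outside of these positions. -/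
def endOrientation (Q : SkewedGentleQuiver V E) (Z : Word V E) (n₁ n₂ : ℕ) (H₁ H₂ : Bool) (i : ℕ) :
    Bool :=
  if i < n₁ then !H₁ else if n₂ < i then H₂ else decide (WordLt Q (Z.drop (i + 1)) (winv (Z.take i)))

/-- Letters `ε*` are replaced by letters for `Q.hat`. -/
def orientBy (c : Bool) : Letter V E → Letter V E
  | .special e => arrowLetter c e
  | l => l

/-- The string `Z` with its special letters oriented according to `endOrientation`. -/
def orientEnds (Q : SkewedGentleQuiver V E) (Z : Word V E) (n₁ n₂ : ℕ) (H₁ H₂ : Bool) : Word V E :=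
  Z.mapIdx fun i l => orientBy (endOrientation Q Z n₁ n₂ H₁ H₂ i) l

lemma getElem?_orientEnds (i : ℕ) : (orientEnds Q Z n₁ n₂ H₁ H₂)[i]? = Z[i]?.map
    (orientBy (endOrientation Q Z n₁ n₂ H₁ H₂ i)) := by simp [orientEnds]

lemma length_orientEnds : (orientEnds Q Z n₁ n₂ H₁ H₂).length = Z.length := by simp [orientEnds]

lemma F_orientBy (c : Bool) (hl : l.IsValid Q) : (orientBy c l).IsMixed Q ∧ (orientBy c l).F Q = l ∧
    (orientBy c l).IsValid Q.hat := by
  cases l with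
  | special e =>
    cases c
    exacts [⟨trivial, F_of_special hl (.inr (.inr rfl)), id⟩, ⟨trivial, F_of_special hl (.inl rfl),
      id⟩]
  | dir a | inv a => exact ⟨hl.isMixed, hl.F_eq, id⟩
  | triv p | trivInv p => exact ⟨hl.isMixed, hl.F_eq, fun e he => he.elim⟩

lemma map_F_orientEnds (hZ : IsString Q Z) : (orientEnds Q Z n₁ n₂ H₁ H₂).map (Letter.F Q) = Z := by
  refine List.ext_getElem? fun i => ?_
  rw [List.getElem?_map, getElem?_orientEnds, Option.map_map]
  cases h : Z[i]? with
  | none => rfl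
  | some l => exact congrArg some (F_orientBy _ (hZ.1.1 l (List.mem_of_getElem? h))).2.1

lemma isString_orientEnds (hZ : IsString Q Z) : IsString Q.hat (orientEnds Q Z n₁ n₂ H₁ H₂) := by
  have key : ∀ l ∈ orientEnds Q Z n₁ n₂ H₁ H₂, l.IsMixed Q ∧ l.IsValid Q.hat := by
    intro l hl; obtain ⟨i, h⟩ := List.mem_iff_getElem?.1 hl
    rw [getElem?_orientEnds, Option.map_eq_some_iff] at h; obtain ⟨l', h, rfl⟩ := h
    have := F_orientBy (Q := Q) (endOrientation Q Z n₁ n₂ H₁ H₂ i) (hZ.1.1 l' (List.mem_of_getElem? h))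
    grind
  have h1 := (isStringIn_mixed_iff fun l hl => (key l hl).1).2 (by rwa [map_F_orientEnds hZ])
  refine isString_iff.2 (isStringIn_hat.2 ⟨fun l hl => (key l hl).2, h1.chain, h1.head, h1.last⟩)

lemma WordLt.head_inv (h : WordLt Q R T) (hR : R[0]? = some (.inv f)) : T[0]? = some (.inv f) := by
  obtain ⟨u, x, y, v', w', rfl, rfl, h1⟩ := h; rcases u with - | ⟨z, u⟩
  · cases hR; exact h1.2.elim
  · exact hR

lemma head_inv_of_not_wordLt (h : ¬ WordLt Q R T) (hT : T[0]? = some (.inv f)) (hR : R[0]? = some l)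
    (hl : l.tgt Q = some (Q.source f)) (hs : ∀ e, l ≠ .special e) : ∃ g, l = .inv g := by
  rcases R with - | ⟨l', R⟩
  · cases hR
  rcases T with - | ⟨l'', T⟩
  · cases hT
  cases hR; cases hT
  have : Letter.Lt Q l (.inv f) → False := fun h2 => h ⟨[], _, _, R, T, rfl, rfl, h2⟩
  cases l with
  | dir a | triv a => exact (this ⟨hl, trivial⟩).elim
  | inv a => exact ⟨a, rfl⟩
  | special e => exact absurd rfl (hs e)
  | trivInv p => cases hl

/-- The positions in `Z` of the two words which arise from `Z` by deleting ends. -/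
lemma Ends.interval (h : Ends Q Z n₁ n₂ H₁ H₂) (hn : n₁ < n₂ ∨ n₁ = n₂ ∧ H₁ = false ∧ H₂ = true) :
    Interval Q (orientEnds Q Z n₁ n₂ H₁ H₂) (if H₁ then n₁ else 0) (if H₂ then n₂ - 1 else Z.length
    - 2) (if H₁ then 0 else n₁) (if H₂ then Z.length - 2 else n₂ - 1) := by
  classical
  obtain ⟨h1, h2, ⟨p, h3, h4⟩, ⟨a, ha, h5⟩, h6⟩ := h.left_index
  obtain ⟨k1, k2, ⟨q, k3, k4⟩, ⟨b, hb, k5⟩, k6⟩ := h.right_index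
  have keep : ∀ {i : ℕ} {l : Letter V E}, Z[i]? = some l → (∀ e, l ≠ .special e) →
      (orientEnds Q Z n₁ n₂ H₁ H₂)[i]? = some l := by
    intro i l hi hl
    rw [getElem?_orientEnds, hi]
    cases l with
    | special e => exact absurd rfl (hl e)
    | _ => rfl
  have spec : ∀ {i : ℕ} {e : E}, Z[i]? = some (.special e) → (orientEnds Q Z n₁ n₂ H₁ H₂)[i]? =
      some (arrowLetter (endOrientation Q Z n₁ n₂ H₁ H₂ i) e) := by
    intro i e hi
    rw [getElem?_orientEnds, hi]; rfl
  have hal : ∀ (b : Bool) (a e : E), (arrowLetter b a : Letter V E) ≠ .special e := by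
    intro b a e; cases b <;> simp [arrowLetter]
  have left : ∀ i, 0 < i → i < n₁ →
      ∃ e, (orientEnds Q Z n₁ n₂ H₁ H₂)[i]? = some (arrowLetter (!H₁) e) := by
    intro i hi hi'
    obtain ⟨e, he | he⟩ := h6 i hi hi'
    · exact ⟨e, by rw [spec he]; simp [endOrientation, hi']⟩
    · grind
  have right : ∀ i, n₂ < i → i + 1 < Z.length →
      ∃ e, (orientEnds Q Z n₁ n₂ H₁ H₂)[i]? = some (arrowLetter H₂ e) := by
    intro i hi hi'
    obtain ⟨e, he | he⟩ := k6 i hi hi'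
    · refine ⟨e, ?_⟩
      rw [spec he, endOrientation, if_neg (by omega), if_pos hi]
    · grind
  have back : ∀ {i : ℕ} {l : Letter V E}, (orientEnds Q Z n₁ n₂ H₁ H₂)[i]? = some l →
      Z[i]? = some l ∨ ∃ e ∈ Q.special, Z[i]? = some (.special e) ∧
        l = arrowLetter (endOrientation Q Z n₁ n₂ H₁ H₂ i) e := by
    intro i l hi
    rw [getElem?_orientEnds, Option.map_eq_some_iff] at hi
    obtain ⟨l', hi, rfl⟩ := hi
    cases l' with
    | special e => exact .inr ⟨e, h.isString.1.1 _ (List.mem_of_getElem? hi), hi, rfl⟩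
    | _ => exact .inl hi
  have nadj : ∀ {i : ℕ} {e e' : E}, e ∈ Q.special → e' ∈ Q.special → Z[i]? = some (.special e) →
      Z[i + 1]? = some (.special e') → False := by
    intro i e e' he he' hi hi'
    obtain ⟨q, g1, g2⟩ := h.isString.compat hi hi'
    cases g1
    exact special_compat_special he he' (Option.some.inj g2)
  have hS := isString_orientEnds (n₁ := n₁) (n₂ := n₂) (H₁ := H₁) (H₂ := H₂) h.isString
  have ori : ∀ {i : ℕ} {e : E} {c}, e ∈ Q.special → (orientEnds Q Z n₁ n₂ H₁ H₂)[i]? =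
      some (arrowLetter c e) → Z[i]? = some (.special e) ∧ endOrientation Q Z n₁ n₂ H₁ H₂ i = c := by
    intro i e c he g1
    rcases back g1 with g1 | ⟨e', -, g1, g3⟩
    · exact absurd he (by cases c <;> exact h.isString.1.1 _ (List.mem_of_getElem? g1))
    · cases hc : endOrientation Q Z n₁ n₂ H₁ H₂ i <;> rw [hc] at g3 <;> cases c <;> cases g3 <;>
        exact ⟨g1, rfl⟩
  have h5' := keep h5 (hal _ _)
  have k5' := keep k5 (hal _ _)
  refine ⟨hS, ?_, ?_, ?_, ?_, ⟨p, keep h3 (by simp), ?_⟩,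
    ⟨q, by rw [length_orientEnds]; exact keep k3 (by simp), ?_⟩, ?_, ?_⟩
  · grind
  · grind
  · grind
  · grind
  · cases H₁
    exacts [.inr (.inl ⟨rfl, h1, ⟨a, ha, h5'⟩, left, h4⟩), .inl ⟨rfl, h1, ⟨a, ha, h5'⟩, left, h4⟩]
  · rw [length_orientEnds]
    have e : n₂ - 1 + 1 = n₂ := by omega
    cases H₂
    · exact .inr (.inl ⟨by simp; omega, by simp; omega,
        ⟨b, hb, by simpa [e, arrowLetter] using k5'⟩,
        by simpa [e, arrowLetter] using right, k4⟩)
    · exact .inl ⟨by simp; omega, by simp; omega, ⟨b, hb, by simpa [e, arrowLetter] using k5'⟩,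
        by simpa [e, arrowLetter] using right, k4⟩
  -- special letters between ordinary letters of a tail follow the direction of the tail
  · rintro i e he g1 ⟨f, g2⟩
    obtain ⟨g3, hc⟩ := ori (c := true) he g1
    have hi := (List.getElem?_eq_some_iff.1 g2).1
    rw [length_orientEnds] at hi
    unfold endOrientation at hc
    split_ifs at hc with h8 h9
    · obtain rfl : H₁ = false := by simpa using hc
      rcases i with - | i
      · obtain ⟨r, g4, g5⟩ := h.isString.compat h3 g3
        obtain ⟨r', g6, g7⟩ := (compat_hat _ _).1 (hS.compat g1 g2)
        cases g4
        cases g6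
        refine absurd ?_ (h4 f)
        rw [loop_ends he] at g7
        have := (Option.some.inj g7).trans (congrArg flip (Option.some.inj g5))
        rwa [flip_flip] at this
      · exact left (i + 1) (by omega) (by omega)
    · subst hc
      by_cases h10 : i + 2 + 1 < Z.length
      · obtain ⟨g, hg⟩ := right (i + 2) (by omega) h10
        cases g2.symm.trans hg
      · grind
    · obtain ⟨l, hl⟩ : ∃ l, Z[i]? = some l := ⟨_, List.getElem?_eq_getElem (by omega)⟩
      have e2 := getElem?_winv_of (i := 0) (by rwa [List.getElem?_take_of_lt (Nat.lt_succ_self i)])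
        (by simp; omega)
      rcases back g2 with g2 | ⟨f', hf, g2, -⟩
      · rw [decide_eq_true_eq] at hc
        have e3 := e2.symm.trans (hc.head_inv (by rwa [List.getElem?_drop]))
        cases l <;> cases e3
        grind
      · grind
  · rintro i e he g1 ⟨f, g2⟩
    obtain ⟨g3, hc⟩ := ori (c := false) he g1
    have hi := (hS.pos_of_arrow (.inr g1)).2
    rw [length_orientEnds] at hi
    unfold endOrientation at hc
    split_ifs at hc with h8 h9
    · obtain rfl : H₁ = true := by simpa using hc
      rcases i with - | i
      · cases g2.symm.trans (keep h3 (by simp))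
      · obtain ⟨g, hg⟩ := left (i + 1) (by omega) (by omega)
        cases g2.symm.trans hg
    · subst hc
      by_cases h10 : i + 2 + 1 < Z.length
      · exact right (i + 2) (by omega) h10
      · rw [show Z.length - 1 = i + 2 by omega] at k3
        obtain ⟨r, g4, g5⟩ := h.isString.compat g3 k3
        obtain ⟨r', g6, g7⟩ := (compat_hat _ _).1 (hS.compat g2 g1)
        cases g4
        cases g6
        cases g5
        refine absurd ?_ (k4 f)
        exact (flip_flip _).symm.trans (congrArg flip (Option.some.inj g7).symm)
    · rw [decide_eq_false_iff_not] at hc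
      obtain ⟨l, hl⟩ : ∃ l, Z[i + 2]? = some l := ⟨_, List.getElem?_eq_getElem (by omega)⟩
      rcases back g2 with g2 | ⟨f', hf, g2, -⟩
      · obtain ⟨r, g4, g5⟩ := h.isString.compat g2 g3
        obtain ⟨r', g6, g7⟩ := h.isString.compat g3 hl
        cases g4
        cases g6
        have hs : ∀ e', l ≠ .special e' := by
          grind
        obtain ⟨g, rfl⟩ := head_inv_of_not_wordLt hc (getElem?_winv_of (i := 0) (j := i)
          (by rwa [List.getElem?_take_of_lt (Nat.lt_succ_self i)]) (by simp; omega))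
          (by rw [List.getElem?_drop]; exact hl) (by
            rw [g7, loop_ends he, Option.some.inj (g5 : some (Q.target e) = _)]
            exact congrArg some (flip_flip _)) hs
        exact ⟨g, keep hl (by simp)⟩
      · exact (nadj hf he g2 g3).elim

/-- If both ends of an interval on the right are cut off at a special letter, then the right end
becomes punctured. -/
lemma Interval.cut {a b c d : ℕ} (I : Interval Q Z a b c d) (he : e ∈ Q.special)
    (hi : Z[i]? = some (.dir e) ∨ Z[i]? = some (.inv e)) (ha : a < i) (hc : c < i) :
    Interval Q (Z.take i ++ [.triv (Q.source e)]) a (i - 1) c (i - 1) := by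
  obtain ⟨p, h1, h2⟩ := I.left; have hlen : i < Z.length := by grind
  have hl : (Z.take i ++ [Letter.triv (V := V) (E := E) (Q.source e)]).length = i + 1 := by
    simp; omega
  have key : ∀ j, j < i → (Z.take i ++ [Letter.triv (Q.source e)])[j]? = Z[j]? := by grind
  have last : (Z.take i ++ [Letter.triv (Q.source e)])[i]? = some (Letter.triv (V := V) (E := E) (Q.source e)) := by
    grind
  have bound : ∀ {j : ℕ} {l : Letter V E},
      (Z.take i ++ [Letter.triv (Q.source e)])[j]? = some l → (∀ q, l ≠ .triv q) → j < i := by grind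
  have compat : ∀ {l : Letter V E}, Z[i - 1]? = some l → l.src Q = some (flip (Q.target e)) := by
    intro l h3
    have h4 : ∃ l', Z[i - 1 + 1]? = some l' ∧ l'.tgt Q = some (Q.target e) := by
      rw [show i - 1 + 1 = i by omega]; rcases hi with hi | hi
      exacts [⟨_, hi, rfl⟩, ⟨_, hi, congrArg some (loop_ends he)⟩]
    obtain ⟨l', h4, h5⟩ := h4; obtain ⟨q, h6, h7⟩ := (compat_hat _ _).1 (I.isString.compat h3 h4)
    rw [h6, Option.some.inj (h5.symm.trans h7), flip_flip]
  refine ⟨?_, by omega, by omega, by rw [hl]; omega, by rw [hl]; omega,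
    ⟨p, by rw [key 0 (by omega)]; exact h1, ?_⟩,
    ⟨_, by rw [hl]; exact last, .inr (.inr ⟨by rw [hl]; omega, by rw [hl]; omega, e, he, rfl⟩)⟩,
    ?_, ?_⟩
  · have hs := isStringIn_hat.1 (isString_iff.1 I.isString)
    refine isString_iff.2 (isStringIn_hat.2 ⟨fun l hl => ?_, ?_, ⟨p, ?_⟩, ⟨_, List.getLast?_concat⟩⟩)
    · rcases List.mem_append.1 hl with hl | hl
      · exact hs.mem l (List.mem_of_mem_take hl)
      · rw [List.mem_singleton.1 hl]; exact fun e' he' => he'.elim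
    · refine List.isChain_append.2 ⟨hs.chain.take _, List.isChain_singleton _, fun x hx y hy => ?_⟩
      cases hy
      rw [List.getLast?_eq_getElem?, List.length_take, Nat.min_eq_left hlen.le,
        List.getElem?_take_of_lt (by omega)] at hx
      exact ⟨_, compat hx, by rw [flip_flip, ← loop_ends he]; rfl⟩
    · rw [List.head?_eq_getElem?, key 0 (by omega)]; exact h1
  · grind
  · rintro j e' he' h3 ⟨f, h4⟩; have h5 := bound h4 (by simp); rw [key _ (by omega)] at h3 h4 ⊢
    exact I.orient_dir j e' he' h3 ⟨f, h4⟩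
  · rintro j e' he' h3 ⟨f, h4⟩; have h5 := bound h3 (by simp); rw [key _ (by omega)] at h3 h4
    rcases Nat.lt_or_ge (j + 2) i with h6 | h6
    · rw [key _ h6]; exact I.orient_inv j e' he' h3 ⟨f, h4⟩
    · rw [show j + 1 = i - 1 by omega] at h3; refine absurd ?_ (special_compat_special he he')
      rw [loop_ends he]; exact Option.some.inj (compat h3)

end

section

variable {n₁ n₂ : ℕ} {H₁ H₂ : Bool} {l₀ l₁ l₀' l₁' : Letter V E}

variable {A : Word V E}

lemma isSubword_of_map (hx : IsString Q.hat x) (hz : IsString Q.hat z) (h : x.map (Letter.F Q) = l₀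
    :: core ++ [l₁]) (h' : z.map (Letter.F Q) = P ++ l₀' :: core ++ l₁' :: P')
    (hl : l₀.src Q = some q) (hl' : l₀'.src Q = some q) : IsSubword Q x z P.length
    (P.length + core.length) := by
  have hlen := congrArg List.length h; have hlen' := congrArg List.length h'
  simp only [List.length_map, List.length_append, List.length_cons, List.length_nil] at hlen hlen'
  have get : ∀ i, i < x.length → ∃ l, x[i]? = some l ∧ (l₀ :: core ++ [l₁])[i]? = some (l.F Q) := by
    intro i hi; refine ⟨_, List.getElem?_eq_getElem hi, ?_⟩; grind
  have get' : ∀ i, i < z.length → ∃ l, z[i]? = some l ∧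
      (P ++ (l₀' :: core ++ l₁' :: P'))[i]? = some (l.F Q) := by
    intro i hi; refine ⟨_, List.getElem?_eq_getElem hi, ?_⟩; grind
  refine ⟨hx, by omega, fun i hi hi' => ?_, ?_⟩
  · grind
  · obtain ⟨l, h1, h2⟩ := get 0 (by omega); obtain ⟨l', h3, h4⟩ := get' P.length (by omega)
    obtain ⟨y, h5, -⟩ := get 1 (by omega); obtain ⟨y', h6, -⟩ := get' (P.length + 1) (by omega)
    rw [List.getElem?_append_right le_rfl, Nat.sub_self] at h4; cases h2; cases h4
    obtain ⟨q₁, h7, h8⟩ := (compat_hat _ _).1 (hx.compat h1 h5)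
    obtain ⟨q₂, h9, h10⟩ := (compat_hat _ _).1 (hz.compat h3 h6); cases hl.symm.trans (F_src h7)
    cases hl'.symm.trans (F_src h9); grind

/-- The words `A` and `B` agree up to the last letter of `A`, and `n` letters of `B` do not belong to
`A`. -/
def IsCut (Q : SkewedGentleQuiver V E) (A B : Word V E) (n : ℕ) : Prop :=
  ∃ K l l' T q, A = K ++ [l] ∧ B = K ++ l' :: T ∧ T.length = n ∧ l.symm.src Q = some q ∧
    l'.symm.src Q = some q

lemma Ext.isCut (h : Ext Q A B C) : ∃ H a p m, a ∉ Q.special ∧ ExtTail Q H p m ∧ B = arrowLetter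
    (!H) a :: m ∧ IsCut Q A B (if H then m.length else 0) ∧ IsCut Q C B (if H then 0 else
    m.length) := by
  have self : ∀ {l : Letter V E} {m p}, Tail Q p m → IsCut Q (l :: m) (l :: m) 0 := by
    intro l m p hm; obtain ⟨r, hr⟩ := hm.getLast?; obtain ⟨s, rfl⟩ := List.getLast?_eq_some_iff.1 hr
    exact ⟨l :: s, _, _, [], r, rfl, rfl, rfl, rfl, rfl⟩
  cases h with
  | @hook a m ha hm =>
    exact ⟨true, a, _, m, ha, hm, rfl, ⟨[], _, _, m, _, rfl, rfl, rfl, rfl, rfl⟩, self hm.tail⟩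
  | @cohook a m ha hm =>
    exact ⟨false, a, _, m, ha, hm, rfl, self hm.tail, ⟨[], _, _, m, _, rfl, rfl, rfl, rfl, rfl⟩⟩

variable {mid : Word V E} {n : ℕ}

lemma isSubword_of_isCut {n' : ℕ} (hx : IsString Q.hat x) (hz : IsString Q.hat z)
    (h : x.map (Letter.F Q) = winv A ++ mid ++ A') (h' : z.map (Letter.F Q) = winv B ++ mid ++ B')
    (hn : IsCut Q A B n) (hn' : IsCut Q A' B' n') : IsSubword Q x z n (z.length - 2 - n') := by
  obtain ⟨K, l, l', T, q, rfl, rfl, h3, h4, h5⟩ := hn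
  obtain ⟨K', k, k', T', q', rfl, rfl, h6, -, -⟩ := hn'
  have h7 := isSubword_of_map (l₀ := l.symm) (l₀' := l'.symm) (core := winv K ++ mid ++ K')
    (P := winv T) (l₁ := k) (l₁' := k') (P' := T') hx hz (by rw [h, winv_append]; simp [winv])
    (by rw [h', winv_split]; simp) h4 h5
  have h8 := congrArg List.length h'
  simp only [List.length_map, List.length_append, length_winv, List.length_cons] at h7 h8; grind

lemma IsCut.lt_length (h : IsCut Q A B n) : n < B.length := by
  obtain ⟨K, l, l', T, q, -, rfl, rfl, -⟩ := h; simp; omega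

/-- The relative position of the words which arise by the replacement of both ends. -/
lemma Ext.exists_interval (h : Ext Q A B C) (h' : Ext Q A' B' C')
    (hZ : IsString Q (winv B ++ mid ++ B')) : ∃ n₁ n₂ H₁ H₂ a b c d,
    Interval Q (orientEnds Q (winv B ++ mid ++ B') n₁ n₂ H₁ H₂) a ((winv B ++ mid ++ B').length - 2
    - b) c ((winv B ++ mid ++ B').length - 2 - d) ∧ IsCut Q A B a ∧ IsCut Q A' B' b ∧ IsCut Q C B c
    ∧ IsCut Q C' B' d := by
  obtain ⟨H₁, a₁, _, m₁, h1, h2, rfl, h3, h4⟩ := h.isCut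
  obtain ⟨H₂, a₂, _, m₂, k1, k2, rfl, k3, k4⟩ := h'.isCut
  set Z := winv (arrowLetter (!H₁) a₁ :: m₁) ++ mid ++ arrowLetter (!H₂) a₂ :: m₂ with hZ'
  have hlen : Z.length = m₁.length + 1 + mid.length + (m₂.length + 1) := by
    simp [hZ', length_winv]; omega
  have hE : Ends Q Z m₁.length (m₁.length + 1 + mid.length) H₁ H₂ := by
    refine ⟨hZ, ⟨_, m₁, a₁, mid ++ arrowLetter (!H₂) a₂ :: m₂, h1, h2, ?_, rfl⟩,
      ⟨_, _, a₂, m₂, k1, k2, hZ', by simp [length_winv]⟩⟩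
    rw [hZ', winv_cons, arrowLetter_symm, Bool.not_not]; simp
  have hI := hE.interval (.inl (by omega)); grind

lemma F_triv_source (he : e ∈ Q.special) : Letter.F Q (.triv (Q.source e))
    = (.special e : Letter V E) := by
  have h : ∃ e' ∈ Q.special, Q.source e' = Q.source e := ⟨e, he, rfl⟩
  rw [Letter.F, dif_pos h, Q.source_injective (Classical.choose_spec h).2]

end

section

/-- The word `A(w)` of a symmetric string. -/
lemma map_F_A_of_symm (hw : IsString Q (s ++ .special e :: winv s)) :
    (A Q (s ++ .special e :: winv s)).map (Letter.F Q) = s ++ [.special e] := by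
  have hX := isStringIn_orientMixed hw; have hu := unfolds_A hw
  have hs : winv (s ++ .special e :: winv s) = s ++ .special e :: winv s := by
    rw [winv_split, winv_winv]; rfl
  have ht : wordType Q (A Q (s ++ .special e :: winv s)) = .up := by
    rcases (isAdmissibleString_A hw).2 with ⟨h1, -⟩ | ⟨-, h1⟩
    exacts [absurd hs h1, h1]
  rcases wordType_of_unfolds hX hu with ⟨-, h1⟩ | ⟨-, ⟨e', h1⟩, -⟩
  · grind
  rcases hu with ⟨-, h2⟩ | ⟨u, f, hf, h2, h3, -⟩
  · grind
  have h4 := map_F_orientMixed (isString_iff.1 hw).mem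
  rw [h3, List.map_append, List.map_cons] at h4; have h5 := congrArg List.length h4
  simp only [List.length_append, List.length_map, List.length_cons, length_winv] at h5
  obtain ⟨h6, h7⟩ := List.append_inj h4 (by simp; omega)
  rw [h2, List.map_append, h6, List.map_singleton, F_triv_source hf, ← (List.cons.inj h7).1]; rfl

/-- The words `A(w)` and `A(t)` as parts of one word. -/
lemma Step.exists_interval (h : Step Q w Z t) (hw : IsString Q w) : ∃ z a b c d, Interval Q z a b c
    d ∧ IsSubword Q (A Q w) z a b ∧ IsSubword Q (A Q t) z c d := by
  obtain ⟨-, -, hZ, ht⟩ := h.tau_eq hw; have hA := (isAdmissibleString_A hw).1.1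
  have hA' := (isAdmissibleString_A ht).1.1; by_cases hs : winv w = w
  -- the successor of a symmetric string is symmetric, and all words are cut at the middle letter
  · obtain ⟨A₁, B₁, C₁, u, e, he, h1, rfl, rfl, rfl⟩ := h.of_symm hw hs
    have e1 : ∀ X : Word V E, winv X ++ u ++ .special e :: winv (winv X ++ u) =
        winv X ++ (u ++ .special e :: winv u) ++ X := by intro X; rw [winv_append, winv_winv]; simp
    have hZ' := hZ; rw [e1] at hZ'
    obtain ⟨n₁, n₂, H₁, H₂, a, b, c, d, h2, h3, -, h4, -⟩ := h1.exists_interval h1 hZ'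
    rw [← e1] at h2; set Z := winv B₁ ++ u ++ .special e :: winv (winv B₁ ++ u) with hZ''
    have h5 : Z[(winv B₁ ++ u).length]? = some (.special e) := by grind
    have h6 : (winv B₁ ++ u).length = B₁.length + u.length := by simp [length_winv]
    have h7 := h3.lt_length; have h8 := h4.lt_length
    have hcut := h2.cut (i := (winv B₁ ++ u).length) he (by
      rw [getElem?_orientEnds, h5]; cases endOrientation Q Z n₁ n₂ H₁ H₂ (winv B₁ ++ u).length
      · exact .inr rfl
      · exact .inl rfl) (by omega) (by omega)
    have hF : ((orientEnds Q Z n₁ n₂ H₁ H₂).take (winv B₁ ++ u).length ++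
        [Letter.triv (Q.source e)]).map (Letter.F Q) = winv B₁ ++ u ++ [.special e] := by
      rw [List.map_append, List.map_take, map_F_orientEnds hZ, List.map_singleton, F_triv_source he,
        (split_index _ _ _).2.1]
    have hc : IsCut Q [.special e] [.special e] 0 := ⟨[], _, _, [], _, rfl, rfl, rfl, rfl, rfl⟩
    have hl : ∀ n, (winv B₁ ++ u).length = n → ((orientEnds Q Z n₁ n₂ H₁ H₂).take
        (winv B₁ ++ u).length ++ [Letter.triv (Q.source e)]).length - 2 - 0 = n - 1 := by
      rintro n rfl; have := congrArg List.length hF; rw [List.length_map] at this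
      rw [this, List.length_append, List.length_singleton]; omega
    have k1 := isSubword_of_isCut hA hcut.isString (map_F_A_of_symm hw) hF h3 hc
    have k2 := isSubword_of_isCut hA' hcut.isString (map_F_A_of_symm ht) hF h4 hc
    rw [hl _ rfl] at k1 k2; exact ⟨_, _, _, _, _, hcut, k1, k2⟩
  · have hmap : ∀ {w}, IsString Q w → winv w ≠ w → (A Q w).map (Letter.F Q) = w := by
      intro w hw hs; rcases (isAdmissibleString_A hw).2 with ⟨-, -, h1⟩ | ⟨h1, -⟩
      · rw [h1, map_F_orientMixed (isString_iff.1 hw).mem]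
      · exact absurd h1 hs
    have hF := hmap hw hs; have hF' := hmap ht (h.ne_winv hs)
    cases h with
    | normal h₁ h₂ =>
      obtain ⟨n₁, n₂, H₁, H₂, a, b, c, d, h2, h3, h4, h5, h6⟩ := h₁.exists_interval h₂ hZ
      have k1 := isSubword_of_isCut hA h2.isString hF (map_F_orientEnds hZ) h3 h4
      have k2 := isSubword_of_isCut hA' h2.isString hF' (map_F_orientEnds hZ) h5 h6
      rw [length_orientEnds] at k1 k2; exact ⟨_, _, _, _, _, h2, k1, k2⟩
    | @crossing a m m' ha hm hm' =>
      have hE : Ends Q (winv m ++ .inv a :: m') m.length m.length false true :=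
        ⟨hZ, ⟨_, m, a, m', ha, hm, rfl, rfl⟩, ⟨_, _, a, m', ha, hm', rfl, length_winv m⟩⟩
      have hI := hE.interval (.inr ⟨rfl, rfl, rfl⟩); obtain ⟨r, hr, -⟩ := hm.getLast?
      obtain ⟨K, rfl⟩ := List.getLast?_eq_some_iff.1 hr; obtain ⟨r', hr', -⟩ := hm'.getLast?
      obtain ⟨K', rfl⟩ := List.getLast?_eq_some_iff.1 hr'
      have k1 := isSubword_of_map (P := []) (core := winv K) (l₁ := .triv (Q.source a)) (l₁' := .inv a)
        (l₀ := .trivInv r) (l₀' := .trivInv r) (P' := K' ++ [.triv r']) hA hI.isString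
        (by rw [hF, winv_append]; rfl) (by rw [map_F_orientEnds hZ, winv_append]; rfl) rfl rfl
      have k2 := isSubword_of_map (P := winv (K ++ [.triv r])) (core := K') (l₀ := .trivInv (Q.target a))
        (l₁ := .triv r') (l₁' := .triv r') (P' := []) (l₀' := .inv a) hA' hI.isString
        (by rw [hF']; rfl) (by rw [map_F_orientEnds hZ]; simp) rfl rfl
      refine ⟨_, _, _, _, _, hI, ?_, ?_⟩
      · convert k1 using 1 <;> simp [length_winv]
      · convert k2 using 1 <;> simp [length_winv]; omega

end

/-! ### Inversion of intervals -/

section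

variable {a b c d : ℕ}

lemma Letter.F_symm (l : Letter V E) : l.symm.F Q = (l.F Q).symm := by
  cases l <;> simp only [Letter.F, Letter.symm] <;> split_ifs <;> rfl

/-- Inversion of an interval: the word is read from its right end. -/
lemma Interval.winv (I : Interval Q z a b c d) : Interval Q (winv z) (z.length - 2 - b)
    (z.length - 2 - a) (z.length - 2 - d) (z.length - 2 - c) := by
  obtain ⟨hz, h1, h2, h3, h4, ⟨p, hp, hl⟩, ⟨q, hq, hr⟩, h5, h6⟩ := I
  have get : ∀ {i j : ℕ} {l : Letter V E}, z[j]? = some l → i + j + 1 = z.length →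
      (SkewedGentle.winv z)[i]? = some l.symm := getElem?_winv_of
  have get' : ∀ {i j : ℕ} {l : Letter V E}, (SkewedGentle.winv z)[i]? = some l →
      i + j + 1 = z.length → z[j]? = some l.symm := by
    intro i j l h7 h8; have := getElem?_winv_of (i := j) h7 (by rw [length_winv]; omega)
    rwa [winv_winv] at this
  have hlen := length_winv z
  refine ⟨isString_winv hz, by omega, by omega, by omega, by omega,
    ⟨q, get hq (by omega), ?_⟩, ⟨p, get hp (by omega), ?_⟩, ?_, ?_⟩
  · rcases hr with ⟨k1, k2, ⟨e, he, k3⟩, k4, k5⟩ | ⟨k1, k2, ⟨e, he, k3⟩, k4, k5⟩ | ⟨k1, k2, k3⟩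
    · refine .inl ⟨by omega, by omega, ⟨e, he, get k3 (by omega)⟩, fun i hi hi' => ?_, k5⟩
      obtain ⟨f, hf⟩ := k4 (z.length - 1 - i) (by omega) (by omega); exact ⟨f, get hf (by omega)⟩
    · refine .inr (.inl ⟨by omega, by omega, ⟨e, he, get k3 (by omega)⟩, fun i hi hi' => ?_, k5⟩)
      obtain ⟨f, hf⟩ := k4 (z.length - 1 - i) (by omega) (by omega); exact ⟨f, get hf (by omega)⟩
    · grind
  · rcases hl with ⟨k1, k2, ⟨e, he, k3⟩, k4, k5⟩ | ⟨k1, k2, ⟨e, he, k3⟩, k4, k5⟩ | ⟨k1, k2, k3⟩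
    · refine .inl ⟨by omega, by omega, ⟨e, he, get k3 (by omega)⟩, fun i hi hi' => ?_, k5⟩
      obtain ⟨f, hf⟩ := k4 (z.length - 1 - i) (by omega) (by omega); exact ⟨f, get hf (by omega)⟩
    · refine .inr (.inl ⟨by omega, by omega, ⟨e, he, get k3 (by omega)⟩, fun i hi hi' => ?_, k5⟩)
      obtain ⟨f, hf⟩ := k4 (z.length - 1 - i) (by omega) (by omega); exact ⟨f, get hf (by omega)⟩
    · grind
  · rintro i e he k1 ⟨f, k2⟩; have k3 := (List.getElem?_eq_some_iff.1 k2).1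
    have e1 : z.length - 3 - i + 2 + i + 1 = z.length := by omega
    obtain ⟨g, hg⟩ := h6 (z.length - 3 - i) e he (get' k1 (by omega)) ⟨f, get' k2 (by omega)⟩
    exact ⟨g, get hg (by omega)⟩
  · rintro i e he k1 ⟨f, k2⟩; have k3 := (List.getElem?_eq_some_iff.1 k1).1
    have k4 : i + 2 < z.length := by
      by_contra k4; have := get' k1 (j := 0) (by omega); rw [hp] at this; cases this
    obtain ⟨g, hg⟩ := h5 (z.length - 3 - i) e he (get' k1 (by omega)) ⟨f, get' k2 (by omega)⟩
    exact ⟨g, get hg (by omega)⟩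

lemma symm_tgt_hat (h : l.IsValid Q.hat) : l.symm.tgt Q = l.src Q := by
  cases l with
  | special e => exact h.elim
  | _ => rfl

lemma IsSubword.winv (S : IsSubword Q x z a b) (hz : IsString Q.hat z) (hb : b + 2 ≤ z.length) :
    IsSubword Q (winv x) (winv z) (z.length - 2 - b) (z.length - 2 - a) := by
  obtain ⟨hx, h1, h2, l, l', h3, h4, h5⟩ := S; have h6 := (List.getElem?_eq_some_iff.1 h3).1
  refine ⟨isString_winv hx, by rw [length_winv]; omega, fun i hi hi' => ?_, ?_⟩
  · rw [length_winv] at hi'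
    obtain ⟨l, l', g1, g2, g3⟩ := h2 (x.length - 1 - i) (by omega) (by omega)
    exact ⟨_, _, getElem?_winv_of g1 (by omega), getElem?_winv_of g2 (by omega),
      by rw [Letter.F_symm, Letter.F_symm, g3]⟩
  · obtain ⟨l₁, g1⟩ : ∃ l, x[x.length - 2]? = some l := ⟨_, List.getElem?_eq_getElem (by omega)⟩
    obtain ⟨l₂, g2⟩ : ∃ l, z[b]? = some l := ⟨_, List.getElem?_eq_getElem (by omega)⟩
    refine ⟨_, _, getElem?_winv_of g1 (by omega), getElem?_winv_of g2 (by omega), ?_⟩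
    rw [symm_tgt_hat (hx.1.1 _ (List.mem_of_getElem? g1)),
      symm_tgt_hat (hz.1.1 _ (List.mem_of_getElem? g2))]
    obtain ⟨l₃, g3⟩ : ∃ l, x[x.length - 2 + 1]? = some l := ⟨_, List.getElem?_eq_getElem (by omega)⟩
    obtain ⟨l₄, g4⟩ : ∃ l, z[b + 1]? = some l := ⟨_, List.getElem?_eq_getElem (by omega)⟩
    obtain ⟨q, k1, k2⟩ := (compat_hat _ _).1 (hx.compat g1 g3)
    obtain ⟨q', k3, k4⟩ := (compat_hat _ _).1 (hz.compat g2 g4)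
    rcases Nat.lt_or_ge 2 x.length with h7 | h7
    · obtain ⟨l, l', k5, k6, k7⟩ := h2 (x.length - 2) (by omega) (by omega); rw [g1] at k5
      rw [show a + (x.length - 2) = b by omega, g2] at k6; cases k5; cases k6; have k8 := F_src k1
      rw [k7] at k8; rw [k1, k3, ← k8, F_src k3]
    · rw [show x.length - 2 + 1 = 1 by omega, h3] at g3; rw [show b + 1 = a + 1 by omega, h4] at g4
      cases g3; cases g4; rw [k2, k4] at h5; have := congrArg flip (Option.some.inj h5)
      rw [flip_flip, flip_flip] at this; rw [k1, k3, this]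

/-- The words `x` and `y` are parts of one word, in the relative position of a word and its
translate. -/
def IsTranslate (Q : SkewedGentleQuiver V E) (x y : Word V E) : Prop :=
  ∃ z a b c d, Interval Q z a b c d ∧ IsSubword Q x z a b ∧ IsSubword Q y z c d

lemma IsTranslate.winv (h : IsTranslate Q x y) : IsTranslate Q (winv x) (winv y) := by
  obtain ⟨z, a, b, c, d, I, S, S'⟩ := h
  exact ⟨_, _, _, _, _, I.winv, S.winv I.isString I.le_b, S'.winv I.isString I.le_d⟩

/-- The translate of a string which is not projective. -/
lemma isTranslate_tau (hw : IsString Q w) (hp : ¬ IsProjectiveString Q w) : IsString Q (tau Q w)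
    ∧ (winv w = w ↔ winv (tau Q w) = tau Q w) ∧ IsTranslate Q (A Q w) (A Q (tau Q w)) := by
  have key : ∀ {w Z t}, Step Q w Z t → IsString Q w → (winv w = w ↔ winv t = t) := by
    intro w Z t h hw; refine ⟨fun hs => ?_, fun ht => ?_⟩
    · obtain ⟨A, B, C, u, e, -, -, -, -, rfl⟩ := h.of_symm hw hs; rw [winv_split, winv_winv]; rfl
    · by_contra hs; exact h.ne_winv hs ht
  obtain ⟨Z, t, h | h⟩ := exists_step hw hp
  · obtain ⟨h1, -, -, h2⟩ := h.tau_eq hw; rw [h1]; exact ⟨h2, key h hw, h.exists_interval hw⟩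
  · have hw' := isString_winv hw; obtain ⟨h1, h2, -, h3⟩ := h.tau_eq hw'; have h4 := key h hw'
    have h5 := h.exists_interval hw'; rw [winv_winv] at h2 h4; rw [h2]
    refine ⟨isString_winv h3, by rw [winv_winv, eq_comm, h4, eq_comm], ?_⟩
    have hinv : ∀ {w}, IsString Q w → winv w ≠ w → A Q (winv w) = winv (A Q w) := by
      intro w hw hs; have hs' : winv (winv w) ≠ winv w := by rw [winv_winv]; exact hs.symm
      rcases (isAdmissibleString_A hw).2 with ⟨-, -, g1⟩ | ⟨g1, -⟩
      · rcases (isAdmissibleString_A (isString_winv hw)).2 with ⟨-, -, g2⟩ | ⟨g2, -⟩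
        · rw [g1, g2, orientMixed_winv hw]
        · exact absurd g2 hs'
      · exact absurd g1 hs
    by_cases hs : winv w = w
    · have ht : winv t = t := h4.1 hs.symm; rwa [ht, ← hs]
    · have ht : winv t ≠ t := by grind
      have h6 := IsTranslate.winv h5; rwa [hinv hw hs, winv_winv, ← hinv h3 ht] at h6

end

/-! ### Translates of admissible words -/

section

variable {Q' : SkewedGentleQuiver V E}

/-- In an admissible word the special letters are oriented by the comparison of the words `R i` and
`T i`, which lie on the two sides of the position `i`. Only the first letters of these words
matter here. -/
lemma isOriented_of_order (hz : IsHatWord Q z) (R T : Fin z.length → Word V E)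
    (hR : ∀ i, (∃ e ∈ Q.special, z[i] = .dir e ∨ z[i] = .inv e) → (R i)[0]? = some
    z[letterIx hz (hTarget hz i false) true]) (hT : ∀ i, (∃ e ∈ Q.special, z[i] = .dir e ∨ z[i] =
    .inv e) → (T i)[0]? = some (z[letterIx hz (hTarget hz i true) false]).symm)
    (h1 : ∀ i, ∀ e ∈ Q.special, z[i] = .dir e → WordLt Q.hat (R i) (T i))
    (h2 : ∀ i, ∀ e ∈ Q.special, z[i] = .inv e → ¬ WordLt Q.hat (R i) (T i)) : IsOriented hz := by
  have cast : ∀ {i j : Fin z.length}, i = j → z[i] = z[j] := by simp_all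
  refine @isOriented_of_letters V E Q z hz (fun i e he hi f hj => ?_) fun i e he hi f hj => ?_
  · have h4 := hR i ⟨e, he, .inl hi⟩; rw [hj] at h4; have h5 := (h1 i e he hi).head_inv h4
    rw [hT i ⟨e, he, .inl hi⟩, Option.some.injEq] at h5
    exact ⟨f, by rw [← Letter.symm_symm z[letterIx hz (hTarget hz i true) false], h5]; rfl⟩
  · have h5 := hT i ⟨e, he, .inr hi⟩; rw [hj] at h5; have h6 := src_left hz (hTarget hz i true)
    have h7 := tgt_right hz (hTarget hz i true); have h8 := src_left hz (hTarget hz i false)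
    rw [cast (letterIx_hTarget_true hz i (by simp [hi])), hi] at h7
    rw [cast (letterIx_hTarget_false hz i (by simp [hi])), hi] at h8; rw [hj] at h6
    have h10 : wordPol hz (hTarget hz i false) true = Q.source f := by
      have e1 := wordPol_not hz (hTarget hz i false) false
      have e2 := wordPol_not hz (hTarget hz i true) true
      have e3 : Q.source f = wordPol hz (hTarget hz i true) false := Option.some.inj h6
      have e4 : Q.target e = wordPol hz (hTarget hz i false) false := Option.some.inj h8
      have e5 : Q.source e = wordPol hz (hTarget hz i true) true := Option.some.inj h7
      rw [Bool.not_false, ← e4, ← loop_ends he, e5, ← e2] at e1; rw [e1, e3]; rfl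
    exact head_inv_of_not_wordLt (h2 i e he hi) h5 (hR i ⟨e, he, .inr hi⟩)
      (by rw [hat_tgt, tgt_right hz (hTarget hz i false), h10]; rfl) fun e' h11 => by
        have := isHatWord_valid hz (letterIx hz (hTarget hz i false) true); rw [h11] at this
        exact this

lemma isOriented_of_isAdmissibleString (hx : IsAdmissibleString Q x) (hz : IsHatWord Q x) :
    IsOriented hz := by
  have split : ∀ (i : Fin x.length) (l : Letter V E), x[i] = l → x = x.take i ++ l :: x.drop (i + 1) :=
    fun i l h => eq_take_cons_drop (by rw [← h]; exact List.getElem?_eq_getElem i.2)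
  refine @isOriented_of_order V E Q x hz (fun i => x.drop (i + 1)) (fun i => winv (x.take i))
    (fun i hi => ?_) (fun i hi => ?_) (fun i e he hi => ((hx.2.1 e he _ _).1 (split i _ hi)).2)
    (fun i e he hi => ((hx.2.1 e he _ _).2 (split i _ hi)).2)
  · obtain ⟨e, -, hi⟩ := hi; obtain ⟨j, h1, -, -, h2⟩ := hx.1.neighbours hz hi
    simp_all
  · obtain ⟨e, -, hi⟩ := hi; obtain ⟨j, h1, h2, -, -⟩ := hx.1.neighbours hz hi
    exact getElem?_winv_of (j := j) (by rwa [List.getElem?_take_of_lt (by omega)]) (by simp; omega)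

lemma IsBand.startsTrivial (hx : IsBand Q x) : startsTrivial x = false := by
  rcases x with - | ⟨l, t⟩
  · rfl
  obtain ⟨-, -, h⟩ := List.isChain_append.1 hx.2.2
  obtain ⟨q, -, h1⟩ := h _ (List.getLast?_eq_some_getLast (by simp)) l rfl
  cases l with
  | trivInv p => cases h1
  | _ => rfl

lemma isOriented_of_isAdmissibleBand (hx : IsAdmissibleBand Q x) (hz : IsHatWord Q x) :
    IsOriented hz := by
  have hs := hx.1.startsTrivial
  have split : ∀ (i : Fin x.length) (l : Letter V E), x[i] = l → x = x.take i ++ l :: x.drop (i + 1) :=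
    fun i l h => eq_take_cons_drop (by rw [← h]; exact List.getElem?_eq_getElem i.2)
  -- The rest of a band after a letter is a rotation of the band without its last letter.
  have hget : ∀ (i : Fin x.length) (j : ℕ), j + 1 < x.length →
      (x.drop (i + 1) ++ x.take i)[j]? = x[(j + (i + 1)) % x.length]? := by
    intro i j hj; have hi := i.2
    have h1 : x.rotate (i + 1) = (x.drop (i + 1) ++ x.take i) ++ [x[i]] := by
      rw [List.rotate_eq_drop_append_take hi, List.append_assoc, Fin.getElem_fin,
        List.take_append_getElem]
    rw [← List.getElem?_rotate (by omega), h1,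
      List.getElem?_append_left (l₁ := x.drop (i + 1) ++ x.take i) (by simp; omega)]
  have hlen : ∀ i : Fin x.length, (∃ e ∈ Q.special, x[i] = .dir e ∨ x[i] = .inv e) → 1 < x.length := by
    rintro i ⟨e, he, h⟩; by_contra h1; have hi := i.2
    have h2 : x.drop (i + 1) ++ x.take i = [] := List.length_eq_zero_iff.1 (by simp; omega)
    rcases h with h | h
    · exact ((hx.2.1 e he _ _).1 (split i _ h)).1 (by rw [h2]; rfl)
    · exact ((hx.2.1 e he _ _).2 (split i _ h)).1 (by rw [h2]; rfl)
  refine @isOriented_of_order V E Q x hz (fun i => x.drop (i + 1) ++ x.take i)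
    (fun i => winv (x.drop (i + 1) ++ x.take i))
    (fun i hi => ?_) (fun i hi => ?_) (fun i e he hi => ((hx.2.1 e he _ _).1 (split i _ hi)).2)
    (fun i e he hi => ((hx.2.1 e he _ _).2 (split i _ hi)).2)
  · have h1 := hlen i hi; rw [hget i 0 (by omega), Fin.getElem_fin, ← List.getElem?_eq_getElem]
    congr 1; simp [letterIx, hTarget, rightLetter, rightEnd, hs]
  · have h1 := hlen i hi; have h2 := i.2
    refine getElem?_winv_of (j := x.length - 2) ?_ (by simp; omega)
    rw [hget i _ (by omega), Fin.getElem_fin, ← List.getElem?_eq_getElem]; congr 1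
    simp only [letterIx, hTarget, leftLetter, leftEnd, hs]; simp; congr 1; omega

/-- The ends of a word of type `(p,p)` are punctured, and a band has no ends. -/
lemma wordSide_ne_free (hz : IsHatWord Q x) (ht : wordType Q x = .pp ∨ wordType Q x = .b)
    (j : Pos x) (b : Bool) : wordSide hz j b ≠ .free := by
  intro h; have h1 := letter_eq_of_wordSide hz (j := j) (b := b) (by simp [h]) (by simp [h])
  rcases wordSide_trivial hz h1 with ⟨e, -, -, h2⟩ | ⟨h2, -⟩
  · simp_all
  obtain ⟨h3, h4⟩ := isString_of_letter hz h1
  obtain ⟨-, -, -, ⟨p, hp⟩, q, hq⟩ : startsTrivial x = true ∧ 2 ≤ x.length ∧ IsString Q.hat x := by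
    rcases isHatWord_cases hz with h5 | ⟨h5, -⟩
    · exact h5
    · simp_all
  have h6 := wordType_eq (Q := Q) h3 hp hq
  have h7 : (Loop Q p) ∧ Loop Q q := by
    by_contra h7; rw [h6] at ht; split_ifs at ht <;> simp_all
  cases b
  · cases hp.symm.trans h4; obtain ⟨⟨e, he, h8⟩, -⟩ := h7; exact h2 e he h8
  · cases hq.symm.trans h4; obtain ⟨-, e, he, h8⟩ := h7; exact h2 e he h8

lemma wordType_ne_b (hx : startsTrivial x = true) : wordType Q x ≠ .b := by
  unfold wordType; rw [if_pos hx]; split_ifs <;> simp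

lemma wordType_of_not_startsTrivial (hx : startsTrivial x = false) : wordType Q x = .b := by
  unfold wordType; rw [hx]; rfl

/-- The type of the word `A(w)` of a standard band. -/
lemma IsStandardBand.wordType_A (hw : IsStandardBand Q w) : wordType Q (A Q w) = .pp ∨ wordType Q
    (A Q w) = .b := by
  have hs := hw.1.1.startsTrivial
  have hv : ∀ l ∈ w, l.IsValid Q := fun l hl => hw.1.1.2.1 l (List.mem_append_left _ hl)
  by_cases h : IsSymmetricBand w
  · left; obtain ⟨e, f, v, rfl⟩ := hw.2.resolve_left (not_not.2 h)
    have he : e ∈ Q.special := hv (.special e) (by simp)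
    have hf : f ∈ Q.special := hv (.special f) (by simp)
    have hlen : (Letter.special e :: (v ++ Letter.special f :: winv v)).length / 2 = v.length + 1 := by
      simp [length_winv]; omega
    have h1 : punctureAt Q (.special e :: (v ++ .special f :: winv v)) 0 = [.triv (Q.source e)] := rfl
    have h2 : punctureAt Q (.special e :: (v ++ .special f :: winv v)) (v.length + 1) =
        [.triv (Q.source f)] := by
      unfold punctureAt; rw [List.getElem?_cons_succ, (split_index _ _ _).1]
    unfold A; rw [if_neg (by simp [hs]), if_pos h, hlen, h1, h2]
    rw [wordType_eq (p := Q.source e) (q := Q.source f) rfl rfl List.getLast?_concat,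
      if_pos ⟨e, he, rfl⟩, if_pos ⟨f, hf, rfl⟩]
  · right; refine wordType_of_not_startsTrivial ?_; unfold A; rw [if_neg (by simp [hs]), if_neg h]
    rcases w with - | ⟨l, t⟩
    · rfl
    unfold orientBand; rw [List.mapIdx_cons]
    cases l with
    | trivInv p => cases hs
    | special e =>
      dsimp only; split_ifs <;> rfl
    | _ => rfl

lemma isAdmissibleString_of_wordType (hx : IsAdmissibleWord Q x) (ht : wordType Q x ≠ .b) :
    IsAdmissibleString Q x :=
  hx.resolve_right fun h => ht (wordType_of_not_startsTrivial h.1.startsTrivial)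

/-- Words of the types `(p,p)` and `(b)` are their own translates. -/
lemma tauWord_eq_self (ht : wordType Q x = .pp ∨ wordType Q x = .b) : tauWord Q x = x := by
  unfold tauWord; split_ifs with h1 h2
  · obtain ⟨h3 | h3, h4⟩ := Classical.choose_spec h1
    · exfalso; rw [h4] at ht
      rcases (isAdmissibleString_A h3).2 with ⟨-, h5, -⟩ | ⟨-, h5⟩ <;> rw [h5] at ht <;> simp at ht
    · conv_rhs => rw [h4]
      unfold tau; rw [if_neg (by simp [h3.1.1.startsTrivial])]
  · obtain ⟨h3, h4⟩ := Classical.choose_spec h2; exfalso; rw [h4] at ht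
    have h6 := wordType_winv (isAdmissibleString_A h3).1.1
    rcases (isAdmissibleString_A h3).2 with ⟨-, h5, -⟩ | ⟨-, h5⟩
    · rw [h6.1 h5] at ht; simp at ht
    · rw [h6.2.1 h5] at ht; simp at ht
  · rfl

lemma wordType_A_tau (hw : IsString Q w) (hp : ¬ IsProjectiveString Q w) :
    wordType Q (A Q (tau Q w)) = wordType Q (A Q w) := by
  obtain ⟨h1, h2, -⟩ := isTranslate_tau hw hp
  rcases (isAdmissibleString_A hw).2 with ⟨h3, h4, -⟩ | ⟨h3, h4⟩ <;>
    rcases (isAdmissibleString_A h1).2 with ⟨h5, h6, -⟩ | ⟨h5, h6⟩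
  · rw [h4, h6]
  · simp_all
  · simp_all
  · rw [h4, h6]

/-- Words of the other types are translated by means of the corresponding strings for `Q`. -/
lemma isTranslate_tauWord (hx : IsAdmissibleString Q x) (hp : ¬ IsProjectiveWord Q x)
    (ht : wordType Q x ≠ .pp) : IsAdmissibleString Q (tauWord Q x) ∧ wordType Q (tauWord Q x)
    = wordType Q x ∧ IsTranslate Q x (tauWord Q x) := by
  by_cases h : wordType Q x = .uu ∨ wordType Q x = .up
  · obtain ⟨w, hw, h1⟩ := exists_eq_A hx h
    have h2 : ∃ w, (IsString Q w ∨ IsStandardBand Q w) ∧ x = A Q w := ⟨w, .inl hw, h1⟩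
    unfold tauWord; rw [dif_pos h2]; obtain ⟨h3, h4⟩ := Classical.choose_spec h2
    generalize Classical.choose h2 = w' at h3 h4
    have h5 : IsString Q w' := by
      refine h3.resolve_right fun h3 => ?_
      have h5 := h3.wordType_A; rw [← h4] at h5; rcases h with h | h <;> rw [h] at h5 <;> simp at h5
    have h6 : ¬ IsProjectiveString Q w' := fun h6 => hp ⟨w', h6, .inl h4⟩
    obtain ⟨h7, -, h8⟩ := isTranslate_tau h5 h6; rw [h4]
    exact ⟨(isAdmissibleString_A h7).1, wordType_A_tau h5 h6, h8⟩
  -- type `(p,u)`: the translate is defined by means of the inverse word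
  · have hpu : wordType Q x = .pu := by
      have hb := wordType_ne_b (Q := Q) hx.1.startsTrivial; cases h' : wordType Q x <;> simp_all
    have h0 := (wordType_winv hx.1).2.2 hpu
    obtain ⟨w, hw, h1⟩ := exists_eq_A (isAdmissibleString_winv hx (by rw [h0]; simp)) (.inr h0)
    have h2 : ∃ w, IsString Q w ∧ x = winv (A Q w) := ⟨w, hw, by rw [← h1, winv_winv]⟩
    have h2' : ¬ ∃ w, (IsString Q w ∨ IsStandardBand Q w) ∧ x = A Q w := by
      rintro ⟨w, h3 | h3, rfl⟩
      · rcases (isAdmissibleString_A h3).2 with ⟨-, h4, -⟩ | ⟨-, h4⟩ <;> exact h (by simp [h4])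
      · have h5 := h3.wordType_A; rw [hpu] at h5; simp at h5
    unfold tauWord; rw [dif_neg h2', dif_pos h2]; obtain ⟨h3, h4⟩ := Classical.choose_spec h2
    generalize Classical.choose h2 = w' at h3 h4
    have h6 : ¬ IsProjectiveString Q w' := fun h6 => hp ⟨w', h6, .inr (by rw [h4, winv_winv])⟩
    obtain ⟨h7, -, h8⟩ := isTranslate_tau h3 h6; have h9 := wordType_A_tau h3 h6
    have h10 : wordType Q (A Q w') = .up := by rw [← h0, h4, winv_winv]
    rw [h10] at h9; have h11 := (wordType_winv (isAdmissibleString_A h7).1.1).2.1 h9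
    refine ⟨isAdmissibleString_winv (isAdmissibleString_A h7).1 (by rw [h11]; simp),
      by rw [h11, hpu], ?_⟩
    rw [h4]; exact h8.winv

end

end

end SkewedGentle

open SkewedGentle

theorem mainTheorem6 {V : Type*} {E : Type*} [Fintype V] (Q : SkewedGentle.SkewedGentleQuiver V E)
    (k : Type*) [Field k] (hk : (2 : k) ≠ 0)
    (x : SkewedGentle.AdmWord Q) (hx : ¬ SkewedGentle.IsProjectiveWord Q x.1)
    (σ : SkewedGentle.WordType) (hσ : SkewedGentle.wordType Q x.1 = σ)
    (X : Type*) [AddCommGroup X] [Module k X] [Module (SkewedGentle.WordAlg k σ) X]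
    [IsScalarTower k (SkewedGentle.WordAlg k σ) X] [FiniteDimensional k X]
    (hX : SkewedGentle.IsIndecomposable (SkewedGentle.WordAlg k σ) X) :
    ∃ hy : SkewedGentle.IsAdmissibleWord Q (SkewedGentle.tauWord Q x.1),
      SkewedGentle.wordType Q (SkewedGentle.tauWord Q x.1) = σ ∧
      SkewedGentle.IsARTranslate k (R := SkewedGentle.PathAlg k Q)
        (SkewedGentle.WordModule k σ x X)
        (SkewedGentle.WordModule k σ ⟨SkewedGentle.tauWord Q x.1, hy⟩
          (SkewedGentle.ChiTwist k σ X)) := by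
  subst hσ
  by_cases ht : wordType Q x.1 = .pp ∨ wordType Q x.1 = .b
  · have h1 := tauWord_eq_self ht
    have h2 : IsOriented x.2.isHatWord := by
      rcases id x.2 with h2 | h2
      · exact isOriented_of_isAdmissibleString h2 _
      · exact isOriented_of_isAdmissibleBand h2 _
    have h3 := isARTranslate_self hk x (X := X)
      (wordSide_ne_free x.2.isHatWord ht) h2
    -- the type of the module on the right depends on the word `tauWord Q x.1`
    have h4 : ∀ y, y = x.1 → ∃ hy : IsAdmissibleWord Q y,
        wordType Q y = wordType Q x.1 ∧
        IsARTranslate k (R := PathAlg k Q)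
          (WordModule k (wordType Q x.1) x X)
          (WordModule k (wordType Q x.1) ⟨y, hy⟩
            (ChiTwist k (wordType Q x.1) X)) := by
      rintro y rfl
      exact ⟨x.2, rfl, h3⟩
    exact h4 _ h1
  · have h1 := isAdmissibleString_of_wordType x.2 fun h => ht (Or.inr h)
    obtain ⟨h2, h3, z, a, b, c, d, I, S, S'⟩ :=
      isTranslate_tauWord h1 hx fun h => ht (Or.inl h)
    exact ⟨Or.inl h2, h3, I.isARTranslate hk S (y := ⟨_, Or.inl h2⟩) S'⟩
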